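/- Let $k\ge 1$ be an integer, let $\Gamma\subset SL(2,\mathbb R)$ be a torsion-free discrete subgroup of finite covolume, let $g\in S_{4k}(\Gamma)$ be a holomorphic cusp form of weight $4k$, and let $s\in\mathbb C$ with $\operatorname{Re}s>1$. **Notation.** Write $z=x+iy$, $z'=x'+iy'$ for points of the upper half-plane $\mathbb H$ and put $r(z,z')=1-\left|\frac{z-z'}{\bar z-z'}\right|^2$, $Q_s(z,z')=\frac{\Gamma(s)^2}{\pi\Gamma(2s)}\,r^s\,{}_2F_1(s,s;2s;r)$ with $r=r(z,z')$, $G_s(z,z')=\sum_{\gamma\in\Gamma}Q_s(z,\gamma z')$, and $L_{2j}=(yy')^{-2j}\frac{\partial^2}{\partial z\,\partial z'}(yy')^{2j}$. Define $$F_s^{(k)}(z)=L_{2k-2}\cdots L_2L_0\,\bigl(G_s-Q_s\bigr)(z,z')\Big|_{z'=z},\qquad \langle F_s^{(k)},g\rangle=\int_{\Gamma\backslash\mathbb H}F_s^{(k)}(z)\,\overline{g(z)}\,y^{4k}\,\frac{dx\,dy}{y^2}.$$ For a hyperbolic $\gamma=\begin{pmatrix}a&b\\c&d\end{pmatrix}\in\Gamma$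 let $N(\gamma)>1$ be the number such that $\gamma$ is conjugate in $SL(2,\mathbb R)$ to $\pm\operatorname{diag}(N(\gamma)^{1/2},N(\gamma)^{-1/2})$, and put $\alpha_{2k}(\gamma,g)=\int_{z_0}^{\gamma z_0}\bigl(cz^2+(d-a)z-b\bigr)^{2k-1}g(z)\,dz$, which does not depend on $z_0\in\mathbb H$. Let $\mathcal H(\Gamma)$ be the set of $\Gamma$-conjugacy classes of hyperbolic elements of $\Gamma$. Every hyperbolic $P\in\Gamma$ is a positive power of a primitive hyperbolic element $P_0\in\Gamma$; let $\varepsilon(P_0)\in\{1,-1\}$ be the sign of $\operatorname{tr}P_0$. Choose $\tau\in SL(2,\mathbb R)$ with $\tau P_0\tau^{-1}=\varepsilon(P_0)\operatorname{diag}(N(P_0)^{1/2},N(P_0)^{-1/2})$, and put $g_\tau(z)=j(\tau^{-1},z)^{-4k}g(\tau^{-1}z)$, where $j\left(\begin{pmatrix}a&b\\c&d\end{pmatrix},z\right)=cz+d$, $$f_s^{(k)}(r)=\frac{(-1)^k}{\pi}\,\frac{\Gamma(s+k)^2}{\Gamma(2s)}\,(r-1)^{2k}\,r^{s-k}\,{}_2F_1(s+k,s+k;2s;r),$$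 $$I_s^{(k)}(P;g)=\frac{N(P)^k}{(N(P)-1)^{2k}}\int_{\{z\in\mathbb H\,:\,1\le|z|<N(P_0)\}}z^{-2k}\,f_s^{(k)}\bigl(r(z,N(P)z)\bigr)\,\overline{g_\tau(z)}\,y^{4k}\,\frac{dx\,dy}{y^2}.$$ **Theorem.** The integrals $\langle F_s^{(k)},g\rangle$ and $I_s^{(k)}(P;g)$ converge absolutely, and $$\langle F_s^{(k)},g\rangle=\sum_{P\in\mathcal H(\Gamma)}I_s^{(k)}(P;g),$$ where the series converges absolutely and one may use any choice of representatives $P$ and of matrices $\tau$. If $2s\notin\{3,4,\dots,2k\}$, then $$I_s^{(k)}(P;g)=(-1)^{k+1}\,\frac{\varepsilon(P_0)\,\overline{\alpha_{2k}(P_0,g)}}{2^{6k-3}\sinh^{2k-1}\bigl(\tfrac12\log N(P_0)\bigr)}\,\frac{\Gamma(2s-1)}{\Gamma(2s-2k)}\;{}_2F_1\!\Bigl(-(2k-1),2k;2-2s;\tfrac{N(P)}{N(P)-1}\Bigr)\,\frac{N(P)}{N(P)-1}\,N(P)^{-s},$$ and here $${}_2F_1\!\Bigl(-(2k-1),2k;2-2s;\tfrac{N(P)}{N(P)-1}\Bigr)=\sum_{j=0}^{2k-1}\frac{(1-2k)_j\,(2k)_j}{(2-2s)_j\,j!}\Bigl(\frac{N(P)}{N(P)-1}\Bigr)^j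 .$$ For every $s$ with $\operatorname{Re}s>1$ (including $2s\in\{3,\dots,2k\}$, where the previous formula is to be read by continuity in $s$), $$I_s^{(k)}(P;g)=(-1)^{k+1}\,\frac{\varepsilon(P_0)\,\overline{\alpha_{2k}(P_0,g)}}{2^{6k-3}\sinh^{2k-1}\bigl(\tfrac12\log N(P_0)\bigr)}\;\sum_{j=1}^{2k}p_j(s)\Bigl(\frac{N(P)}{N(P)-1}\Bigr)^jN(P)^{-s},$$ $$p_j(s)=(j-1)!\binom{2k-1}{j-1}\binom{2k+j-2}{j-1}\prod_{i=j+1}^{2k}(2s-i).$$ -/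

import Mathlib

open UpperHalfPlane MeasureTheory
open scoped MatrixGroups ComplexConjugate

noncomputable section

namespace HypPeriod

/-! ### Differential operators on functions on the upper half-plane -/

/-- The Wirtinger derivative `∂f/∂z = (1/2) (∂f/∂x - i ∂f/∂y)` of a function on the upper
half-plane. -/
def dz (f : ℍ → ℂ) (z : ℍ) : ℂ :=
  (1 / 2) * (fderiv ℝ (fun w : ℂ => f (ofComplex w)) (z : ℂ) 1
    - Complex.I * fderiv ℝ (fun w : ℂ => f (ofComplex w)) (z : ℂ) Complex.I)

/-- The operator `L_{2j} = (y y')^{-2j} ∂²/∂z∂z' (y y')^{2j}` on kernels `K(z, z')`. -/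
def opL (j : ℕ) (K : ℍ → ℍ → ℂ) : ℍ → ℍ → ℂ := fun z z' =>
  (((z.im * z'.im) ^ (2 * j) : ℝ) : ℂ)⁻¹ *
    dz (fun w => dz (fun w' => (((w.im * w'.im) ^ (2 * j) : ℝ) : ℂ) * K w w') z') z

/-- The composition `L_{2k-2} ⋯ L_2 L_0`. -/
def opLs : ℕ → (ℍ → ℍ → ℂ) → (ℍ → ℍ → ℂ)
  | 0, K => K
  | k + 1, K => opL k (opLs k K)

/-! ### Resolvent kernels -/

/-- `r(z, z') = 1 - |(z - z') / (z̄ - z')|²`. -/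
def rr (z z' : ℍ) : ℝ := 1 - ‖((z : ℂ) - z') / (conj (z : ℂ) - z')‖ ^ 2

/-- The resolvent kernel `Q_s^{(0)}` of the Laplacian on the upper half-plane. -/
def resolventH (s : ℂ) (z z' : ℍ) : ℂ :=
  Complex.Gamma s ^ 2 / (Real.pi * Complex.Gamma (2 * s)) *
    (rr z z' : ℂ) ^ s * ₂F₁ s s (2 * s) (rr z z' : ℂ)

/-- The resolvent kernel `G_s^{(0)}` of the Laplacian on `Γ \ ℍ` (for `Re s > 1`), as the sum of
`Q_s^{(0)}(z, γ z')` over `γ ∈ Γ`. -/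
def resolventX (Γ : Subgroup SL(2, ℝ)) (s : ℂ) (z z' : ℍ) : ℂ :=
  ∑' γ : Γ, resolventH s z (γ • z')

/-- The Poincaré series `F_s^{(k)}(z) = L_{2k-2} ⋯ L_2 L_0 (G_s^{(0)} - Q_s^{(0)})(z, z')` at
`z' = z`. -/
def poincareF (Γ : Subgroup SL(2, ℝ)) (k : ℕ) (s : ℂ) (z : ℍ) : ℂ :=
  opLs k (fun w w' => resolventX Γ s w w' - resolventH s w w') z z

/-- The integrand `F_s^{(k)}(z) conj(g(z)) y^{4k}` of the Petersson product with respect to the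
hyperbolic measure `dx dy / y²` (which is `volume` on `ℍ`). -/
def peterssonIntegrand (Γ : Subgroup SL(2, ℝ)) (k : ℕ) (s : ℂ) (g : ℍ → ℂ) (z : ℍ) : ℂ :=
  poincareF Γ k s z * conj (g z) * ((z.im ^ (4 * k) : ℝ) : ℂ)

/-! ### Hyperbolic elements, periods and local terms -/

/-- Holomorphic cusp forms of weight `4k` for `Γ`. -/
abbrev CuspFormsFourK (Γ : Subgroup SL(2, ℝ)) (k : ℕ) : Type :=
  CuspForm (Γ.map Matrix.SpecialLinearGroup.toGL) (4 * k : ℤ)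

/-- The norm `N(γ) = exp ℓ(γ) > 1` of a hyperbolic element: the square of the larger absolute
value of its eigenvalues. -/
def nrm (γ : SL(2, ℝ)) : ℝ :=
  ((|γ.1.trace| + √(γ.1.trace ^ 2 - 4)) / 2) ^ 2

/-- The polynomial `Q_γ(z) = c z² + (d - a) z - b`. -/
def quad (γ : SL(2, ℝ)) (z : ℂ) : ℂ :=
  (γ 1 0 : ℂ) * z ^ 2 + ((γ 1 1 : ℂ) - (γ 0 0 : ℂ)) * z - (γ 0 1 : ℂ)

/-- The period integral `α_{2k}(γ, g) = ∫_{z₀}^{γ z₀} Q_γ(z)^{2k-1} g(z) dz`, taken along the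
straight segment from `z₀` to `γ z₀`. -/
def period (k : ℕ) (g : ℍ → ℂ) (γ : SL(2, ℝ)) (z₀ : ℍ) : ℂ :=
  ∫ t in (0 : ℝ)..1,
    (fun z : ℂ => quad γ z ^ (2 * k - 1) * g (ofComplex z))
      ((z₀ : ℂ) + (t : ℂ) * (((γ • z₀ : ℍ) : ℂ) - (z₀ : ℂ))) *
    (((γ • z₀ : ℍ) : ℂ) - (z₀ : ℂ))

/-- `f_s^{(k)}(r) = (-1)^k π⁻¹ Γ(s+k)² Γ(2s)⁻¹ (r-1)^{2k} r^{s-k} ₂F₁(s+k, s+k; 2s; r)`. -/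
def radial (k : ℕ) (s : ℂ) (r : ℝ) : ℂ :=
  (-1) ^ k * (Real.pi : ℂ)⁻¹ * (Complex.Gamma (s + k) ^ 2 / Complex.Gamma (2 * s)) *
    ((r : ℂ) - 1) ^ (2 * k) * (r : ℂ) ^ (s - k) * ₂F₁ (s + k) (s + k) (2 * s) (r : ℂ)

/-- `P₀` is a primitive hyperbolic element of `Γ`: a hyperbolic element that is not a proper power
of an element of `Γ`. -/
def IsPrimitiveHyp (Γ : Subgroup SL(2, ℝ)) (P₀ : Γ) : Prop :=
  (P₀ : SL(2, ℝ)).1.IsHyperbolic ∧ ∀ (γ : Γ) (m : ℕ), γ ^ m = P₀ → m = 1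

/-- `P` is a hyperbolic element of `Γ`, `P₀` is the primitive element of which it is a positive
power, and `τ P₀ τ⁻¹ = ± diag(N(P₀)^{1/2}, N(P₀)^{-1/2})`, the sign being that of `tr P₀`. -/
structure IsLocalDatum (Γ : Subgroup SL(2, ℝ)) (P P₀ : Γ) (τ : SL(2, ℝ)) : Prop where
  hyp : (P : SL(2, ℝ)).1.IsHyperbolic
  prim : IsPrimitiveHyp Γ P₀
  pow : ∃ n : ℕ, 1 ≤ n ∧ P₀ ^ n = P
  diag : (τ * (P₀ : SL(2, ℝ)) * τ⁻¹).1 =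
    Real.sign (P₀ : SL(2, ℝ)).1.trace •
      Matrix.diagonal ![√(nrm (P₀ : SL(2, ℝ))), (√(nrm (P₀ : SL(2, ℝ))))⁻¹]

/-- The half-annulus `F₀ = {z ∈ ℍ | 1 ≤ |z| < N(P₀)}`. -/
def halfAnnulus (P₀ : SL(2, ℝ)) : Set ℍ := {z | 1 ≤ ‖(z : ℂ)‖ ∧ ‖(z : ℂ)‖ < nrm P₀}

/-- `g_τ(z) = j(τ⁻¹, z)^{-4k} g(τ⁻¹ z)`. -/
def twist (k : ℕ) (g : ℍ → ℂ) (τ : SL(2, ℝ)) (z : ℍ) : ℂ :=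
  (((τ⁻¹ 1 0 : ℝ) : ℂ) * z + ((τ⁻¹ 1 1 : ℝ) : ℂ)) ^ (-(4 * k : ℤ)) * g (τ⁻¹ • z)

/-- The value `r(z, N z)` for a positive real number `N`. -/
def rrScale (N : ℝ) (z : ℍ) : ℝ :=
  1 - ‖((z : ℂ) - N * z) / (conj (z : ℂ) - N * z)‖ ^ 2

/-- The integrand `z^{-2k} f_s^{(k)}(r(z, N(P) z)) conj(g_τ(z)) y^{4k}` of the local term, with
respect to the hyperbolic measure. -/
def localIntegrand (k : ℕ) (s : ℂ) (g : ℍ → ℂ) (P τ : SL(2, ℝ)) (z : ℍ) : ℂ :=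
  ((z : ℂ) ^ (2 * k))⁻¹ * radial k s (rrScale (nrm P) z) * conj (twist k g τ z) *
    ((z.im ^ (4 * k) : ℝ) : ℂ)

/-- The local term
`I_s^{(k)}(P; g) = N(P)^k (N(P)-1)^{-2k} ∫_{F₀} z^{-2k} f_s^{(k)}(r(z, N(P) z)) conj(g_τ(z)) y^{4k}
dx dy / y²`. -/
def localTerm (k : ℕ) (s : ℂ) (g : ℍ → ℂ) (P P₀ τ : SL(2, ℝ)) : ℂ :=
  ((nrm P ^ k / (nrm P - 1) ^ (2 * k) : ℝ) : ℂ) *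
    ∫ z in halfAnnulus P₀, localIntegrand k s g P τ z

/-- The set of `Γ`-conjugacy classes of hyperbolic elements of `Γ`. -/
def HypClass (Γ : Subgroup SL(2, ℝ)) : Type :=
  {C : ConjClasses Γ // ∃ P : Γ, (P : SL(2, ℝ)).1.IsHyperbolic ∧ ConjClasses.mk P = C}

/-- The normalized conjugated period
`ε conj(α_{2k}(P₀, g)) / (2^{6k-3} sinh^{2k-1}(log N(P₀) / 2))`, where `ε` is the sign of the trace
of `P₀`. -/
def normPeriod (k : ℕ) (g : ℍ → ℂ) (P₀ : SL(2, ℝ)) (z₀ : ℍ) : ℂ :=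
  (Real.sign P₀.1.trace : ℂ) * conj (period k g P₀ z₀) /
    ((2 ^ (6 * k - 3) * Real.sinh (Real.log (nrm P₀) / 2) ^ (2 * k - 1) : ℝ) : ℂ)

/-- `p_j(s) = (j-1)! binom(2k-1, j-1) binom(2k+j-2, j-1) ∏_{i=j+1}^{2k} (2s - i)`. For `j ≥ 1` it is
the continuous extension in `s` of
`Γ(2s-1)/Γ(2s-2k) · (1-2k)_{j-1} (2k)_{j-1} / ((2-2s)_{j-1} (j-1)!)`. -/
def pPoly (k j : ℕ) (s : ℂ) : ℂ :=
  ((Nat.factorial (j - 1) * Nat.choose (2 * k - 1) (j - 1) *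
      Nat.choose (2 * k + j - 2) (j - 1) : ℕ) : ℂ) *
    ∏ i ∈ Finset.Icc (j + 1) (2 * k), (2 * s - (i : ℂ))

end HypPeriod

end

noncomputable section

namespace HypPeriod

/-! The argument follows the pattern of the Selberg trace formula. Everything attached to γ is
expressed through B(z, w) = `bil γ z w`, which is z - γw with the denominator cleared; for instance
r(z, γw) = 4 Im z Im w / |B(z, w̄)|². If z, z̄, z', z̄' are treated as four independent complex
variables, r becomes a rational function of them. Since (r d/dr)² raises the parameters of r^(s+j)
₂F₁(s+j, s+j; 2s; r), the operator L_{2j} turns the j-th kernel into the (j+1)-st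
(`Good.hasDerivAt_ker'`). Cauchy's estimate allows termwise differentiation of the sum over γ
(`opLs_resolvent_sub_eq`), and on the diagonal F_s^(k)(z) is the sum over γ ≠ 1 of Q_γ(z)^(-2k)
f_s^(k)(r(z, γz)) (`poincareF_eq`).

Absolute convergence. Comparing the orbital sum with an integral over disjoint balls bounds the sum
of all terms at z by a power of 1 + 1/η times |g(z)| y^(2k), where η is a lower bound for the
displacements of z (`exists_tsum_norm_wterm_le`). This bound is uniform in z. The points with large
η are compact modulo Γ because the covolume is finite (`exists_compact_thick`). Elements of small
displacement at a common point commute (`commute_of_disp_le`), which reduces the remaining points to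
finitely many elements up to conjugation (`exists_height_bound`). A hyperbolic element has
displacement bounded below on all of ℍ, and near the fixed point of a parabolic one the exponential
decay of g wins (`exists_thin_bound`).

Unfolding. The terms of one conjugacy class add up to an integral over a fundamental domain of a
centralizer (`integral_conjClass`), and this centralizer is infinite cyclic
(`IsFlow.exists_generator`). There are no elliptic elements. A parabolic class produces the constant
Fourier coefficient of g at a cusp, hence 0 (`tsum_parabolic_eq_zero`). A hyperbolic class produces
I_s^(k)(P; g) (`IsLocalDatum.localTerm_eq`).

Evaluation. On the rays z = y(c + i) the quantity r(z, N(P)z) depends on c alone. The integral over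
y is therefore a conjugated period of g (`integral_ray_annulus`), and there remains the integral
over c of a hypergeometric function (`integral_radR`). Integrating its series term by term gives, up
to an elementary factor, the 2k-th derivative with respect to -cosh t of a multiple of
exp(-(2s-1)t), where t = log N(P) / 2 (`wt_zero`, `hasDerivAt_wt`). This derivative is an
exponential times a polynomial in 1/(1 - e^(-2t)) = N(P)/(N(P)-1) (`wt_succ_eq`), whose coefficients
are the p_j(s); the ratio of consecutive coefficients identifies it with a terminating ₂F₁
(`ecoef_mul_ascPochhammer`). -/

/-! ### The bilinear form attached to a matrix -/

/-- The bilinear form `c z w + d z - a w - b`. -/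
def bil (γ : SL(2, ℝ)) (z w : ℂ) : ℂ :=
  (γ 1 0 : ℂ) * z * w + (γ 1 1 : ℂ) * z - (γ 0 0 : ℂ) * w - (γ 0 1 : ℂ)

/-- The automorphy factor `c z + d`. -/
def jfac (γ : SL(2, ℝ)) (z : ℂ) : ℂ := (γ 1 0 : ℂ) * z + (γ 1 1 : ℂ)

/-- The displacement `|Q_γ(z)|² / (4 y²) = sinh² (d(z, γ z) / 2)`. -/
def disp (γ : SL(2, ℝ)) (z : ℍ) : ℝ := ‖quad γ z‖ ^ 2 / (4 * z.im ^ 2)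

lemma quad_eq_bil (γ : SL(2, ℝ)) (z : ℂ) : quad γ z = bil γ z z := by
  simp only [quad, bil]; ring

lemma det_eq (γ : SL(2, ℝ)) : γ 0 0 * γ 1 1 - γ 0 1 * γ 1 0 = 1 := by
  have := γ.2
  rwa [Matrix.det_fin_two] at this

lemma det_eq_complex (γ : SL(2, ℝ)) :
    (γ 0 0 : ℂ) * (γ 1 1 : ℂ) - (γ 0 1 : ℂ) * (γ 1 0 : ℂ) = 1 := by
  exact_mod_cast det_eq γ

lemma jfac_ne_zero_of_im {γ : SL(2, ℝ)} {z : ℂ} (hz : z.im ≠ 0) : jfac γ z ≠ 0 := by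
  intro h
  have h1 := congrArg Complex.im h
  have h2 := congrArg Complex.re h
  simp [jfac] at h1 h2
  have hc : γ 1 0 = 0 := by tauto
  have := det_eq γ
  rw [hc] at h2 this
  simp at h2
  rw [h2] at this; simp at this

lemma jfac_ne_zero (γ : SL(2, ℝ)) (z : ℍ) : jfac γ z ≠ 0 :=
  jfac_ne_zero_of_im z.im_ne_zero

lemma coe_smul_eq (γ : SL(2, ℝ)) (z : ℍ) :
    ((γ • z : ℍ) : ℂ) = ((γ 0 0 : ℂ) * z + (γ 0 1 : ℂ)) / jfac γ z := by
  rw [coe_specialLinearGroup_apply]; simp [jfac]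

lemma conj_bil (γ : SL(2, ℝ)) (z w : ℂ) : conj (bil γ z w) = bil γ (conj z) (conj w) := by
  simp [bil]

lemma conj_jfac (γ : SL(2, ℝ)) (z : ℂ) : conj (jfac γ z) = jfac γ (conj z) := by
  simp [jfac]

/-- The first argument is an arbitrary complex number, so that the identity also applies at z̄, as
is needed in the denominator of `rr`. -/
lemma sub_smul_eq (γ : SL(2, ℝ)) (z : ℂ) (w : ℍ) :
    z - ((γ • w : ℍ) : ℂ) = bil γ z w / jfac γ w := by
  rw [coe_smul_eq, eq_div_iff (jfac_ne_zero γ w), sub_mul, div_mul_cancel₀ _ (jfac_ne_zero γ w)]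
  simp only [bil, jfac]; ring

lemma im_smul_eq (γ : SL(2, ℝ)) (z : ℍ) : (γ • z).im = z.im / ‖jfac γ z‖ ^ 2 := by
  have h1 : (((γ • z : ℍ) : ℂ) - conj ((γ • z : ℍ) : ℂ)) =
      ((z : ℂ) - conj (z : ℂ)) / (jfac γ z * conj (jfac γ z)) := by
    have h2 : conj ((γ • z : ℍ) : ℂ) =
        ((γ 0 0 : ℂ) * conj (z : ℂ) + (γ 0 1 : ℂ)) / conj (jfac γ z) := by
      rw [coe_smul_eq]; simp
    have hj := jfac_ne_zero γ z
    have hj' : conj (jfac γ z) ≠ 0 := by simpa using hj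
    rw [h2, coe_smul_eq]
    rw [div_sub_div _ _ hj hj']
    congr 1
    rw [conj_jfac]
    simp only [jfac]
    linear_combination ((z : ℂ) - conj (z : ℂ)) * det_eq_complex γ
  have h3 := congrArg Complex.im h1
  rw [Complex.mul_conj, Complex.sub_conj, Complex.sub_conj] at h3
  have h4 : ((2 * ((γ • z : ℍ) : ℂ).im : ℝ) : ℂ) * Complex.I =
      (((2 * (z : ℂ).im) / ‖jfac γ z‖ ^ 2 : ℝ) : ℂ) * Complex.I := by
    rw [Complex.mul_conj, Complex.sub_conj, Complex.sub_conj, Complex.normSq_eq_norm_sq] at h1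
    rw [h1]; push_cast; ring
  have h5 := mul_right_cancel₀ Complex.I_ne_zero h4
  have h6 : 2 * (γ • z).im = 2 * z.im / ‖jfac γ z‖ ^ 2 := by exact_mod_cast h5
  linear_combination h6 / 2

lemma jfac_mul (γ δ : SL(2, ℝ)) (z : ℍ) :
    jfac (γ * δ) z = jfac γ ((δ • z : ℍ) : ℂ) * jfac δ z := by
  have hj := jfac_ne_zero δ z
  have : jfac γ ((δ • z : ℍ) : ℂ) =
      (γ 1 0 * ((δ 0 0 : ℂ) * z + (δ 0 1 : ℂ)) + γ 1 1 * jfac δ z) / jfac δ z := by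
    rw [eq_div_iff hj, jfac, add_mul, coe_smul_eq, mul_assoc, div_mul_cancel₀ _ hj]
  rw [this, div_mul_cancel₀ _ hj]
  simp only [jfac, Matrix.SpecialLinearGroup.coe_mul, Matrix.mul_apply, Fin.sum_univ_two]
  push_cast; ring

lemma jfac_one (z : ℂ) : jfac 1 z = 1 := by simp [jfac]

lemma jfac_inv_smul (δ : SL(2, ℝ)) (z : ℍ) :
    jfac δ⁻¹ ((δ • z : ℍ) : ℂ) = (jfac δ z)⁻¹ := by
  have := jfac_mul δ⁻¹ δ z
  rw [inv_mul_cancel, jfac_one] at this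
  exact eq_inv_of_mul_eq_one_left this.symm

/-- Equivariance of the bilinear form under conjugation. -/
lemma bil_conj (γ δ : SL(2, ℝ)) (z w : ℍ) :
    bil (δ⁻¹ * γ * δ) z w = bil γ (δ • z : ℍ) (δ • w : ℍ) * (jfac δ z * jfac δ w) := by
  have hz := jfac_ne_zero δ z
  have hw := jfac_ne_zero δ w
  have : bil γ (δ • z : ℍ) (δ • w : ℍ) * (jfac δ z * jfac δ w) =
      γ 1 0 * ((δ 0 0 : ℂ) * z + (δ 0 1 : ℂ)) * ((δ 0 0 : ℂ) * w + (δ 0 1 : ℂ))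
      + γ 1 1 * ((δ 0 0 : ℂ) * z + (δ 0 1 : ℂ)) * jfac δ w
      - γ 0 0 * ((δ 0 0 : ℂ) * w + (δ 0 1 : ℂ)) * jfac δ z
      - γ 0 1 * (jfac δ z * jfac δ w) := by
    rw [coe_smul_eq, coe_smul_eq, bil]; field_simp
  rw [this]
  simp only [bil, jfac, Matrix.SpecialLinearGroup.coe_mul, Matrix.mul_apply, Fin.sum_univ_two,
    Matrix.SpecialLinearGroup.coe_inv, Matrix.adjugate_fin_two, Matrix.of_apply,
    Matrix.cons_val', Matrix.cons_val_zero, Matrix.cons_val_one, Matrix.empty_val',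
    Matrix.cons_val_fin_one]
  push_cast; ring

lemma quad_conj (γ δ : SL(2, ℝ)) (z : ℍ) :
    quad (δ⁻¹ * γ * δ) z = quad γ (δ • z : ℍ) * jfac δ z ^ 2 := by
  rw [quad_eq_bil, quad_eq_bil, bil_conj]; ring

lemma disp_conj (γ δ : SL(2, ℝ)) (z : ℍ) : disp (δ⁻¹ * γ * δ) z = disp γ (δ • z) := by
  rw [disp, disp, quad_conj, im_smul_eq]
  have h := norm_ne_zero_iff.mpr (jfac_ne_zero δ z)
  rw [norm_mul, norm_pow]
  have hy := z.im_ne_zero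
  field_simp

/-- `|B(z, w̄)|² = |B(z, w)|² + 4 Im z Im w`. -/
lemma norm_bil_conj_sq (γ : SL(2, ℝ)) (z w : ℂ) :
    ‖bil γ z (conj w)‖ ^ 2 = ‖bil γ z w‖ ^ 2 + 4 * z.im * w.im := by
  rw [← Complex.normSq_eq_norm_sq, ← Complex.normSq_eq_norm_sq]
  simp only [bil, Complex.normSq_apply, Complex.sub_re, Complex.add_re, Complex.mul_re,
    Complex.ofReal_re, Complex.ofReal_im, Complex.sub_im, Complex.add_im, Complex.mul_im,
    Complex.conj_re, Complex.conj_im]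
  linear_combination 4 * z.im * w.im * det_eq γ

lemma norm_bil_conj_left (γ : SL(2, ℝ)) (z w : ℂ) :
    ‖bil γ (conj z) w‖ = ‖bil γ z (conj w)‖ := by
  rw [← Complex.norm_conj, conj_bil, Complex.conj_conj]

lemma bil_conj_ne_zero (γ : SL(2, ℝ)) (z w : ℍ) : bil γ z (conj (w : ℂ)) ≠ 0 := by
  intro h
  have := norm_bil_conj_sq γ z w
  rw [h] at this
  have h1 : 0 < z.im * w.im := mul_pos z.im_pos w.im_pos
  simp only [coe_im] at this
  simp at this
  nlinarith [sq_nonneg ‖bil γ z w‖]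

lemma bil_conj_ne_zero' (γ : SL(2, ℝ)) (z w : ℍ) : bil γ (conj (z : ℂ)) w ≠ 0 := by
  rw [← norm_ne_zero_iff, norm_bil_conj_left, norm_ne_zero_iff]
  exact bil_conj_ne_zero γ z w

/-- The function `4 Im z Im w / |B(z, w̄)|²`, which is `rr z (γ • w)`. -/
lemma rr_smul (γ : SL(2, ℝ)) (z w : ℍ) :
    rr z (γ • w) = 4 * z.im * w.im / ‖bil γ z (conj (w : ℂ))‖ ^ 2 := by
  have h0 := norm_ne_zero_iff.mpr (bil_conj_ne_zero γ z w)
  have hj := norm_ne_zero_iff.mpr (jfac_ne_zero γ w)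
  rw [rr, sub_smul_eq, sub_smul_eq, norm_div, norm_div, norm_div, norm_bil_conj_left]
  have := norm_bil_conj_sq γ z w
  simp only [coe_im] at this
  rw [div_div_div_cancel_right₀ hj, div_pow, eq_div_iff (pow_ne_zero 2 h0), sub_mul,
    div_mul_cancel₀ _ (pow_ne_zero 2 h0), this]
  ring

lemma one_sub_rr_smul (γ : SL(2, ℝ)) (z w : ℍ) :
    1 - rr z (γ • w) = ‖bil γ z w‖ ^ 2 / ‖bil γ z (conj (w : ℂ))‖ ^ 2 := by
  have h0 := norm_ne_zero_iff.mpr (bil_conj_ne_zero γ z w)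
  rw [rr_smul, norm_bil_conj_sq]
  have h1 : ‖bil γ z w‖ ^ 2 + 4 * (z : ℂ).im * (w : ℂ).im ≠ 0 := by
    rw [← norm_bil_conj_sq]; exact pow_ne_zero 2 h0
  simp only [coe_im] at *
  field_simp
  ring

lemma bil_eq_zero_iff (γ : SL(2, ℝ)) (z w : ℍ) : bil γ z w = 0 ↔ γ • w = z := by
  have h := sub_smul_eq γ z w
  constructor
  · intro h1
    rw [h1, zero_div, sub_eq_zero] at h
    exact (UpperHalfPlane.ext h).symm
  · intro h1
    rw [h1, sub_self, eq_comm, div_eq_zero_iff] at h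
    exact h.resolve_right (jfac_ne_zero γ w)

lemma rr_smul_lt_one {γ : SL(2, ℝ)} {z w : ℍ} (h : γ • w ≠ z) : rr z (γ • w) < 1 := by
  have h0 := one_sub_rr_smul γ z w
  have h1 := norm_pos_iff.mpr (mt (bil_eq_zero_iff γ z w).mp h)
  have h2 := norm_pos_iff.mpr (bil_conj_ne_zero γ z w)
  have : 0 < ‖bil γ z w‖ ^ 2 / ‖bil γ z (conj (w : ℂ))‖ ^ 2 := by positivity
  linarith

lemma rr_self_smul (γ : SL(2, ℝ)) (z : ℍ) : rr z (γ • z) = (1 + disp γ z)⁻¹ := by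
  have hy := z.im_pos
  rw [rr_smul, norm_bil_conj_sq, disp, quad_eq_bil, coe_im]
  have h1 : 0 ≤ ‖bil γ z z‖ ^ 2 := sq_nonneg _
  field_simp
  ring

lemma disp_nonneg (γ : SL(2, ℝ)) (z : ℍ) : 0 ≤ disp γ z := by unfold disp; positivity

lemma disp_eq_zero_iff (γ : SL(2, ℝ)) (z : ℍ) : disp γ z = 0 ↔ γ • z = z := by
  have hy := z.im_ne_zero
  rw [disp, div_eq_zero_iff, quad_eq_bil, ← bil_eq_zero_iff γ z z]
  simp [hy]

lemma one_sub_rr_self_smul (γ : SL(2, ℝ)) (z : ℍ) :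
    1 - rr z (γ • z) = disp γ z * rr z (γ • z) := by
  rw [rr_self_smul]
  have := disp_nonneg γ z
  field_simp
  ring

lemma disp_eq_sinh (γ : SL(2, ℝ)) (z : ℍ) : disp γ z = Real.sinh (dist z (γ • z) / 2) ^ 2 := by
  rw [sinh_half_dist, Complex.dist_eq, sub_smul_eq, im_smul_eq, disp, quad_eq_bil]
  have hj := norm_ne_zero_iff.mpr (jfac_ne_zero γ z)
  have hy := z.im_pos
  rw [div_pow, mul_pow, Real.sq_sqrt (by positivity), norm_div]
  field_simp
  ring

/-- The displacement at `i` in terms of matrix entries. -/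
lemma disp_I (γ : SL(2, ℝ)) :
    4 * disp γ UpperHalfPlane.I = (γ 0 0 - γ 1 1) ^ 2 + (γ 0 1 + γ 1 0) ^ 2 := by
  rw [disp, ← Complex.normSq_eq_norm_sq, quad]
  simp [Complex.normSq_apply, pow_two]
  ring

lemma continuous_disp (γ : SL(2, ℝ)) : Continuous (disp γ) := by
  unfold disp quad
  have h1 : Continuous (fun z : ℍ => (z : ℂ)) := continuous_coe
  have h2 : Continuous (fun z : ℍ => z.im) := continuous_im
  refine Continuous.div (by fun_prop) (by fun_prop) (fun z => ?_)
  have := z.im_pos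
  positivity

/-! ### Power series with coefficients of polynomial growth -/

/-- A sequence of polynomial growth. -/
def PolyBdd (a : ℕ → ℂ) : Prop := ∃ C : ℝ, ∃ M : ℕ, 0 ≤ C ∧ ∀ n, ‖a n‖ ≤ C * ((n : ℝ) + 1) ^ M

lemma PolyBdd.add_mul {a : ℕ → ℂ} (ha : PolyBdd a) (α : ℂ) :
    PolyBdd (fun n => (n + α) * a n) := by
  obtain ⟨C, M, hC, h⟩ := ha
  refine ⟨(1 + ‖α‖) * C, M + 1, by positivity, fun n => ?_⟩
  rw [norm_mul]
  have h1 : ‖(n : ℂ) + α‖ ≤ (1 + ‖α‖) * ((n : ℝ) + 1) := by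
    refine (norm_add_le _ _).trans ?_
    rw [Complex.norm_natCast]
    nlinarith [norm_nonneg α, (Nat.cast_nonneg n : (0 : ℝ) ≤ n)]
  calc ‖(n : ℂ) + α‖ * ‖a n‖ ≤ ((1 + ‖α‖) * ((n : ℝ) + 1)) * (C * ((n : ℝ) + 1) ^ M) := by
        gcongr; exact h n
    _ = _ := by ring

/-- (n+1)^M is at most M! times the binomial coefficient (n+M choose M), whose generating series is
(1-ρ)^(-M-1). -/
lemma summable_poly_mul_geometric (C : ℝ) (M : ℕ) {ρ : ℝ} (h0 : 0 ≤ ρ) (h1 : ρ < 1) :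
    Summable (fun n : ℕ => C * ((n : ℝ) + 1) ^ M * ρ ^ n) := by
  have hρ : ‖ρ‖ < 1 := by rwa [Real.norm_of_nonneg h0]
  have h := ((summable_choose_mul_geometric_of_norm_lt_one M hρ).mul_left (M.factorial : ℝ)).mul_left |C|
  refine Summable.of_norm_bounded h fun n => ?_
  rw [norm_mul, norm_mul, Real.norm_eq_abs, norm_pow, norm_pow, Real.norm_of_nonneg h0,
    Real.norm_of_nonneg (by positivity : (0 : ℝ) ≤ (n : ℝ) + 1), mul_assoc, ← mul_assoc (M.factorial : ℝ)]
  refine mul_le_mul_of_nonneg_left (mul_le_mul_of_nonneg_right ?_ (by positivity)) (abs_nonneg C)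
  have h2 := Nat.pow_succ_le_ascFactorial (n + 1) M
  rw [Nat.ascFactorial_eq_factorial_mul_choose] at h2
  have h3 : (n + 1) ^ M ≤ M.factorial * (n + M).choose M := by
    simpa using h2
  exact_mod_cast h3

/-- The sum of a power series. -/
def pser (a : ℕ → ℂ) (r : ℂ) : ℂ := ∑' n, a n * r ^ n

lemma PolyBdd.summable_norm {a : ℕ → ℂ} (ha : PolyBdd a) {r : ℂ} (hr : ‖r‖ < 1) :
    Summable (fun n => ‖a n * r ^ n‖) := by
  obtain ⟨C, M, hC, h⟩ := ha
  refine (summable_poly_mul_geometric C M (norm_nonneg r) hr).of_nonneg_of_le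
    (fun n => norm_nonneg _) (fun n => ?_)
  rw [norm_mul, norm_pow]
  gcongr
  exact h n

/-- Polynomial blow-up at the boundary is all the information about the singularity at r = 1 that
the convergence proof uses; the decay of the cusp form absorbs any fixed power. -/
lemma PolyBdd.norm_pser_le {a : ℕ → ℂ} (ha : PolyBdd a) :
    ∃ C : ℝ, ∃ M : ℕ, 0 ≤ C ∧ ∀ r : ℂ, ‖r‖ < 1 → ‖pser a r‖ ≤ C * ((1 - ‖r‖)⁻¹) ^ M := by
  have ha' := ha
  obtain ⟨C, M, hC, h⟩ := ha
  refine ⟨C * M.factorial, M + 1, by positivity, fun r hr => ?_⟩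
  have hr' : ‖‖r‖‖ < 1 := by rwa [norm_norm]
  have hs := (hasSum_choose_mul_geometric_of_norm_lt_one M hr').mul_left (C * M.factorial)
  have h1 : ‖pser a r‖ ≤ ∑' n, ‖a n * r ^ n‖ := norm_tsum_le_tsum_norm (ha'.summable_norm hr)
  refine h1.trans ?_
  rw [show C * M.factorial * ((1 - ‖r‖)⁻¹) ^ (M + 1) =
    C * M.factorial * (1 / (1 - ‖r‖) ^ (M + 1)) by rw [inv_pow, one_div]]
  rw [← hs.tsum_eq]
  refine Summable.tsum_le_tsum (fun n => ?_) (ha'.summable_norm hr) hs.summable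
  rw [norm_mul, norm_pow, mul_assoc, ← mul_assoc (M.factorial : ℝ), ← mul_assoc C]
  gcongr
  refine (h n).trans ?_
  gcongr
  have h2 := Nat.pow_succ_le_ascFactorial (n + 1) M
  rw [Nat.ascFactorial_eq_factorial_mul_choose] at h2
  have h3 : (n + 1) ^ M ≤ M.factorial * (n + M).choose M := by
    simpa using h2
  exact_mod_cast h3

lemma PolyBdd.hasDerivAt_pser {a : ℕ → ℂ} (ha : PolyBdd a) {r : ℂ} (hr : ‖r‖ < 1) :
    HasDerivAt (pser a) (∑' n : ℕ, a n * (n * r ^ (n - 1))) r := by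
  obtain ⟨ρ, h1, h2⟩ := exists_between hr
  have hρ : 0 ≤ ρ := (norm_nonneg r).trans h1.le
  have ha' := ha
  obtain ⟨C, M, hC, h⟩ := ha
  have hs : Summable (fun n : ℕ => C * ((n : ℝ) + 1) ^ (M + 1) * ρ ^ (n - 1)) := by
    rw [← summable_nat_add_iff 1]
    refine ((summable_poly_mul_geometric (C * 2 ^ (M + 1)) (M + 1) hρ h2)).of_nonneg_of_le
      (fun n => by positivity) (fun n => ?_)
    rw [Nat.add_sub_cancel, mul_assoc C, mul_assoc C, mul_assoc C, ← mul_pow]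
    push_cast
    gcongr
    linarith [(Nat.cast_nonneg n : (0 : ℝ) ≤ n)]
  refine hasDerivAt_tsum_of_isPreconnected (t := Metric.ball (0 : ℂ) ρ) hs Metric.isOpen_ball
    (convex_ball _ _).isPreconnected (fun n y _ => ((hasDerivAt_pow n y).const_mul (a n)))
    (fun n y hy => ?_) (y₀ := 0) (by simpa using (norm_nonneg r).trans_lt h1) ?_
    (by simpa using h1)
  · rw [mem_ball_zero_iff] at hy
    rw [norm_mul, norm_mul, norm_pow, Complex.norm_natCast]
    calc ‖a n‖ * ((n : ℝ) * ‖y‖ ^ (n - 1)) ≤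
        (C * ((n : ℝ) + 1) ^ M) * (((n : ℝ) + 1) * ρ ^ (n - 1)) := by
          gcongr
          · exact h n
          · linarith
      _ = _ := by ring
  · exact (ha'.summable_norm (r := 0) (by simp)).of_norm

lemma PolyBdd.hasDerivAt_pser' {a : ℕ → ℂ} (ha : PolyBdd a) {r : ℂ} (hr : ‖r‖ < 1)
    (h0 : r ≠ 0) : HasDerivAt (pser a) (pser (fun n => n * a n) r / r) r := by
  convert ha.hasDerivAt_pser hr using 1
  rw [pser, div_eq_mul_inv, ← tsum_mul_right]
  refine tsum_congr fun n => ?_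
  rcases n with _ | n
  · simp
  · rw [Nat.add_sub_cancel, pow_succ]; field_simp

/-- `r ^ α` times a power series. -/
def powser (α : ℂ) (a : ℕ → ℂ) (r : ℂ) : ℂ := r ^ α * pser a r

/-- The Euler operator r d/dr multiplies the n-th coefficient by n + α, so that differential
identities become identities between coefficients. -/
lemma PolyBdd.hasDerivAt_powser {a : ℕ → ℂ} (ha : PolyBdd a) (α : ℂ) {r : ℂ} (hr : ‖r‖ < 1)
    (h0 : r ∈ Complex.slitPlane) :
    HasDerivAt (powser α a) (powser α (fun n => (n + α) * a n) r / r) r := by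
  have hr0 : r ≠ 0 := Complex.slitPlane_ne_zero h0
  have h1 : HasDerivAt (fun x : ℂ => x ^ α) (α * r ^ (α - 1)) r := by
    simpa using (hasDerivAt_id r).cpow_const (c := α) h0
  refine HasDerivAt.congr_deriv (h1.mul (ha.hasDerivAt_pser' hr hr0)) ?_
  have hn : PolyBdd (fun n => n * a n) := by simpa using ha.add_mul 0
  have h2 : pser (fun n => (n + α) * a n) r = pser (fun n => n * a n) r + α * pser a r := by
    rw [pser, pser, pser, ← tsum_mul_left, ← Summable.tsum_add]
    · exact tsum_congr fun n => by ring
    · exact (hn.summable_norm hr).of_norm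
    · exact ((ha.summable_norm hr).of_norm).mul_left _
  simp only [powser]
  rw [h2, Complex.cpow_sub _ _ hr0, Complex.cpow_one]
  field_simp
  ring

lemma PolyBdd.differentiableAt_pser {a : ℕ → ℂ} (ha : PolyBdd a) {r : ℂ} (hr : ‖r‖ < 1) :
    DifferentiableAt ℂ (pser a) r := (ha.hasDerivAt_pser hr).differentiableAt

/-! ### Hypergeometric coefficients -/

/-- The coefficients of `₂F₁ (s + j) (s + j) (2 s)`. -/
def hyp (s : ℂ) (j n : ℕ) : ℂ :=
  (ascPochhammer ℂ n).eval (s + j) ^ 2 / ((ascPochhammer ℂ n).eval (2 * s) * (n.factorial : ℂ))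

lemma two_mul_add_natCast_ne_zero {s : ℂ} (hs : 1 < s.re) (n : ℕ) : 2 * s + n ≠ 0 := by
  intro h
  have := congrArg Complex.re h
  simp at this
  have hn : (0 : ℝ) ≤ n := Nat.cast_nonneg n
  linarith

lemma ascPochhammer_eval_ne_zero {x : ℂ} (n : ℕ) (h : ∀ m < n, x + m ≠ 0) :
    (ascPochhammer ℂ n).eval x ≠ 0 := by
  induction n with
  | zero => simp
  | succ n ih =>
    rw [ascPochhammer_succ_eval]
    exact mul_ne_zero (ih fun m hm => h m (by omega)) (h n (by omega))

lemma hyp_succ (s : ℂ) (j n : ℕ) :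
    hyp s j (n + 1) = hyp s j n * ((s + j + n) ^ 2 / ((2 * s + n) * (n + 1))) := by
  rw [hyp, hyp, ascPochhammer_succ_eval, ascPochhammer_succ_eval, Nat.factorial_succ,
    div_mul_div_comm]
  push_cast
  congr 1 <;> ring

/-- The ratio of consecutive terms is at most 1 + M/(n+1), hence at most ((n+2)/(n+1))^M, and these
bounds telescope to (n+1)^M. The assumption Re s > 1 enters through |2s + n| ≥ n + 2. -/
lemma PolyBdd.of_ratio {s : ℂ} (hs : 1 < s.re) {a c : ℕ → ℂ} {x : ℝ} (hx : 0 ≤ x)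
    (ha : ∀ n, a (n + 1) = a n * (c n / ((2 * s + n) * (n + 1))))
    (hc : ∀ n, ‖c n‖ ≤ (x + n) ^ 2) : PolyBdd a := by
  obtain ⟨M, hM⟩ := exists_nat_ge ((x + 1) ^ 2)
  refine ⟨‖a 0‖, M, norm_nonneg _, fun n => ?_⟩
  induction n with
  | zero => simp
  | succ n ih =>
    rw [ha, norm_mul, norm_div, norm_mul]
    have h2 : (n : ℝ) + 2 ≤ ‖2 * s + n‖ := by
      refine le_trans ?_ (Complex.re_le_norm _)
      simp; linarith
    have h3 : ‖(n : ℂ) + 1‖ = (n : ℝ) + 1 := by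
      rw [show (n : ℂ) + 1 = ((n + 1 : ℕ) : ℂ) by push_cast; rfl, Complex.norm_natCast]
      push_cast; rfl
    rw [h3]
    have hn : (0 : ℝ) ≤ n := Nat.cast_nonneg n
    have h4 : 1 + (M : ℝ) * (1 / ((n : ℝ) + 1)) ≤ (1 + 1 / ((n : ℝ) + 1)) ^ M :=
      one_add_mul_le_pow (by have : (0:ℝ) ≤ 1 / ((n : ℝ) + 1) := by positivity
                             linarith) M
    have h5 : ((n : ℝ) + 1) ^ M * (1 + 1 / ((n : ℝ) + 1)) ^ M = (((n + 1 : ℕ) : ℝ) + 1) ^ M := by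
      rw [← mul_pow]; congr 1; push_cast; field_simp
    rw [← h5, ← mul_assoc]
    refine mul_le_mul ih (le_trans ?_ h4) (by positivity) (by positivity)
    calc ‖c n‖ / (‖2 * s + n‖ * ((n : ℝ) + 1))
        ≤ (x + n) ^ 2 / (((n : ℝ) + 2) * ((n : ℝ) + 1)) := by gcongr; exact hc n
      _ ≤ 1 + (M : ℝ) * (1 / ((n : ℝ) + 1)) := by
        rw [div_le_iff₀ (by positivity)]
        have : (1 + (M : ℝ) * (1 / ((n : ℝ) + 1))) * (((n : ℝ) + 2) * ((n : ℝ) + 1)) =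
          ((n : ℝ) + 1 + M) * ((n : ℝ) + 2) := by field_simp
        rw [this]
        nlinarith [mul_nonneg hx hn]

lemma polyBdd_hyp {s : ℂ} (hs : 1 < s.re) (j : ℕ) : PolyBdd (hyp s j) := by
  refine .of_ratio hs (x := ‖s‖ + j) (by positivity) (hyp_succ s j) fun n => ?_
  rw [norm_pow]
  gcongr
  refine (norm_add_le _ _).trans (add_le_add ((norm_add_le _ _).trans ?_) ?_) <;>
  simp

/-- From (s+j)_n (s+j+n) = (s+j) (s+j+1)_n, squared. This is the reason why applying r d/dr twice
replaces j by j + 1. -/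
lemma add_sq_mul_hyp (s : ℂ) (j n : ℕ) :
    (n + (s + j)) * ((n + (s + j)) * hyp s j n) = (s + j) ^ 2 * hyp s (j + 1) n := by
  have h : (ascPochhammer ℂ n).eval (s + j) * (s + j + n) =
      (s + j) * (ascPochhammer ℂ n).eval (s + (j + 1 : ℕ)) := by
    rw [← ascPochhammer_succ_eval, ascPochhammer_succ_left, Polynomial.eval_mul,
      Polynomial.eval_X, Polynomial.eval_comp]
    simp [add_assoc]
  rw [hyp, hyp, mul_div_assoc', mul_div_assoc', mul_div_assoc', ← mul_pow, ← h]
  congr 1; ring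

lemma hypergeometric_eq_pser (s : ℂ) (j : ℕ) (r : ℂ) :
    ₂F₁ (s + j) (s + j) (2 * s) r = pser (hyp s j) r := by
  rw [ordinaryHypergeometric_eq_tsum]
  refine tsum_congr fun n => ?_
  rw [hyp, smul_eq_mul]
  congr 1
  rw [div_eq_mul_inv, mul_inv]
  ring

/-- The function `r ^ (s + j) ₂F₁ (s + j) (s + j) (2 s) r`. -/
def radR (s : ℂ) (j : ℕ) : ℂ → ℂ := powser (s + j) (hyp s j)

/-- The logarithmic derivative `r d/dr` of `radR`. -/
def radR' (s : ℂ) (j : ℕ) : ℂ → ℂ := powser (s + j) (fun n => (n + (s + j)) * hyp s j n)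

lemma hasDerivAt_radR {s : ℂ} (hs : 1 < s.re) (j : ℕ) {r : ℂ} (hr : ‖r‖ < 1)
    (h0 : r ∈ Complex.slitPlane) : HasDerivAt (radR s j) (radR' s j r / r) r :=
  (polyBdd_hyp hs j).hasDerivAt_powser _ hr h0

/-- Together with `hasDerivAt_radR`: (r d/dr)² `radR s j` = (s+j)² `radR s (j+1)` / r, the radial
form of the action of L_{2j}. -/
lemma hasDerivAt_radR' {s : ℂ} (hs : 1 < s.re) (j : ℕ) {r : ℂ} (hr : ‖r‖ < 1)
    (h0 : r ∈ Complex.slitPlane) :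
    HasDerivAt (radR' s j) ((s + j) ^ 2 * radR s (j + 1) r / r ^ 2) r := by
  have hr0 := Complex.slitPlane_ne_zero h0
  refine HasDerivAt.congr_deriv
    (((polyBdd_hyp hs j).add_mul (s + j)).hasDerivAt_powser (s + j) hr h0) ?_
  have h : (fun n : ℕ => (n + (s + j)) * ((n + (s + j)) * hyp s j n)) =
      fun n => (s + j) ^ 2 * hyp s (j + 1) n := funext fun n => add_sq_mul_hyp s j n
  rw [h]
  simp only [radR, powser, pser, mul_assoc]
  rw [tsum_mul_left]
  push_cast
  rw [← add_assoc, Complex.cpow_add (s + j) 1 hr0, Complex.cpow_one]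
  field_simp

/-- The constant `(-1)^j Γ(s+j)² / (π Γ(2s))`. -/
def cst (s : ℂ) (j : ℕ) : ℂ :=
  (-1) ^ j * (Real.pi : ℂ)⁻¹ * (Complex.Gamma (s + j) ^ 2 / Complex.Gamma (2 * s))

lemma cst_succ {s : ℂ} (hs : 1 < s.re) (j : ℕ) : cst s (j + 1) = -(s + j) ^ 2 * cst s j := by
  have h : s + j ≠ 0 := by
    intro h
    have := congrArg Complex.re h
    simp at this
    have hn : (0 : ℝ) ≤ j := Nat.cast_nonneg j
    linarith
  rw [cst, cst, pow_succ]
  push_cast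
  rw [← add_assoc, Complex.Gamma_add_one _ h]
  ring

/-- The factor ((r-1)/r)^(2k) is isolated because at r = r(z, γz) the quotient (1-r)/r is the
displacement `disp γ z`. -/
lemma radial_eq (k : ℕ) (s : ℂ) {r : ℝ} (hr : 0 < r) :
    radial k s r = cst s k * ((r : ℂ) - 1) ^ (2 * k) / (r : ℂ) ^ (2 * k) * radR s k r := by
  have hr0 : (r : ℂ) ≠ 0 := by exact_mod_cast hr.ne'
  rw [radial, hypergeometric_eq_pser, radR, powser, cst,
    show s - (k : ℂ) = s + k - (2 * k : ℕ) by push_cast; ring, Complex.cpow_sub _ _ hr0,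
    Complex.cpow_natCast]
  field_simp

/-! ### The hyperbolic measure in coordinates -/

/-- The point `x + i y` of the upper half-plane (for `y > 0`). -/
def toH (p : ℝ × ℝ) : ℍ := ofComplex (p.1 + p.2 * Complex.I)

lemma coe_toH {x y : ℝ} (hy : 0 < y) : (toH (x, y) : ℂ) = x + y * Complex.I := by
  rw [toH, ofComplex_apply_of_im_pos (by simpa using hy)]

lemma toH_im {x y : ℝ} (hy : 0 < y) : (toH (x, y)).im = y := by
  rw [← coe_im, coe_toH hy]; simp

lemma toH_re {x y : ℝ} (hy : 0 < y) : (toH (x, y)).re = x := by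
  rw [← coe_re, coe_toH hy]; simp

lemma measurable_toH : Measurable toH := by
  rw [← measurableEmbedding_coe.measurable_comp_iff]
  -- Below the real axis `ofComplex` has one constant default value, represented here by `toH (0,
  -- -1)`; this makes `toH` measurable on the whole plane.
  have : UpperHalfPlane.coe ∘ toH = fun p : ℝ × ℝ =>
      if 0 < p.2 then (p.1 + p.2 * Complex.I : ℂ) else (toH (0, -1) : ℂ) := by
    ext p
    by_cases h : 0 < p.2
    · simp only [Function.comp_apply, h, if_true]; exact coe_toH h
    · simp only [Function.comp_apply, h, if_false]
      rw [toH, toH, ofComplex_apply_eq_of_im_nonpos] <;> simp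
      linarith
  rw [this]
  exact Measurable.ite (measurableSet_lt measurable_const measurable_snd) (by fun_prop) (by fun_prop)

/-- The measure `dx dy / y²` on `{y > 0}`. -/
def hypMeas : Measure (ℝ × ℝ) :=
  (volume : Measure ℝ).prod ((volume.restrict (Set.Ioi 0)).withDensity
    fun y => ENNReal.ofReal (1 / y ^ 2))

lemma measurable_hypDensity : Measurable (fun y : ℝ => ENNReal.ofReal (1 / y ^ 2)) := by fun_prop

instance : SFinite ((volume.restrict (Set.Ioi (0 : ℝ))).withDensity
    fun y => ENNReal.ofReal (1 / y ^ 2)) := by infer_instance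

lemma lintegral_hypMeas (f : ℝ × ℝ → ENNReal) (hf : Measurable f) :
    ∫⁻ p, f p ∂hypMeas =
      ∫⁻ y in Set.Ioi (0 : ℝ), ∫⁻ x : ℝ, f (x, y) * ENNReal.ofReal (1 / y ^ 2) := by
  rw [hypMeas, lintegral_prod_symm' _ hf, lintegral_withDensity_eq_lintegral_mul _
    measurable_hypDensity hf.lintegral_prod_left']
  refine lintegral_congr fun y => ?_
  simp only [Pi.mul_apply]
  rw [lintegral_mul_const _ (by fun_prop), mul_comm]

lemma measurePreserving_toH : MeasurePreserving toH hypMeas volume := by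
  refine ⟨measurable_toH, ?_⟩
  ext s hs
  rw [Measure.map_apply measurable_toH hs, volume_eq_lintegral,
    ← lintegral_indicator_one (measurable_toH hs), lintegral_hypMeas _ (by
      exact measurable_one.indicator (measurable_toH hs)),
    ← Complex.volume_preserving_equiv_real_prod.symm.setLIntegral_comp_preimage_emb
      (MeasurableEquiv.measurableEmbedding _)]
  have hm : MeasurableSet (UpperHalfPlane.coe '' s) :=
    measurableEmbedding_coe.measurableSet_image.mpr hs
  have hm2 : MeasurableSet (Complex.measurableEquivRealProd.symm ⁻¹' (UpperHalfPlane.coe '' s)) :=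
    Complex.measurableEquivRealProd.symm.measurable hm
  rw [← lintegral_indicator hm2, Measure.volume_eq_prod, lintegral_prod_symm',
    ← lintegral_indicator measurableSet_Ioi]
  · refine lintegral_congr fun y => ?_
    by_cases hy : 0 < y
    · rw [Set.indicator_of_mem (by exact hy)]
      refine lintegral_congr fun x => ?_
      have h1 : (x, y) ∈ toH ⁻¹' s ↔
          (x, y) ∈ Complex.measurableEquivRealProd.symm ⁻¹' (UpperHalfPlane.coe '' s) := by
        simp only [Set.mem_preimage, Complex.measurableEquivRealProd_symm_apply]
        have h2 : (⟨x, y⟩ : ℂ) = (toH (x, y) : ℂ) := by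
          rw [coe_toH hy]; apply Complex.ext <;> simp
        rw [h2]
        simp
      by_cases h3 : (x, y) ∈ toH ⁻¹' s
      · rw [Set.indicator_of_mem h3, Set.indicator_of_mem (h1.mp h3)]
        simp only [Pi.one_apply, one_mul, Complex.measurableEquivRealProd_symm_apply]
        rw [← ENNReal.ofReal_coe_nnreal]
        congr 1
        simp
      · rw [Set.indicator_of_notMem h3, Set.indicator_of_notMem (mt h1.mpr h3), zero_mul]
    · rw [Set.indicator_of_notMem (by exact hy), eq_comm, lintegral_eq_zero_iff']
      · refine Filter.Eventually.of_forall fun x => ?_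
        simp only [Pi.zero_apply]
        rw [Set.indicator_of_notMem]
        rintro ⟨w, hw, h⟩
        apply hy
        have := congrArg Complex.im h
        simp [Complex.measurableEquivRealProd_symm_apply] at this
        rw [← this]; exact w.im_pos
      · refine Measurable.aemeasurable ?_
        have : Measurable ((Complex.measurableEquivRealProd.symm ⁻¹' (UpperHalfPlane.coe '' s)).indicator
          fun a : ℝ × ℝ => (((1 / ‖(Complex.measurableEquivRealProd.symm a).im‖₊) ^ 2 : NNReal) : ENNReal)) := by
          refine Measurable.indicator ?_ hm2
          simp only [Complex.measurableEquivRealProd_symm_apply]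
          fun_prop
        exact this.comp measurable_prodMk_right
  · refine Measurable.indicator ?_ hm2
    simp only [Complex.measurableEquivRealProd_symm_apply]
    fun_prop

lemma lintegral_eq_coord (f : ℍ → ENNReal) (hf : Measurable f) :
    ∫⁻ z, f z = ∫⁻ y in Set.Ioi (0 : ℝ), ∫⁻ x : ℝ, f (toH (x, y)) * ENNReal.ofReal (1 / y ^ 2) := by
  rw [← measurePreserving_toH.lintegral_comp hf]
  exact lintegral_hypMeas (fun p => f (toH p)) (hf.comp measurable_toH)

section

open scoped Pointwise

/-! ### Orbital sums -/

lemma rr_eq_cosh (z w : ℍ) : rr z w = (Real.cosh (dist z w / 2) ^ 2)⁻¹ := by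
  have h : ‖((z : ℂ) - w) / (conj (z : ℂ) - w)‖ = Real.tanh (dist z w / 2) := by
    rw [tanh_half_dist, norm_div, Complex.dist_eq, Complex.dist_eq]
    congr 1
    rw [← Complex.norm_conj]; simp
  rw [rr, h, Real.tanh_eq_sinh_div_cosh, div_pow]
  have h1 := Real.cosh_sq (dist z w / 2)
  have h2 := Real.cosh_pos (dist z w / 2)
  field_simp
  linarith

lemma rr_pos (z w : ℍ) : 0 < rr z w := by
  rw [rr_eq_cosh]
  have h2 := Real.cosh_pos (dist z w / 2)
  positivity

lemma cosh_le_exp_mul_cosh {x y δ : ℝ} (h : x ≤ y + δ) (h2 : y ≤ x + δ) :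
    Real.cosh x ≤ Real.exp δ * Real.cosh y := by
  rw [Real.cosh_eq, Real.cosh_eq]
  have h3 : Real.exp x ≤ Real.exp δ * Real.exp y := by
    rw [← Real.exp_add]; exact Real.exp_le_exp.mpr (by linarith)
  have h4 : Real.exp (-x) ≤ Real.exp δ * Real.exp (-y) := by
    rw [← Real.exp_add]; exact Real.exp_le_exp.mpr (by linarith)
  linarith

lemma rr_le_of_dist {z w w' : ℍ} {δ : ℝ} (h : dist w w' ≤ δ) :
    rr z w ≤ Real.exp δ * rr z w' := by
  rw [rr_eq_cosh, rr_eq_cosh]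
  have h1 := dist_triangle z w' w
  have h2 := dist_triangle z w w'
  rw [dist_comm w' w] at h1
  have h3 : Real.cosh (dist z w' / 2) ≤ Real.exp (δ / 2) * Real.cosh (dist z w / 2) :=
    cosh_le_exp_mul_cosh (by linarith) (by linarith)
  have hp := Real.cosh_pos (dist z w / 2)
  have hp' := Real.cosh_pos (dist z w' / 2)
  have h4 : Real.cosh (dist z w' / 2) ^ 2 ≤ Real.exp δ * Real.cosh (dist z w / 2) ^ 2 := by
    calc Real.cosh (dist z w' / 2) ^ 2 ≤ (Real.exp (δ / 2) * Real.cosh (dist z w / 2)) ^ 2 := by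
          gcongr
      _ = _ := by rw [mul_pow, ← Real.exp_nat_mul]; congr 2; push_cast; ring
  rw [inv_eq_one_div, div_le_iff₀ (by positivity), mul_assoc]
  calc (1 : ℝ) = Real.cosh (dist z w' / 2) ^ 2 * (Real.cosh (dist z w' / 2) ^ 2)⁻¹ := by
        field_simp
    _ ≤ Real.exp δ * Real.cosh (dist z w / 2) ^ 2 * (Real.cosh (dist z w' / 2) ^ 2)⁻¹ := by gcongr
    _ = _ := by ring

lemma continuous_rr (z : ℍ) : Continuous (rr z) := by
  have : rr z = fun w => (Real.cosh (dist z w / 2) ^ 2)⁻¹ := funext fun w => rr_eq_cosh z w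
  rw [this]
  refine Continuous.inv₀ (by fun_prop) fun w => ?_
  have := Real.cosh_pos (dist z w / 2)
  positivity

lemma rr_smul_smul (δ : SL(2, ℝ)) (z w : ℍ) : rr (δ • z) (δ • w) = rr z w := by
  rw [rr_eq_cosh, rr_eq_cosh, dist_smul]

instance : SMulInvariantMeasure SL(2, ℝ) ℍ volume where
  measure_preimage_smul g s hs := by
    have := measure_preimage_smul (volume : Measure ℍ) (g : GL (Fin 2) ℝ) s
    exact this

lemma rr_I {x y : ℝ} (hy : 0 < y) :
    rr UpperHalfPlane.I (toH (x, y)) = 4 * y / (x ^ 2 + (y + 1) ^ 2) := by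
  have h := rr_smul 1 UpperHalfPlane.I (toH (x, y))
  rw [one_smul] at h
  rw [h, toH_im hy, coe_toH hy, ← Complex.normSq_eq_norm_sq]
  simp [bil, Complex.normSq_apply]
  ring

/-- Up to a factor 2, x² + (y+1)² dominates both (1+|x|)² and (1+y)². The total exponent 2σ is split
as (σ+2)/2 + (3σ-2)/2: the first exceeds 1, which makes the x-integral converge, and the second
leaves y^(-σ/2-1) as y → ∞, while y^(σ-2) is integrable at 0 because σ > 1. -/
lemma rpow_rr_I_le {σ : ℝ} (hσ : 1 < σ) {x y : ℝ} (hy : 0 < y) :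
    (rr UpperHalfPlane.I (toH (x, y))) ^ σ * (1 / y ^ 2) ≤
      (4 ^ σ * 2 ^ σ) * ((1 + ‖x‖) ^ (-((σ + 2) / 2)) * (y ^ (σ - 2) * (1 + y) ^ (-((3 * σ - 2) / 2)))) := by
  have h1 : (1 + ‖x‖) ^ ((σ + 2) / 2) * (1 + y) ^ ((3 * σ - 2) / 2) ≤
      (2 * (x ^ 2 + (y + 1) ^ 2)) ^ σ := by
    set m := max (1 + ‖x‖) (1 + y)
    have hx : (0 : ℝ) < 1 + ‖x‖ := by positivity
    have hm : 0 < m := lt_max_of_lt_left hx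
    calc (1 + ‖x‖) ^ ((σ + 2) / 2) * (1 + y) ^ ((3 * σ - 2) / 2)
        ≤ m ^ ((σ + 2) / 2) * m ^ ((3 * σ - 2) / 2) := by
          gcongr
          · exact le_max_left (1 + ‖x‖) (1 + y)
          · linarith
          · exact le_max_right (1 + ‖x‖) (1 + y)
      _ = (m ^ 2) ^ σ := by
          rw [← Real.rpow_add hm, ← Real.rpow_natCast, ← Real.rpow_mul hm.le]
          congr 1; push_cast; ring
      _ ≤ _ := by
          gcongr
          rcases max_choice (1 + ‖x‖) (1 + y) with h | h
          · rw [show m = 1 + ‖x‖ from h]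
            have := abs_nonneg x
            have h2 := sq_abs x
            rw [Real.norm_eq_abs]
            nlinarith [sq_nonneg (1 - |x|)]
          · rw [show m = 1 + y from h]
            nlinarith [sq_nonneg x]
  have h0 : (0 : ℝ) < x ^ 2 + (y + 1) ^ 2 := by positivity
  have hx : (0 : ℝ) < 1 + ‖x‖ := by positivity
  have hy1 : (0 : ℝ) < 1 + y := by linarith
  rw [rr_I hy, Real.div_rpow (by positivity) h0.le, Real.mul_rpow (by norm_num) hy.le,
    Real.rpow_neg hx.le, Real.rpow_neg hy1.le, Real.rpow_sub hy, Real.rpow_two]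
  rw [Real.mul_rpow (by norm_num) h0.le] at h1
  have e1 : 0 < (x ^ 2 + (y + 1) ^ 2) ^ σ := Real.rpow_pos_of_pos h0 _
  have e2 := Real.rpow_pos_of_pos hx ((σ + 2) / 2)
  have e3 := Real.rpow_pos_of_pos hy1 ((3 * σ - 2) / 2)
  have e4 := Real.rpow_pos_of_pos hy σ
  have e5 : (0 : ℝ) < 4 ^ σ := by positivity
  have e6 : ((x ^ 2 + (y + 1) ^ 2) ^ σ)⁻¹ ≤
      2 ^ σ * (((1 + ‖x‖) ^ ((σ + 2) / 2))⁻¹ * ((1 + y) ^ ((3 * σ - 2) / 2))⁻¹) := by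
    rw [← mul_inv, inv_eq_one_div, div_le_iff₀ e1]
    calc (1 : ℝ) = ((1 + ‖x‖) ^ ((σ + 2) / 2) * (1 + y) ^ ((3 * σ - 2) / 2)) *
          ((1 + ‖x‖) ^ ((σ + 2) / 2) * (1 + y) ^ ((3 * σ - 2) / 2))⁻¹ := by field_simp
      _ ≤ (2 ^ σ * (x ^ 2 + (y + 1) ^ 2) ^ σ) *
          ((1 + ‖x‖) ^ ((σ + 2) / 2) * (1 + y) ^ ((3 * σ - 2) / 2))⁻¹ := by gcongr
      _ = _ := by ring
  calc 4 ^ σ * y ^ σ / (x ^ 2 + (y + 1) ^ 2) ^ σ * (1 / y ^ 2)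
      = (4 ^ σ * y ^ σ * (1 / y ^ 2)) * ((x ^ 2 + (y + 1) ^ 2) ^ σ)⁻¹ := by ring
    _ ≤ (4 ^ σ * y ^ σ * (1 / y ^ 2)) * (2 ^ σ * (((1 + ‖x‖) ^ ((σ + 2) / 2))⁻¹ *
        ((1 + y) ^ ((3 * σ - 2) / 2))⁻¹)) := by gcongr
    _ = _ := by ring

lemma integrableOn_rpow_mul_rpow {σ : ℝ} (hσ : 1 < σ) :
    IntegrableOn (fun y : ℝ => y ^ (σ - 2) * (1 + y) ^ (-((3 * σ - 2) / 2))) (Set.Ioi 0) := by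
  have hsplit : Set.Ioi (0 : ℝ) = Set.Ioo 0 1 ∪ Set.Ici 1 := by
    rw [Set.Ioo_union_Ici_eq_Ioi zero_lt_one]
  have hmeas : Measurable (fun y : ℝ => y ^ (σ - 2) * (1 + y) ^ (-((3 * σ - 2) / 2))) := by fun_prop
  rw [hsplit]
  refine IntegrableOn.union ?_ ?_
  · have h : IntegrableOn (fun y : ℝ => y ^ (σ - 2)) (Set.Ioo 0 1) :=
      (intervalIntegral.integrableOn_Ioo_rpow_iff zero_lt_one).mpr (by linarith)
    refine Integrable.mono' h hmeas.aestronglyMeasurable ?_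
    refine (ae_restrict_iff' measurableSet_Ioo).mpr (Filter.Eventually.of_forall fun y hy => ?_)
    have h1 := Real.rpow_nonneg hy.1.le (σ - 2)
    have h3 : (0 : ℝ) ≤ 1 + y := by linarith [hy.1]
    have h2 := Real.rpow_nonneg h3 (-((3 * σ - 2) / 2))
    rw [Real.norm_of_nonneg (mul_nonneg h1 h2)]
    refine mul_le_of_le_one_right h1 (Real.rpow_le_one_of_one_le_of_nonpos (by linarith [hy.1]) ?_)
    linarith
  · have h : IntegrableOn (fun y : ℝ => y ^ (-(σ / 2) - 1)) (Set.Ioi (1/2)) :=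
      integrableOn_Ioi_rpow_of_lt (by linarith) (by norm_num)
    have h' : IntegrableOn (fun y : ℝ => y ^ (-(σ / 2) - 1)) (Set.Ici 1) :=
      h.mono_set (fun y hy => by simp only [Set.mem_Ici] at hy; simp only [Set.mem_Ioi]; linarith)
    refine Integrable.mono' h' hmeas.aestronglyMeasurable ?_
    refine (ae_restrict_iff' measurableSet_Ici).mpr (Filter.Eventually.of_forall fun y hy => ?_)
    simp only [Set.mem_Ici] at hy
    have hy0 : 0 < y := by linarith
    have h1 := Real.rpow_nonneg hy0.le (σ - 2)
    have h3 : (0 : ℝ) ≤ 1 + y := by linarith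
    have h2 := Real.rpow_nonneg h3 (-((3 * σ - 2) / 2))
    rw [Real.norm_of_nonneg (mul_nonneg h1 h2)]
    calc y ^ (σ - 2) * (1 + y) ^ (-((3 * σ - 2) / 2)) ≤ y ^ (σ - 2) * y ^ (-((3 * σ - 2) / 2)) := by
          refine mul_le_mul_of_nonneg_left ?_ h1
          exact Real.rpow_le_rpow_of_nonpos hy0 (by linarith) (by linarith)
      _ = y ^ (-(σ / 2) - 1) := by rw [← Real.rpow_add hy0]; congr 1; ring

lemma lintegral_rpow_rr_lt_top {σ : ℝ} (hσ : 1 < σ) :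
    ∫⁻ w : ℍ, ENNReal.ofReal (rr UpperHalfPlane.I w ^ σ) < ⊤ := by
  have hm : Measurable (fun w : ℍ => ENNReal.ofReal (rr UpperHalfPlane.I w ^ σ)) := by
    have := (continuous_rr UpperHalfPlane.I).measurable
    fun_prop
  rw [lintegral_eq_coord _ hm]
  set f : ℝ → ENNReal := fun x => ENNReal.ofReal ((1 + ‖x‖) ^ (-((σ + 2) / 2)))
  set h : ℝ → ENNReal := fun y => ENNReal.ofReal (y ^ (σ - 2) * (1 + y) ^ (-((3 * σ - 2) / 2)))
  have hfm : Measurable f := by fun_prop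
  have hhm : Measurable h := by fun_prop
  have h1 : ∀ y ∈ Set.Ioi (0 : ℝ), ∫⁻ x : ℝ, ENNReal.ofReal
      (rr UpperHalfPlane.I (toH (x, y)) ^ σ) * ENNReal.ofReal (1 / y ^ 2) ≤
      (ENNReal.ofReal (4 ^ σ * 2 ^ σ) * ∫⁻ x, f x) * h y := by
    intro y hy
    simp only [Set.mem_Ioi] at hy
    calc _ ≤ ∫⁻ x : ℝ, ENNReal.ofReal (4 ^ σ * 2 ^ σ) * f x * h y := by
          refine lintegral_mono fun x => ?_
          simp only [f, h]
          rw [← ENNReal.ofReal_mul (Real.rpow_nonneg (rr_pos _ _).le _),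
            ← ENNReal.ofReal_mul (by positivity), ← ENNReal.ofReal_mul (by positivity)]
          refine ENNReal.ofReal_le_ofReal ((rpow_rr_I_le hσ hy).trans (le_of_eq ?_))
          ring
      _ = _ := by
          rw [lintegral_mul_const _ (by fun_prop), lintegral_const_mul _ hfm]
  refine lt_of_le_of_lt (setLIntegral_mono' measurableSet_Ioi h1) ?_
  rw [lintegral_const_mul _ hhm]
  refine ENNReal.mul_lt_top (ENNReal.mul_lt_top ENNReal.ofReal_lt_top ?_) ?_
  · have : Integrable (fun x : ℝ => (1 + ‖x‖) ^ (-((σ + 2) / 2))) :=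
      integrable_one_add_norm (by simp; linarith)
    exact this.lintegral_lt_top
  · exact (integrableOn_rpow_mul_rpow hσ).lintegral_lt_top

lemma lintegral_smul_eq (δ : SL(2, ℝ)) (f : ℍ → ENNReal) :
    ∫⁻ w : ℍ, f (δ • w) = ∫⁻ w : ℍ, f w :=
  (measurePreserving_smul δ (volume : Measure ℍ)).lintegral_comp_emb
    (measurableEmbedding_const_smul δ) f

lemma volume_ball_eq (z : ℍ) (ε : ℝ) :
    volume (Metric.ball z ε) = volume (Metric.ball UpperHalfPlane.I ε) := by
  have h : Metric.ball z ε = z.toSL2R • Metric.ball UpperHalfPlane.I ε := by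
    rw [Metric.smul_ball, toSL2R_smul_I]
  rw [h, measure_smul]

/-- By homogeneity the centre may be taken to be i. The ball is then a Euclidean disc of radius sinh
ε ≥ ε, and y ≤ e on it because ε ≤ 1, so that the density 1/y² is at least e^(-2). -/
lemma le_volume_ball {ε : ℝ} (h0 : 0 < ε) (h1 : ε ≤ 1) (z : ℍ) :
    ENNReal.ofReal (ε ^ 2 * Real.exp (-2)) ≤ volume (Metric.ball z ε) := by
  rw [volume_ball_eq, volume_eq_lintegral]
  calc ENNReal.ofReal (ε ^ 2 * Real.exp (-2))
      ≤ ∫⁻ w in UpperHalfPlane.coe '' (Metric.ball UpperHalfPlane.I ε), ENNReal.ofReal (Real.exp (-2)) := by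
        rw [setLIntegral_const, image_coe_ball, Complex.volume_ball, mul_comm,
          ENNReal.ofReal_mul (Real.exp_pos _).le]
        gcongr
        rw [I_im, one_mul, ← ENNReal.ofReal_pow (Real.sinh_nonneg_iff.mpr h0.le),
          ← ENNReal.ofReal_coe_nnreal, ← ENNReal.ofReal_mul (by positivity)]
        refine ENNReal.ofReal_le_ofReal ?_
        have e1 : ε ≤ Real.sinh ε := Real.self_le_sinh_iff.mpr h0.le
        have e2 : ε ^ 2 ≤ Real.sinh ε ^ 2 := by gcongr
        have e3 : (1 : ℝ) ≤ NNReal.pi := by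
          rw [NNReal.coe_real_pi]; linarith [Real.pi_gt_three]
        nlinarith [sq_nonneg (Real.sinh ε)]
    _ ≤ _ := by
        refine setLIntegral_mono' (measurableEmbedding_coe.measurableSet_image.mpr
          measurableSet_ball) ?_
        rintro _ ⟨w, hw, rfl⟩
        rw [← ENNReal.ofReal_coe_nnreal]
        refine ENNReal.ofReal_le_ofReal ?_
        have h2 : w.im ≤ Real.exp 1 := by
          have := im_le_im_mul_exp_dist w UpperHalfPlane.I
          rw [I_im, one_mul] at this
          refine this.trans (Real.exp_le_exp.mpr ?_)
          rw [Metric.mem_ball] at hw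
          linarith
        have h3 := w.im_pos
        push_cast
        rw [coe_im, Real.norm_of_nonneg h3.le, one_div, inv_pow, Real.exp_neg]
        refine inv_anti₀ (by positivity) ?_
        calc w.im ^ 2 ≤ Real.exp 1 ^ 2 := by gcongr
          _ = Real.exp 2 := by rw [← Real.exp_nat_mul]; norm_num

instance (Γ : Subgroup SL(2, ℝ)) : IsIsometricSMul Γ ℍ :=
  ⟨fun γ => isometry_smul ℍ (γ : SL(2, ℝ))⟩

/-- The balls of radius ε around the points γz' are disjoint, r(z, ·) changes at most by a factor e
on each of them, and the integral of r(z, ·)^σ over ℍ is finite and independent of z. The constant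
does not depend on Γ, z, z' or ε: later ε tends to 0 along the cusps, and the price is exactly
ε^(-2). -/
lemma exists_orbital_sum_bound {σ : ℝ} (hσ : 1 < σ) : ∃ C : ℝ, 0 ≤ C ∧
    ∀ (Γ : Subgroup SL(2, ℝ)) [Countable Γ] (z z' : ℍ) (ε : ℝ), 0 < ε → ε ≤ 1 →
      (∀ γ : Γ, γ ≠ 1 → 2 * ε ≤ dist z' (γ • z')) →
      Summable (fun γ : Γ => rr z (γ • z') ^ σ) ∧
        ∑' γ : Γ, rr z (γ • z') ^ σ ≤ C * (ε ^ 2)⁻¹ := by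
  set A := ∫⁻ w : ℍ, ENNReal.ofReal (rr UpperHalfPlane.I w ^ σ)
  have hA : A < ⊤ := lintegral_rpow_rr_lt_top hσ
  refine ⟨Real.exp 1 ^ σ * A.toReal * Real.exp 2, by positivity, ?_⟩
  intro Γ _ z z' ε h0 h1 hsep
  have hdisj : Pairwise (Function.onFun Disjoint fun γ : Γ => Metric.ball (γ • z') ε) := by
    intro γ δ hγδ
    refine Metric.ball_disjoint_ball ?_
    have h2 := hsep (γ⁻¹ * δ) (by rwa [ne_eq, inv_mul_eq_one])
    rw [mul_smul, ← dist_smul γ, smul_inv_smul] at h2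
    linarith
  have hA' : ∀ z : ℍ, ∫⁻ w : ℍ, ENNReal.ofReal (rr z w ^ σ) = A := by
    intro z
    rw [← lintegral_smul_eq z.toSL2R]
    refine lintegral_congr fun w => ?_
    nth_rewrite 1 [← toSL2R_smul_I z]
    rw [rr_smul_smul]
  have key : ∑' γ : Γ, ENNReal.ofReal (rr z (γ • z') ^ σ) * ENNReal.ofReal (ε ^ 2 * Real.exp (-2)) ≤
      ENNReal.ofReal (Real.exp 1 ^ σ) * A := by
    calc _ ≤ ∑' γ : Γ, ∫⁻ w in Metric.ball (γ • z') ε,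
          ENNReal.ofReal (Real.exp 1 ^ σ) * ENNReal.ofReal (rr z w ^ σ) := by
          refine ENNReal.tsum_le_tsum fun γ => ?_
          calc _ ≤ ENNReal.ofReal (rr z (γ • z') ^ σ) * volume (Metric.ball (γ • z') ε) := by
                gcongr; exact le_volume_ball h0 h1 _
            _ = ∫⁻ w in Metric.ball (γ • z') ε, ENNReal.ofReal (rr z (γ • z') ^ σ) := by
                rw [setLIntegral_const]
            _ ≤ _ := by
                refine setLIntegral_mono' measurableSet_ball fun w hw => ?_
                rw [← ENNReal.ofReal_mul (by positivity),
                  ← Real.mul_rpow (Real.exp_pos _).le (rr_pos _ _).le]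
                refine ENNReal.ofReal_le_ofReal ?_
                refine Real.rpow_le_rpow (rr_pos _ _).le (rr_le_of_dist ?_) (by linarith)
                rw [Metric.mem_ball, dist_comm] at hw
                linarith
      _ = ∫⁻ w in ⋃ γ : Γ, Metric.ball (γ • z') ε,
          ENNReal.ofReal (Real.exp 1 ^ σ) * ENNReal.ofReal (rr z w ^ σ) := by
          rw [lintegral_iUnion (fun γ => measurableSet_ball) hdisj]
      _ ≤ ∫⁻ w, ENNReal.ofReal (Real.exp 1 ^ σ) * ENNReal.ofReal (rr z w ^ σ) :=
          setLIntegral_le_lintegral _ _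
      _ = _ := by
          rw [lintegral_const_mul, hA']
          have := (continuous_rr z).measurable
          fun_prop
  rw [ENNReal.tsum_mul_right] at key
  have hpos : 0 < ε ^ 2 * Real.exp (-2) := by positivity
  have key2 : ∑' γ : Γ, ENNReal.ofReal (rr z (γ • z') ^ σ) ≤
      ENNReal.ofReal (Real.exp 1 ^ σ * A.toReal * Real.exp 2 * (ε ^ 2)⁻¹) := by
    have e1 : ENNReal.ofReal (Real.exp 1 ^ σ * A.toReal * Real.exp 2 * (ε ^ 2)⁻¹) =
        (ENNReal.ofReal (Real.exp 1 ^ σ) * A) / ENNReal.ofReal (ε ^ 2 * Real.exp (-2)) := by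
      rw [← ENNReal.ofReal_toReal hA.ne, ← ENNReal.ofReal_mul (by positivity),
        ← ENNReal.ofReal_div_of_pos hpos, ENNReal.toReal_ofReal ENNReal.toReal_nonneg, Real.exp_neg]
      congr 1
      have := Real.exp_pos 2
      field_simp
    rw [e1, ENNReal.le_div_iff_mul_le (Or.inl (by simpa using hpos))
      (Or.inl ENNReal.ofReal_ne_top)]
    exact key
  have hnn : ∀ γ : Γ, 0 ≤ rr z (γ • z') ^ σ := fun γ => Real.rpow_nonneg (rr_pos _ _).le _
  have hsum : Summable (fun γ : Γ => rr z (γ • z') ^ σ) := by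
    have h3 : ∑' γ : Γ, ENNReal.ofReal (rr z (γ • z') ^ σ) ≠ ⊤ :=
      (key2.trans_lt ENNReal.ofReal_lt_top).ne
    have := ENNReal.summable_toReal h3
    simpa [ENNReal.toReal_ofReal (hnn _)] using this
  refine ⟨hsum, ?_⟩
  rw [← ENNReal.ofReal_tsum_of_nonneg hnn hsum] at key2
  exact (ENNReal.ofReal_le_ofReal_iff (by positivity)).mp key2

end

/-! ### Torsion-free discrete groups -/

instance : SecondCountableTopology SL(2, ℝ) :=
  have : SecondCountableTopology (Matrix (Fin 2) (Fin 2) ℝ) :=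
    inferInstanceAs (SecondCountableTopology (Fin 2 → Fin 2 → ℝ))
  (Matrix.SpecialLinearGroup.isClosedEmbedding_val (n := Fin 2) (R := ℝ)).isEmbedding.secondCountableTopology

instance (Γ : Subgroup SL(2, ℝ)) [DiscreteTopology Γ] : Countable Γ :=
  TopologicalSpace.separableSpace_iff_countable.mp inferInstance

section

variable {Γ : Subgroup SL(2, ℝ)} [DiscreteTopology Γ]

lemma finite_smul_inter {K L : Set ℍ} (hK : IsCompact K) (hL : IsCompact L) :
    {γ : Γ | ∃ z ∈ K, γ • z ∈ L}.Finite := by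
  refine (ProperlyDiscontinuousSMul.finite_disjoint_inter_image (Γ := Γ) hK hL).subset ?_
  rintro γ ⟨z, hz, hz'⟩
  have : ((fun w : ℍ => γ • w) '' K ∩ L).Nonempty := ⟨γ • z, ⟨z, hz, rfl⟩, hz'⟩
  exact this

/-- Proper discontinuity makes the stabilizer of z finite, so an element fixing z has finite order.
-/
lemma smul_ne_self (htf : ∀ γ : Γ, γ ≠ 1 → ¬ IsOfFinOrder γ) {γ : Γ} (hγ : γ ≠ 1) (z : ℍ) :
    γ • z ≠ z := by
  intro h
  apply htf γ hγ
  rw [← finite_powers]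
  refine (finite_smul_inter (Γ := Γ) (isCompact_singleton (x := z)) (isCompact_singleton (x := z))).subset ?_
  rintro _ ⟨n, rfl⟩
  refine ⟨z, rfl, ?_⟩
  simp only [Set.mem_singleton_iff]
  induction n with
  | zero => simp
  | succ n ih => simp only [pow_succ, mul_smul, h]; exact ih

lemma exists_separation (htf : ∀ γ : Γ, γ ≠ 1 → ¬ IsOfFinOrder γ) (z : ℍ) :
    ∃ ε : ℝ, 0 < ε ∧ ε ≤ 1 ∧ ∀ γ : Γ, γ ≠ 1 → 2 * ε ≤ dist z (γ • z) := by
  have hfin := finite_smul_inter (Γ := Γ) (isCompact_singleton (x := z))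
    (isCompact_closedBall z 2)
  have h : ∀ᶠ ε : ℝ in nhdsWithin 0 (Set.Ioi 0),
      ∀ γ ∈ {γ : Γ | ∃ w ∈ ({z} : Set ℍ), γ • w ∈ Metric.closedBall z 2},
        γ ≠ 1 → 2 * ε ≤ dist z (γ • z) := by
    rw [Filter.eventually_all_finite hfin]
    intro γ _
    by_cases hγ : γ = 1
    · simp [hγ]
    · have hd : 0 < dist z (γ • z) / 2 := by
        have := dist_pos.mpr (smul_ne_self htf hγ z).symm
        positivity
      filter_upwards [Ioo_mem_nhdsGT hd] with ε hε _
      linarith [hε.2]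
  obtain ⟨ε, h1, h2⟩ := (h.and (Ioo_mem_nhdsGT (zero_lt_one' ℝ))).exists
  refine ⟨ε, h2.1, h2.2.le, fun γ hγ => ?_⟩
  by_cases hm : γ • z ∈ Metric.closedBall z 2
  · exact h1 γ ⟨z, rfl, hm⟩ hγ
  · rw [Metric.mem_closedBall, not_le, dist_comm] at hm
    linarith [h2.2]

lemma summable_rr_smul (htf : ∀ γ : Γ, γ ≠ 1 → ¬ IsOfFinOrder γ) {σ : ℝ} (hσ : 1 < σ) (z z' : ℍ) :
    Summable (fun γ : Γ => rr z (γ • z') ^ σ) := by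
  obtain ⟨C, _, hC⟩ := exists_orbital_sum_bound hσ
  obtain ⟨ε, h0, h1, h2⟩ := exists_separation htf z'
  exact (hC Γ z z' ε h0 h1 h2).1

variable (Γ) in
/-- The set of pairs `(z, z')` that are not equivalent under a nontrivial element of `Γ`. -/
def freePairs : Set (ℍ × ℍ) := {p | ∀ γ : Γ, γ ≠ 1 → γ • p.2 ≠ p.1}

lemma isOpen_freePairs : IsOpen (freePairs Γ) := by
  rw [isOpen_iff_eventually]
  rintro ⟨z, z'⟩ hp
  have hfin := finite_smul_inter (Γ := Γ) (isCompact_closedBall z' 1) (isCompact_closedBall z 1)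
  have h1 : ∀ᶠ p : ℍ × ℍ in nhds (z, z'),
      p.1 ∈ Metric.closedBall z 1 ∧ p.2 ∈ Metric.closedBall z' 1 :=
    (continuous_fst.continuousAt.eventually_mem (Metric.closedBall_mem_nhds z one_pos)).and
    (continuous_snd.continuousAt.eventually_mem (Metric.closedBall_mem_nhds z' one_pos))
  have h2 : ∀ᶠ p : ℍ × ℍ in nhds (z, z'),
      ∀ γ ∈ {γ : Γ | ∃ w ∈ Metric.closedBall z' 1, γ • w ∈ Metric.closedBall z 1},
        γ ≠ 1 → γ • p.2 ≠ p.1 := by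
    rw [Filter.eventually_all_finite hfin]
    intro γ _
    by_cases hγ : γ = 1
    · simp [hγ]
    · have : ContinuousAt (fun p : ℍ × ℍ => ((γ : SL(2, ℝ)) • p.2, p.1)) (z, z') := by fun_prop
      filter_upwards [this.eventually (isOpen_ne_fun continuous_fst continuous_snd |>.mem_nhds
        (hp γ hγ))] with p hp' _
      exact hp'
  filter_upwards [h1, h2] with p hp1 hp2 γ hγ he
  exact hp2 γ ⟨p.2, hp1.2, he ▸ hp1.1⟩ hγ he

lemma diag_mem_freePairs (htf : ∀ γ : Γ, γ ≠ 1 → ¬ IsOfFinOrder γ) (z : ℍ) :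
    (z, z) ∈ freePairs Γ := fun _ hγ => smul_ne_self htf hγ z

/-- Each value is below 1, and all but finitely many are below 1/2, being terms of a convergent
series. Hence they stay uniformly away from the singularity at r = 1. -/
lemma exists_rr_le (htf : ∀ γ : Γ, γ ≠ 1 → ¬ IsOfFinOrder γ) {p : ℍ × ℍ} (hp : p ∈ freePairs Γ) :
    ∃ κ : ℝ, 0 < κ ∧ κ < 1 ∧ ∀ γ : Γ, γ ≠ 1 → rr p.1 (γ • p.2) ≤ 1 - κ := by
  have hs := (summable_rr_smul htf (one_lt_two : (1:ℝ) < 2) p.1 p.2).tendsto_cofinite_zero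
  have h1 : ∀ᶠ γ : Γ in Filter.cofinite, rr p.1 (γ • p.2) ^ (2 : ℝ) < 1 / 4 :=
    hs.eventually (gt_mem_nhds (by norm_num))
  rw [Filter.eventually_cofinite] at h1
  have h : ∀ᶠ κ : ℝ in nhdsWithin 0 (Set.Ioi 0),
      ∀ γ ∈ {γ : Γ | ¬ rr p.1 (γ • p.2) ^ (2 : ℝ) < 1 / 4},
        γ ≠ 1 → rr p.1 (γ • p.2) ≤ 1 - κ := by
    rw [Filter.eventually_all_finite h1]
    intro γ _
    by_cases hγ : γ = 1
    · simp [hγ]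
    · have hd : 0 < 1 - rr p.1 (γ • p.2) :=
        sub_pos.mpr (rr_smul_lt_one (γ := (γ : SL(2, ℝ))) (hp γ hγ))
      filter_upwards [Ioo_mem_nhdsGT hd] with ε hε _
      linarith [hε.2]
  obtain ⟨κ, h2, h3⟩ := (h.and (Ioo_mem_nhdsGT (by norm_num : (0:ℝ) < 1 / 2))).exists
  refine ⟨κ, h3.1, by linarith [h3.2], fun γ hγ => ?_⟩
  by_cases hm : rr p.1 (γ • p.2) ^ (2 : ℝ) < 1 / 4
  · rw [Real.rpow_two] at hm
    nlinarith [h3.2, rr_pos p.1 (γ • p.2)]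
  · exact h2 γ hm hγ

end

/-! ### Sums of holomorphic functions of several variables -/

section

variable {E : Type*} [NormedAddCommGroup E] [NormedSpace ℂ E]

/-- Cauchy's estimate on the complex line through q in direction v, over the disc of radius
ρ/(4‖v‖), whose image stays inside the ball around p. -/
lemma norm_fderiv_apply_le_of_bound {f : E → ℂ} {p : E} {ρ M : ℝ} (hρ : 0 < ρ)
    (hf : ∀ q ∈ Metric.ball p ρ, DifferentiableAt ℂ f q)
    (hb : ∀ q ∈ Metric.ball p ρ, ‖f q‖ ≤ M) {q : E} (hq : q ∈ Metric.ball p (ρ / 2)) (v : E) :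
    ‖fderiv ℂ f q v‖ ≤ M * (4 / ρ) * ‖v‖ := by
  by_cases hv : v = 0
  · simp [hv]
  have hv' : 0 < ‖v‖ := norm_pos_iff.mpr hv
  set R := ρ / 4 / ‖v‖
  have hR : 0 < R := by positivity
  have hmem : ∀ t ∈ Metric.closedBall (0 : ℂ) R, q + t • v ∈ Metric.ball p ρ := by
    intro t ht
    rw [mem_closedBall_zero_iff] at ht
    rw [Metric.mem_ball] at hq ⊢
    calc dist (q + t • v) p ≤ dist (q + t • v) q + dist q p := dist_triangle _ _ _
      _ ≤ ρ / 4 + dist q p := by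
          gcongr
          rw [dist_eq_norm, add_sub_cancel_left, norm_smul]
          calc ‖t‖ * ‖v‖ ≤ R * ‖v‖ := by gcongr
            _ = ρ / 4 := by simp only [R]; field_simp
      _ < ρ := by linarith
  have hline : ∀ t : ℂ, HasDerivAt (fun t : ℂ => q + t • v) v t := by
    intro t
    simpa using ((hasDerivAt_id t).smul_const v).const_add q
  have hd : HasDerivAt (fun t : ℂ => f (q + t • v)) (fderiv ℂ f q v) 0 := by
    have h1 : HasFDerivAt f (fderiv ℂ f q) (q + (0 : ℂ) • v) := by
      rw [zero_smul, add_zero]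
      refine (hf q ?_).hasFDerivAt
      exact Metric.ball_subset_ball (by linarith) hq
    exact h1.comp_hasDerivAt (0 : ℂ) (hline 0)
  have h2 := Complex.norm_deriv_le_of_forall_mem_sphere_norm_le (c := (0 : ℂ)) (C := M)
    (f := fun t : ℂ => f (q + t • v)) hR ?_ (fun t ht => hb _ (hmem t (Metric.sphere_subset_closedBall ht)))
  · rw [hd.deriv] at h2
    refine h2.trans (le_of_eq ?_)
    simp only [R]; field_simp
  · refine DifferentiableOn.diffContOnCl (fun t ht => ?_)
    have ht' := hmem t (Metric.closure_ball_subset_closedBall ht)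
    exact (((hf _ ht').hasFDerivAt.comp_hasDerivAt t (hline t)).differentiableAt).differentiableWithinAt

/-- Only bounds for the functions themselves are assumed; those for the derivatives follow from
Cauchy's estimate. This is the benefit of extending the kernels to holomorphic functions of four
variables. -/
lemma hasFDerivAt_tsum_of_bound {ι : Type*} {f : ι → E → ℂ} {u : ι → ℝ} (hu : Summable u) {p : E}
    {ρ : ℝ} (hρ : 0 < ρ) (hf : ∀ i, ∀ q ∈ Metric.ball p ρ, DifferentiableAt ℂ (f i) q)
    (hb : ∀ i, ∀ q ∈ Metric.ball p ρ, ‖f i q‖ ≤ u i) {q : E} (hq : q ∈ Metric.ball p (ρ / 2)) :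
    ∃ F' : E →L[ℂ] ℂ, HasFDerivAt (fun q => ∑' i, f i q) F' q ∧
      ∀ v, F' v = ∑' i, fderiv ℂ (f i) q v := by
  have hu0 : ∀ i, 0 ≤ u i := fun i => (norm_nonneg _).trans (hb i p (Metric.mem_ball_self hρ))
  have hbd : ∀ i, ∀ q ∈ Metric.ball p (ρ / 2), ‖fderiv ℂ (f i) q‖ ≤ u i * (4 / ρ) := by
    intro i q hq
    refine ContinuousLinearMap.opNorm_le_bound _ (mul_nonneg (hu0 i) (by positivity)) fun v => ?_
    exact norm_fderiv_apply_le_of_bound hρ (hf i) (hb i) hq v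
  refine ⟨∑' i, fderiv ℂ (f i) q, ?_, fun v => ?_⟩
  · let _ : NormedSpace ℝ E := NormedSpace.restrictScalars ℝ ℂ E
    refine hasFDerivAt_tsum_of_isPreconnected (hu.mul_right (4 / ρ)) Metric.isOpen_ball
      (convex_ball p (ρ / 2)).isPreconnected (fun i y hy => ?_) hbd
      (Metric.mem_ball_self (by positivity : 0 < ρ / 2)) ?_ hq
    · exact (hf i y (Metric.ball_subset_ball (by linarith) hy)).hasFDerivAt
    · exact Summable.of_norm_bounded hu fun i => hb i p (Metric.mem_ball_self hρ)
  · have hs : Summable (fun i => fderiv ℂ (f i) q) :=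
      Summable.of_norm_bounded (hu.mul_right (4 / ρ)) fun i => hbd i q hq
    exact ContinuousLinearMap.map_tsum (ContinuousLinearMap.apply ℂ ℂ v) hs

/-- The Wirtinger derivative in z sees only the direction e that multiplies w; the contributions of
the direction e' multiplying w̄ cancel. Thus ∂/∂z becomes a partial derivative of the holomorphic
extension. -/
lemma dz_eq_of_hasFDerivAt [NormedSpace ℝ E] [IsScalarTower ℝ ℂ E] {f : ℍ → ℂ} {z : ℍ} {F : E → ℂ} {F' : E →L[ℂ] ℂ} {e e' : E}
    {ι : ℂ → E} (hι : ∀ w : ℂ, ι w = ι 0 + w • e + conj w • e')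
    (hF : HasFDerivAt F F' (ι z)) (hfF : ∀ᶠ w : ℍ in nhds z, f w = F (ι w)) :
    dz f z = F' e := by
  set L : ℂ →L[ℝ] E := (ContinuousLinearMap.toSpanSingleton ℂ e).restrictScalars ℝ +
    ((ContinuousLinearMap.toSpanSingleton ℂ e').restrictScalars ℝ).comp
      (Complex.conjCLE : ℂ →L[ℝ] ℂ) with hL
  have hLapp : ∀ w, L w = w • e + conj w • e' := by
    intro w; simp [hL]
  have hι' : HasFDerivAt ι L (z : ℂ) := by
    have : ι = fun w => ι 0 + L w := by
      funext w; rw [hLapp, hι w, add_assoc]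
    rw [this]
    exact L.hasFDerivAt.const_add _
  have h1 : HasFDerivAt (fun w : ℂ => F (ι w)) ((F'.restrictScalars ℝ).comp L) (z : ℂ) :=
    (hF.restrictScalars ℝ).comp (z : ℂ) hι'
  have h2 : (fun w : ℂ => f (ofComplex w)) =ᶠ[nhds (z : ℂ)] fun w => F (ι w) := by
    have hc : Filter.Tendsto ofComplex (nhds (z : ℂ)) (nhds z) := by
      have := (contMDiffAt_ofComplex (n := 0) z.im_pos).continuousAt
      rw [ContinuousAt, ofComplex_apply] at this
      exact this
    filter_upwards [hc.eventually hfF, eventuallyEq_coe_comp_ofComplex z.im_pos] with w hw hw'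
    rw [hw]
    congr 2
  have h3 := (h1.congr_of_eventuallyEq h2).fderiv
  rw [dz, h3]
  simp only [ContinuousLinearMap.comp_apply, ContinuousLinearMap.coe_restrictScalars', hLapp]
  simp only [map_add, map_smul, map_one, Complex.conj_I, one_smul, smul_eq_mul]
  linear_combination (1 / 2 * (F' e' - F' e)) * Complex.I_sq

end

/-! ### The holomorphic extension of the kernels -/

/-- The four holomorphic variables `(z, z̄, z', z̄')`. -/
abbrev C4 : Type := ℂ × ℂ × ℂ × ℂ

/-- The holomorphic extension of `r(z, γ z')`. -/
def rc (γ : SL(2, ℝ)) (q : C4) : ℂ :=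
  -((q.1 - q.2.1) * (q.2.2.1 - q.2.2.2)) / (bil γ q.2.1 q.2.2.1 * bil γ q.1 q.2.2.2)

/-- The holomorphic extension of the kernels, weighted by powers of `16 (y y')²`. -/
def ker (s : ℂ) (j : ℕ) (γ : SL(2, ℝ)) (q : C4) : ℂ :=
  cst s j * bil γ q.2.1 q.2.2.2 ^ (2 * j) * radR s j (rc γ q)

/-- The derivative of `ker` with respect to `z'`. -/
def ker' (s : ℂ) (j : ℕ) (γ : SL(2, ℝ)) (q : C4) : ℂ :=
  cst s j * bil γ q.2.1 q.2.2.2 ^ (2 * j + 1) * radR' s j (rc γ q) /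
    ((q.2.2.1 - q.2.2.2) * bil γ q.2.1 q.2.2.1)

/-- The domain of the holomorphic extension. -/
def Good (γ : SL(2, ℝ)) (q : C4) : Prop := rc γ q ∈ Complex.slitPlane ∧ ‖rc γ q‖ < 1

lemma Good.ne {γ : SL(2, ℝ)} {q : C4} (h : Good γ q) :
    (q.1 - q.2.1 ≠ 0 ∧ q.2.2.1 - q.2.2.2 ≠ 0) ∧ bil γ q.2.1 q.2.2.1 ≠ 0 ∧ bil γ q.1 q.2.2.2 ≠ 0 := by
  have := Complex.slitPlane_ne_zero h.1
  rw [rc, div_ne_zero_iff, neg_ne_zero, mul_ne_zero_iff, mul_ne_zero_iff] at this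
  exact this

lemma Good.differentiableAt_rc {γ : SL(2, ℝ)} {q : C4} (h : Good γ q) :
    DifferentiableAt ℂ (rc γ) q := by
  have hn := h.ne
  have h1 : DifferentiableAt ℂ (fun q : C4 => bil γ q.2.1 q.2.2.1) q := by unfold bil; fun_prop
  have h2 : DifferentiableAt ℂ (fun q : C4 => bil γ q.1 q.2.2.2) q := by unfold bil; fun_prop
  unfold rc
  fun_prop (disch := exact mul_ne_zero hn.2.1 hn.2.2)

lemma Good.differentiableAt_ker {s : ℂ} (hs : 1 < s.re) (j : ℕ) {γ : SL(2, ℝ)} {q : C4}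
    (h : Good γ q) : DifferentiableAt ℂ (ker s j γ) q := by
  have h1 : DifferentiableAt ℂ (fun q : C4 => bil γ q.2.1 q.2.2.2) q := by unfold bil; fun_prop
  have h2 : DifferentiableAt ℂ (fun q : C4 => radR s j (rc γ q)) q :=
    (hasDerivAt_radR hs j h.2 h.1).differentiableAt.comp q h.differentiableAt_rc
  unfold ker
  fun_prop

lemma Good.differentiableAt_ker' {s : ℂ} (hs : 1 < s.re) (j : ℕ) {γ : SL(2, ℝ)} {q : C4}
    (h : Good γ q) : DifferentiableAt ℂ (ker' s j γ) q := by
  have h1 : DifferentiableAt ℂ (fun q : C4 => bil γ q.2.1 q.2.2.2) q := by unfold bil; fun_prop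
  have h3 : DifferentiableAt ℂ (fun q : C4 => bil γ q.2.1 q.2.2.1) q := by unfold bil; fun_prop
  have h2 : DifferentiableAt ℂ (fun q : C4 => radR' s j (rc γ q)) q :=
    (hasDerivAt_radR' hs j h.2 h.1).differentiableAt.comp q h.differentiableAt_rc
  unfold ker'
  fun_prop (disch := exact mul_ne_zero h.ne.1.2 h.ne.2.1)

/-- Logarithmic differentiation: B(ζ, ·) is affine, so 1/(z'-ζ') minus its logarithmic derivative
has numerator B(ζ, z') - (cζ - a)(z' - ζ') = B(ζ, ζ'). -/
lemma Good.hasDerivAt_rc_snd {γ : SL(2, ℝ)} {z ζ z' ζ' : ℂ} (h : Good γ (z, ζ, z', ζ')) :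
    HasDerivAt (fun t => rc γ (z, ζ, t, ζ'))
      (rc γ (z, ζ, z', ζ') * (bil γ ζ ζ' / ((z' - ζ') * bil γ ζ z'))) z' := by
  obtain ⟨⟨h1, h2⟩, h3, h4⟩ := h.ne
  simp only at h1 h2 h3 h4
  have hb : HasDerivAt (fun t => bil γ ζ t) ((γ 1 0 : ℂ) * ζ - γ 0 0) z' := by
    have := (((hasDerivAt_id z').const_mul ((γ 1 0 : ℂ) * ζ - γ 0 0)).add_const
      ((γ 1 1 : ℂ) * ζ - γ 0 1))
    simp only [id, mul_one] at this
    refine this.congr_of_eventuallyEq (Filter.Eventually.of_forall fun t => ?_)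
    simp only [bil]; ring
  have hn : HasDerivAt (fun t => -((z - ζ) * (t - ζ'))) (-((z - ζ) * 1)) z' :=
    (((hasDerivAt_id z').sub_const ζ').const_mul (z - ζ)).neg
  refine (hn.div (hb.mul_const (bil γ z ζ')) (mul_ne_zero h3 h4)).congr_deriv ?_
  simp only [rc]
  have hkey : bil γ ζ z' - ((γ 1 0 : ℂ) * ζ - γ 0 0) * (z' - ζ') = bil γ ζ ζ' := by
    simp only [bil]; ring
  rw [← hkey]
  field_simp
  ring

lemma Good.hasDerivAt_rc_fst {γ : SL(2, ℝ)} {z ζ z' ζ' : ℂ} (h : Good γ (z, ζ, z', ζ')) :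
    HasDerivAt (fun t => rc γ (t, ζ, z', ζ'))
      (rc γ (z, ζ, z', ζ') * (bil γ ζ ζ' / ((z - ζ) * bil γ z ζ'))) z := by
  obtain ⟨⟨h1, h2⟩, h3, h4⟩ := h.ne
  simp only at h1 h2 h3 h4
  have hb : HasDerivAt (fun t => bil γ t ζ') ((γ 1 0 : ℂ) * ζ' + γ 1 1) z := by
    have := (((hasDerivAt_id z).const_mul ((γ 1 0 : ℂ) * ζ' + γ 1 1)).sub_const
      ((γ 0 0 : ℂ) * ζ' + γ 0 1))
    simp only [id, mul_one] at this
    refine this.congr_of_eventuallyEq (Filter.Eventually.of_forall fun t => ?_)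
    simp only [bil]; ring
  have hn : HasDerivAt (fun t => -((t - ζ) * (z' - ζ'))) (-(1 * (z' - ζ'))) z :=
    (((hasDerivAt_id z).sub_const ζ).mul_const (z' - ζ')).neg
  refine (hn.div (hb.const_mul (bil γ ζ z')) (mul_ne_zero h3 h4)).congr_deriv ?_
  simp only [rc]
  have hkey : bil γ z ζ' - ((γ 1 0 : ℂ) * ζ' + γ 1 1) * (z - ζ) = bil γ ζ ζ' := by
    simp only [bil]; ring
  rw [← hkey]
  field_simp
  ring

lemma Good.hasDerivAt_ker {s : ℂ} (hs : 1 < s.re) (j : ℕ) {γ : SL(2, ℝ)} {z ζ z' ζ' : ℂ}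
    (h : Good γ (z, ζ, z', ζ')) :
    HasDerivAt (fun t => ker s j γ (z, ζ, t, ζ')) (ker' s j γ (z, ζ, z', ζ')) z' := by
  have h1 := (hasDerivAt_radR hs j h.2 h.1).comp z' h.hasDerivAt_rc_snd
  refine (h1.const_mul (cst s j * bil γ ζ ζ' ^ (2 * j))).congr_deriv ?_
  obtain ⟨⟨h1, h2⟩, h3, h4⟩ := h.ne
  have h5 := Complex.slitPlane_ne_zero h.1
  simp only [ker'] at *
  field_simp
  ring

/-- The factor B(ζ, ζ') involves neither z nor z', so it passes through both derivatives and gains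
one power from each. The remaining denominator ((z-ζ)(z'-ζ'))² equals 16 (yy')² at actual points of
ℍ × ℍ, which accounts for the change of weight from (yy')^(2j) to (yy')^(2j+2) and for the power of
16 in `kerR`. The constants match by `cst_succ`. -/
lemma Good.hasDerivAt_ker' {s : ℂ} (hs : 1 < s.re) (j : ℕ) {γ : SL(2, ℝ)} {z ζ z' ζ' : ℂ}
    (h : Good γ (z, ζ, z', ζ')) :
    HasDerivAt (fun t => ker' s j γ (t, ζ, z', ζ'))
      (ker s (j + 1) γ (z, ζ, z', ζ') / ((z - ζ) * (z' - ζ')) ^ 2) z := by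
  have h1 := (hasDerivAt_radR' hs j h.2 h.1).comp z h.hasDerivAt_rc_fst
  refine ((h1.const_mul (cst s j * bil γ ζ ζ' ^ (2 * j + 1))).div_const
    ((z' - ζ') * bil γ ζ z')).congr_deriv ?_
  obtain ⟨⟨h1, h2⟩, h3, h4⟩ := h.ne
  have h5 := Complex.slitPlane_ne_zero h.1
  simp only [ker, cst_succ hs] at *
  have h6 : rc γ (z, ζ, z', ζ') * (bil γ ζ z' * bil γ z ζ') = -((z - ζ) * (z' - ζ')) := by
    simp only [rc]; field_simp
  have h7 : (s + j) ^ 2 * radR s (j + 1) (rc γ (z, ζ, z', ζ')) / rc γ (z, ζ, z', ζ') ^ 2 *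
      (rc γ (z, ζ, z', ζ') * (bil γ ζ ζ' / ((z - ζ) * bil γ z ζ'))) =
      -(s + j) ^ 2 * radR s (j + 1) (rc γ (z, ζ, z', ζ')) * bil γ ζ ζ' * bil γ ζ z' /
        ((z - ζ) ^ 2 * (z' - ζ')) := by
    have h8 : bil γ z ζ' = -((z - ζ) * (z' - ζ')) / (rc γ (z, ζ, z', ζ') * bil γ ζ z') := by
      rw [← h6]; field_simp
    rw [h8]; field_simp
  rw [h7]
  field_simp
  ring

lemma Good.fderiv_ker {s : ℂ} (hs : 1 < s.re) (j : ℕ) {γ : SL(2, ℝ)} {q : C4}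
    (h : Good γ q) : fderiv ℂ (ker s j γ) q (0, 0, 1, 0) = ker' s j γ q := by
  obtain ⟨z, ζ, z', ζ'⟩ := q
  have h1 : HasDerivAt (fun t : ℂ => ((z, ζ, t, ζ') : C4)) (0, 0, 1, 0) z' :=
    (hasDerivAt_const _ _).prodMk ((hasDerivAt_const _ _).prodMk
      ((hasDerivAt_id _).prodMk (hasDerivAt_const _ _)))
  have h2 := (h.differentiableAt_ker hs j).hasFDerivAt.comp_hasDerivAt z' h1
  exact h2.unique (h.hasDerivAt_ker hs j)

lemma Good.fderiv_ker' {s : ℂ} (hs : 1 < s.re) (j : ℕ) {γ : SL(2, ℝ)} {q : C4}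
    (h : Good γ q) : fderiv ℂ (ker' s j γ) q (1, 0, 0, 0) =
      ker s (j + 1) γ q / ((q.1 - q.2.1) * (q.2.2.1 - q.2.2.2)) ^ 2 := by
  obtain ⟨z, ζ, z', ζ'⟩ := q
  have h1 : HasDerivAt (fun t : ℂ => ((t, ζ, z', ζ') : C4)) (1, 0, 0, 0) z :=
    (hasDerivAt_id _).prodMk ((hasDerivAt_const _ _).prodMk
      ((hasDerivAt_const _ _).prodMk (hasDerivAt_const _ _)))
  have h2 := (h.differentiableAt_ker' hs j).hasFDerivAt.comp_hasDerivAt z h1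
  exact h2.unique (h.hasDerivAt_ker' hs j)

/-! ### The Poincaré series as a sum over the group -/

/-- B(z, ·) is affine, so its values at z' and z̄' determine cz - a, and the imaginary part of the
latter gives c; similarly in the other variable. Since |B(z, z')| ≤ |B(z, z̄')|, all entries of γ
are controlled by |B(z, z̄')|, uniformly in γ. This uniformity allows one neighbourhood to serve all
γ at once. -/
lemma exists_coeff_bound (z z' : ℍ) : ∃ C : ℝ, 0 ≤ C ∧ ∀ (γ : SL(2, ℝ)) (i j : Fin 2),
    ‖(γ i j : ℂ)‖ ≤ C * ‖bil γ z (conj (z' : ℂ))‖ := by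
  have hy := z.im_pos
  have hy' := z'.im_pos
  set c1 := 1 / (z.im * z'.im)
  set c2 := 1 / z'.im + c1 * ‖(z : ℂ)‖
  set c3 := 1 / z.im + c1 * ‖(z' : ℂ)‖
  set c4 := 1 + c1 * ‖(z : ℂ)‖ * ‖(z' : ℂ)‖ + c3 * ‖(z : ℂ)‖ + c2 * ‖(z' : ℂ)‖
  have hc1 : 0 ≤ c1 := by positivity
  have hc2 : 0 ≤ c2 := by positivity
  have hc3 : 0 ≤ c3 := by positivity
  have hc4 : 0 ≤ c4 := by positivity
  refine ⟨c1 + c2 + c3 + c4, by positivity, fun γ => ?_⟩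
  set m := ‖bil γ z (conj (z' : ℂ))‖ with hm
  have hm0 : 0 ≤ m := norm_nonneg _
  have hsq := norm_bil_conj_sq γ z z'
  simp only [coe_im] at hsq
  have h1 : ‖bil γ z z'‖ ≤ m := by
    refine abs_le_of_sq_le_sq' ?_ hm0 |>.2
    have : 0 < z.im * z'.im := by positivity
    nlinarith
  have hI : ∀ w : ℍ, ‖(w : ℂ) - conj (w : ℂ)‖ = 2 * w.im := by
    intro w
    rw [Complex.sub_conj, norm_mul, Complex.norm_I, mul_one, Complex.norm_real,
      Real.norm_of_nonneg (by have := w.im_pos; rw [coe_im]; positivity), coe_im]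
  have h2 : ‖(γ 1 0 : ℂ) * z - γ 0 0‖ ≤ m / z'.im := by
    have e : ((γ 1 0 : ℂ) * z - γ 0 0) * ((z' : ℂ) - conj (z' : ℂ)) =
        bil γ z z' - bil γ z (conj (z' : ℂ)) := by simp only [bil]; ring
    have := congrArg norm e
    rw [norm_mul, hI] at this
    have h3 := norm_sub_le (bil γ z z') (bil γ z (conj (z' : ℂ)))
    rw [le_div_iff₀ hy']
    linarith
  have h3 : ‖(γ 1 0 : ℂ) * z' + γ 1 1‖ ≤ m / z.im := by
    have e : ((γ 1 0 : ℂ) * z' + γ 1 1) * ((z : ℂ) - conj (z : ℂ)) =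
        bil γ z z' - bil γ (conj (z : ℂ)) z' := by simp only [bil]; ring
    have := congrArg norm e
    rw [norm_mul, hI] at this
    have h3 := norm_sub_le (bil γ z z') (bil γ (conj (z : ℂ)) z')
    rw [norm_bil_conj_left] at h3
    rw [le_div_iff₀ hy]
    linarith
  have hc : ‖(γ 1 0 : ℂ)‖ ≤ c1 * m := by
    have h4 := Complex.abs_im_le_norm ((γ 1 0 : ℂ) * z - γ 0 0)
    simp only [Complex.sub_im, Complex.mul_im, Complex.ofReal_re, Complex.ofReal_im, zero_mul,
      add_zero, sub_zero, coe_im, abs_mul, abs_of_pos hy] at h4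
    rw [Complex.norm_real, Real.norm_eq_abs]
    have h5 := h4.trans h2
    rw [le_div_iff₀ hy'] at h5
    simp only [c1]
    rw [one_div, inv_mul_eq_div, le_div_iff₀ (by positivity)]
    linarith
  have ha : ‖(γ 0 0 : ℂ)‖ ≤ c2 * m := by
    have e : (γ 0 0 : ℂ) = (γ 1 0 : ℂ) * z - ((γ 1 0 : ℂ) * z - γ 0 0) := by ring
    rw [e]
    refine (norm_sub_le _ _).trans ?_
    rw [norm_mul]
    calc ‖(γ 1 0 : ℂ)‖ * ‖(z : ℂ)‖ + _ ≤ c1 * m * ‖(z : ℂ)‖ + m / z'.im := by gcongr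
      _ = c2 * m := by simp only [c2]; ring
  have hd : ‖(γ 1 1 : ℂ)‖ ≤ c3 * m := by
    have e : (γ 1 1 : ℂ) = ((γ 1 0 : ℂ) * z' + γ 1 1) - (γ 1 0 : ℂ) * z' := by ring
    rw [e]
    refine (norm_sub_le _ _).trans ?_
    rw [norm_mul]
    calc _ + ‖(γ 1 0 : ℂ)‖ * ‖(z' : ℂ)‖ ≤ m / z.im + c1 * m * ‖(z' : ℂ)‖ := by gcongr
      _ = c3 * m := by simp only [c3]; ring
  have hb : ‖(γ 0 1 : ℂ)‖ ≤ c4 * m := by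
    have e : (γ 0 1 : ℂ) = (γ 1 0 : ℂ) * z * conj (z' : ℂ) + (γ 1 1 : ℂ) * z -
        (γ 0 0 : ℂ) * conj (z' : ℂ) - bil γ z (conj (z' : ℂ)) := by simp only [bil]; ring
    rw [e]
    refine (norm_sub_le _ _).trans ?_
    refine (add_le_add_left (norm_sub_le _ _) _).trans ?_
    refine (add_le_add_left (add_le_add_left (norm_add_le _ _) _) _).trans ?_
    rw [norm_mul, norm_mul, norm_mul, norm_mul, Complex.norm_conj]
    calc _ ≤ c1 * m * ‖(z : ℂ)‖ * ‖(z' : ℂ)‖ + c3 * m * ‖(z : ℂ)‖ + c2 * m * ‖(z' : ℂ)‖ + m := by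
          gcongr
      _ = c4 * m := by simp only [c4]; ring
  intro i j
  fin_cases i <;> fin_cases j <;> simp only [Fin.zero_eta, Fin.mk_one]
  · exact ha.trans (by gcongr; linarith)
  · exact hb.trans (by gcongr; linarith)
  · exact hc.trans (by gcongr; linarith)
  · exact hd.trans (by gcongr; linarith)

/-- The point `(z, z̄, z', z̄')`. -/
def cpt (z z' : ℍ) : C4 := (z, conj (z : ℂ), z', conj (z' : ℂ))

lemma rc_cpt (γ : SL(2, ℝ)) (z z' : ℍ) : rc γ (cpt z z') = (rr z (γ • z') : ℂ) := by
  rw [rr_smul, rc, cpt]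
  simp only
  have h : bil γ (conj (z : ℂ)) z' = conj (bil γ z (conj (z' : ℂ))) := by
    rw [conj_bil, Complex.conj_conj]
  rw [h, mul_comm (conj _), Complex.mul_conj, Complex.normSq_eq_norm_sq, Complex.sub_conj,
    Complex.sub_conj]
  push_cast
  simp only [coe_im]
  congr 1
  linear_combination (-4 * (z.im : ℂ) * z'.im) * Complex.I_sq

lemma norm_bil_sub_le {γ : SL(2, ℝ)} {C m : ℝ} (hC : ∀ i j, ‖(γ i j : ℂ)‖ ≤ C * m)
    (w w' u u' : ℂ) :
    ‖bil γ w w' - bil γ u u'‖ ≤ C * m * (‖w * w' - u * u'‖ + ‖w - u‖ + ‖w' - u'‖) := by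
  have e : bil γ w w' - bil γ u u' =
      (γ 1 0 : ℂ) * (w * w' - u * u') + (γ 1 1 : ℂ) * (w - u) - (γ 0 0 : ℂ) * (w' - u') := by
    simp only [bil]; ring
  rw [e]
  refine (norm_sub_le _ _).trans ?_
  refine (add_le_add_left (norm_add_le _ _) _).trans ?_
  rw [norm_mul, norm_mul, norm_mul]
  calc _ ≤ C * m * ‖w * w' - u * u'‖ + C * m * ‖w - u‖ + C * m * ‖w' - u'‖ := by
        gcongr <;> exact hC _ _
    _ = _ := by ring

/-- The holomorphic extension of `r(z, γ z')` is, relatively, a uniformly small perturbation. -/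
lemma eventually_rc_near (z z' : ℍ) {δ : ℝ} (hδ : 0 < δ) :
    ∀ᶠ q in nhds (cpt z z'), ∀ γ : SL(2, ℝ),
      ∃ t : ℂ, ‖t - 1‖ < δ ∧ rc γ q = (rr z (γ • z') : ℂ) * t := by
  obtain ⟨C, hC0, hC⟩ := exists_coeff_bound z z'
  -- `rc` is a quotient of products of four factors. Each factor is relatively close to its value at
  -- `cpt z z'`, uniformly in γ, and continuity of the quotient at (1, 1, 1, 1) turns this into the
  -- bound δ.
  have hcont : ContinuousAt (fun p : ℂ × ℂ × ℂ × ℂ => p.1 * p.2.1 / (p.2.2.1 * p.2.2.2))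
      (1, 1, 1, 1) := by
    fun_prop (disch := simp)
  have h1 := Metric.continuousAt_iff.mp hcont δ hδ
  obtain ⟨η, hη, h1⟩ := h1
  have hz0 : (z : ℂ) - conj (z : ℂ) ≠ 0 := by
    rw [Complex.sub_conj, coe_im]
    have := z.im_ne_zero
    simp [this]
  have hz0' : (z' : ℂ) - conj (z' : ℂ) ≠ 0 := by
    rw [Complex.sub_conj, coe_im]
    have := z'.im_ne_zero
    simp [this]
  have e1 : ∀ᶠ q : C4 in nhds (cpt z z'), 
      dist ((q.1 - q.2.1) / ((z : ℂ) - conj (z : ℂ))) 1 < η := by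
    have : ContinuousAt (fun q : C4 => dist ((q.1 - q.2.1) / ((z : ℂ) - conj (z : ℂ))) 1)
        (cpt z z') := by
      fun_prop (disch := exact hz0)
    exact this.eventually (gt_mem_nhds (by simpa [cpt, div_self hz0] using hη))
  have e2 : ∀ᶠ q : C4 in nhds (cpt z z'),
      dist ((q.2.2.1 - q.2.2.2) / ((z' : ℂ) - conj (z' : ℂ))) 1 < η := by
    have : ContinuousAt (fun q : C4 =>
        dist ((q.2.2.1 - q.2.2.2) / ((z' : ℂ) - conj (z' : ℂ))) 1) (cpt z z') := by
      fun_prop (disch := exact hz0')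
    exact this.eventually (gt_mem_nhds (by simpa [cpt, div_self hz0'] using hη))
  have e3 : ∀ᶠ q : C4 in nhds (cpt z z'), C * (‖q.2.1 * q.2.2.1 - conj (z : ℂ) * z'‖ +
      ‖q.2.1 - conj (z : ℂ)‖ + ‖q.2.2.1 - z'‖) < η := by
    have : ContinuousAt (fun q : C4 => C * (‖q.2.1 * q.2.2.1 - conj (z : ℂ) * z'‖ +
      ‖q.2.1 - conj (z : ℂ)‖ + ‖q.2.2.1 - z'‖)) (cpt z z') := by fun_prop
    exact this.eventually (gt_mem_nhds (by simpa [cpt] using hη))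
  have e4 : ∀ᶠ q : C4 in nhds (cpt z z'), C * (‖q.1 * q.2.2.2 - z * conj (z' : ℂ)‖ +
      ‖q.1 - z‖ + ‖q.2.2.2 - conj (z' : ℂ)‖) < η := by
    have : ContinuousAt (fun q : C4 => C * (‖q.1 * q.2.2.2 - z * conj (z' : ℂ)‖ +
      ‖q.1 - z‖ + ‖q.2.2.2 - conj (z' : ℂ)‖)) (cpt z z') := by fun_prop
    exact this.eventually (gt_mem_nhds (by simpa [cpt] using hη))
  filter_upwards [e1, e2, e3, e4] with q h1' h2' h3' h4' γ
  have hm := norm_pos_iff.mpr (bil_conj_ne_zero γ z z')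
  have hb3 : dist (bil γ q.2.1 q.2.2.1 / bil γ (conj (z : ℂ)) z') 1 < η := by
    rw [dist_eq_norm, div_sub_one (bil_conj_ne_zero' γ z z'), norm_div, norm_bil_conj_left,
      div_lt_iff₀ hm]
    refine (norm_bil_sub_le (hC γ) _ _ _ _).trans_lt ?_
    calc _ = C * (‖q.2.1 * q.2.2.1 - conj (z : ℂ) * z'‖ + ‖q.2.1 - conj (z : ℂ)‖ +
          ‖q.2.2.1 - z'‖) * ‖bil γ z (conj (z' : ℂ))‖ := by ring
      _ < _ := by gcongr
  have hb4 : dist (bil γ q.1 q.2.2.2 / bil γ z (conj (z' : ℂ))) 1 < η := by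
    rw [dist_eq_norm, div_sub_one (bil_conj_ne_zero γ z z'), norm_div, div_lt_iff₀ hm]
    refine (norm_bil_sub_le (hC γ) _ _ _ _).trans_lt ?_
    calc _ = C * (‖q.1 * q.2.2.2 - z * conj (z' : ℂ)‖ + ‖q.1 - z‖ +
          ‖q.2.2.2 - conj (z' : ℂ)‖) * ‖bil γ z (conj (z' : ℂ))‖ := by ring
      _ < _ := by gcongr
  refine ⟨rc γ q / rc γ (cpt z z'), ?_, ?_⟩
  rotate_left
  · rw [← rc_cpt]
    have hr : rc γ (cpt z z') ≠ 0 := by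
      rw [rc_cpt]; exact_mod_cast (rr_pos _ _).ne'
    exact (mul_div_cancel₀ _ hr).symm
  · have h5 := h1 (x := ((q.1 - q.2.1) / ((z : ℂ) - conj (z : ℂ)),
      (q.2.2.1 - q.2.2.2) / ((z' : ℂ) - conj (z' : ℂ)),
      bil γ q.2.1 q.2.2.1 / bil γ (conj (z : ℂ)) z',
      bil γ q.1 q.2.2.2 / bil γ z (conj (z' : ℂ)))) ?_
    · rw [dist_eq_norm] at h5
      refine lt_of_eq_of_lt ?_ h5
      congr 1
      simp only [mul_one, div_one]
      congr 1
      have n1 := bil_conj_ne_zero γ z z'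
      have n2 := bil_conj_ne_zero' γ z z'
      simp only [rc, cpt]
      simp only [neg_div, div_neg, neg_neg]
      rw [div_mul_div_comm, div_mul_div_comm, div_div_div_eq, div_div_div_eq]
      congr 1; ring
    · simp only [Prod.dist_eq, max_lt_iff]
      exact ⟨h1', h2', hb3, hb4⟩

section

variable {Γ : Subgroup SL(2, ℝ)} [DiscreteTopology Γ]

variable (Γ) in
/-- The nontrivial elements of `Γ`. -/
abbrev NT : Type := ↥({1}ᶜ : Set Γ)

lemma NT.ne {Γ : Subgroup SL(2, ℝ)} (γ : NT Γ) : (γ : Γ) ≠ 1 := γ.2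

/-- The underlying matrix of a nontrivial element. -/
abbrev NT.mat {Γ : Subgroup SL(2, ℝ)} (γ : NT Γ) : SL(2, ℝ) := ((γ : Γ) : SL(2, ℝ))

lemma norm_cpow_le_of_re {r : ℂ} (hr : r ≠ 0) (s : ℂ) :
    ‖r ^ s‖ ≤ ‖r‖ ^ s.re * Real.exp (Real.pi * |s.im|) := by
  rw [Complex.norm_cpow_of_ne_zero hr, div_eq_mul_inv, ← Real.exp_neg]
  gcongr
  have h1 := Complex.abs_arg_le_pi r
  calc -(Complex.arg r * s.im) ≤ |Complex.arg r * s.im| := neg_le_abs _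
    _ = |Complex.arg r| * |s.im| := abs_mul _ _
    _ ≤ _ := by gcongr

/-- Write m = |B(z, z̄')| and r₀ = r(z, γz'). The factor B(ζ, ζ')^(2j) may grow like m^(2j), but the
power of r supplies r₀^j, and m² r₀ = 4yy' does not depend on γ. What remains is r₀^(Re s), which is
summable whatever j is. -/
lemma eventually_ker_bound (htf : ∀ γ : Γ, γ ≠ 1 → ¬ IsOfFinOrder γ) {s : ℂ} (hs : 1 < s.re)
    (j : ℕ) {z z' : ℍ} (hp : (z, z') ∈ freePairs Γ) :
    ∃ C : ℝ, ∀ᶠ q in nhds (cpt z z'), ∀ γ : NT Γ, Good γ.mat q ∧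
      ‖ker s j γ.mat q‖ ≤ C * rr z (γ.mat • z') ^ s.re := by
  obtain ⟨κ, hκ0, hκ1, hκ⟩ := exists_rr_le htf hp
  obtain ⟨C, hC0, hC⟩ := exists_coeff_bound z z'
  obtain ⟨A, M, hA0, hA⟩ := (polyBdd_hyp hs j).norm_pser_le
  set B : ℝ := (‖conj (z : ℂ)‖ * ‖conj (z' : ℂ)‖ + ‖conj (z : ℂ)‖ + ‖conj (z' : ℂ)‖ + 1) + 1
  have e1 : ∀ᶠ q : C4 in nhds (cpt z z'), ‖q.2.1‖ * ‖q.2.2.2‖ + ‖q.2.1‖ + ‖q.2.2.2‖ + 1 < B := by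
    have : ContinuousAt (fun q : C4 => ‖q.2.1‖ * ‖q.2.2.2‖ + ‖q.2.1‖ + ‖q.2.2.2‖ + 1) (cpt z z') := by
      fun_prop
    exact this.eventually (gt_mem_nhds (by simp only [cpt, B]; linarith))
  have hB : 0 ≤ B := by positivity
  refine ⟨‖cst s j‖ * ((C * B) ^ (2 * j) * (4 * z.im * z'.im) ^ j) *
    (2 ^ (s.re + j) * Real.exp (Real.pi * |s.im|)) * (A * (2 / κ) ^ M), ?_⟩
  -- With relative error κ/2, |`rc`| ≤ (1-κ)(1+κ/2) ≤ 1 - κ/2, and the perturbed value keeps a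
  -- positive real part; so one stays in the domain of the series.
  filter_upwards [e1, eventually_rc_near z z' (δ := κ / 2) (by positivity)] with q hq1 hq2 γ
  obtain ⟨t, ht1, ht2⟩ := hq2 γ.mat
  set r0 := rr z (γ.mat • z') with hr0
  have hr0pos : 0 < r0 := rr_pos _ _
  have hr0le : r0 ≤ 1 - κ := hκ γ γ.2
  have htn : ‖t‖ ≤ 1 + κ / 2 := by
    have := norm_sub_norm_le t 1
    rw [norm_one] at this; linarith
  have htre : 0 < t.re := by
    have h1 := Complex.abs_re_le_norm (t - 1)
    rw [Complex.sub_re, Complex.one_re] at h1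
    have h2 := abs_lt.mp (h1.trans_lt ht1)
    linarith [h2.1]
  have hrcn : ‖rc γ.mat q‖ = r0 * ‖t‖ := by
    rw [ht2, norm_mul, Complex.norm_real, Real.norm_of_nonneg hr0pos.le]
  have hlt : ‖rc γ.mat q‖ ≤ 1 - κ / 2 := by
    rw [hrcn]
    calc r0 * ‖t‖ ≤ (1 - κ) * (1 + κ / 2) := by gcongr
      _ ≤ _ := by nlinarith
  have hslit : rc γ.mat q ∈ Complex.slitPlane := by
    refine Or.inl ?_
    rw [ht2, Complex.re_ofReal_mul]; positivity
  refine ⟨⟨hslit, by linarith⟩, ?_⟩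
  set m := ‖bil γ.mat z (conj (z' : ℂ))‖ with hmdef
  have hm : 0 < m := norm_pos_iff.mpr (bil_conj_ne_zero γ.mat z z')
  have hbil : ‖bil γ.mat q.2.1 q.2.2.2‖ ≤ C * B * m := by
    rw [bil]
    refine (norm_sub_le _ _).trans ?_
    refine (add_le_add_left (norm_sub_le _ _) _).trans ?_
    refine (add_le_add_left (add_le_add_left (norm_add_le _ _) _) _).trans ?_
    rw [norm_mul, norm_mul, norm_mul, norm_mul]
    calc _ ≤ C * m * ‖q.2.1‖ * ‖q.2.2.2‖ + C * m * ‖q.2.1‖ + C * m * ‖q.2.2.2‖ + C * m := by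
          gcongr <;> exact hC _ _ _
      _ = C * m * (‖q.2.1‖ * ‖q.2.2.2‖ + ‖q.2.1‖ + ‖q.2.2.2‖ + 1) := by ring
      _ ≤ C * m * B := by gcongr
      _ = _ := by ring
  have hmr : m ^ (2 * j) * r0 ^ j = (4 * z.im * z'.im) ^ j := by
    rw [pow_mul, ← mul_pow, hr0, rr_smul, ← hmdef]
    congr 1
    field_simp
  have hpow : ‖rc γ.mat q ^ (s + j)‖ ≤
      2 ^ (s.re + j) * (r0 ^ s.re * r0 ^ j) * Real.exp (Real.pi * |s.im|) := by
    refine (norm_cpow_le_of_re (Complex.slitPlane_ne_zero hslit) _).trans ?_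
    simp only [Complex.add_re, Complex.natCast_re, Complex.add_im, Complex.natCast_im, add_zero]
    gcongr
    rw [← Real.rpow_natCast r0 j, ← Real.rpow_add hr0pos, ← Real.mul_rpow (by norm_num) hr0pos.le,
      hrcn, mul_comm]
    gcongr
    linarith
  have hps : ‖pser (hyp s j) (rc γ.mat q)‖ ≤ A * (2 / κ) ^ M := by
    refine (hA _ (by linarith)).trans ?_
    gcongr
    · exact inv_nonneg.mpr (by linarith)
    rw [inv_eq_one_div, div_le_div_iff₀ (by linarith) hκ0]
    linarith
  rw [ker, norm_mul, norm_mul, norm_pow, radR, powser, norm_mul]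
  calc ‖cst s j‖ * ‖bil γ.mat q.2.1 q.2.2.2‖ ^ (2 * j) *
        (‖rc γ.mat q ^ (s + j)‖ * ‖pser (hyp s j) (rc γ.mat q)‖)
      ≤ ‖cst s j‖ * (C * B * m) ^ (2 * j) *
        ((2 ^ (s.re + j) * (r0 ^ s.re * r0 ^ j) * Real.exp (Real.pi * |s.im|)) *
          (A * (2 / κ) ^ M)) := by gcongr
    _ = ‖cst s j‖ * ((C * B) ^ (2 * j) * (m ^ (2 * j) * r0 ^ j)) *
      (2 ^ (s.re + j) * Real.exp (Real.pi * |s.im|)) * (A * (2 / κ) ^ M) * r0 ^ s.re := by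
        rw [mul_pow (C * B) m]; ring
    _ = _ := by rw [hmr]

/-- The kernel `L_{2j-2} ⋯ L_0 Q_s(z, γ z')`. -/
def kerR (s : ℂ) (j : ℕ) (γ : SL(2, ℝ)) (z z' : ℍ) : ℂ :=
  (16 ^ j * (((z.im * z'.im) ^ (2 * j) : ℝ) : ℂ))⁻¹ * ker s j γ (cpt z z')

lemma resolventH_smul (s : ℂ) (γ : SL(2, ℝ)) (z z' : ℍ) :
    resolventH s z (γ • z') = kerR s 0 γ z z' := by
  rw [resolventH, kerR, ker, rc_cpt, radR, powser, cst]
  have h := hypergeometric_eq_pser s 0 (rr z (γ • z') : ℂ)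
  simp only [Nat.cast_zero, add_zero] at h
  rw [h]
  simp only [Nat.cast_zero, add_zero, pow_zero, mul_zero]
  push_cast
  rw [div_eq_mul_inv, mul_inv, div_eq_mul_inv]
  ring

lemma summable_kerR (htf : ∀ γ : Γ, γ ≠ 1 → ¬ IsOfFinOrder γ) {s : ℂ} (hs : 1 < s.re)
    (j : ℕ) {z z' : ℍ} (hp : (z, z') ∈ freePairs Γ) :
    Summable (fun γ : NT Γ => kerR s j γ.mat z z') := by
  obtain ⟨C, hC⟩ := eventually_ker_bound htf hs j hp
  have h1 := hC.self_of_nhds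
  refine Summable.mul_left _ (Summable.of_norm_bounded (g := fun γ : NT Γ =>
    C * rr z (γ.mat • z') ^ s.re) ?_ fun γ => (h1 γ).2)
  exact ((summable_rr_smul htf hs z z').subtype _).mul_left C

/-- The weight (yy')^(2j) inserted by L_{2j} cancels the one in `kerR`, so that what is
differentiated is a sum of restrictions of holomorphic functions. Subtracting Q_s removes γ = 1, the
only term singular on the diagonal. The induction runs over the open set `freePairs Γ` and not over
the diagonal, because derivatives require a neighbourhood. -/
lemma opLs_resolvent_sub_eq (htf : ∀ γ : Γ, γ ≠ 1 → ¬ IsOfFinOrder γ) {s : ℂ} (hs : 1 < s.re)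
    (j : ℕ) : ∀ z z' : ℍ, (z, z') ∈ freePairs Γ →
    opLs j (fun w w' => resolventX Γ s w w' - resolventH s w w') z z' =
      ∑' γ : NT Γ, kerR s j γ.mat z z' := by
  induction j with
  | zero =>
    intro z z' hp
    have h1 := summable_kerR htf hs 0 hp
    have h2 : Summable (fun γ : Γ => resolventH s z (γ • z')) := by
      rw [← (Set.finite_singleton (1 : Γ)).summable_compl_iff]
      refine h1.congr fun γ => ?_
      exact (resolventH_smul s ((γ : Γ) : SL(2, ℝ)) z z').symm
    have h3 := h2.tsum_subtype_add_tsum_subtype_compl {(1 : Γ)}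
    have h4 : ∑' x : ({1} : Set Γ), resolventH s z ((x : Γ) • z') = resolventH s z z' := by
      rw [tsum_singleton 1 (fun γ : Γ => resolventH s z (γ • z')), one_smul]
    rw [h4] at h3
    simp only [opLs, resolventX]
    rw [← h3, add_sub_cancel_left]
    exact tsum_congr fun γ => resolventH_smul s ((γ : Γ) : SL(2, ℝ)) z z'
  | succ j ih =>
    have hu : ∀ z z' : ℍ, Summable (fun γ : NT Γ => rr z (γ.mat • z') ^ s.re) := fun z z' =>
      (summable_rr_smul htf hs z z').subtype _
    have hwt : ∀ w w' : ℍ, (((w.im * w'.im) ^ (2 * j) : ℝ) : ℂ) ≠ 0 := by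
      intro w w'
      have := w.im_pos
      have := w'.im_pos
      exact_mod_cast (by positivity : (0:ℝ) < (w.im * w'.im) ^ (2 * j)).ne'
    have hinner : ∀ w w' : ℍ, (w, w') ∈ freePairs Γ →
        dz (fun v => (((w.im * v.im) ^ (2 * j) : ℝ) : ℂ) *
          opLs j (fun w w' => resolventX Γ s w w' - resolventH s w w') w v) w' =
        (16 ^ j)⁻¹ * ∑' γ : NT Γ, ker' s j γ.mat (cpt w w') := by
      intro w w' hp
      obtain ⟨C, hC⟩ := eventually_ker_bound htf hs j hp
      obtain ⟨ρ, hρ, hball⟩ := Metric.eventually_nhds_iff_ball.mp hC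
      obtain ⟨F', hF', hF'v⟩ := hasFDerivAt_tsum_of_bound ((hu w w').mul_left C) hρ
        (fun γ q hq => ((hball q hq) γ).1.differentiableAt_ker hs j)
        (fun γ q hq => ((hball q hq) γ).2) (Metric.mem_ball_self (half_pos hρ))
      have h1 := dz_eq_of_hasFDerivAt
        (f := fun v : ℍ => (((w.im * v.im) ^ (2 * j) : ℝ) : ℂ) *
          opLs j (fun w w' => resolventX Γ s w w' - resolventH s w w') w v)
        (z := w') (e := (0, 0, 1, 0)) (e' := (0, 0, 0, 1))
        (ι := fun v => ((w : ℂ), conj (w : ℂ), v, conj v)) (by intro v; simp)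
        (hF'.const_mul ((16 ^ j : ℂ)⁻¹)) ?_
      · rw [h1]
        simp only [smul_apply, smul_eq_mul, hF'v]
        congr 1
        exact tsum_congr fun γ =>
          ((hball _ (Metric.mem_ball_self hρ)) γ).1.fderiv_ker hs j
      · have hcont : ContinuousAt (fun v : ℍ => (w, v)) w' := by fun_prop
        filter_upwards [hcont.eventually (isOpen_freePairs.mem_nhds hp)] with v hv
        rw [ih w v hv]
        simp only [kerR]
        rw [tsum_mul_left, ← mul_assoc, mul_inv]
        congr 1
        have := hwt w v
        field_simp
    intro z z' hp
    simp only [opLs, opL]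
    obtain ⟨C, hC⟩ := eventually_ker_bound htf hs j hp
    obtain ⟨ρ, hρ, hball⟩ := Metric.eventually_nhds_iff_ball.mp hC
    have hsub : ∀ q ∈ Metric.ball (cpt z z') (ρ / 2), q ∈ Metric.ball (cpt z z') ρ :=
      fun q hq => Metric.ball_subset_ball (by linarith) hq
    -- The summable majorant for `ker'` comes from Cauchy's estimate applied to `ker`, at the cost
    -- of halving the ball.
    obtain ⟨F', hF', hF'v⟩ := hasFDerivAt_tsum_of_bound
      (f := fun γ : NT Γ => ker' s j γ.mat)
      ((((hu z z').mul_left C).mul_right (4 / ρ)).mul_right ‖((0, 0, 1, 0) : C4)‖) (half_pos hρ)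
      (fun γ q hq => ((hball q (hsub q hq)) γ).1.differentiableAt_ker' hs j)
      (fun γ q hq => by
        rw [← ((hball q (hsub q hq)) γ).1.fderiv_ker hs j]
        exact norm_fderiv_apply_le_of_bound hρ
          (fun q hq => ((hball q hq) γ).1.differentiableAt_ker hs j)
          (fun q hq => ((hball q hq) γ).2) hq _) (Metric.mem_ball_self (half_pos (half_pos hρ)))
    have h1 := dz_eq_of_hasFDerivAt
      (f := fun w : ℍ => dz (fun v => (((w.im * v.im) ^ (2 * j) : ℝ) : ℂ) *
          opLs j (fun w w' => resolventX Γ s w w' - resolventH s w w') w v) z')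
      (z := z) (e := (1, 0, 0, 0)) (e' := (0, 1, 0, 0))
      (ι := fun v => (v, conj v, (z' : ℂ), conj (z' : ℂ))) (by intro v; simp)
      (hF'.const_mul ((16 ^ j : ℂ)⁻¹)) ?_
    · rw [h1]
      simp only [smul_apply, smul_eq_mul, hF'v]
      rw [← tsum_mul_left, ← tsum_mul_left]
      refine tsum_congr fun γ => ?_
      rw [((hball _ (Metric.mem_ball_self hρ)) γ).1.fderiv_ker' hs j, kerR]
      simp only [cpt]
      have e : (((z : ℂ) - conj (z : ℂ)) * ((z' : ℂ) - conj (z' : ℂ))) ^ 2 =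
          16 * (((z.im * z'.im) ^ 2 : ℝ) : ℂ) := by
        rw [Complex.sub_conj, Complex.sub_conj, coe_im, coe_im]
        push_cast
        rw [show (2 * (z.im : ℂ) * Complex.I * (2 * (z'.im : ℂ) * Complex.I)) =
          4 * (z.im : ℂ) * z'.im * (Complex.I ^ 2) by ring, Complex.I_sq]
        ring
      rw [e, show 2 * (j + 1) = 2 * j + 2 by ring, pow_add (z.im * z'.im), pow_succ (16 : ℂ)]
      push_cast
      rw [div_eq_mul_inv]
      simp only [mul_inv]
      ring
    · have hcont : ContinuousAt (fun v : ℍ => (v, z')) z := by fun_prop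
      filter_upwards [hcont.eventually (isOpen_freePairs.mem_nhds hp)] with v hv
      exact hinner v z' hv

/-- The contribution `Q_γ(z)^{-2k} f_s^{(k)}(r(z, γ z))` of `γ`. -/
def hterm (k : ℕ) (s : ℂ) (γ : SL(2, ℝ)) (z : ℍ) : ℂ :=
  (quad γ z ^ (2 * k))⁻¹ * radial k s (rr z (γ • z))

/-- On the diagonal (r-1)/r = -Q_γ(z) B(z̄, z̄) / (4y²). Hence B(z̄, z̄)^(2k) / (16^k y^(4k)) =
Q_γ(z)^(-2k) ((r-1)/r)^(2k), which is how the negative power of Q_γ arises. -/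
lemma kerR_diag {k : ℕ} {s : ℂ} {γ : SL(2, ℝ)} {z : ℍ} (h : γ • z ≠ z) :
    kerR s k γ z z = hterm k s γ z := by
  have hr := rr_pos z (γ • z)
  rw [kerR, hterm, radial_eq k s hr, ker, rc_cpt]
  have hq : quad γ z ≠ 0 := by rw [quad_eq_bil]; exact mt (bil_eq_zero_iff γ z z).mp h
  have hb := bil_conj_ne_zero γ z z
  have hy : (z.im : ℂ) ≠ 0 := by exact_mod_cast z.im_ne_zero
  have e1 : ((rr z (γ • z) : ℂ) - 1) / (rr z (γ • z) : ℂ) =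
      (-(bil γ z z * bil γ (conj (z : ℂ)) (conj (z : ℂ)))) / (4 * z.im * z.im) := by
    have h1 := rr_smul γ z z
    have h2 := one_sub_rr_smul γ z z
    have h3 : (rr z (γ • z) : ℂ) - 1 = ((-(1 - rr z (γ • z)) : ℝ) : ℂ) := by push_cast; ring
    have h0 : ‖bil γ z (conj (z : ℂ))‖ ≠ 0 := norm_ne_zero_iff.mpr hb
    have h4 : bil γ z z * bil γ (conj (z : ℂ)) (conj (z : ℂ)) = ((‖bil γ z z‖ ^ 2 : ℝ) : ℂ) := by
      rw [← conj_bil, Complex.mul_conj, Complex.normSq_eq_norm_sq]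
    rw [h3, h2, h1, h4, ← Complex.ofReal_div]
    have : -(‖bil γ z z‖ ^ 2 / ‖bil γ z (conj (z : ℂ))‖ ^ 2) /
        (4 * z.im * z.im / ‖bil γ z (conj (z : ℂ))‖ ^ 2) = -‖bil γ z z‖ ^ 2 / (4 * z.im * z.im) := by
      have := z.im_ne_zero
      field_simp
    rw [this]; push_cast; ring
  rw [mul_div_assoc, ← div_pow, e1]
  simp only [cpt]
  rw [quad_eq_bil] at hq ⊢
  rw [show (16 : ℂ) ^ k = 4 ^ (2 * k) by rw [pow_mul]; norm_num]
  rw [div_pow, (even_two_mul k).neg_pow, mul_pow (bil γ z z)]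
  push_cast
  simp only [mul_pow]
  field_simp

lemma poincareF_eq (htf : ∀ γ : Γ, γ ≠ 1 → ¬ IsOfFinOrder γ) {s : ℂ} (hs : 1 < s.re)
    (k : ℕ) (z : ℍ) : poincareF Γ k s z = ∑' γ : NT Γ, hterm k s γ.mat z := by
  rw [poincareF, opLs_resolvent_sub_eq htf hs k z z (diag_mem_freePairs htf z)]
  exact tsum_congr fun γ => kerR_diag (smul_ne_self htf γ.2 z)

end

/-! ### The contribution of a group element to the Petersson product -/

/-- The contribution of `γ` to the integrand of the Petersson product. -/
def wterm (k : ℕ) (s : ℂ) (g : ℍ → ℂ) (γ : SL(2, ℝ)) (z : ℍ) : ℂ :=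
  hterm k s γ z * conj (g z) * ((z.im ^ (4 * k) : ℝ) : ℂ)

lemma rr_conj_smul (γ δ : SL(2, ℝ)) (z : ℍ) :
    rr z ((δ⁻¹ * γ * δ) • z) = rr (δ • z) (γ • δ • z) := by
  rw [← rr_smul_smul δ, smul_smul, smul_smul]
  congr 2
  group

/-- With j the automorphy factor of δ at z, passing from z to δz contributes j^(4k) from Q_γ^(-2k),
its conjugate from ḡ, and |j|^(-8k) from y^(4k); these cancel. Two functions g, g' are allowed, so
that the lemma serves both elements of Γ (g' = g) and changes of coordinates (g' = `twist k g τ`).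
-/
lemma wterm_conj (k : ℕ) (s : ℂ) {g g' : ℍ → ℂ} (γ : SL(2, ℝ)) {δ : SL(2, ℝ)} {z : ℍ}
    (hg : g' (δ • z) = jfac δ z ^ (4 * k) * g z) :
    wterm k s g (δ⁻¹ * γ * δ) z = wterm k s g' γ (δ • z) := by
  have hj := jfac_ne_zero δ z
  have hj' : conj (jfac δ z) ≠ 0 := by simpa using hj
  simp only [wterm, hterm]
  rw [rr_conj_smul, quad_conj, hg, im_smul_eq]
  have e : (‖jfac δ z‖ ^ 2 : ℝ) = jfac δ z * conj (jfac δ z) := by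
    rw [Complex.mul_conj, Complex.normSq_eq_norm_sq]
  push_cast at e ⊢
  rw [div_pow, e, map_mul, map_pow, mul_pow, mul_pow]
  have h4 : 4 * k = 2 * (2 * k) := by ring
  rw [h4]
  by_cases hq : quad γ (δ • z : ℍ) = 0
  · by_cases hk : k = 0
    · subst hk; simp
    · simp [hq, hk]
  · field_simp
    rw [← pow_mul]
    ring

lemma disp_mul_rr (γ : SL(2, ℝ)) (z : ℍ) : disp γ z * rr z (γ • z) ≤ 1 := by
  rw [← one_sub_rr_self_smul]; linarith [rr_pos z (γ • z)]

lemma quad_ne_zero {γ : SL(2, ℝ)} {z : ℍ} (h : γ • z ≠ z) : quad γ z ≠ 0 := by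
  rw [quad_eq_bil]; exact mt (bil_eq_zero_iff γ z z).mp h

/-- The algebraic factors combine to (disp · r)^k (y/2)^(2k) with disp · r = 1 - r ≤ 1. The
hypergeometric series costs a power of 1/(1-r) = 1 + 1/disp. -/
lemma exists_norm_wterm_le (k : ℕ) {s : ℂ} (hs : 1 < s.re) : ∃ C : ℝ, ∃ M : ℕ, 0 ≤ C ∧
    ∀ (g : ℍ → ℂ) (γ : SL(2, ℝ)) (z : ℍ) (η : ℝ), 0 < η → η ≤ disp γ z →
      ‖wterm k s g γ z‖ ≤ C * (1 + 1 / η) ^ M * (‖g z‖ * z.im ^ (2 * k)) *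
        rr z (γ • z) ^ s.re := by
  obtain ⟨A, M, hA0, hA⟩ := (polyBdd_hyp hs k).norm_pser_le
  refine ⟨‖cst s k‖ * (Real.exp (Real.pi * |s.im|) * A), M, by positivity,
    fun g γ z η hη hd => ?_⟩
  set r := rr z (γ • z) with hr
  have hr0 : 0 < r := rr_pos _ _
  have hd0 : 0 < disp γ z := hη.trans_le hd
  have hne : γ • z ≠ z := fun h => hd0.ne' ((disp_eq_zero_iff γ z).mpr h)
  have hq := quad_ne_zero hne
  have hy := z.im_pos
  have h1 : 1 - r = disp γ z * r := one_sub_rr_self_smul γ z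
  have hr1 : r < 1 := by nlinarith
  have hinv : (1 - r)⁻¹ ≤ 1 + 1 / η := by
    rw [h1, hr, rr_self_smul]
    have : (disp γ z * (1 + disp γ z)⁻¹)⁻¹ = 1 + 1 / disp γ z := by field_simp; ring
    rw [this]
    gcongr
  have hn : ‖(r : ℂ)‖ = r := by rw [Complex.norm_real, Real.norm_of_nonneg hr0.le]
  have hrad : ‖radR s k r‖ ≤ r ^ s.re * r ^ k * (Real.exp (Real.pi * |s.im|)) *
      (A * (1 + 1 / η) ^ M) := by
    rw [radR, powser, norm_mul]
    gcongr
    · refine (norm_cpow_le_of_re (by exact_mod_cast hr0.ne') _).trans_eq ?_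
      simp only [Complex.add_re, Complex.natCast_re, Complex.add_im, Complex.natCast_im, add_zero]
      rw [hn, Real.rpow_add hr0, Real.rpow_natCast]
    · refine (hA _ (by rw [hn]; exact hr1)).trans ?_
      rw [hn]
      have : 0 ≤ (1 - r)⁻¹ := inv_nonneg.mpr (by linarith)
      gcongr
  have hu : ‖quad γ z‖ ^ 2 = disp γ z * (4 * z.im ^ 2) := by
    rw [disp]; field_simp
  have hfac : ‖(quad γ z ^ (2 * k))⁻¹ * (((r : ℂ) - 1) ^ (2 * k) / (r : ℂ) ^ (2 * k))‖ * r ^ k *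
      z.im ^ (4 * k) ≤ z.im ^ (2 * k) := by
    have e2 : ‖(r : ℂ) - 1‖ = disp γ z * r := by
      rw [← h1, ← Complex.ofReal_one, ← Complex.ofReal_sub, Complex.norm_real, Real.norm_eq_abs,
        abs_sub_comm, abs_of_pos (by linarith)]
    rw [norm_mul, norm_inv, norm_div, norm_pow, norm_pow, norm_pow, hn, e2, pow_mul, hu]
    have e3 : ((disp γ z * (4 * z.im ^ 2)) ^ k)⁻¹ * ((disp γ z * r) ^ (2 * k) / r ^ (2 * k)) *
        r ^ k * z.im ^ (4 * k) = (disp γ z * r) ^ k * z.im ^ (2 * k) * (4 ^ k)⁻¹ := by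
      rw [mul_pow, mul_pow, mul_pow, mul_pow, ← pow_mul, show 4 * k = 2 * k + 2 * k by ring,
        pow_add]
      have := hd0.ne'
      field_simp
      ring
    rw [e3]
    have h5 : (disp γ z * r) ^ k ≤ 1 := pow_le_one₀ (by positivity) (disp_mul_rr γ z)
    have h6 : ((4 : ℝ) ^ k)⁻¹ ≤ 1 := inv_le_one_of_one_le₀ (one_le_pow₀ (by norm_num))
    calc _ ≤ 1 * z.im ^ (2 * k) * 1 := by gcongr
      _ = _ := by ring
  rw [wterm, hterm, radial_eq k s hr0, norm_mul, norm_mul, Complex.norm_conj, Complex.norm_real,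
    Real.norm_of_nonneg (by positivity)]
  rw [show (quad γ z ^ (2 * k))⁻¹ * (cst s k * ((r : ℂ) - 1) ^ (2 * k) / (r : ℂ) ^ (2 * k) *
    radR s k r) = ((quad γ z ^ (2 * k))⁻¹ * (((r : ℂ) - 1) ^ (2 * k) / (r : ℂ) ^ (2 * k))) *
      (cst s k * radR s k r) by ring, norm_mul, norm_mul (cst s k)]
  set X := ‖(quad γ z ^ (2 * k))⁻¹ * (((r : ℂ) - 1) ^ (2 * k) / (r : ℂ) ^ (2 * k))‖ with hX
  have hX0 : 0 ≤ X := norm_nonneg _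
  calc X * (‖cst s k‖ * ‖radR s k r‖) * ‖g z‖ * z.im ^ (4 * k)
      ≤ X * (‖cst s k‖ * (r ^ s.re * r ^ k * (Real.exp (Real.pi * |s.im|)) *
      (A * (1 + 1 / η) ^ M))) * ‖g z‖ * z.im ^ (4 * k) := by gcongr
    _ = (X * r ^ k * z.im ^ (4 * k)) * (‖cst s k‖ * (Real.exp (Real.pi * |s.im|) * A) *
      (1 + 1 / η) ^ M * ‖g z‖ * r ^ s.re) := by ring
    _ ≤ z.im ^ (2 * k) * (‖cst s k‖ * (Real.exp (Real.pi * |s.im|) * A) *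
      (1 + 1 / η) ^ M * ‖g z‖ * r ^ s.re) := by gcongr
    _ = _ := by ring

lemma sinh_le_of_le_one {x : ℝ} (h0 : 0 ≤ x) (h1 : x ≤ 1) : Real.sinh x ≤ 3 / 2 * x := by
  have h2 := Real.abs_exp_sub_one_sub_id_le (x := x) (by rwa [abs_of_nonneg h0])
  have h3 := (abs_le.mp h2).2
  have h4 := Real.add_one_le_exp (-x)
  rw [Real.sinh_eq]
  nlinarith

/-- A lower bound for the displacement gives a lower bound for the distance. -/
lemma two_mul_le_dist {γ : SL(2, ℝ)} {z : ℍ} {ε : ℝ} (h0 : 0 ≤ ε) (h1 : ε ≤ 1)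
    (h : 9 / 4 * ε ^ 2 ≤ disp γ z) : 2 * ε ≤ dist z (γ • z) := by
  by_contra! hlt
  rw [disp_eq_sinh] at h
  have h2 : Real.sinh (dist z (γ • z) / 2) < Real.sinh ε :=
    Real.sinh_lt_sinh.mpr (by linarith)
  have h3 := sinh_le_of_le_one h0 h1
  have h4 : 0 ≤ Real.sinh (dist z (γ • z) / 2) := Real.sinh_nonneg_iff.mpr (by positivity)
  nlinarith

section

variable {Γ : Subgroup SL(2, ℝ)}

lemma exists_tsum_norm_wterm_le (k : ℕ) {s : ℂ} (hs : 1 < s.re) : ∃ C : ℝ, ∃ M : ℕ, 0 ≤ C ∧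
    ∀ (Γ : Subgroup SL(2, ℝ)) [Countable Γ] (g : ℍ → ℂ) (z : ℍ) (η : ℝ), 0 < η →
      (∀ γ : Γ, γ ≠ 1 → η ≤ disp γ z) →
      Summable (fun γ : NT Γ => ‖wterm k s g γ.mat z‖) ∧
        ∑' γ : NT Γ, ‖wterm k s g γ.mat z‖ ≤
          C * ((1 + 1 / η) ^ M * (‖g z‖ * z.im ^ (2 * k))) := by
  obtain ⟨C, M, hC, hw⟩ := exists_norm_wterm_le k hs
  obtain ⟨C', hC', hsum⟩ := exists_orbital_sum_bound hs
  refine ⟨C * (C' * 4), M + 1, by positivity, fun Γ _ g z η hη hd => ?_⟩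
  -- This choice satisfies 9/4 ε² ≤ η, as `two_mul_le_dist` demands, while ε^(-2) ≤ 4(1 + 1/η); the
  -- orbital sum thus raises the exponent by one.
  set ε := min 1 (√η) / 2 with hε
  have hm : 0 < min 1 (√η) := lt_min one_pos (Real.sqrt_pos.mpr hη)
  have hε0 : 0 < ε := by positivity
  have hm1 : min 1 (√η) ≤ 1 := min_le_left _ _
  have hmη : min 1 (√η) ^ 2 ≤ η := by
    calc _ ≤ (√η) ^ 2 := by gcongr; exact min_le_right _ _
      _ = η := Real.sq_sqrt hη.le
  have hεinv : (ε ^ 2)⁻¹ ≤ 4 * (1 + 1 / η) := by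
    have h1 : 1 ≤ min 1 (√η) ^ 2 * (1 + 1 / η) := by
      rcases min_choice 1 (√η) with h | h
      · rw [h]; have : 0 ≤ 1 / η := by positivity
        linarith
      · rw [h, Real.sq_sqrt hη.le]; field_simp; linarith
    rw [inv_le_iff_one_le_mul₀ (by positivity), hε]
    nlinarith
  obtain ⟨h1, h2⟩ := hsum Γ z z ε hε0 (by rw [hε]; linarith) fun γ hγ =>
    two_mul_le_dist (γ := (γ : SL(2, ℝ))) hε0.le (by rw [hε]; linarith)
      (le_trans (by rw [hε]; nlinarith) (hd γ hγ))
  set B := C * (1 + 1 / η) ^ M * (‖g z‖ * z.im ^ (2 * k)) with hB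
  have hy := z.im_pos
  have hB0 : 0 ≤ B := by positivity
  have hle : ∀ γ : NT Γ, ‖wterm k s g γ.mat z‖ ≤ B * rr z ((γ : Γ) • z) ^ s.re :=
    fun γ => hw g γ.mat z η hη (hd γ γ.ne)
  have h3 : Summable (fun γ : NT Γ => B * rr z ((γ : Γ) • z) ^ s.re) :=
    (h1.subtype _).mul_left B
  have h4 := h3.of_nonneg_of_le (fun _ => norm_nonneg _) hle
  refine ⟨h4, (h4.tsum_le_tsum hle h3).trans ?_⟩
  rw [tsum_mul_left]
  have h5 : ∑' γ : NT Γ, rr z ((γ : Γ) • z) ^ s.re ≤ ∑' γ : Γ, rr z (γ • z) ^ s.re :=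
    h1.tsum_subtype_le _ _ (fun γ => Real.rpow_nonneg (rr_pos _ _).le _)
  calc _ ≤ B * (C' * (4 * (1 + 1 / η))) := by
        gcongr; exact h5.trans (h2.trans (by gcongr))
    _ = _ := by rw [hB]; ring

lemma continuous_wterm (k : ℕ) {s : ℂ} (hs : 1 < s.re) {g : ℍ → ℂ} (hg : Continuous g)
    {γ : SL(2, ℝ)} (hγ : ∀ z : ℍ, γ • z ≠ z) : Continuous (wterm k s g γ) := by
  have hr : Continuous fun z : ℍ => rr z (γ • z) := by
    simp only [rr_self_smul]
    exact ((continuous_const.add (continuous_disp γ)).inv₀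
      fun z => by have := disp_nonneg γ z; exact (by linarith : (0:ℝ) < 1 + disp γ z).ne')
  have hrad : Continuous fun z : ℍ => radial k s (rr z (γ • z)) := by
    have : (fun z : ℍ => radial k s (rr z (γ • z))) = fun z : ℍ => cst s k *
        ((rr z (γ • z) : ℂ) - 1) ^ (2 * k) / (rr z (γ • z) : ℂ) ^ (2 * k) *
          radR s k (rr z (γ • z)) := funext fun z => radial_eq k s (rr_pos _ _)
    rw [this]
    refine Continuous.mul ?_ ?_
    · refine Continuous.div (by fun_prop) (by fun_prop) fun z => ?_
      exact pow_ne_zero _ (by exact_mod_cast (rr_pos _ _).ne')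
    · refine continuous_iff_continuousAt.mpr fun z => ?_
      have h1 := (hasDerivAt_radR hs k (r := rr z (γ • z))
        (by rw [Complex.norm_real, Real.norm_of_nonneg (rr_pos _ _).le]
            exact rr_smul_lt_one (hγ z))
        (Or.inl (by simpa using rr_pos _ _))).continuousAt
      exact ContinuousAt.comp (f := fun z : ℍ => (rr z (γ • z) : ℂ)) h1
        (Complex.continuous_ofReal.comp hr).continuousAt
  have hq : Continuous fun z : ℍ => quad γ z := by unfold quad; fun_prop
  unfold wterm hterm
  refine ((((hq.pow _).inv₀ fun z => pow_ne_zero _ (quad_ne_zero (hγ z))).mul hrad).mul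
    (by fun_prop)).mul ?_
  exact Complex.continuous_ofReal.comp (UpperHalfPlane.continuous_im.pow _)

end

section

/-! ### Displacement and commutation -/

lemma trace_eq (γ : SL(2, ℝ)) : γ.1.trace = γ 0 0 + γ 1 1 := Matrix.trace_fin_two _

lemma four_mul_disp_I (γ : SL(2, ℝ)) :
    4 * disp γ UpperHalfPlane.I = γ.1.trace ^ 2 - 4 + (γ 0 1 - γ 1 0) ^ 2 := by
  rw [disp_I, trace_eq]
  linear_combination (-4 : ℝ) * det_eq γ

lemma trace_conj (γ δ : SL(2, ℝ)) : (δ⁻¹ * γ * δ).1.trace = γ.1.trace := by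
  change (δ⁻¹.1 * γ.1 * δ.1).trace = _
  rw [Matrix.trace_mul_cycle, ← Matrix.SpecialLinearGroup.coe_mul]
  simp

lemma exists_smul_I (z : ℍ) : ∃ σ : SL(2, ℝ), σ • UpperHalfPlane.I = z :=
  MulAction.exists_smul_eq _ _ _

lemma trace_sq_sub_le_disp (γ : SL(2, ℝ)) (z : ℍ) : γ.1.trace ^ 2 - 4 ≤ 4 * disp γ z := by
  obtain ⟨σ, rfl⟩ := exists_smul_I z
  rw [← disp_conj, four_mul_disp_I, trace_conj]
  nlinarith [sq_nonneg ((σ⁻¹ * γ * σ) 0 1 - (σ⁻¹ * γ * σ) 1 0)]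

/-- The coefficient vectors of `quad γ'` and `quad γ` are proportional with ratio `l`. -/
def PropTo (l : ℝ) (γ γ' : SL(2, ℝ)) : Prop :=
  γ' 1 0 = l * γ 1 0 ∧ γ' 1 1 - γ' 0 0 = l * (γ 1 1 - γ 0 0) ∧ γ' 0 1 = l * γ 0 1

lemma PropTo.quad {l : ℝ} {γ γ' : SL(2, ℝ)} (h : PropTo l γ γ') (z : ℂ) :
    quad γ' z = l * quad γ z := by
  obtain ⟨h1, h2, h3⟩ := h
  have h2' : (γ' 1 1 : ℂ) - γ' 0 0 = l * (γ 1 1 - γ 0 0) := by exact_mod_cast h2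
  rw [HypPeriod.quad, HypPeriod.quad, h2', h1, h3]
  push_cast; ring

lemma PropTo.disp {l : ℝ} {γ γ' : SL(2, ℝ)} (h : PropTo l γ γ') (z : ℍ) :
    disp γ' z = l ^ 2 * disp γ z := by
  rw [HypPeriod.disp, HypPeriod.disp, h.quad, norm_mul, Complex.norm_real, mul_pow,
    Real.norm_eq_abs, sq_abs, mul_div_assoc]

/-- A scalar matrix in SL(2, ℝ) is ±1. The case -1 is recorded as γ² = 1, the form that
torsion-freeness excludes. -/
lemma eq_one_or_neg_one {γ : SL(2, ℝ)} (h1 : γ 1 0 = 0) (h2 : γ 1 1 - γ 0 0 = 0) (h3 : γ 0 1 = 0) :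
    γ = 1 ∨ γ * γ = 1 := by
  right
  have hd := det_eq γ
  have h4 : γ 1 1 = γ 0 0 := by linarith
  rw [h1, h3, h4] at hd
  ext i j
  fin_cases i <;> fin_cases j <;>
    simp [Matrix.mul_apply, Fin.sum_univ_two, h1, h3, h4] <;> linarith

lemma ext_of_entries {γ γ' : SL(2, ℝ)} (h : ∀ i j, γ i j = γ' i j) : γ = γ' := by
  ext i j; exact h i j

lemma inv_apply_00 (γ : SL(2, ℝ)) : γ⁻¹ 0 0 = γ 1 1 := by
  rw [Matrix.SpecialLinearGroup.SL2_inv_expl]; rfl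

lemma inv_apply_01 (γ : SL(2, ℝ)) : γ⁻¹ 0 1 = -γ 0 1 := by
  rw [Matrix.SpecialLinearGroup.SL2_inv_expl]; rfl

lemma inv_apply_10 (γ : SL(2, ℝ)) : γ⁻¹ 1 0 = -γ 1 0 := by
  rw [Matrix.SpecialLinearGroup.SL2_inv_expl]; rfl

lemma inv_apply_11 (γ : SL(2, ℝ)) : γ⁻¹ 1 1 = γ 0 0 := by
  rw [Matrix.SpecialLinearGroup.SL2_inv_expl]; rfl

/-- The three equations say that the coefficient vectors of Q_γ and Q_γ' are parallel, that is, that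
γ and γ' have the same fixed points. -/
lemma commute_iff (γ γ' : SL(2, ℝ)) : Commute γ γ' ↔
    γ 0 1 * γ' 1 0 = γ' 0 1 * γ 1 0 ∧
    (γ 1 1 - γ 0 0) * γ' 0 1 = (γ' 1 1 - γ' 0 0) * γ 0 1 ∧
    (γ 1 1 - γ 0 0) * γ' 1 0 = (γ' 1 1 - γ' 0 0) * γ 1 0 := by
  constructor
  · intro h
    have e : ∀ i j, (γ * γ') i j = (γ' * γ) i j := fun i j => by rw [h.eq]
    have e00 := e 0 0
    have e01 := e 0 1
    have e10 := e 1 0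
    simp only [Matrix.SpecialLinearGroup.coe_mul, Matrix.mul_apply, Fin.sum_univ_two] at e00 e01 e10
    refine ⟨by linarith, by linarith, by linarith⟩
  · rintro ⟨h1, h2, h3⟩
    refine ext_of_entries fun i j => ?_
    fin_cases i <;> fin_cases j <;>
      simp only [Matrix.SpecialLinearGroup.coe_mul, Matrix.mul_apply, Fin.sum_univ_two,
        Fin.zero_eta, Fin.mk_one] <;> linarith

lemma exists_propTo_of_commute {γ γ' : SL(2, ℝ)} (hγ : ¬ (γ 1 0 = 0 ∧ γ 1 1 - γ 0 0 = 0 ∧ γ 0 1 = 0))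
    (h : Commute γ γ') : ∃ l, PropTo l γ γ' := by
  obtain ⟨h1, h2, h3⟩ := (commute_iff γ γ').mp h
  by_cases hc : γ 1 0 = 0
  · by_cases hb : γ 0 1 = 0
    · have hd : γ 1 1 - γ 0 0 ≠ 0 := fun hd => hγ ⟨hc, hd, hb⟩
      refine ⟨(γ' 1 1 - γ' 0 0) / (γ 1 1 - γ 0 0), ?_, ?_, ?_⟩
      · field_simp; linarith
      · field_simp
      · field_simp; linarith
    · refine ⟨γ' 0 1 / γ 0 1, ?_, ?_, ?_⟩
      · field_simp; linarith
      · field_simp; linarith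
      · field_simp
  · refine ⟨γ' 1 0 / γ 1 0, ?_, ?_, ?_⟩
    · field_simp
    · field_simp; linarith
    · field_simp; linarith

/-! ### Torsion-free discrete groups: traces, contraction and centralizers -/

section

variable {Γ : Subgroup SL(2, ℝ)}

lemma entries_ne (htf : ∀ γ : Γ, γ ≠ 1 → ¬ IsOfFinOrder γ) {γ : Γ} (hγ : γ ≠ 1) :
    ¬ ((γ : SL(2, ℝ)) 1 0 = 0 ∧ (γ : SL(2, ℝ)) 1 1 - (γ : SL(2, ℝ)) 0 0 = 0 ∧
      (γ : SL(2, ℝ)) 0 1 = 0) := by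
  rintro ⟨h1, h2, h3⟩
  rcases eq_one_or_neg_one h1 h2 h3 with h | h
  · exact hγ (Subtype.ext h)
  · exact htf γ hγ (isOfFinOrder_iff_pow_eq_one.mpr ⟨2, two_pos, by
      rw [pow_two]; exact Subtype.ext h⟩)

variable [DiscreteTopology Γ]

/-- If tr² < 4, the quadratic polynomial Q_γ has the root (a-d)/(2c) + i√(4-tr²)/(2|c|) in ℍ, which
γ would fix. -/
lemma four_le_trace_sq (htf : ∀ γ : Γ, γ ≠ 1 → ¬ IsOfFinOrder γ) (γ : Γ) :
    4 ≤ (γ : SL(2, ℝ)).1.trace ^ 2 := by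
  by_cases hγ : γ = 1
  · subst hγ; simp; norm_num
  set δ : SL(2, ℝ) := (γ : SL(2, ℝ)) with hδ
  by_contra! hlt
  have hd := det_eq δ
  rw [trace_eq] at hlt
  have hc : δ 1 0 ≠ 0 := by
    intro hc
    rw [hc, mul_zero, sub_zero] at hd
    nlinarith [sq_nonneg (δ 0 0 - δ 1 1)]
  set D := 4 - (δ 0 0 + δ 1 1) ^ 2 with hD
  have hDpos : 0 < D := by linarith
  have hc' : 0 < |δ 1 0| := abs_pos.mpr hc
  let z : ℍ := toH ((δ 0 0 - δ 1 1) / (2 * δ 1 0), √D / (2 * |δ 1 0|))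
  have hy : 0 < √D / (2 * |δ 1 0|) := by have := Real.sqrt_pos.mpr hDpos; positivity
  refine smul_ne_self htf hγ z ?_
  rw [Subgroup.smul_def]
  refine (bil_eq_zero_iff δ z z).mp ?_
  rw [← quad_eq_bil, quad, coe_toH hy]
  have e1 : ((√D / (2 * |δ 1 0|) : ℝ) : ℂ) ^ 2 = ((D / (4 * δ 1 0 ^ 2) : ℝ) : ℂ) := by
    rw [← Complex.ofReal_pow, div_pow, Real.sq_sqrt hDpos.le, mul_pow, sq_abs]; norm_num
  set t := ((√D / (2 * |δ 1 0|) : ℝ) : ℂ) with ht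
  have hc2 : (δ 1 0 : ℂ) ≠ 0 := by exact_mod_cast hc
  have hd2 := det_eq_complex δ
  have e3 : (δ 1 0 : ℂ) * (((((δ 0 0 - δ 1 1) / (2 * δ 1 0) : ℝ)) : ℂ)) =
    ((δ 0 0 : ℂ) - δ 1 1) / 2 := by push_cast; field_simp
  have e4 : (δ 1 0 : ℂ) ^ 2 * t ^ 2 = (4 - ((δ 0 0 : ℂ) + δ 1 1) ^ 2) / 4 := by
    rw [e1, hD]; push_cast; field_simp
  set X := (((((δ 0 0 - δ 1 1) / (2 * δ 1 0) : ℝ)) : ℂ)) with hX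
  have e5 : (δ 1 0 : ℂ) * ((δ 1 0 : ℂ) * (X + t * Complex.I) ^ 2 +
      ((δ 1 1 : ℂ) - δ 0 0) * (X + t * Complex.I) - δ 0 1) = 0 := by
    linear_combination ((δ 1 0 : ℂ) * X + ((δ 0 0 : ℂ) - δ 1 1) / 2 +
      2 * t * Complex.I * (δ 1 0 : ℂ) + ((δ 1 1 : ℂ) - δ 0 0)) * e3 + (δ 1 0 : ℂ) ^ 2 * t ^ 2 *
      Complex.I_sq - e4 + hd2
  exact (mul_eq_zero.mp e5).resolve_left hc2

lemma exists_disp_ge (htf : ∀ γ : Γ, γ ≠ 1 → ¬ IsOfFinOrder γ) (z : ℍ) :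
    ∃ η : ℝ, 0 < η ∧ ∀ γ : Γ, γ ≠ 1 → η ≤ disp γ z := by
  obtain ⟨ε, h0, -, h⟩ := exists_separation htf z
  refine ⟨Real.sinh ε ^ 2, by have := Real.sinh_pos_iff.mpr h0; positivity, fun γ hγ => ?_⟩
  rw [disp_eq_sinh]
  have h1 := h γ hγ
  have := (Real.sinh_pos_iff.mpr h0).le
  gcongr
  refine Real.sinh_le_sinh.mpr ?_
  rw [Subgroup.smul_def] at h1
  linarith

/-- Iterating the conjugation would give nontrivial elements whose displacement at i tends to 0,
against discreteness. This rules out, for example, a hyperbolic element sharing a fixed point with a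
parabolic one. -/
lemma not_contracting (htf : ∀ γ : Γ, γ ≠ 1 → ¬ IsOfFinOrder γ) {γ δ : Γ} (hγ : γ ≠ 1) {m : ℝ}
    (h0 : 0 ≤ m) (h1 : m < 1) (h : ∀ z : ℍ, disp (δ * γ * δ⁻¹ : Γ) z = m * disp γ z) : False := by
  have hn : ∀ (n : ℕ) (z : ℍ), disp (δ ^ n * γ * (δ ^ n)⁻¹ : Γ) z = m ^ n * disp γ z := by
    intro n
    induction n with
    | zero => intro z; simp
    | succ n ih =>
      intro z
      have e : (δ ^ (n + 1) * γ * (δ ^ (n + 1))⁻¹ : Γ) =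
          (δ⁻¹)⁻¹ * (δ ^ n * γ * (δ ^ n)⁻¹) * δ⁻¹ := by rw [pow_succ']; group
      have e2 : δ * γ * δ⁻¹ = (δ⁻¹)⁻¹ * γ * δ⁻¹ := by group
      have h2 := h z
      rw [e2] at h2
      rw [e]
      push_cast at h2 ⊢
      rw [disp_conj] at h2 ⊢
      have h3 := ih ((δ : SL(2, ℝ))⁻¹ • z)
      push_cast at h3
      rw [h3, h2, pow_succ]; ring
  obtain ⟨η, hη, hle⟩ := exists_disp_ge htf UpperHalfPlane.I
  have ht : Filter.Tendsto (fun n : ℕ => m ^ n * disp γ UpperHalfPlane.I) Filter.atTop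
      (nhds (0 * disp γ UpperHalfPlane.I)) :=
    (tendsto_pow_atTop_nhds_zero_of_lt_one h0 h1).mul_const _
  rw [zero_mul] at ht
  obtain ⟨n, hn'⟩ := (ht.eventually (gt_mem_nhds hη)).exists
  have := hle (δ ^ n * γ * (δ ^ n)⁻¹) (by simpa using hγ)
  rw [hn] at this
  linarith

/-- Commutation makes Q of the conjugate equal to l · Q_γ, and `not_contracting`, applied to δ or
δ⁻¹, forces l² = 1. As the traces agree, the conjugate is γ if l = 1 and γ⁻¹ if l = -1. In the
second case δγ = γ⁻¹δ forces tr δ = 0, which contradicts `four_le_trace_sq`. -/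
lemma commute_of_commute_conj (htf : ∀ γ : Γ, γ ≠ 1 → ¬ IsOfFinOrder γ) {γ δ : Γ} (hγ : γ ≠ 1)
    (h : Commute γ (δ * γ * δ⁻¹)) : Commute γ δ := by
  have hne := entries_ne htf hγ
  obtain ⟨l, hl⟩ := exists_propTo_of_commute (γ := γ) (γ' := (δ * γ * δ⁻¹ : Γ)) hne (by
    have := congrArg Subtype.val h.eq
    exact this)
  have htr : (δ * γ * δ⁻¹ : Γ).1.1.trace = γ.1.1.trace := by
    have := trace_conj γ.1 (δ.1)⁻¹
    rw [inv_inv] at this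
    exact this
  have hl1 : l ^ 2 = 1 := by
    rcases lt_trichotomy (l ^ 2) 1 with h1 | h1 | h1
    · exact (not_contracting htf hγ (sq_nonneg l) h1 hl.disp).elim
    · exact h1
    · refine (not_contracting (δ := δ⁻¹) htf hγ (m := (l ^ 2)⁻¹) (by positivity)
        (inv_lt_one_of_one_lt₀ h1) fun z => ?_).elim
      have h2 := hl.disp ((δ : SL(2, ℝ)) • z)
      have e : (δ * γ * δ⁻¹ : Γ) = (δ⁻¹)⁻¹ * γ * δ⁻¹ := by group
      rw [e] at h2
      push_cast at h2 ⊢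
      rw [disp_conj, inv_smul_smul] at h2
      rw [inv_inv, disp_conj, h2, inv_mul_cancel_left₀ (by positivity)]
  obtain ⟨l1, l2, l3⟩ := hl
  rw [trace_eq, trace_eq] at htr
  rcases (show l = 1 ∨ l = -1 from by simpa using hl1) with rfl | rfl
  · have e : δ * γ * δ⁻¹ = γ := by
      refine Subtype.ext (ext_of_entries fun i j => ?_)
      fin_cases i <;> fin_cases j <;> simp only [Fin.zero_eta, Fin.mk_one] <;> linarith
    exact (mul_inv_eq_iff_eq_mul.mp e).symm
  · have e : δ * γ * δ⁻¹ = γ⁻¹ := by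
      refine Subtype.ext (ext_of_entries fun i j => ?_)
      fin_cases i <;> fin_cases j <;>
        simp only [Fin.zero_eta, Fin.mk_one, Subgroup.coe_inv, inv_apply_00, inv_apply_01,
          inv_apply_10, inv_apply_11] <;> linarith
    have e2 : δ * γ = γ⁻¹ * δ := mul_inv_eq_iff_eq_mul.mp e
    have e3 : ∀ i j, ((δ : SL(2, ℝ)) * γ) i j = ((γ : SL(2, ℝ))⁻¹ * δ) i j := fun i j => by
      have := congrArg Subtype.val e2
      push_cast at this
      rw [this]
    have e00 := e3 0 0
    have e01 := e3 0 1
    have e10 := e3 1 0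
    have e11 := e3 1 1
    simp only [Matrix.SpecialLinearGroup.coe_mul, Matrix.mul_apply, Fin.sum_univ_two,
      inv_apply_00, inv_apply_01, inv_apply_10, inv_apply_11] at e00 e01 e10 e11
    have htr := four_le_trace_sq htf δ
    rw [trace_eq] at htr
    have hb : (γ : SL(2, ℝ)) 0 1 * ((δ : SL(2, ℝ)) 0 0 + (δ : SL(2, ℝ)) 1 1) = 0 := by linarith
    have hc : (γ : SL(2, ℝ)) 1 0 * ((δ : SL(2, ℝ)) 0 0 + (δ : SL(2, ℝ)) 1 1) = 0 := by linarith
    have ht : (δ : SL(2, ℝ)) 0 0 + (δ : SL(2, ℝ)) 1 1 ≠ 0 := by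
      intro h0; rw [h0] at htr; norm_num at htr
    have hb0 := (mul_eq_zero.mp hb).resolve_right ht
    have hc0 := (mul_eq_zero.mp hc).resolve_right ht
    exfalso
    refine hne ⟨hc0, ?_, hb0⟩
    rw [hb0] at e00 e11
    rw [hc0] at e00 e11
    have h5 : ((γ : SL(2, ℝ)) 1 1 - (γ : SL(2, ℝ)) 0 0) *
      ((δ : SL(2, ℝ)) 0 0 + (δ : SL(2, ℝ)) 1 1) = 0 := by linarith
    exact (mul_eq_zero.mp h5).resolve_right ht

/-! ### Small displacements commute -/

attribute [local instance] Matrix.frobeniusNormedRing Matrix.frobeniusNormedAddCommGroup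

lemma frobenius_sq (A : Matrix (Fin 2) (Fin 2) ℝ) :
    ‖A‖ ^ 2 = A 0 0 ^ 2 + A 0 1 ^ 2 + A 1 0 ^ 2 + A 1 1 ^ 2 := by
  rw [Matrix.frobenius_norm_def, ← Real.sqrt_eq_rpow, Real.sq_sqrt (by positivity)]
  simp [Fin.sum_univ_two]
  ring

lemma frobenius_inv_sub_one (γ : SL(2, ℝ)) : ‖γ⁻¹.1 - 1‖ = ‖γ.1 - 1‖ := by
  have : ‖γ⁻¹.1 - 1‖ ^ 2 = ‖γ.1 - 1‖ ^ 2 := by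
    rw [frobenius_sq, frobenius_sq]
    simp only [Matrix.sub_apply, inv_apply_00, inv_apply_01, inv_apply_10, inv_apply_11]
    simp
    ring
  exact (sq_eq_sq₀ (norm_nonneg _) (norm_nonneg _)).mp this

lemma frobenius_le (γ : SL(2, ℝ)) (h : ‖γ.1 - 1‖ ≤ 1 / 10) : ‖γ.1‖ ≤ 1.52 := by
  have h1 : ‖(1 : Matrix (Fin 2) (Fin 2) ℝ)‖ ≤ 1.42 := by
    refine abs_le_of_sq_le_sq' ?_ (by norm_num) |>.2
    rw [frobenius_sq]; norm_num
  have := norm_add_le (γ.1 - 1) 1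
  rw [sub_add_cancel] at this
  linarith

/-- The commutator minus 1 is (XY - YX) γ⁻¹δ⁻¹ with X = γ - 1 and Y = δ - 1, hence quadratically
small. Numerically 2 · (1/10) · 1.52² < 1/2. -/
lemma frobenius_commutator (γ δ : SL(2, ℝ)) (h1 : ‖γ.1 - 1‖ ≤ 1 / 10) (h2 : ‖δ.1 - 1‖ ≤ 1 / 10) :
    ‖(γ * δ * γ⁻¹ * δ⁻¹).1 - 1‖ ≤ ‖δ.1 - 1‖ / 2 := by
  have e : (γ * δ * γ⁻¹ * δ⁻¹).1 - 1 =
      ((γ.1 - 1) * (δ.1 - 1) - (δ.1 - 1) * (γ.1 - 1)) * γ⁻¹.1 * δ⁻¹.1 := by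
    have e1 : (1 : Matrix (Fin 2) (Fin 2) ℝ) = (δ * γ * γ⁻¹ * δ⁻¹).1 := by simp
    have e2 : (γ.1 - 1) * (δ.1 - 1) - (δ.1 - 1) * (γ.1 - 1) = γ.1 * δ.1 - δ.1 * γ.1 := by
      noncomm_ring
    rw [e2, sub_mul, sub_mul]
    nth_rw 1 [e1]
    rfl
  have h3 := frobenius_le γ⁻¹ (by rwa [frobenius_inv_sub_one])
  have h4 := frobenius_le δ⁻¹ (by rwa [frobenius_inv_sub_one])
  rw [e]
  set x := ‖γ.1 - 1‖
  set y := ‖δ.1 - 1‖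
  have hx : 0 ≤ x := norm_nonneg _
  have hy : 0 ≤ y := norm_nonneg _
  have h5 : ‖(γ.1 - 1) * (δ.1 - 1) - (δ.1 - 1) * (γ.1 - 1)‖ ≤ 2 * (x * y) := by
    refine (norm_sub_le _ _).trans ?_
    have a1 := norm_mul_le (γ.1 - 1) (δ.1 - 1)
    have a2 := norm_mul_le (δ.1 - 1) (γ.1 - 1)
    linarith
  calc _ ≤ ‖(γ.1 - 1) * (δ.1 - 1) - (δ.1 - 1) * (γ.1 - 1)‖ * ‖γ⁻¹.1‖ * ‖δ⁻¹.1‖ :=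
        (norm_mul_le _ _).trans (by gcongr; exact norm_mul_le _ _)
    _ ≤ 2 * (1 / 10 * y) * 1.52 * 1.52 := by
      gcongr
      exact h5.trans (by gcongr)
    _ ≤ y / 2 := by nlinarith

/-- The displacement does not see the sign of γ, so closeness to 1 holds only after choosing the
sign with tr ≥ 2. Then (tr-2)² ≤ tr² - 4, and the two expressions for 4 · `disp` at i together give
‖δ - 1‖² ≤ 4 · `disp` ≤ 1/100. -/
lemma exists_sign_frobenius_le {γ : SL(2, ℝ)} (h : 4 ≤ γ.1.trace ^ 2)
    (h1 : disp γ UpperHalfPlane.I ≤ 1 / 400) :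
    ∃ δ : SL(2, ℝ), (δ = γ ∨ δ = -γ) ∧ ‖δ.1 - 1‖ ≤ 1 / 10 := by
  have key : ∀ δ : SL(2, ℝ), 2 ≤ δ.1.trace → disp δ UpperHalfPlane.I ≤ 1 / 400 →
      ‖δ.1 - 1‖ ≤ 1 / 10 := by
    intro δ h h1
    refine abs_le_of_sq_le_sq' ?_ (by norm_num) |>.2
    have h2 := disp_I δ
    have h3 := four_mul_disp_I δ
    rw [frobenius_sq]
    rw [trace_eq] at h h3
    simp
    nlinarith
  by_cases h0 : 0 ≤ γ.1.trace
  · exact ⟨γ, Or.inl rfl, key γ (by nlinarith) h1⟩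
  · refine ⟨-γ, Or.inr rfl, key (-γ) ?_ ?_⟩
    · rw [trace_eq] at h h0 ⊢
      simp
      nlinarith
    · have h2 := disp_I γ
      have h3 := disp_I (-γ)
      simp at h3
      nlinarith

lemma disp_I_le_of_sign {γ δ : SL(2, ℝ)} (h : δ = γ ∨ δ = -γ) :
    2 * disp γ UpperHalfPlane.I ≤ ‖δ.1 - 1‖ ^ 2 := by
  have h2 := disp_I γ
  rw [frobenius_sq]
  rcases h with rfl | rfl
  · simp
    nlinarith [sq_nonneg (δ 0 0 + δ 1 1 - 2), sq_nonneg (δ 0 1 - δ 1 0)]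
  · simp
    nlinarith [sq_nonneg (γ 0 0 + γ 1 1 + 2), sq_nonneg (γ 0 1 - γ 1 0)]

/-- The iterated commutators `[γ, [γ, …, [γ, δ]]]`. -/
def iterComm {G : Type*} [Group G] (γ δ : G) : ℕ → G
  | 0 => δ
  | n + 1 => γ * iterComm γ δ n * γ⁻¹ * (iterComm γ δ n)⁻¹

/-- Zassenhaus' argument: after conjugating the point to i and correcting signs, each commutator
with γ at least halves the bound on the distance to 1, so by discreteness the iterated commutators
become trivial. One then descends through them with `commute_of_commute_conj`. -/
lemma commute_of_disp_le (htf : ∀ γ : Γ, γ ≠ 1 → ¬ IsOfFinOrder γ) {γ δ : Γ} {z : ℍ}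
    (h1 : disp γ z ≤ 1 / 400) (h2 : disp δ z ≤ 1 / 400) : Commute γ δ := by
  by_cases hγ : γ = 1
  · subst hγ; exact Commute.one_left _
  obtain ⟨σ, rfl⟩ := exists_smul_I z
  rw [← disp_conj] at h1 h2
  obtain ⟨A, hA, hA1⟩ := exists_sign_frobenius_le
    (by rw [trace_conj]; exact four_le_trace_sq htf γ) h1
  obtain ⟨B, hB, hB1⟩ := exists_sign_frobenius_le
    (by rw [trace_conj]; exact four_le_trace_sq htf δ) h2
  have hseq : ∀ n : ℕ, ∃ B : SL(2, ℝ), (B = σ⁻¹ * (iterComm γ δ n : Γ) * σ ∨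
      B = -(σ⁻¹ * (iterComm γ δ n : Γ) * σ)) ∧ ‖B.1 - 1‖ ≤ 1 / 10 * (1 / 2) ^ n := by
    intro n
    induction n with
    | zero => exact ⟨B, hB, by simpa using hB1⟩
    | succ n ih =>
      obtain ⟨B, hB, hB1⟩ := ih
      have hp : (1 / 2 : ℝ) ^ n ≤ 1 := pow_le_one₀ (by norm_num) (by norm_num)
      refine ⟨A * B * A⁻¹ * B⁻¹, Or.inl ?_,
        (frobenius_commutator A B hA1 (hB1.trans (by linarith))).trans ?_⟩
      -- Signs drop out of commutators, so from the second term on no correction is needed.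
      · have e : A * B * A⁻¹ * B⁻¹ = (σ⁻¹ * γ * σ) * (σ⁻¹ * (iterComm γ δ n : Γ) * σ) *
            (σ⁻¹ * γ * σ)⁻¹ * (σ⁻¹ * (iterComm γ δ n : Γ) * σ)⁻¹ := by
          rcases hA with rfl | rfl <;> rcases hB with rfl | rfl <;> simp
        rw [e, iterComm]
        push_cast
        group
      · rw [pow_succ]; linarith
  obtain ⟨η, hη, hle⟩ := exists_disp_ge htf (σ • UpperHalfPlane.I)
  have hlim : Filter.Tendsto (fun n : ℕ => (1 / 10 * (1 / 2 : ℝ) ^ n) ^ 2) Filter.atTop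
      (nhds ((1 / 10 * 0) ^ 2)) :=
    ((tendsto_pow_atTop_nhds_zero_of_lt_one (by norm_num) (by norm_num)).const_mul _).pow 2
  rw [mul_zero, zero_pow two_ne_zero] at hlim
  obtain ⟨n, hn⟩ := (hlim.eventually (gt_mem_nhds hη)).exists
  have hone : iterComm γ δ n = 1 := by
    by_contra hne
    have h3 := hle _ hne
    rw [← disp_conj] at h3
    obtain ⟨B, hB, hB1⟩ := hseq n
    have h4 := disp_I_le_of_sign hB
    have h5 : ‖B.1 - 1‖ ^ 2 ≤ (1 / 10 * (1 / 2 : ℝ) ^ n) ^ 2 := by gcongr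
    linarith
  have hdown : ∀ m, Commute γ (iterComm γ δ m) → Commute γ δ := by
    intro m
    induction m with
    | zero => exact id
    | succ m ih =>
      intro h
      refine ih (commute_of_commute_conj htf hγ ?_)
      rw [iterComm] at h
      -- For x the m-th iterated commutator, γ⁻¹[γ, x] = xγ⁻¹x⁻¹; thus if γ commutes with [γ, x], it
      -- commutes with xγx⁻¹.
      have h6 : Commute γ (γ⁻¹ * (γ * iterComm γ δ m * γ⁻¹ * (iterComm γ δ m)⁻¹)) :=
        (Commute.refl γ).inv_right.mul_right h
      have h7 := h6.inv_right
      have e : (γ⁻¹ * (γ * iterComm γ δ m * γ⁻¹ * (iterComm γ δ m)⁻¹))⁻¹ =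
        iterComm γ δ m * γ * (iterComm γ δ m)⁻¹ := by group
      rwa [e] at h7
  exact hdown n (by rw [hone]; exact Commute.one_right _)

end

end

open scoped Manifold

/-! ### Automorphy of cusp forms and their translates -/

section

variable {Γ : Subgroup SL(2, ℝ)} {k : ℕ}

open scoped ModularForm in
lemma slash_toGL (f : ℍ → ℂ) (m : ℤ) (γ : SL(2, ℝ)) (z : ℍ) :
    (f ∣[m] (Matrix.SpecialLinearGroup.toGL γ)) z = f (γ • z) * jfac γ z ^ (-m) := by
  rw [ModularForm.slash_apply]
  have h1 : (Matrix.SpecialLinearGroup.toGL γ) • z = γ • z := rfl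
  have h2 : denom (Matrix.SpecialLinearGroup.toGL γ) z = jfac γ z := rfl
  have h3 : (Matrix.SpecialLinearGroup.toGL γ).det.val = 1 := γ.2
  rw [h1, h2, h3]
  simp [σ]

lemma cuspForm_smul (g : CuspFormsFourK Γ k) (γ : Γ) (z : ℍ) :
    g ((γ : SL(2, ℝ)) • z) = jfac (γ : SL(2, ℝ)) z ^ (4 * k) * g z := by
  have h := SlashInvariantFormClass.slash_action_eq g
    (Matrix.SpecialLinearGroup.toGL (γ : SL(2, ℝ))) ⟨γ, γ.2, rfl⟩
  have h1 := congrFun h z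
  rw [slash_toGL, zpow_neg] at h1
  have hj := jfac_ne_zero (γ : SL(2, ℝ)) z
  have e : jfac (γ : SL(2, ℝ)) z ^ (4 * k : ℤ) = jfac (γ : SL(2, ℝ)) z ^ (4 * k) := by
    rw [← zpow_natCast]; push_cast; rfl
  rw [e] at h1
  rw [← h1, mul_left_comm, mul_inv_cancel₀ (pow_ne_zero _ hj), mul_one]

lemma cuspForm_mdiff (g : CuspFormsFourK Γ k) : MDiff (g : ℍ → ℂ) := g.holo'

lemma cuspForm_continuous (g : CuspFormsFourK Γ k) : Continuous (g : ℍ → ℂ) :=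
  (cuspForm_mdiff g).continuous

lemma twist_eq (k : ℕ) (g : ℍ → ℂ) (τ : SL(2, ℝ)) (z : ℍ) :
    twist k g τ z = g (τ⁻¹ • z) * jfac τ⁻¹ z ^ (-(4 * k : ℤ)) := by
  rw [twist, mul_comm]; rfl

lemma twist_eq' (k : ℕ) (g : ℍ → ℂ) (τ : SL(2, ℝ)) (z : ℍ) :
    twist k g τ z = g (τ⁻¹ • z) * (jfac τ⁻¹ z ^ (4 * k))⁻¹ := by
  rw [twist_eq, zpow_neg, show ((4 * k : ℤ)) = ((4 * k : ℕ) : ℤ) by push_cast; ring, zpow_natCast]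

open scoped ModularForm in
lemma twist_eq_slash (k : ℕ) (g : ℍ → ℂ) (τ : SL(2, ℝ)) :
    twist k g τ = g ∣[(4 * k : ℤ)] (Matrix.SpecialLinearGroup.toGL τ⁻¹) := by
  ext z; rw [slash_toGL, twist_eq]

lemma apply_eq_twist (k : ℕ) (g : ℍ → ℂ) (τ : SL(2, ℝ)) (z : ℍ) :
    twist k g τ (τ • z) = g z * jfac τ z ^ (4 * k) := by
  rw [twist_eq', inv_smul_smul, jfac_inv_smul, inv_pow, inv_inv]

lemma twist_mdiff {g : ℍ → ℂ} (hg : MDiff g) (τ : SL(2, ℝ)) : MDiff (twist k g τ) := by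
  rw [twist_eq_slash]
  exact hg.slash _ _

lemma twist_smul {g : ℍ → ℂ} {γ τ : SL(2, ℝ)}
    (hg : ∀ z : ℍ, g (γ • z) = jfac γ z ^ (4 * k) * g z) (z : ℍ) :
    twist k g τ ((τ * γ * τ⁻¹) • z) = jfac (τ * γ * τ⁻¹) z ^ (4 * k) * twist k g τ z := by
  obtain ⟨w, rfl⟩ : ∃ w, τ • w = z := ⟨τ⁻¹ • z, smul_inv_smul _ _⟩
  have e : (τ * γ * τ⁻¹) • τ • w = τ • γ • w := by
    rw [smul_smul, smul_smul]; congr 1; group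
  rw [e, apply_eq_twist, apply_eq_twist, hg, jfac_mul, jfac_inv_smul, inv_smul_smul, jfac_mul]
  have := jfac_ne_zero τ w
  rw [mul_assoc _ _ (jfac τ w)⁻¹, mul_pow, mul_pow, inv_pow]
  field_simp

lemma norm_twist_mul_im_pow (g : ℍ → ℂ) (τ : SL(2, ℝ)) (z : ℍ) :
    ‖twist k g τ (τ • z)‖ * (τ • z).im ^ (2 * k) = ‖g z‖ * z.im ^ (2 * k) := by
  have hj : ‖jfac τ z‖ ≠ 0 := norm_ne_zero_iff.mpr (jfac_ne_zero τ z)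
  rw [apply_eq_twist, norm_mul, norm_pow, im_smul_eq, div_pow, ← pow_mul,
    show 2 * (2 * k) = 4 * k by ring]
  field_simp

/-- The invariant function `|g(z)| y^{2k}`. -/
def height (k : ℕ) (g : ℍ → ℂ) (z : ℍ) : ℝ := ‖g z‖ * z.im ^ (2 * k)

lemma continuous_height {g : ℍ → ℂ} (hg : Continuous g) : Continuous (height k g) := by
  unfold height
  exact hg.norm.mul (UpperHalfPlane.continuous_im.pow _)

lemma height_smul (g : CuspFormsFourK Γ k) (γ : Γ) (z : ℍ) :
    height k g ((γ : SL(2, ℝ)) • z) = height k g z := by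
  have hj : ‖jfac (γ : SL(2, ℝ)) z‖ ≠ 0 := norm_ne_zero_iff.mpr (jfac_ne_zero _ z)
  rw [height, height, cuspForm_smul, norm_mul, norm_pow, im_smul_eq, div_pow, ← pow_mul,
    show 2 * (2 * k) = 4 * k by ring]
  field_simp

end

/-! ### The thick part is compact modulo the group -/

section

variable {Γ : Subgroup SL(2, ℝ)}

variable (Γ) in
/-- The points that are moved by a definite amount by every nontrivial element of `Γ`. -/
def thick (ε : ℝ) : Set ℍ := {z | ∀ γ : Γ, γ ≠ 1 → ε ≤ disp γ z}

lemma exists_two_mul_le_dist {η : ℝ} (hη : 0 < η) : ∃ ρ : ℝ, 0 < ρ ∧ ρ ≤ 1 ∧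
    ∀ (γ : SL(2, ℝ)) (z : ℍ), η ≤ disp γ z → 2 * ρ ≤ dist z (γ • z) := by
  have hm : 0 < min 1 (√η) := lt_min one_pos (Real.sqrt_pos.mpr hη)
  have hm1 : min 1 (√η) ≤ 1 := min_le_left _ _
  have hmη : min 1 (√η) ^ 2 ≤ η := by
    calc _ ≤ (√η) ^ 2 := by gcongr; exact min_le_right _ _
      _ = η := Real.sq_sqrt hη.le
  exact ⟨min 1 (√η) / 2, by positivity, by linarith, fun γ z h =>
    two_mul_le_dist (by positivity) (by linarith) (le_trans (by nlinarith) h)⟩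

variable [DiscreteTopology Γ]

/-- Otherwise one finds arbitrarily many thick points whose Γ-orbits are pairwise 2ρ apart. The
ρ-balls around them and all their translates are disjoint, so each of them takes up a fixed amount
of the finite volume of D. -/
lemma exists_compact_thick {D : Set ℍ} (hD : IsFundamentalDomain Γ D (volume : Measure ℍ))
    (hvol : volume D ≠ ⊤) {ε : ℝ} (hε : 0 < ε) :
    ∃ K : Set ℍ, IsCompact K ∧ ∀ z ∈ thick Γ ε, ∃ γ : Γ, γ • z ∈ K := by
  obtain ⟨ρ, hρ0, hρ1, hρ⟩ := exists_two_mul_le_dist hε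
  by_contra! hcon
  have hex : ∀ n : ℕ, ∃ S : Finset ℍ, S.card = n ∧ (∀ z ∈ S, z ∈ thick Γ ε) ∧
      ∀ z ∈ S, ∀ w ∈ S, z ≠ w → ∀ γ : Γ, 2 * ρ ≤ dist z (γ • w) := by
    intro n
    induction n with
    | zero => exact ⟨∅, by simp⟩
    | succ n ih =>
      obtain ⟨S, hcard, hS, hsep⟩ := ih
      obtain ⟨z, hz, hzK⟩ := hcon (⋃ w ∈ S, Metric.closedBall w (2 * ρ))
        (S.isCompact_biUnion fun w _ => isCompact_closedBall w _)
      have hfar : ∀ w ∈ S, ∀ γ : Γ, 2 * ρ < dist (γ • z) w := by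
        intro w hw γ
        have := hzK γ
        simp only [Set.mem_iUnion, Metric.mem_closedBall, not_exists, not_le] at this
        exact this w hw
      have hzS : z ∉ S := fun h => by
        have := hfar z h 1
        rw [one_smul, dist_self] at this
        linarith
      classical
      refine ⟨insert z S, by rw [Finset.card_insert_of_notMem hzS, hcard], ?_, ?_⟩
      · intro w hw
        rcases Finset.mem_insert.mp hw with rfl | hw
        · exact hz
        · exact hS w hw
      · intro a ha b hb hab γ
        rcases Finset.mem_insert.mp ha with ha' | ha' <;> rcases Finset.mem_insert.mp hb with hb' | hb'
        · exact absurd (ha'.trans hb'.symm) hab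
        · have := (hfar b hb' γ⁻¹).le
          rwa [← dist_smul γ, smul_inv_smul, ← ha'] at this
        · rw [dist_comm, hb']; exact (hfar a ha' γ).le
        · exact hsep a ha' b hb' hab γ
  set v := ENNReal.ofReal (ρ ^ 2 * Real.exp (-2)) with hv
  have hv0 : v ≠ 0 := by
    rw [hv, Ne, ENNReal.ofReal_eq_zero, not_le]; positivity
  have hbound : ∀ n : ℕ, (n : ENNReal) * v ≤ volume D := by
    intro n
    obtain ⟨S, hcard, hS, hsep⟩ := hex n
    set t : Set ℍ := ⋃ w ∈ S, Metric.ball w ρ with ht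
    have htm : MeasurableSet t := S.measurableSet_biUnion fun w _ => measurableSet_ball
    have hvt : (n : ENNReal) * v ≤ volume t := by
      rw [ht, measure_biUnion_finset]
      · rw [← hcard, ← nsmul_eq_mul]
        exact Finset.card_nsmul_le_sum _ _ _ fun w _ => le_volume_ball hρ0 hρ1 w
      · intro a ha b hb hab
        refine Metric.ball_disjoint_ball ?_
        have := hsep a ha b hb hab 1
        rw [one_smul] at this
        linarith
      · exact fun w _ => measurableSet_ball
    refine hvt.trans (hD.measure_le_of_pairwise_disjoint htm.nullMeasurableSet ?_)
    refine Pairwise.aedisjoint fun g₁ g₂ hne => ?_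
    refine (Disjoint.inf_left _ ?_).inf_right _
    rw [Set.disjoint_left]
    rintro _ ⟨x, hx, rfl⟩ ⟨y, hy, hxy : g₂ • y = g₁ • x⟩
    simp only [ht, Set.mem_iUnion, Metric.mem_ball] at hx hy
    obtain ⟨a, ha, hxa⟩ := hx
    obtain ⟨b, hb, hyb⟩ := hy
    have hyx : y = (g₂⁻¹ * g₁) • x := by rw [mul_smul, ← hxy, inv_smul_smul]
    have h1 : dist b ((g₂⁻¹ * g₁) • a) < 2 * ρ := by
      calc _ ≤ dist b y + dist y ((g₂⁻¹ * g₁) • a) := dist_triangle _ _ _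
        _ < ρ + ρ := by
          refine add_lt_add (by rwa [dist_comm]) ?_
          rwa [hyx, dist_smul]
        _ = _ := by ring
    by_cases hab : b = a
    · subst hab
      have h2 := hρ ((g₂⁻¹ * g₁ : Γ) : SL(2, ℝ)) b (hS b hb _ (mt inv_mul_eq_one.1 hne.symm))
      rw [Subgroup.smul_def] at h1
      linarith
    · exact absurd (hsep b hb a ha hab (g₂⁻¹ * g₁)) (not_le.mpr h1)
  obtain ⟨n, hn⟩ := ENNReal.exists_nat_mul_gt hv0 hvol
  exact absurd (hbound n) (not_le.mpr hn)

end

/-! ### Displacements are unbounded -/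

/-- The displacement tends to infinity on approaching a boundary point that γ does not fix: ∞ if c ≠
0, otherwise 0 if b ≠ 0. If γ is diagonal, one moves away from its axis horizontally. -/
lemma exists_disp_ge_of_entries {γ : SL(2, ℝ)}
    (hγ : ¬ (γ 1 0 = 0 ∧ γ 1 1 - γ 0 0 = 0 ∧ γ 0 1 = 0)) {t : ℝ} (ht : 0 ≤ t) :
    ∃ z : ℍ, t ≤ disp γ z := by
  have key : ∀ {y : ℝ} (hy : 0 < y), (2 * √t * y ≤ |γ 1 0 * y ^ 2 + γ 0 1|) →
      t ≤ disp γ (toH (0, y)) := by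
    intro y hy h
    rw [disp, le_div_iff₀ (by rw [toH_im hy]; positivity), toH_im hy]
    have h1 := Complex.abs_re_le_norm (quad γ (toH (0, y)))
    have h2 : (quad γ (toH (0, y))).re = -(γ 1 0 * y ^ 2 + γ 0 1) := by
      rw [quad, coe_toH hy]
      simp [pow_two]
      ring
    rw [h2, abs_neg] at h1
    have h3 : (2 * √t * y) ^ 2 ≤ ‖quad γ (toH (0, y))‖ ^ 2 := by gcongr; exact h.trans h1
    rw [mul_pow, mul_pow, Real.sq_sqrt ht] at h3
    linarith
  have hs := Real.sqrt_nonneg t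
  by_cases hc : γ 1 0 = 0
  · by_cases hb : γ 0 1 = 0
    · have hd : 0 < |γ 1 1 - γ 0 0| := abs_pos.mpr fun hd => hγ ⟨hc, hd, hb⟩
      refine ⟨toH (2 * √t / |γ 1 1 - γ 0 0|, 1), ?_⟩
      rw [disp, le_div_iff₀ (by rw [toH_im one_pos]; positivity), toH_im one_pos, quad,
        coe_toH one_pos, hc, hb]
      have h1 := Complex.abs_re_le_norm (((γ 1 1 : ℂ) - γ 0 0) *
        (((2 * √t / |γ 1 1 - γ 0 0| : ℝ) : ℂ) + ((1 : ℝ) : ℂ) * Complex.I))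
      have h2 : (((γ 1 1 : ℂ) - γ 0 0) *
        (((2 * √t / |γ 1 1 - γ 0 0| : ℝ) : ℂ) + ((1 : ℝ) : ℂ) * Complex.I)).re =
        (γ 1 1 - γ 0 0) * (2 * √t / |γ 1 1 - γ 0 0|) := by
          rw [← Complex.ofReal_sub, Complex.re_ofReal_mul]; simp
      rw [h2, abs_mul, abs_div, abs_abs, mul_div_cancel₀ _ hd.ne', abs_of_nonneg (by positivity)] at h1
      have h3 : (2 * √t) ^ 2 ≤ ‖((γ 1 1 : ℂ) - γ 0 0) *
        (((2 * √t / |γ 1 1 - γ 0 0| : ℝ) : ℂ) + ((1 : ℝ) : ℂ) * Complex.I)‖ ^ 2 := by gcongr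
      rw [mul_pow, Real.sq_sqrt ht] at h3
      simp only [Complex.ofReal_zero, zero_mul, zero_add, sub_zero]
      linarith
    · have hb' : 0 < |γ 0 1| := abs_pos.mpr hb
      set y := (2 * √t / |γ 0 1| + 1)⁻¹ with hy
      have hy0 : 0 < y := by positivity
      refine ⟨_, key hy0 ?_⟩
      rw [hc, zero_mul, zero_add]
      rw [hy, ← div_eq_mul_inv, div_le_iff₀ (by positivity)]
      have : |γ 0 1| * (2 * √t / |γ 0 1| + 1) = 2 * √t + |γ 0 1| := by field_simp
      linarith
  · have hc' : 0 < |γ 1 0| := abs_pos.mpr hc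
    set y := (2 * √t + |γ 0 1|) / |γ 1 0| + 1 with hy
    have hy1 : 1 ≤ y := by rw [hy]; have : 0 ≤ (2 * √t + |γ 0 1|) / |γ 1 0| := by positivity
                           linarith
    refine ⟨_, key (by linarith : 0 < y) ?_⟩
    have h1 : |γ 1 0| * y = 2 * √t + |γ 0 1| + |γ 1 0| := by rw [hy]; field_simp
    have h2 : |γ 1 0 * y ^ 2| - |γ 0 1| ≤ |γ 1 0 * y ^ 2 + γ 0 1| := by
      have := abs_sub_abs_le_abs_sub (γ 1 0 * y ^ 2) (-γ 0 1)
      rwa [abs_neg, sub_neg_eq_add] at this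
    rw [abs_mul, abs_of_nonneg (by positivity : 0 ≤ y ^ 2), show |γ 1 0| * y ^ 2 = |γ 1 0| * y * y by ring, h1] at h2
    have h3 := abs_nonneg (γ 0 1)
    nlinarith

lemma exists_disp_eq {γ : SL(2, ℝ)} (hγ : ¬ (γ 1 0 = 0 ∧ γ 1 1 - γ 0 0 = 0 ∧ γ 0 1 = 0))
    {t : ℝ} {z : ℍ} (h : disp γ z ≤ t) : ∃ w : ℍ, disp γ w = t := by
  obtain ⟨w, hw⟩ := exists_disp_ge_of_entries hγ ((disp_nonneg γ z).trans h)
  exact mem_range_of_exists_le_of_exists_ge (continuous_disp γ) ⟨z, h⟩ ⟨w, hw⟩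

lemma dist_le_of_disp_le {γ : SL(2, ℝ)} {z : ℍ} (h : disp γ z ≤ 1) : dist z (γ • z) ≤ 2 := by
  rw [disp_eq_sinh] at h
  have h1 : 0 ≤ dist z (γ • z) / 2 := by positivity
  have h2 := Real.self_le_sinh_iff.mpr h1
  nlinarith

section

variable {Γ : Subgroup SL(2, ℝ)} [DiscreteTopology Γ]

lemma finite_disp_le {K : Set ℍ} (hK : IsCompact K) {c : ℝ} (hc : c ≤ 1) :
    {γ : Γ | ∃ z ∈ K, disp γ z ≤ c}.Finite := by
  refine (finite_smul_inter (Γ := Γ) hK (hK.cthickening (r := 2))).subset ?_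
  rintro γ ⟨z, hz, h⟩
  refine ⟨z, hz, Metric.mem_cthickening_of_dist_le _ z _ _ hz ?_⟩
  rw [dist_comm]
  exact dist_le_of_disp_le (h.trans hc)

/-- A bound of Siegel type: it suffices to control the thin parts that belong to individual
elements of the group. -/
lemma exists_height_bound (htf : ∀ γ : Γ, γ ≠ 1 → ¬ IsOfFinOrder γ)
    {D : Set ℍ} (hD : IsFundamentalDomain Γ D (volume : Measure ℍ))
    (hvol : volume D ≠ ⊤) {H : ℍ → ℝ} (hH : Continuous H) 
    (hinv : ∀ (γ : Γ) (z : ℍ), H ((γ : SL(2, ℝ)) • z) = H z) (M : ℕ)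
    (hthin : ∀ γ : Γ, γ ≠ 1 → ∃ ε : ℝ, 0 < ε ∧ ∃ C : ℝ, ∀ z : ℍ, disp γ z ≤ ε →
      (1 + 1 / disp γ z) ^ M * H z ≤ C) :
    ∃ C : ℝ, ∀ z : ℍ, ∃ η : ℝ, 0 < η ∧ (∀ γ : Γ, γ ≠ 1 → η ≤ disp γ z) ∧
      (1 + 1 / η) ^ M * H z ≤ C := by
  obtain ⟨K, hK, hKc⟩ := exists_compact_thick hD hvol (ε := 1 / 400) (by norm_num)
  choose! ε hε0 C hC using hthin
  have hF := finite_disp_le (Γ := Γ) hK (c := 1 / 400) (by norm_num)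
  set F := hF.toFinset.erase 1 with hFdef
  have hFmem : ∀ γ : Γ, γ ∈ F ↔ γ ≠ 1 ∧ ∃ z ∈ K, disp γ z ≤ 1 / 400 := by
    intro γ; simp [hFdef]
  obtain ⟨ε1, hε1, hε1c, hε1F⟩ : ∃ ε1 : ℝ, 0 < ε1 ∧ ε1 ≤ 1 / 400 ∧ ∀ γ ∈ F, ε1 ≤ ε γ := by
    have hne : (insert (1 / 400) (F.image ε)).Nonempty := Finset.insert_nonempty _ _
    refine ⟨(insert (1 / 400) (F.image ε)).min' hne, ?_, ?_, ?_⟩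
    · rw [Finset.lt_min'_iff]
      intro y hy
      rcases Finset.mem_insert.mp hy with rfl | hy
      · norm_num
      · obtain ⟨γ, hγ, rfl⟩ := Finset.mem_image.mp hy
        exact hε0 γ ((hFmem γ).mp hγ).1
    · exact Finset.min'_le _ _ (Finset.mem_insert_self _ _)
    · intro γ hγ
      exact Finset.min'_le _ _ (Finset.mem_insert_of_mem (Finset.mem_image_of_mem _ hγ))
  obtain ⟨K', hK', hK'c⟩ := exists_compact_thick hD hvol hε1
  obtain ⟨B, hB⟩ := hK'.bddAbove_image hH.continuousOn
  obtain ⟨C1, hC1⟩ := (F.image C).bddAbove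
  refine ⟨max ((1 + 1 / ε1) ^ M * B) C1, fun z => ?_⟩
  by_cases hz : z ∈ thick Γ ε1
  · refine ⟨ε1, hε1, hz, le_max_of_le_left ?_⟩
    obtain ⟨γ, hγ⟩ := hK'c z hz
    have h1 : H z ≤ B := by
      rw [← hinv γ]; exact hB (Set.mem_image_of_mem _ hγ)
    gcongr
  · simp only [thick, Set.mem_ofPred_eq, not_forall, not_le] at hz
    obtain ⟨γ0, hγ0, hlt⟩ := hz
    have hfin : {γ : Γ | γ ≠ 1 ∧ disp γ z ≤ 1 / 400}.Finite :=
      (finite_disp_le (Γ := Γ) (isCompact_singleton (x := z)) (c := 1 / 400) (by norm_num)).subset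
        fun γ hγ => ⟨z, rfl, hγ.2⟩
    -- The element with the least displacement at z serves as witness: its displacement is the η of
    -- the conclusion.
    obtain ⟨γ, ⟨hγ, hγc⟩, hmin⟩ := Set.exists_min_image _ (fun γ : Γ => disp γ z) hfin
      ⟨γ0, hγ0, by linarith⟩
    have hmin' : ∀ δ : Γ, δ ≠ 1 → disp γ z ≤ disp δ z := by
      intro δ hδ
      by_cases h : disp δ z ≤ 1 / 400
      · exact hmin δ ⟨hδ, h⟩
      · linarith
    have hγlt : disp γ z < ε1 := (hmin' γ0 hγ0).trans_lt hlt
    have hpos : 0 < disp γ z := lt_of_le_of_ne (disp_nonneg _ _) fun h =>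
      smul_ne_self htf hγ z ((disp_eq_zero_iff _ _).mp h.symm)
    refine ⟨disp γ z, hpos, hmin', le_max_of_le_right ?_⟩
    -- At a point w where γ has displacement exactly 1/400 nothing nontrivial moves less: such an
    -- element would commute with γ, so its displacement would be that of γ times a constant l²,
    -- with l² < 1 at w and l² ≥ 1 at z by minimality. Hence a translate of w lies in the compact
    -- set K, and a conjugate of γ belongs to the finite set F.
    obtain ⟨w, hw⟩ := exists_disp_eq (entries_ne htf hγ) hγc
    have hwthick : w ∈ thick Γ (1 / 400) := by
      intro δ hδ
      by_contra! hlt'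
      have hcomm := commute_of_disp_le htf hw.le hlt'.le
      obtain ⟨l, hl⟩ := exists_propTo_of_commute (γ' := (δ : SL(2, ℝ))) (entries_ne htf hγ)
        (congrArg Subtype.val hcomm.eq)
      have h1 := hmin' δ hδ
      rw [hl.disp] at h1 hlt'
      rw [hw] at hlt'
      nlinarith
    obtain ⟨δ, hδ⟩ := hKc w hwthick
    have hconj : ∀ x : ℍ, disp (δ * γ * δ⁻¹ : Γ) ((δ : SL(2, ℝ)) • x) = disp γ x := by
      intro x
      have := disp_conj (δ * γ * δ⁻¹ : Γ) (δ : SL(2, ℝ)) x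
      rw [← this]
      push_cast
      congr 1
      group
    have hmemF : δ * γ * δ⁻¹ ∈ F :=
      (hFmem _).mpr ⟨by simpa using hγ, (δ : SL(2, ℝ)) • w, hδ, by rw [hconj, hw]⟩
    have h2 := hC _ ((hFmem _).mp hmemF).1 ((δ : SL(2, ℝ)) • z)
      (by rw [hconj]; exact hγlt.le.trans (hε1F _ hmemF))
    rw [hconj, hinv] at h2
    exact h2.trans (hC1 (Finset.mem_image_of_mem _ hmemF))

end

/-! ### Parabolic elements and cusps -/

lemma conj_apply_10 (σ γ : SL(2, ℝ)) : (σ * γ * σ⁻¹) 1 0 =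
    (σ 1 0 * γ 0 0 + σ 1 1 * γ 1 0) * σ 1 1 - (σ 1 0 * γ 0 1 + σ 1 1 * γ 1 1) * σ 1 0 := by
  simp only [Matrix.SpecialLinearGroup.coe_mul, Matrix.mul_apply, Fin.sum_univ_two, inv_apply_00,
    inv_apply_10]
  ring

lemma exists_conj_upper {γ : SL(2, ℝ)} (h : 4 ≤ γ.1.trace ^ 2) :
    ∃ σ : SL(2, ℝ), (σ * γ * σ⁻¹) 1 0 = 0 := by
  by_cases hc : γ 1 0 = 0
  · exact ⟨1, by simpa using hc⟩
  -- x is a real fixed point of γ, and σ is z ↦ -1/(z - x), which sends it to ∞.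
  · set x := (γ 0 0 - γ 1 1 + √(γ.1.trace ^ 2 - 4)) / (2 * γ 1 0) with hx
    let σ : SL(2, ℝ) := ⟨!![0, -1; 1, -x], by simp [Matrix.det_fin_two]⟩
    refine ⟨σ, ?_⟩
    rw [conj_apply_10]
    have e1 : σ 1 0 = 1 := rfl
    have e2 : σ 1 1 = -x := rfl
    rw [e1, e2]
    have h1 : 2 * γ 1 0 * x = γ 0 0 - γ 1 1 + √(γ.1.trace ^ 2 - 4) := by rw [hx]; field_simp
    have h2 : √(γ.1.trace ^ 2 - 4) ^ 2 = γ.1.trace ^ 2 - 4 := Real.sq_sqrt (by linarith)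
    set q := √(γ.1.trace ^ 2 - 4)
    rw [trace_eq] at h2
    have hd := det_eq γ
    have h3 : 4 * γ 1 0 * ((1 * γ 0 0 + -x * γ 1 0) * -x - (1 * γ 0 1 + -x * γ 1 1) * 1) = 0 := by
      linear_combination (2 * γ 1 0 * x + q - (γ 0 0 - γ 1 1)) * h1 + h2 + 4 * hd
    exact (mul_eq_zero.mp h3).resolve_left (by simpa using hc)

lemma trace_conj' (σ γ : SL(2, ℝ)) : (σ * γ * σ⁻¹).1.trace = γ.1.trace := by
  have := trace_conj γ σ⁻¹
  rwa [inv_inv] at this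

/-- A parabolic element is conjugate to a translation, up to sign. -/
lemma exists_parabolic_normal {γ : SL(2, ℝ)}
    (hγ : ¬ (γ 1 0 = 0 ∧ γ 1 1 - γ 0 0 = 0 ∧ γ 0 1 = 0)) (h : γ.1.trace ^ 2 = 4) :
    ∃ σ : SL(2, ℝ), (σ * γ * σ⁻¹) 1 0 = 0 ∧ (σ * γ * σ⁻¹) 1 1 = (σ * γ * σ⁻¹) 0 0 ∧
      (σ * γ * σ⁻¹) 0 0 ^ 2 = 1 ∧ (σ * γ * σ⁻¹) 0 1 ≠ 0 := by
  obtain ⟨σ, hσ⟩ := exists_conj_upper h.ge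
  have ht := trace_conj' σ γ
  rw [← ht, trace_eq] at h
  have hd := det_eq (σ * γ * σ⁻¹)
  rw [hσ, mul_zero, sub_zero] at hd
  have h1 : (σ * γ * σ⁻¹) 1 1 = (σ * γ * σ⁻¹) 0 0 := by
    nlinarith [sq_nonneg ((σ * γ * σ⁻¹) 1 1 - (σ * γ * σ⁻¹) 0 0)]
  refine ⟨σ, hσ, h1, by rw [pow_two]; rwa [h1] at hd, fun hb => hγ ?_⟩
  set P := σ * γ * σ⁻¹ with hP
  have e : γ = σ⁻¹ * P * σ := by rw [hP]; group
  have hPs : ∀ i j, P.1 i j = (P 0 0 • (1 : Matrix (Fin 2) (Fin 2) ℝ)) i j := by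
    intro i j
    fin_cases i <;> fin_cases j <;> simp [hσ, h1, hb]
  have e2 : γ.1 = P 0 0 • (1 : Matrix (Fin 2) (Fin 2) ℝ) := by
    have hP' : P.1 = P 0 0 • (1 : Matrix (Fin 2) (Fin 2) ℝ) := Matrix.ext hPs
    calc γ.1 = σ⁻¹.1 * P.1 * σ.1 := congrArg Subtype.val e
      _ = P 0 0 • (σ⁻¹ * σ).1 := by
        have e3 : ∀ c : ℝ, σ⁻¹.1 * (c • (1 : Matrix (Fin 2) (Fin 2) ℝ)) * σ.1 =
            c • (σ⁻¹ * σ).1 := fun c => by rw [Matrix.mul_smul, mul_one, Matrix.smul_mul]; rfl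
        exact (congrArg (fun X => σ⁻¹.1 * X * σ.1) hP').trans (e3 _)
      _ = _ := by simp
  refine ⟨?_, ?_, ?_⟩ <;> rw [show ∀ i j, γ i j = γ.1 i j from fun _ _ => rfl] <;> simp [e2]

section

variable {P : SL(2, ℝ)}

lemma jfac_of_upper (h0 : P 1 0 = 0) (z : ℂ) : jfac P z = P 1 1 := by
  rw [jfac, h0]; simp

lemma coe_smul_of_upper (h0 : P 1 0 = 0) (h1 : P 1 1 = P 0 0) (h2 : P 0 0 ^ 2 = 1) (z : ℍ) :
    ((P • z : ℍ) : ℂ) = z + ((P 0 0 * P 0 1 : ℝ) : ℂ) := by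
  rw [coe_smul_eq, jfac_of_upper h0, h1]
  have h3 : (P 0 0 : ℂ) ^ 2 = 1 := by exact_mod_cast h2
  have h4 : (P 0 0 : ℂ) ≠ 0 := fun h => by rw [h] at h3; norm_num at h3
  rw [div_eq_iff h4]
  push_cast
  linear_combination -(P 0 1 : ℂ) * h3

lemma disp_of_upper (h0 : P 1 0 = 0) (h1 : P 1 1 = P 0 0) (z : ℍ) :
    disp P z = P 0 1 ^ 2 / (4 * z.im ^ 2) := by
  rw [disp, quad, h0, h1]
  simp

end

section

variable {Γ : Subgroup SL(2, ℝ)} {k : ℕ}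

lemma isCusp_of_upper {γ : Γ} {σ : SL(2, ℝ)}
    (hγ : ¬ ((γ : SL(2, ℝ)) 1 0 = 0 ∧ (γ : SL(2, ℝ)) 1 1 - (γ : SL(2, ℝ)) 0 0 = 0 ∧
      (γ : SL(2, ℝ)) 0 1 = 0)) (h : (γ : SL(2, ℝ)).1.trace ^ 2 = 4)
    (h0 : (σ * γ * σ⁻¹) 1 0 = 0) :
    IsCusp ((Matrix.SpecialLinearGroup.toGL σ⁻¹) • (OnePoint.infty : OnePoint ℝ))
      (Γ.map Matrix.SpecialLinearGroup.toGL) := by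
  refine ⟨Matrix.SpecialLinearGroup.toGL (γ : SL(2, ℝ)), ⟨γ, γ.2, rfl⟩, ⟨?_, ?_⟩, ?_⟩
  · rintro ⟨x, hx⟩
    have hx' : ∀ i j, (γ : SL(2, ℝ)) i j = (Matrix.scalar (Fin 2) x) i j := fun i j => by
      rw [hx]; rfl
    refine hγ ⟨?_, ?_, ?_⟩ <;> simp [hx']
  · rw [Matrix.discr_fin_two]
    have : (Matrix.SpecialLinearGroup.toGL (γ : SL(2, ℝ))).val = (γ : SL(2, ℝ)).1 := rfl
    rw [this, h, (γ : SL(2, ℝ)).2]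
    norm_num
  · have e : (γ : SL(2, ℝ)) * σ⁻¹ = σ⁻¹ * (σ * γ * σ⁻¹) := by group
    rw [smul_smul, ← map_mul, e, map_mul, mul_smul]
    congr 1
    exact OnePoint.smul_infty_eq_self_iff.mpr h0

lemma isZeroAtImInfty_twist (g : CuspFormsFourK Γ k) {γ : Γ} {σ : SL(2, ℝ)}
    (hγ : ¬ ((γ : SL(2, ℝ)) 1 0 = 0 ∧ (γ : SL(2, ℝ)) 1 1 - (γ : SL(2, ℝ)) 0 0 = 0 ∧
      (γ : SL(2, ℝ)) 0 1 = 0)) (h : (γ : SL(2, ℝ)).1.trace ^ 2 = 4)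
    (h0 : (σ * γ * σ⁻¹) 1 0 = 0) : IsZeroAtImInfty (twist k g σ) := by
  rw [twist_eq_slash]
  exact g.zero_at_cusps' (isCusp_of_upper hγ h h0) _ rfl

lemma twist_vadd (g : CuspFormsFourK Γ k) {γ : Γ} {σ : SL(2, ℝ)}
    (h0 : (σ * γ * σ⁻¹) 1 0 = 0) (h1 : (σ * γ * σ⁻¹) 1 1 = (σ * γ * σ⁻¹) 0 0)
    (h2 : (σ * γ * σ⁻¹) 0 0 ^ 2 = 1) (z : ℍ) :
    twist k g σ ((σ * γ * σ⁻¹) • z) = twist k g σ z := by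
  rw [twist_smul (cuspForm_smul g γ), jfac_of_upper h0, h1]
  have h3 : ((σ * γ * σ⁻¹) 0 0 : ℂ) ^ (4 * k) = 1 := by
    rw [show 4 * k = 2 * (2 * k) by ring, pow_mul]
    have : ((σ * γ * σ⁻¹) 0 0 : ℂ) ^ 2 = 1 := by exact_mod_cast h2
    rw [this, one_pow]
  rw [h3, one_mul]

lemma twist_periodic (g : CuspFormsFourK Γ k) {γ : Γ} {σ : SL(2, ℝ)}
    (h0 : (σ * γ * σ⁻¹) 1 0 = 0) (h1 : (σ * γ * σ⁻¹) 1 1 = (σ * γ * σ⁻¹) 0 0)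
    (h2 : (σ * γ * σ⁻¹) 0 0 ^ 2 = 1) :
    Function.Periodic (twist k g σ ∘ ofComplex)
      ((|(σ * γ * σ⁻¹) 0 0 * (σ * γ * σ⁻¹) 0 1| : ℝ) : ℂ) := by
  set t := (σ * γ * σ⁻¹) 0 0 * (σ * γ * σ⁻¹) 0 1 with ht
  have hper : Function.Periodic (twist k g σ ∘ ofComplex) (t : ℂ) := by
    intro w
    simp only [Function.comp_apply]
    by_cases hw : 0 < w.im
    · have e : ofComplex (w + t) = (σ * γ * σ⁻¹) • ofComplex w := by
        apply UpperHalfPlane.ext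
        rw [coe_smul_of_upper h0 h1 h2, ofComplex_apply_of_im_pos hw,
          ofComplex_apply_of_im_pos (by simpa using hw)]
      rw [e, twist_vadd g h0 h1 h2]
    · have hw' : (w + t).im ≤ 0 := by simpa using not_lt.mp hw
      rw [ofComplex_apply_of_im_nonpos hw', ofComplex_apply_of_im_nonpos (not_lt.mp hw)]
  rcases abs_choice t with h | h
  · rw [h]; exact hper
  · rw [h, Complex.ofReal_neg]; exact hper.neg

lemma pow_mul_exp_neg_le (n : ℕ) {c y : ℝ} (hc : 0 < c) (hy : 0 ≤ y) :
    y ^ n * Real.exp (-(c * y)) ≤ n.factorial / c ^ n := by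
  have h := Real.pow_div_factorial_le_exp (c * y) (by positivity) n
  rw [Real.exp_neg, ← div_eq_mul_inv, div_le_div_iff₀ (Real.exp_pos _) (by positivity)]
  rw [div_le_iff₀ (by positivity), mul_pow] at h
  linarith

variable [DiscreteTopology Γ]

/-- If γ is parabolic then, in coordinates where it is a translation by ±b, its displacement is
b²/(4y²). Hence 1/disp grows only like y², while g decays exponentially in y. -/
lemma exists_thin_bound (htf : ∀ γ : Γ, γ ≠ 1 → ¬ IsOfFinOrder γ) (g : CuspFormsFourK Γ k) (M : ℕ)
    {γ : Γ} (hγ : γ ≠ 1) : ∃ ε : ℝ, 0 < ε ∧ ∃ C : ℝ, ∀ z : ℍ, disp γ z ≤ ε →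
      (1 + 1 / disp γ z) ^ M * height k g z ≤ C := by
  rcases (four_le_trace_sq htf γ).lt_or_eq with h | h
  -- A hyperbolic γ has displacement at least (tr²-4)/4 everywhere, so for this ε the condition is
  -- never met and any bound will do.
  · refine ⟨((γ : SL(2, ℝ)).1.trace ^ 2 - 4) / 8, by linarith, 0, fun z hz => ?_⟩
    have := trace_sq_sub_le_disp γ z
    linarith
  have hne := entries_ne htf hγ
  obtain ⟨σ, h0, h1, h2, h3⟩ := exists_parabolic_normal hne h.symm
  set P := σ * γ * σ⁻¹ with hP
  have hz := isZeroAtImInfty_twist g hne h.symm h0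
  have hper := twist_periodic g h0 h1 h2
  rw [← hP] at hper
  set t := |P 0 0 * P 0 1| with ht
  have ht0 : 0 < t := abs_pos.mpr (mul_ne_zero (fun h => by rw [h] at h2; norm_num at h2) h3)
  have hO := hz.exp_decay_atImInfty ht0 hper (twist_mdiff (cuspForm_mdiff g) σ) hz.isBoundedAtImInfty
  obtain ⟨C, hC⟩ := hO.bound
  obtain ⟨A, hA⟩ := (UpperHalfPlane.atImInfty_mem _).mp hC
  set A' := max A 1 with hA'
  have hA1 : 1 ≤ A' := le_max_right _ _
  set b := P 0 1 with hb
  have hb2 : 0 < b ^ 2 := by positivity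
  set c := 2 * Real.pi / t with hc
  have hc0 : 0 < c := by have := Real.pi_pos; positivity
  -- This ε forces y ≥ A', beyond which the exponential decay holds. Since A' ≥ 1, also 1 + 4y²/b² ≤
  -- (1 + 4/b²) y².
  refine ⟨b ^ 2 / (4 * A' ^ 2), by positivity, (1 + 4 / b ^ 2) ^ M *
    (max C 0 * ((2 * M + 2 * k).factorial / c ^ (2 * M + 2 * k))), fun z hz' => ?_⟩
  have e1 : disp (γ : SL(2, ℝ)) z = b ^ 2 / (4 * (σ • z).im ^ 2) := by
    rw [← disp_of_upper h0 h1, ← disp_conj, hP]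
    congr 1; group
  set y := (σ • z).im with hy
  have hy0 : 0 < y := (σ • z).im_pos
  rw [e1] at hz' ⊢
  have hyA : A' ≤ y := by
    rw [div_le_div_iff₀ (by positivity) (by positivity)] at hz'
    have : A' ^ 2 ≤ y ^ 2 := by nlinarith
    exact (sq_le_sq₀ (by linarith) hy0.le).mp this
  have h5 : ‖twist k g σ (σ • z)‖ ≤ max C 0 * Real.exp (-(c * y)) := by
    have := hA (σ • z) ((le_max_left _ _).trans hyA)
    simp only [Set.mem_ofPred_eq, Real.norm_eq_abs, Real.abs_exp] at this
    refine this.trans ?_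
    have e : -2 * Real.pi * (σ • z).im / t = -(c * y) := by rw [hc]; ring
    rw [e]
    gcongr
    exact le_max_left _ _
  have h6 : height k g z = ‖twist k g σ (σ • z)‖ * y ^ (2 * k) :=
    (norm_twist_mul_im_pow g σ z).symm
  have h7 : (1 + 1 / (b ^ 2 / (4 * y ^ 2))) ≤ (1 + 4 / b ^ 2) * y ^ 2 := by
    have h8 : 1 ≤ y ^ 2 := one_le_pow₀ (hA1.trans hyA)
    have e : 1 / (b ^ 2 / (4 * y ^ 2)) = 4 / b ^ 2 * y ^ 2 := by field_simp
    rw [e]; linarith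
  rw [h6]
  calc _ ≤ ((1 + 4 / b ^ 2) * y ^ 2) ^ M * (max C 0 * Real.exp (-(c * y)) * y ^ (2 * k)) := by
        gcongr
    _ = (1 + 4 / b ^ 2) ^ M * (max C 0 * (y ^ (2 * M + 2 * k) * Real.exp (-(c * y)))) := by
        rw [mul_pow, ← pow_mul, pow_add]; ring
    _ ≤ _ := by
        gcongr
        exact pow_mul_exp_neg_le _ hc0 hy0.le

/-- Since D has finite volume, this single uniform bound justifies the integrability and every
interchange of sum and integral over D. -/
lemma exists_tsum_bound (htf : ∀ γ : Γ, γ ≠ 1 → ¬ IsOfFinOrder γ)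
    {D : Set ℍ} (hD : IsFundamentalDomain Γ D (volume : Measure ℍ)) (hvol : volume D ≠ ⊤)
    (g : CuspFormsFourK Γ k) {s : ℂ} (hs : 1 < s.re) : ∃ C : ℝ, ∀ z : ℍ,
      Summable (fun γ : NT Γ => ‖wterm k s g γ.mat z‖) ∧
        ∑' γ : NT Γ, ‖wterm k s g γ.mat z‖ ≤ C := by
  obtain ⟨C, M, hC, hsum⟩ := exists_tsum_norm_wterm_le k hs
  obtain ⟨B, hB⟩ := exists_height_bound htf hD hvol
    (continuous_height (cuspForm_continuous g)) (fun γ z => height_smul g γ z) M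
    (fun γ hγ => exists_thin_bound htf g M hγ)
  refine ⟨C * B, fun z => ?_⟩
  obtain ⟨η, hη, hd, hle⟩ := hB z
  obtain ⟨h1, h2⟩ := hsum Γ g z η hη hd
  exact ⟨h1, h2.trans (by gcongr; exact hle)⟩

end

open scoped Pointwise

/-! ### Centralizers -/

section

variable {Γ : Subgroup SL(2, ℝ)}

/-- The centralizer of `γ` acts on the level sets of `φ` and on the curve `c` by translations. -/
structure IsFlow (γ : Γ) (φ : ℍ → ℝ) (c : ℝ → ℍ) : Prop where
  cont : Continuous c
  exists_time : ∀ δ : Γ, Commute γ δ →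
    ∃ t : ℝ, (∀ z : ℍ, φ (δ • z) = φ z + t) ∧ δ • c 0 = c t ∧ (t = 0 → δ = 1)

lemma apply_zpow_smul {φ : ℍ → ℝ} {P : Γ} {h : ℝ} (hP : ∀ z, φ (P • z) = φ z + h) (m : ℤ) (z : ℍ) :
    φ (P ^ m • z) = φ z + m • h := by
  have hinv : ∀ z, φ (P⁻¹ • z) = φ z - h := by
    intro z
    have := hP (P⁻¹ • z)
    rw [smul_inv_smul] at this
    linarith
  induction m using Int.induction_on generalizing z with
  | zero => simp
  | succ n ih => rw [zpow_add_one, mul_smul, ih, hP, add_smul, one_smul]; ring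
  | pred n ih => rw [zpow_sub_one, mul_smul, ih, hinv, sub_smul, one_smul]; ring

/-- The translation times of the centralizer form a subgroup of ℝ. It is nonzero because γ itself
has a nonzero time, and a discrete subgroup of ℝ is generated by its least positive element; time 0
occurs only for the identity. -/
lemma IsFlow.exists_generator [DiscreteTopology Γ] {γ : Γ} {φ : ℍ → ℝ} {c : ℝ → ℍ}
    (hf : IsFlow γ φ c) (hγ : γ ≠ 1) : ∃ P : Γ, ∃ h : ℝ, 0 < h ∧
      (∀ δ : Γ, δ ∈ Subgroup.zpowers P ↔ Commute γ δ) ∧ ∀ z, φ (P • z) = φ z + h := by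
  let H : AddSubgroup ℝ :=
    { carrier := {t | ∃ δ : Γ, Commute γ δ ∧ ∀ z : ℍ, φ (δ • z) = φ z + t}
      zero_mem' := ⟨1, Commute.one_right _, fun z => by simp⟩
      add_mem' := by
        rintro a b ⟨δ, h1, h2⟩ ⟨δ', h1', h2'⟩
        exact ⟨δ' * δ, h1'.mul_right h1, fun z => by rw [mul_smul, h2', h2]; ring⟩
      neg_mem' := by
        rintro a ⟨δ, h1, h2⟩
        refine ⟨δ⁻¹, h1.inv_right, fun z => ?_⟩
        have := h2 (δ⁻¹ • z)
        rw [smul_inv_smul] at this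
        linarith }
  have hmem : ∀ t, t ∈ H ↔ ∃ δ : Γ, Commute γ δ ∧ ∀ z : ℍ, φ (δ • z) = φ z + t := fun t => Iff.rfl
  have htime : ∀ δ : Γ, Commute γ δ → ∀ t, (∀ z : ℍ, φ (δ • z) = φ z + t) →
      δ • c 0 = c t ∧ (t = 0 → δ = 1) := by
    intro δ hδ t ht
    obtain ⟨t', h1, h2⟩ := hf.exists_time δ hδ
    have : t = t' := by have a1 := ht (c 0); have a2 := h1 (c 0); linarith
    rwa [this]
  obtain ⟨t0, ht0, -, hne0⟩ := hf.exists_time γ (Commute.refl γ)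
  have ht0H : t0 ∈ H := ⟨γ, Commute.refl γ, ht0⟩
  have ht0ne : t0 ≠ 0 := fun h => hγ (hne0 h)
  have habs : |t0| ∈ H := by
    rcases abs_choice t0 with h | h <;> rw [h]
    · exact ht0H
    · exact H.neg_mem ht0H
  -- An element with time in (0, |t₀|] moves c(0) into a compact arc of the curve, and only finitely
  -- many elements do so.
  have hfin : {t | t ∈ H ∧ 0 < t ∧ t ≤ |t0|}.Finite := by
    have hK : (({c 0} : Set ℍ)).Nonempty := ⟨_, rfl⟩
    have h1 := finite_smul_inter (Γ := Γ) (isCompact_singleton (x := c 0))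
      ((isCompact_Icc (a := (0 : ℝ)) (b := |t0|)).image hf.cont)
    refine (h1.image fun δ : Γ => φ (δ • c 0) - φ (c 0)).subset ?_
    rintro t ⟨⟨δ, hδ, hδt⟩, htpos, htle⟩
    refine ⟨δ, ⟨c 0, rfl, t, ⟨htpos.le, htle⟩, (htime δ hδ t hδt).1.symm⟩, ?_⟩
    simp only [hδt]; ring
  obtain ⟨a, ⟨haH, hapos, hale⟩, hmin⟩ := Set.exists_min_image _ id hfin
    ⟨|t0|, habs, abs_pos.mpr ht0ne, le_rfl⟩
  have hleast : IsLeast {t | t ∈ H ∧ 0 < t} a := by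
    refine ⟨⟨haH, hapos⟩, fun t ht => ?_⟩
    by_cases h : t ≤ |t0|
    · exact hmin t ⟨ht.1, ht.2, h⟩
    · linarith
  have hcl := AddSubgroup.cyclic_of_min hleast
  obtain ⟨P, hP1, hP2⟩ := haH
  refine ⟨P, a, hapos, fun δ => ⟨?_, fun hδ => ?_⟩, hP2⟩
  · rintro ⟨m, rfl⟩
    exact hP1.zpow_right m
  · obtain ⟨t, ht, -⟩ := hf.exists_time δ hδ
    have htH : t ∈ AddSubgroup.closure {a} := by rw [← hcl]; exact ⟨δ, hδ, ht⟩
    obtain ⟨m, hm⟩ := AddSubgroup.mem_closure_singleton.mp htH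
    refine ⟨m, ?_⟩
    have hc : Commute γ (δ⁻¹ * P ^ m) := hδ.inv_right.mul_right (hP1.zpow_right m)
    have h0 := (htime _ hc 0 fun z => by
      rw [mul_smul]
      have h1 := ht (δ⁻¹ • P ^ m • z)
      rw [smul_inv_smul, apply_zpow_smul hP2, hm] at h1
      linarith).2 rfl
    exact (inv_mul_eq_one.mp h0).symm

/-- A fundamental domain for a cyclic group acting by translations on the values of `φ`. -/
lemma isFundamentalDomain_zpowers {φ : ℍ → ℝ} (hφ : Measurable φ) {P : Γ} {h : ℝ} (hh : 0 < h)
    (hP : ∀ z, φ (P • z) = φ z + h) (a : ℝ) :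
    IsFundamentalDomain (Subgroup.zpowers P) {z | φ z ∈ Set.Ico a (a + h)} (volume : Measure ℍ) := by
  refine IsFundamentalDomain.mk' (hφ measurableSet_Ico).nullMeasurableSet fun z => ?_
  obtain ⟨m, hm, huniq⟩ := existsUnique_add_zsmul_mem_Ico hh (φ z) a
  refine ⟨⟨P ^ m, m, rfl⟩, ?_, ?_⟩
  · change φ (P ^ m • z) ∈ Set.Ico a (a + h)
    rwa [apply_zpow_smul hP]
  · rintro ⟨_, n, rfl⟩ hn
    change φ (P ^ n • z) ∈ Set.Ico a (a + h) at hn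
    rw [apply_zpow_smul hP] at hn
    have := huniq n hn
    subst this
    rfl

/-! ### Unfolding -/

variable {D : Set ℍ}

/-- The conjugates of γ correspond to the cosets Zδ of its centralizer through δ ↦ δ⁻¹γδ. The q x
are therefore coset representatives, and their translates of D tile a fundamental domain of Z. -/
lemma isFundamentalDomain_iUnion [Countable Γ] (hD : IsFundamentalDomain Γ D (volume : Measure ℍ))
    {γ : Γ} {Z : Subgroup Γ} (hZ : ∀ δ, δ ∈ Z ↔ Commute γ δ) {S : Set Γ}
    (hS : ∀ δ : Γ, δ⁻¹ * γ * δ ∈ S) {q : S → Γ} (hq : ∀ x, (q x)⁻¹ * γ * q x = x) :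
    IsFundamentalDomain Z (⋃ x, q x • D) (volume : Measure ℍ) where
  nullMeasurableSet := NullMeasurableSet.iUnion fun x => hD.nullMeasurableSet_smul _
  ae_covers := by
    filter_upwards [hD.ae_covers] with z ⟨δ, hδ⟩
    set x : S := ⟨δ * γ * δ⁻¹, by simpa using hS δ⁻¹⟩ with hx
    have h1 : (q x)⁻¹ * γ * q x = δ * γ * δ⁻¹ := hq x
    have hc : q x * δ ∈ Z := by
      rw [hZ]
      change γ * (q x * δ) = q x * δ * γ
      calc γ * (q x * δ) = q x * ((q x)⁻¹ * γ * q x) * δ := by group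
        _ = q x * δ * γ := by rw [h1]; group
    refine ⟨⟨q x * δ, hc⟩, Set.mem_iUnion.mpr ⟨x, ?_⟩⟩
    change (q x * δ) • z ∈ q x • D
    rw [mul_smul]
    exact Set.smul_mem_smul_set hδ
  aedisjoint := by
    intro ζ ζ' hne
    change AEDisjoint volume (ζ • ⋃ x, q x • D) (ζ' • ⋃ x, q x • D)
    rw [Set.smul_set_iUnion, Set.smul_set_iUnion]
    rw [AEDisjoint.iUnion_left_iff]
    intro x
    rw [AEDisjoint.iUnion_right_iff]
    intro y
    have e1 : ζ • q x • D = ((ζ : Γ) * q x) • D := by rw [mul_smul]; rfl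
    have e2 : ζ' • q y • D = ((ζ' : Γ) * q y) • D := by rw [mul_smul]; rfl
    rw [e1, e2]
    refine hD.aedisjoint fun heq => hne ?_
    have hxy : (x : Γ) = y := by
      rw [← hq x, ← hq y]
      have c1 := (hZ _).mp ζ.2
      have c2 := (hZ _).mp ζ'.2
      have a1 : (q x)⁻¹ * γ * q x = ((ζ : Γ) * q x)⁻¹ * γ * ((ζ : Γ) * q x) := by
        have : (ζ : Γ)⁻¹ * γ * ζ = γ := by rw [mul_assoc, c1.eq, inv_mul_cancel_left]
        calc _ = (q x)⁻¹ * ((ζ : Γ)⁻¹ * γ * ζ) * q x := by rw [this]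
          _ = _ := by group
      have a2 : (q y)⁻¹ * γ * q y = ((ζ' : Γ) * q y)⁻¹ * γ * ((ζ' : Γ) * q y) := by
        have : (ζ' : Γ)⁻¹ * γ * ζ' = γ := by rw [mul_assoc, c2.eq, inv_mul_cancel_left]
        calc _ = (q y)⁻¹ * ((ζ' : Γ)⁻¹ * γ * ζ') * q y := by rw [this]
          _ = _ := by group
      rw [a1, a2]
      exact congrArg (fun δ => δ⁻¹ * γ * δ) heq
    obtain rfl : x = y := Subtype.ext hxy
    exact Subtype.ext (mul_right_cancel heq)

end

section

variable {Γ : Subgroup SL(2, ℝ)} {D : Set ℍ} {k : ℕ}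

lemma wterm_smul (g : CuspFormsFourK Γ k) (s : ℂ) (γ δ : Γ) (z : ℍ) :
    wterm k s g γ (δ • z) = wterm k s g (δ⁻¹ * γ * δ : Γ) z :=
  (wterm_conj k s (g := g) (g' := g) (γ : SL(2, ℝ)) (cuspForm_smul g δ z)).symm

lemma lintegral_smul_set (δ : Γ) (f : ℍ → ENNReal) (D : Set ℍ) :
    ∫⁻ z in δ • D, f z = ∫⁻ z in D, f (δ • z) := by
  have hmp : MeasurePreserving (fun z : ℍ => δ • z) volume volume := measurePreserving_smul δ volume
  rw [← Set.image_smul, ← hmp.setLIntegral_comp_emb (measurableEmbedding_const_smul δ)]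

lemma integral_smul_set (δ : Γ) (f : ℍ → ℂ) (D : Set ℍ) :
    ∫ z in δ • D, f z = ∫ z in D, f (δ • z) := by
  have hmp : MeasurePreserving (fun z : ℍ => δ • z) volume volume := measurePreserving_smul δ volume
  rw [← Set.image_smul, hmp.setIntegral_image_emb (measurableEmbedding_const_smul δ)]

variable [DiscreteTopology Γ]

/-- The contributions of the nontrivial elements are absolutely summable. -/
lemma tsum_lintegral_lt_top (htf : ∀ γ : Γ, γ ≠ 1 → ¬ IsOfFinOrder γ)
    (hD : IsFundamentalDomain Γ D (volume : Measure ℍ)) (hvol : volume D ≠ ⊤)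
    (g : CuspFormsFourK Γ k) {s : ℂ} (hs : 1 < s.re) :
    ∑' γ : NT Γ, ∫⁻ z in D, ‖wterm k s g γ.mat z‖ₑ < ⊤ := by
  obtain ⟨C, hC⟩ := exists_tsum_bound htf hD hvol g hs
  rw [← lintegral_tsum fun γ : NT Γ => (continuous_wterm k hs (cuspForm_continuous g)
    (γ := γ.mat) (fun z => smul_ne_self htf γ.ne z)).enorm.measurable.aemeasurable]
  calc _ ≤ ∫⁻ _ in D, ENNReal.ofReal C := by
        refine lintegral_mono fun z => ?_
        obtain ⟨h1, h2⟩ := hC z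
        calc ∑' γ : NT Γ, ‖wterm k s g γ.mat z‖ₑ
            = ∑' γ : NT Γ, ENNReal.ofReal ‖wterm k s g γ.mat z‖ := by
              simp only [ofReal_norm]
          _ = ENNReal.ofReal (∑' γ : NT Γ, ‖wterm k s g γ.mat z‖) :=
              (ENNReal.ofReal_tsum_of_nonneg (fun _ => norm_nonneg _) h1).symm
          _ ≤ _ := ENNReal.ofReal_le_ofReal h2
    _ = ENNReal.ofReal C * volume D := by rw [lintegral_const, Measure.restrict_apply_univ]
    _ < ⊤ := ENNReal.mul_lt_top ENNReal.ofReal_lt_top hvol.lt_top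

/-- The total contribution of a conjugacy class is an integral over a fundamental domain of the
centralizer. -/
lemma integral_conjClass (htf : ∀ γ : Γ, γ ≠ 1 → ¬ IsOfFinOrder γ)
    (hD : IsFundamentalDomain Γ D (volume : Measure ℍ)) (hvol : volume D ≠ ⊤)
    (g : CuspFormsFourK Γ k) {s : ℂ} (hs : 1 < s.re) {γ : Γ} (hγ : γ ≠ 1) {Z : Subgroup Γ}
    (hZ : ∀ δ, δ ∈ Z ↔ Commute γ δ) {E : Set ℍ} (hE : IsFundamentalDomain Z E (volume : Measure ℍ)) :
    IntegrableOn (wterm k s g γ) E ∧ ∫ z in E, wterm k s g γ z =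
      ∑' x : {x : Γ // ConjClasses.mk x = ConjClasses.mk γ}, ∫ z in D, wterm k s g (x : Γ) z := by
  set S : Set Γ := {x : Γ | ConjClasses.mk x = ConjClasses.mk γ} with hSdef
  have hS : ∀ δ : Γ, δ⁻¹ * γ * δ ∈ S := fun δ =>
    ConjClasses.mk_eq_mk_iff_isConj.mpr (isConj_iff.mpr ⟨δ, by group⟩)
  have hex : ∀ x : S, ∃ q : Γ, q⁻¹ * γ * q = x := by
    rintro ⟨x, hx⟩
    obtain ⟨q, hq⟩ := isConj_iff.mp (ConjClasses.mk_eq_mk_iff_isConj.mp hx)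
    exact ⟨q, by rw [← hq]; group⟩
  choose q hq using hex
  have hne : ∀ x : S, (x : Γ) ∈ ({1}ᶜ : Set Γ) := by
    intro x h
    have h1 : (x : Γ) = 1 := h
    rw [← hq x] at h1
    refine hγ ?_
    have : (q x)⁻¹ * γ = (q x)⁻¹ := by
      calc (q x)⁻¹ * γ = ((q x)⁻¹ * γ * q x) * (q x)⁻¹ := by group
        _ = _ := by rw [h1, one_mul]
    simpa using this
  have hE' := isFundamentalDomain_iUnion hD hZ hS hq
  have hcont := continuous_wterm k hs (cuspForm_continuous g) (γ := (γ : SL(2, ℝ)))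
    (fun z => smul_ne_self htf hγ z)
  have hqinj : Function.Injective q := fun x y h => Subtype.ext (by rw [← hq x, ← hq y, h])
  have hdisj : Pairwise (Function.onFun (AEDisjoint volume) fun x : S => q x • D) :=
    fun x y hxy => hD.aedisjoint (hqinj.ne hxy)
  have hmeas : ∀ x : S, NullMeasurableSet (q x • D) volume := fun x => hD.nullMeasurableSet_smul _
  have hterm : ∀ (x : S) (z : ℍ), wterm k s g γ (q x • z) = wterm k s g (x : Γ) z := by
    intro x z; rw [wterm_smul, hq]
  have hint : IntegrableOn (wterm k s g γ) (⋃ x, q x • D) := by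
    refine ⟨hcont.aestronglyMeasurable, ?_⟩
    rw [HasFiniteIntegral, lintegral_iUnion₀ hmeas hdisj]
    refine lt_of_le_of_lt ?_ (tsum_lintegral_lt_top htf hD hvol g hs)
    calc _ = ∑' x : S, ∫⁻ z in D, ‖wterm k s g (x : Γ) z‖ₑ := by
          refine tsum_congr fun x => ?_
          rw [lintegral_smul_set]
          simp only [hterm]
      _ ≤ _ := ENNReal.tsum_comp_le_tsum_of_injective (f := fun x : S => (⟨x, hne x⟩ : NT Γ))
          (fun x y h => Subtype.ext (congrArg (fun a : NT Γ => (a : Γ)) h))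
          (fun γ : NT Γ => ∫⁻ z in D, ‖wterm k s g γ.mat z‖ₑ)
  have hinvar : ∀ (ζ : Z) (z : ℍ), wterm k s g γ (ζ • z) = wterm k s g γ z := by
    intro ζ z
    have h1 := wterm_smul g s γ ζ z
    have c1 := (hZ _).mp ζ.2
    have : (ζ : Γ)⁻¹ * γ * ζ = γ := by rw [mul_assoc, c1.eq, inv_mul_cancel_left]
    rw [this] at h1
    exact h1
  -- The term of γ is invariant under its centralizer, so the tiled domain may be exchanged for the
  -- given E.
  refine ⟨(hE.integrableOn_iff hE' hinvar).mpr hint, ?_⟩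
  rw [hE.setIntegral_eq hE' hinvar, integral_iUnion_ae hmeas hdisj hint]
  refine tsum_congr fun x => ?_
  rw [integral_smul_set]
  simp only [hterm]

end

/-! ### Parabolic classes do not contribute -/

lemma integral_strip_eq_zero {F : ℍ → ℂ} {h : ℝ} (hh : 0 ≤ h)
    (hF : IntegrableOn F {z | z.re ∈ Set.Ico 0 h})
    (hzero : ∀ y : ℝ, 0 < y → ∫ x in (0 : ℝ)..h, F (toH (x, y)) = 0) :
    ∫ z in {z : ℍ | z.re ∈ Set.Ico 0 h}, F z = 0 := by
  have hS : MeasurableSet {z : ℍ | z.re ∈ Set.Ico 0 h} :=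
    UpperHalfPlane.continuous_re.measurable measurableSet_Ico
  rw [← integral_indicator hS]
  rw [← integrable_indicator_iff hS] at hF
  have hae : AEStronglyMeasurable ({z : ℍ | z.re ∈ Set.Ico 0 h}.indicator F)
      (Measure.map toH hypMeas) := by
    rw [measurePreserving_toH.map_eq]; exact hF.1
  rw [← measurePreserving_toH.map_eq, integral_map measurable_toH.aemeasurable hae]
  have hF' : Integrable (fun p => {z : ℍ | z.re ∈ Set.Ico 0 h}.indicator F (toH p)) hypMeas :=
    (measurePreserving_toH.integrable_comp_of_integrable hF)
  unfold hypMeas at hF' ⊢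
  rw [integral_prod_symm _ hF']
  refine integral_eq_zero_of_ae ?_
  have h1 : ∀ᵐ y ∂((volume.restrict (Set.Ioi (0 : ℝ))).withDensity
      fun y => ENNReal.ofReal (1 / y ^ 2)), 0 < y :=
    (withDensity_absolutelyContinuous _ _).ae_le (ae_restrict_mem measurableSet_Ioi)
  filter_upwards [h1] with y hy
  have h2 : (fun x => {z : ℍ | z.re ∈ Set.Ico 0 h}.indicator F (toH (x, y))) =
      (Set.Ico 0 h).indicator fun x => F (toH (x, y)) := by
    ext x
    simp only [Set.indicator, Set.mem_ofPred_eq, toH_re hy]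
  rw [h2, integral_indicator measurableSet_Ico, integral_Ico_eq_integral_Ioc,
    ← intervalIntegral.integral_of_le hh, hzero y hy]
  rfl

/-- The integral over one period at height y is h times the constant Fourier coefficient, which is
the value of f at the cusp. -/
lemma integral_twist_eq_zero {f : ℍ → ℂ} {h : ℝ} (hh : 0 < h)
    (hper : Function.Periodic (f ∘ ofComplex) h) (hol : MDiff f) (hz : IsZeroAtImInfty f)
    {y : ℝ} (hy : 0 < y) : ∫ x in (0 : ℝ)..h, f (toH (x, y)) = 0 := by
  have h1 := qExpansion_coeff_eq_intervalIntegral hh hper hol hz.isBoundedAtImInfty 0 hy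
  rw [qExpansion_coeff, iteratedDeriv_zero, hz.cuspFunction_apply_zero hh, mul_zero] at h1
  simp only [pow_zero, div_one, one_mul, UpperHalfPlane.coe_I] at h1
  have h2 : ∫ x in (0 : ℝ)..h, f (toH (x, y)) =
      ∫ u in (0 : ℝ)..h, f ⟨u + y * Complex.I, by simpa using hy⟩ := by
    refine intervalIntegral.integral_congr fun x _ => ?_
    exact congrArg f (UpperHalfPlane.ext (coe_toH hy))
  rw [h2]
  have h3 : (1 / (h : ℂ)) ≠ 0 := one_div_ne_zero (by exact_mod_cast hh.ne')
  exact (mul_eq_zero.mp h1.symm).resolve_left h3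

section

variable {Γ : Subgroup SL(2, ℝ)} {k : ℕ}

lemma upper_of_commute {γ δ σ : SL(2, ℝ)} (h0 : (σ * γ * σ⁻¹) 1 0 = 0)
    (h1 : (σ * γ * σ⁻¹) 1 1 = (σ * γ * σ⁻¹) 0 0) (h3 : (σ * γ * σ⁻¹) 0 1 ≠ 0)
    (h : Commute γ δ) : (σ * δ * σ⁻¹) 1 0 = 0 ∧ (σ * δ * σ⁻¹) 1 1 = (σ * δ * σ⁻¹) 0 0 ∧
      (σ * δ * σ⁻¹) 0 0 ^ 2 = 1 := by
  have hc : Commute (σ * γ * σ⁻¹) (σ * δ * σ⁻¹) := by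
    change _ * _ = _ * _
    calc σ * γ * σ⁻¹ * (σ * δ * σ⁻¹) = σ * (γ * δ) * σ⁻¹ := by group
      _ = σ * (δ * γ) * σ⁻¹ := by rw [h.eq]
      _ = _ := by group
  obtain ⟨c1, c2, c3⟩ := (commute_iff _ _).mp hc
  have a1 : (σ * δ * σ⁻¹) 1 0 = 0 := by
    rw [h0, mul_zero] at c1
    exact (mul_eq_zero.mp c1).resolve_left h3
  have a2 : (σ * δ * σ⁻¹) 1 1 = (σ * δ * σ⁻¹) 0 0 := by
    rw [h1, sub_self, zero_mul] at c2
    have := (mul_eq_zero.mp c2.symm).resolve_right h3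
    linarith
  refine ⟨a1, a2, ?_⟩
  have hd := det_eq (σ * δ * σ⁻¹)
  rw [a1, a2] at hd
  linarith

lemma isFlow_parabolic (htf : ∀ γ : Γ, γ ≠ 1 → ¬ IsOfFinOrder γ) {γ : Γ} {σ : SL(2, ℝ)}
    (h0 : (σ * γ * σ⁻¹) 1 0 = 0)
    (h1 : (σ * γ * σ⁻¹) 1 1 = (σ * γ * σ⁻¹) 0 0) (h3 : (σ * γ * σ⁻¹) 0 1 ≠ 0) :
    IsFlow γ (fun z => (σ • z).re) (fun t => σ⁻¹ • toH (t, 1)) where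
  cont := by
    refine (continuous_const_smul _).comp ?_
    refine UpperHalfPlane.isEmbedding_coe.continuous_iff.mpr ?_
    have : ((↑) : ℍ → ℂ) ∘ (fun t : ℝ => toH (t, 1)) = fun t : ℝ => (t : ℂ) + (1 : ℝ) * Complex.I :=
      funext fun t => coe_toH one_pos
    rw [this]
    fun_prop
  exists_time := by
    intro δ hδ
    obtain ⟨a1, a2, a3⟩ := upper_of_commute h0 h1 h3 (congrArg Subtype.val hδ.eq :
      Commute (γ : SL(2, ℝ)) (δ : SL(2, ℝ)))
    have hmove : ∀ z : ℍ, σ • (δ : SL(2, ℝ)) • z = (σ * δ * σ⁻¹) • σ • z := by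
      intro z; simp only [smul_smul]; congr 1; group
    refine ⟨(σ * δ * σ⁻¹) 0 0 * (σ * δ * σ⁻¹) 0 1, fun z => ?_, ?_, fun ht => ?_⟩
    · rw [Subgroup.smul_def, hmove, ← coe_re, coe_smul_of_upper a1 a2 a3, Complex.add_re,
        Complex.ofReal_re, coe_re]
    · rw [Subgroup.smul_def, ← smul_left_cancel_iff σ, hmove, smul_inv_smul, smul_inv_smul]
      apply UpperHalfPlane.ext
      rw [coe_smul_of_upper a1 a2 a3, coe_toH one_pos, coe_toH one_pos]
      push_cast; ring
    · have hb : (σ * δ * σ⁻¹) 0 1 = 0 := by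
        refine (mul_eq_zero.mp ht).resolve_left fun h => ?_
        rw [h] at a3; norm_num at a3
      by_contra hne
      have h5 : (σ * δ * σ⁻¹) * (σ * δ * σ⁻¹) = 1 := by
        rcases eq_one_or_neg_one a1 (by linarith) hb with h | h
        · rw [h, one_mul]
        · exact h
      have h6 : (δ : SL(2, ℝ)) * δ = 1 := by
        calc (δ : SL(2, ℝ)) * δ = σ⁻¹ * ((σ * δ * σ⁻¹) * (σ * δ * σ⁻¹)) * σ := by group
          _ = 1 := by rw [h5]; group
      exact htf δ hne (isOfFinOrder_iff_pow_eq_one.mpr ⟨2, two_pos, by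
        rw [pow_two]; exact Subtype.ext h6⟩)

lemma wterm_eq_twist (k : ℕ) (s : ℂ) (g : ℍ → ℂ) (γ σ : SL(2, ℝ)) (z : ℍ) :
    wterm k s g γ z = wterm k s (twist k g σ) (σ * γ * σ⁻¹) (σ • z) := by
  rw [← wterm_conj k s (g := g) (σ * γ * σ⁻¹) (by rw [apply_eq_twist, mul_comm])]
  congr 1; group

lemma integral_twist_coords {f : ℍ → ℂ} (σ : SL(2, ℝ)) (S : Set ℍ) :
    ∫ z in {z | σ • z ∈ S}, f (σ • z) = ∫ z in S, f z := by
  have hmp : MeasurePreserving (fun z : ℍ => σ • z) volume volume := measurePreserving_smul σ volume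
  exact hmp.setIntegral_preimage_emb (measurableEmbedding_const_smul σ) f S

lemma integrableOn_twist_coords {f : ℍ → ℂ} (σ : SL(2, ℝ)) (S : Set ℍ) :
    IntegrableOn (fun z => f (σ • z)) {z | σ • z ∈ S} ↔ IntegrableOn f S := by
  have hmp : MeasurePreserving (fun z : ℍ => σ • z) volume volume := measurePreserving_smul σ volume
  exact hmp.integrableOn_comp_preimage (measurableEmbedding_const_smul σ)

variable [DiscreteTopology Γ]

/-- In coordinates where γ is a translation up to sign, Q_γ is constant and r(z, γz) depends only on
y. The conjugate of g is then the only factor depending on x, and its mean over the strip vanishes.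
-/
lemma tsum_parabolic_eq_zero (htf : ∀ γ : Γ, γ ≠ 1 → ¬ IsOfFinOrder γ) {D : Set ℍ}
    (hD : IsFundamentalDomain Γ D (volume : Measure ℍ)) (hvol : volume D ≠ ⊤)
    (g : CuspFormsFourK Γ k) {s : ℂ} (hs : 1 < s.re) {γ : Γ} (hγ : γ ≠ 1)
    (htr : (γ : SL(2, ℝ)).1.trace ^ 2 = 4) :
    ∑' x : {x : Γ // ConjClasses.mk x = ConjClasses.mk γ}, ∫ z in D, wterm k s g (x : Γ) z = 0 := by
  have hne := entries_ne htf hγ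
  obtain ⟨σ, h0, h1, h2, h3⟩ := exists_parabolic_normal hne htr
  obtain ⟨Q, h, hh, hQ, hQh⟩ := (isFlow_parabolic htf h0 h1 h3).exists_generator hγ
  have hE := isFundamentalDomain_zpowers
    (UpperHalfPlane.continuous_re.measurable.comp (measurable_const_smul σ)) hh hQh 0
  obtain ⟨hint, heq⟩ := integral_conjClass htf hD hvol g hs hγ hQ hE
  rw [← heq]
  simp only [zero_add] at hint ⊢
  set P := σ * γ * σ⁻¹ with hP
  have hw : (fun z => wterm k s g γ z) = fun z => wterm k s (twist k g σ) P (σ • z) :=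
    funext fun z => wterm_eq_twist k s g γ σ z
  have hset : {z : ℍ | ((fun z : ℍ => z.re) ∘ fun z => σ • z) z ∈ Set.Ico 0 h} =
      {z | σ • z ∈ {z : ℍ | z.re ∈ Set.Ico 0 h}} := rfl
  rw [hset, hw, integral_twist_coords]
  change IntegrableOn (fun z => wterm k s g γ z) {z | σ • z ∈ {z : ℍ | z.re ∈ Set.Ico 0 h}} at hint
  rw [hw, integrableOn_twist_coords] at hint
  refine integral_strip_eq_zero hh.le hint fun y hy => ?_
  obtain ⟨a1, a2, a3⟩ := upper_of_commute h0 h1 h3 (congrArg Subtype.val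
    ((hQ Q).mp (Subgroup.mem_zpowers Q)).eq : Commute (γ : SL(2, ℝ)) (Q : SL(2, ℝ)))
  -- The strip has the width of the generator Q of the centralizer, which may be smaller than the
  -- translation by γ; hence periodicity under Q is needed.
  have hper := twist_periodic g a1 a2 a3
  have hper_eq : (σ * Q * σ⁻¹) 0 0 * (σ * Q * σ⁻¹) 0 1 = h := by
    have e1 := hQh (σ⁻¹ • UpperHalfPlane.I)
    have e2 : σ • Q • σ⁻¹ • UpperHalfPlane.I = (σ * Q * σ⁻¹) • UpperHalfPlane.I := by
      rw [Subgroup.smul_def]; simp only [smul_smul]; congr 1; group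
    simp only [e2, smul_inv_smul] at e1
    rw [← coe_re, coe_smul_of_upper a1 a2 a3, Complex.add_re, Complex.ofReal_re, coe_re] at e1
    linarith
  rw [hper_eq, abs_of_pos hh] at hper
  have hzero := integral_twist_eq_zero hh hper (twist_mdiff (cuspForm_mdiff g) σ)
    (isZeroAtImInfty_twist g hne htr h0) hy
  have hform : ∀ x : ℝ, wterm k s (twist k g σ) P (toH (x, y)) =
      (((-(P 0 1 : ℂ)) ^ (2 * k))⁻¹ * radial k s (1 + P 0 1 ^ 2 / (4 * y ^ 2))⁻¹ *
        ((y ^ (4 * k) : ℝ) : ℂ)) * conj (twist k g σ (toH (x, y))) := by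
    intro x
    rw [wterm, hterm, rr_self_smul, disp_of_upper h0 h1, toH_im hy, quad, h0, h1]
    simp only [Complex.ofReal_zero, zero_mul, sub_self, zero_add, zero_sub]
    ring
  simp only [hform]
  rw [intervalIntegral.integral_const_mul]
  have : ∫ x in (0 : ℝ)..h, conj (twist k g σ (toH (x, y))) =
      conj (∫ x in (0 : ℝ)..h, twist k g σ (toH (x, y))) := by
    rw [intervalIntegral.integral_of_le hh.le, intervalIntegral.integral_of_le hh.le, integral_conj]
  rw [this, hzero, map_zero, mul_zero]

end

/-! ### Hyperbolic elements -/

lemma isHyperbolic_iff (γ : SL(2, ℝ)) : γ.1.IsHyperbolic ↔ 4 < γ.1.trace ^ 2 := by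
  rw [Matrix.IsHyperbolic, Matrix.discr_fin_two, γ.2, mul_one, sub_pos]

/-- `γ` is the diagonal matrix with entries `a, a⁻¹`. -/
structure IsDiag (γ : SL(2, ℝ)) (a : ℝ) : Prop where
  e00 : γ 0 0 = a
  e01 : γ 0 1 = 0
  e10 : γ 1 0 = 0
  e11 : γ 1 1 = a⁻¹

lemma IsDiag.of_zero {γ : SL(2, ℝ)} (h1 : γ 0 1 = 0) (h2 : γ 1 0 = 0) : IsDiag γ (γ 0 0) where
  e00 := rfl
  e01 := h1
  e10 := h2
  e11 := by
    have := det_eq γ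
    rw [h1, zero_mul, sub_zero] at this
    exact eq_inv_of_mul_eq_one_right this

section

variable {γ : SL(2, ℝ)} {a : ℝ}

lemma IsDiag.ne_zero (h : IsDiag γ a) : a ≠ 0 := by
  have := det_eq γ
  rw [h.e00, h.e01, zero_mul, sub_zero] at this
  exact left_ne_zero_of_mul_eq_one this

lemma IsDiag.sq_pos (h : IsDiag γ a) : 0 < a ^ 2 := by
  have := h.ne_zero; positivity

lemma IsDiag.coe_smul (h : IsDiag γ a) (z : ℍ) : ((γ • z : ℍ) : ℂ) = ((a ^ 2 : ℝ) : ℂ) * z := by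
  have h0 : (a : ℂ) ≠ 0 := by exact_mod_cast h.ne_zero
  rw [coe_smul_eq, jfac, h.e00, h.e01, h.e10, h.e11]
  push_cast
  field_simp
  ring

lemma IsDiag.quad (h : IsDiag γ a) (z : ℂ) : quad γ z = ((a⁻¹ - a : ℝ) : ℂ) * z := by
  rw [HypPeriod.quad, h.e00, h.e01, h.e10, h.e11]; push_cast; ring

lemma IsDiag.mul {γ' : SL(2, ℝ)} {b : ℝ} (h : IsDiag γ a) (h' : IsDiag γ' b) :
    IsDiag (γ * γ') (a * b) := by
  constructor <;>
  simp only [Matrix.SpecialLinearGroup.coe_mul, Matrix.mul_apply, Fin.sum_univ_two, h.e00, h.e01,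
    h.e10, h.e11, h'.e00, h'.e01, h'.e10, h'.e11, mul_inv] <;> ring

lemma IsDiag.pow (h : IsDiag γ a) (n : ℕ) : IsDiag (γ ^ n) (a ^ n) := by
  induction n with
  | zero => constructor <;> simp
  | succ n ih => rw [pow_succ, pow_succ]; exact ih.mul h

lemma IsDiag.trace (h : IsDiag γ a) : γ.1.trace = a + a⁻¹ := by
  rw [trace_eq, h.e00, h.e11]

lemma IsDiag.trace_sq_sub (h : IsDiag γ a) : γ.1.trace ^ 2 - 4 = (a - a⁻¹) ^ 2 := by
  have := h.ne_zero
  rw [h.trace]; field_simp; ring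

lemma IsDiag.four_lt (h : IsDiag γ a) (ha : 1 < a ^ 2) : 4 < γ.1.trace ^ 2 := by
  have h1 := h.trace_sq_sub
  have h2 : 0 < (a - a⁻¹) ^ 2 := by
    have h3 : a - a⁻¹ ≠ 0 := fun h4 => by
      have h5 : a ^ 2 = 1 := by
        have := h.ne_zero
        have h6 : a = a⁻¹ := by linarith
        rw [pow_two]; nth_rw 2 [h6]; exact mul_inv_cancel₀ this
      linarith
    positivity
  linarith

lemma sign_add_inv {a : ℝ} : Real.sign (a + a⁻¹) = Real.sign a := by
  rcases lt_trichotomy a 0 with h | h | h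
  · rw [Real.sign_of_neg h, Real.sign_of_neg (by have := inv_lt_zero.mpr h; linarith)]
  · simp [h]
  · rw [Real.sign_of_pos h, Real.sign_of_pos (by have := inv_pos.mpr h; linarith)]

lemma sqrt_nrm_of_isDiag (h : IsDiag γ a) (ha : 1 < a ^ 2) : nrm γ = a ^ 2 := by
  have h1 : 1 < |a| := by
    rw [← sq_abs] at ha
    nlinarith [abs_nonneg a]
  have h2 : |a + a⁻¹| = |a| + |a|⁻¹ := by
    rcases lt_trichotomy a 0 with h | h | h
    · rw [abs_of_neg h, abs_of_neg (by have := inv_lt_zero.mpr h; linarith), inv_neg]; ring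
    · simp [h]
    · rw [abs_of_pos h, abs_of_pos (by have := inv_pos.mpr h; linarith)]
  have h3 : √((a - a⁻¹) ^ 2) = |a| - |a|⁻¹ := by
    have e : (a - a⁻¹) ^ 2 = (|a| - |a|⁻¹) ^ 2 := by
      have := h.ne_zero
      have h4 : |a| ≠ 0 := by simpa using this
      have h5 : |a| ^ 2 = a ^ 2 := sq_abs a
      have e1 : (a - a⁻¹) ^ 2 = a ^ 2 - 2 + (a ^ 2)⁻¹ := by field_simp; ring
      have e2 : (|a| - |a|⁻¹) ^ 2 = |a| ^ 2 - 2 + (|a| ^ 2)⁻¹ := by field_simp; ring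
      rw [e1, e2, h5]
    rw [e, Real.sqrt_sq (by have := inv_lt_one_of_one_lt₀ h1; linarith)]
  rw [nrm, h.trace_sq_sub, h3, h.trace, h2, ← sq_abs a]
  ring

end

lemma nrm_conj (τ γ : SL(2, ℝ)) : nrm (τ * γ * τ⁻¹) = nrm γ := by
  rw [nrm, nrm, trace_conj']

/-- A hyperbolic element is conjugate to a diagonal matrix. -/
lemma exists_isDiag {γ : SL(2, ℝ)} (h : 4 < γ.1.trace ^ 2) :
    ∃ τ : SL(2, ℝ), ∃ a : ℝ, IsDiag (τ * γ * τ⁻¹) a ∧ 1 < a ^ 2 := by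
  have hdiag : ∃ τ : SL(2, ℝ), ∃ a : ℝ, IsDiag (τ * γ * τ⁻¹) a := by
    obtain ⟨σ, hσ⟩ := exists_conj_upper h.le
    have ht := trace_conj' σ γ
    set P := σ * γ * σ⁻¹ with hP
    have hd := det_eq P
    rw [hσ, mul_zero, sub_zero] at hd
    rw [← ht, trace_eq] at h
    have hne : P 0 0 - P 1 1 ≠ 0 := fun h0 => by nlinarith
    -- The eigenvalues are distinct, so a unipotent conjugation removes the upper right entry.
    let n : SL(2, ℝ) := ⟨!![1, P 0 1 / (P 0 0 - P 1 1); 0, 1], by simp [Matrix.det_fin_two]⟩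
    have n00 : n 0 0 = 1 := rfl
    have n01 : n 0 1 = P 0 1 / (P 0 0 - P 1 1) := rfl
    have n10 : n 1 0 = 0 := rfl
    have n11 : n 1 1 = 1 := rfl
    refine ⟨n * σ, (n * P * n⁻¹) 0 0, ?_⟩
    have e : n * σ * γ * (n * σ)⁻¹ = n * P * n⁻¹ := by rw [hP]; group
    rw [e]
    refine IsDiag.of_zero ?_ ?_
    · simp only [Matrix.SpecialLinearGroup.coe_mul, Matrix.mul_apply, Fin.sum_univ_two, inv_apply_01,
        inv_apply_11, n00, n01, hσ]
      field_simp
      ring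
    · rw [conj_apply_10, n10, n11, hσ]; ring
  obtain ⟨τ, a, ha⟩ := hdiag
  have h1 : a ^ 2 ≠ 1 := by
    intro h1
    have h2 := ha.trace_sq_sub
    rw [trace_conj'] at h2
    have h3 : a⁻¹ = a := by
      have := ha.ne_zero
      field_simp
      exact h1.symm
    rw [h3, sub_self] at h2
    norm_num at h2
    linarith
  -- If a² < 1, conjugation by the Weyl element exchanges the eigenvalues and makes the larger one
  -- come first.
  rcases lt_or_gt_of_ne h1 with h2 | h2
  · let w : SL(2, ℝ) := ⟨!![0, -1; 1, 0], by simp [Matrix.det_fin_two]⟩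
    have w00 : w 0 0 = 0 := rfl
    have w01 : w 0 1 = -1 := rfl
    have w10 : w 1 0 = 1 := rfl
    have w11 : w 1 1 = 0 := rfl
    refine ⟨w * τ, a⁻¹, ?_, ?_⟩
    · have e : w * τ * γ * (w * τ)⁻¹ = w * (τ * γ * τ⁻¹) * w⁻¹ := by group
      rw [e]
      constructor <;>
      simp only [Matrix.SpecialLinearGroup.coe_mul (A := w * (τ * γ * τ⁻¹)),
        Matrix.SpecialLinearGroup.coe_mul (A := w), Matrix.mul_apply, Fin.sum_univ_two, inv_apply_01,
        inv_apply_11, inv_apply_00, inv_apply_10, w00, w01, w10, w11, ha.e00, ha.e01, ha.e10,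
        ha.e11, inv_inv] <;> ring
    · rw [inv_pow]
      exact (one_lt_inv₀ ha.sq_pos).mpr h2
  · exact ⟨τ, a, ha, h2⟩

/-! ### Centralizers of hyperbolic elements and primitive roots -/

section

variable {Γ : Subgroup SL(2, ℝ)}

lemma isDiag_of_commute {γ δ τ : SL(2, ℝ)} {a : ℝ} (hd : IsDiag (τ * γ * τ⁻¹) a) (ha : 1 < a ^ 2)
    (h : Commute γ δ) : ∃ b, IsDiag (τ * δ * τ⁻¹) b := by
  have hc : Commute (τ * γ * τ⁻¹) (τ * δ * τ⁻¹) := by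
    change _ * _ = _ * _
    calc τ * γ * τ⁻¹ * (τ * δ * τ⁻¹) = τ * (γ * δ) * τ⁻¹ := by group
      _ = τ * (δ * γ) * τ⁻¹ := by rw [h.eq]
      _ = _ := by group
  obtain ⟨-, c2, c3⟩ := (commute_iff _ _).mp hc
  have hne : a⁻¹ - a ≠ 0 := fun h0 => by
    have h3 : a = a⁻¹ := by linarith
    have h5 : a ^ 2 = 1 := by
      rw [pow_two]; nth_rw 2 [h3]; exact mul_inv_cancel₀ hd.ne_zero
    linarith
  rw [hd.e11, hd.e00, hd.e01, mul_zero] at c2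
  rw [hd.e11, hd.e00, hd.e10, mul_zero] at c3
  exact ⟨_, IsDiag.of_zero ((mul_eq_zero.mp c2).resolve_left hne)
    ((mul_eq_zero.mp c3).resolve_left hne)⟩

/-- The logarithmic radius in the coordinate `τ z`. -/
def logRad (τ : SL(2, ℝ)) (z : ℍ) : ℝ := Real.log ‖((τ • z : ℍ) : ℂ)‖

lemma norm_coe_pos (z : ℍ) : 0 < ‖(z : ℂ)‖ := norm_pos_iff.mpr z.ne_zero

lemma continuous_logRad (τ : SL(2, ℝ)) : Continuous (logRad τ) := by
  unfold logRad
  exact Continuous.log (UpperHalfPlane.continuous_coe.comp (continuous_const_smul τ)).norm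
    fun z => (norm_coe_pos _).ne'

lemma conj_smul_smul (τ δ : SL(2, ℝ)) (z : ℍ) : τ • δ • z = (τ * δ * τ⁻¹) • τ • z := by
  simp only [smul_smul]; congr 1; group

lemma logRad_smul {τ δ : SL(2, ℝ)} {b : ℝ} (h : IsDiag (τ * δ * τ⁻¹) b) (z : ℍ) :
    logRad τ (δ • z) = logRad τ z + Real.log (b ^ 2) := by
  rw [logRad, logRad, conj_smul_smul, h.coe_smul, norm_mul, Complex.norm_real,
    Real.norm_of_nonneg (sq_nonneg b), Real.log_mul h.sq_pos.ne' (norm_coe_pos _).ne', add_comm]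

lemma isFlow_hyperbolic (htf : ∀ γ : Γ, γ ≠ 1 → ¬ IsOfFinOrder γ) {γ : Γ} {τ : SL(2, ℝ)} {a : ℝ}
    (hd : IsDiag (τ * γ * τ⁻¹) a) (ha : 1 < a ^ 2) :
    IsFlow γ (logRad τ) (fun t => τ⁻¹ • toH (0, Real.exp t)) where
  cont := by
    refine (continuous_const_smul _).comp ?_
    refine UpperHalfPlane.isEmbedding_coe.continuous_iff.mpr ?_
    have : ((↑) : ℍ → ℂ) ∘ (fun t : ℝ => toH (0, Real.exp t)) =
        fun t : ℝ => ((0 : ℝ) : ℂ) + (Real.exp t : ℝ) * Complex.I :=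
      funext fun t => coe_toH (Real.exp_pos t)
    rw [this]
    fun_prop
  exists_time := by
    intro δ hδ
    obtain ⟨b, hb⟩ := isDiag_of_commute hd ha (congrArg Subtype.val hδ.eq :
      Commute (γ : SL(2, ℝ)) (δ : SL(2, ℝ)))
    refine ⟨Real.log (b ^ 2), fun z => logRad_smul hb z, ?_, fun ht => ?_⟩
    · rw [Subgroup.smul_def, ← smul_left_cancel_iff τ, conj_smul_smul, smul_inv_smul, smul_inv_smul]
      apply UpperHalfPlane.ext
      rw [hb.coe_smul, coe_toH (Real.exp_pos _), coe_toH (Real.exp_pos _), Real.exp_log hb.sq_pos]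
      simp
    · have hb1 : b ^ 2 = 1 := Real.eq_one_of_pos_of_log_eq_zero hb.sq_pos ht
      have hbinv : b⁻¹ = b := by
        have := hb.ne_zero
        field_simp
        exact hb1.symm
      by_contra hne
      have h5 : (τ * δ * τ⁻¹) * (τ * δ * τ⁻¹) = 1 := by
        rcases eq_one_or_neg_one hb.e10 (by rw [hb.e11, hb.e00, hbinv, sub_self]) hb.e01 with h | h
        · rw [h, one_mul]
        · exact h
      have h6 : (δ : SL(2, ℝ)) * δ = 1 := by
        calc (δ : SL(2, ℝ)) * δ = τ⁻¹ * ((τ * δ * τ⁻¹) * (τ * δ * τ⁻¹)) * τ := by group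
          _ = 1 := by rw [h5]; group
      exact htf δ hne (isOfFinOrder_iff_pow_eq_one.mpr ⟨2, two_pos, by
        rw [pow_two]; exact Subtype.ext h6⟩)

lemma isDiag_of_diag {τ P₀ : SL(2, ℝ)} (h : (τ * P₀ * τ⁻¹).1 =
    Real.sign P₀.1.trace • Matrix.diagonal ![√(nrm P₀), (√(nrm P₀))⁻¹]) :
    IsDiag (τ * P₀ * τ⁻¹) (Real.sign P₀.1.trace * √(nrm P₀)) := by
  have e : ∀ i j, (τ * P₀ * τ⁻¹) i j = (Real.sign P₀.1.trace •
    Matrix.diagonal ![√(nrm P₀), (√(nrm P₀))⁻¹]) i j := fun i j => by rw [← h]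
  have h0 := IsDiag.of_zero (γ := τ * P₀ * τ⁻¹) (by simp [e]) (by simp [e])
  rw [e] at h0
  simpa using h0

lemma diag_of_isDiag {τ P₀ : SL(2, ℝ)} {a : ℝ} (h : IsDiag (τ * P₀ * τ⁻¹) a) (ha : 1 < a ^ 2) :
    (τ * P₀ * τ⁻¹).1 = Real.sign P₀.1.trace • Matrix.diagonal ![√(nrm P₀), (√(nrm P₀))⁻¹] := by
  have h1 : nrm P₀ = a ^ 2 := by rw [← nrm_conj τ, sqrt_nrm_of_isDiag h ha]
  have h2 : Real.sign P₀.1.trace = Real.sign a := by rw [← trace_conj' τ, h.trace, sign_add_inv]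
  have h3 : Real.sign a * |a| = a := by
    rcases lt_trichotomy a 0 with h | h | h
    · rw [Real.sign_of_neg h, abs_of_neg h]; ring
    · simp [h]
    · rw [Real.sign_of_pos h, abs_of_pos h]; ring
  have h4 : Real.sign a * |a|⁻¹ = a⁻¹ := by
    nth_rw 3 [← h3]
    rw [mul_inv, Real.inv_sign]
  rw [h1, h2, Real.sqrt_sq_eq_abs]
  ext i j
  fin_cases i <;> fin_cases j
  · simpa [h3] using h.e00
  · simpa using h.e01
  · simpa using h.e10
  · simpa [h4] using h.e11

/-- The generator Q of the centralizer of P with positive translation length is the primitive root.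
If δⁿ = Q, then δ commutes with P, so δ = Q^j with jn = 1. A matrix that diagonalizes P diagonalizes
Q as well. -/
lemma exists_isLocalDatum [DiscreteTopology Γ] (htf : ∀ γ : Γ, γ ≠ 1 → ¬ IsOfFinOrder γ) {P : Γ}
    (hP : (P : SL(2, ℝ)).1.IsHyperbolic) : ∃ P₀ τ, IsLocalDatum Γ P P₀ τ := by
  obtain ⟨τ, a, hd, ha⟩ := exists_isDiag ((isHyperbolic_iff _).mp hP)
  have hne : P ≠ 1 := fun h => by
    rw [h, isHyperbolic_iff] at hP
    simp at hP
    norm_num at hP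
  obtain ⟨Q, h, hh, hQ, hQh⟩ := (isFlow_hyperbolic htf hd ha).exists_generator hne
  have hQc := (hQ Q).mp (Subgroup.mem_zpowers Q)
  obtain ⟨q, hq⟩ := isDiag_of_commute hd ha (congrArg Subtype.val hQc.eq :
      Commute (P : SL(2, ℝ)) (Q : SL(2, ℝ)))
  have hqh : Real.log (q ^ 2) = h := by
    have h1 := logRad_smul hq UpperHalfPlane.I
    have h2 := hQh UpperHalfPlane.I
    rw [Subgroup.smul_def] at h2
    linarith
  have hq1 : 1 < q ^ 2 := by
    rw [← hqh] at hh
    exact (Real.log_pos_iff (sq_nonneg q)).mp hh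
  obtain ⟨m, hm⟩ := (hQ P).mpr (Commute.refl P)
  simp only at hm
  have hmh : m • h = Real.log (a ^ 2) := by
    have h1 := logRad_smul hd UpperHalfPlane.I
    have h2 := apply_zpow_smul hQh m UpperHalfPlane.I
    rw [hm, Subgroup.smul_def] at h2
    linarith
  have hmpos : 0 < m := by
    have : 0 < m • h := by rw [hmh]; exact Real.log_pos ha
    rw [zsmul_eq_mul] at this
    exact_mod_cast (pos_iff_pos_of_mul_pos this).mpr hh
  refine ⟨Q, τ, hP, ⟨(isHyperbolic_iff _).mpr ?_, ?_⟩, ⟨m.toNat, by omega, ?_⟩,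
    diag_of_isDiag hq hq1⟩
  · rw [← trace_conj' τ]; exact hq.four_lt hq1
  · intro δ n hδ
    have hcomm : Commute P δ := by
      rw [← hm, ← hδ]
      exact ((Commute.refl δ).pow_left n).zpow_left m
    obtain ⟨j, hj⟩ := (hQ δ).mpr hcomm
    simp only at hj
    have h1 : Q ^ (j * n) = Q ^ (1 : ℤ) := by rw [zpow_mul, hj, zpow_natCast, hδ, zpow_one]
    have h2 := apply_zpow_smul hQh (j * n) UpperHalfPlane.I
    rw [h1, apply_zpow_smul hQh] at h2
    have h3 : (1 : ℤ) • h = (j * n : ℤ) • h := by linarith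
    have h4 : (1 : ℤ) = j * n := (zsmul_left_strictMono hh).injective h3
    have h5 := Int.eq_one_or_neg_one_of_mul_eq_one' h4.symm
    omega
  · rw [← zpow_natCast, Int.toNat_of_nonneg hmpos.le, hm]

/-! ### The contribution of a hyperbolic conjugacy class -/

section datum

variable {P P₀ : Γ} {τ : SL(2, ℝ)}

lemma one_lt_nrm {γ : SL(2, ℝ)} (h : γ.1.IsHyperbolic) : 1 < nrm γ := by
  rw [isHyperbolic_iff] at h
  have h1 : 2 < |γ.1.trace| := by
    rw [← sq_abs] at h; nlinarith [abs_nonneg γ.1.trace]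
  have h2 := Real.sqrt_nonneg (γ.1.trace ^ 2 - 4)
  rw [nrm]
  nlinarith

lemma IsLocalDatum.isDiag (h : IsLocalDatum Γ P P₀ τ) : ∃ a : ℝ,
    IsDiag (τ * P₀ * τ⁻¹) a ∧ nrm (P₀ : SL(2, ℝ)) = a ^ 2 ∧ 1 < a ^ 2 ∧
      a = Real.sign (P₀ : SL(2, ℝ)).1.trace * √(nrm (P₀ : SL(2, ℝ))) := by
  have h1 := one_lt_nrm h.prim.1
  have ht : (P₀ : SL(2, ℝ)).1.trace ≠ 0 := fun h0 => by
    have := (isHyperbolic_iff _).mp h.prim.1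
    rw [h0] at this; norm_num at this
  have h2 : nrm (P₀ : SL(2, ℝ)) =
      (Real.sign (P₀ : SL(2, ℝ)).1.trace * √(nrm (P₀ : SL(2, ℝ)))) ^ 2 := by
    rw [mul_pow, Real.sq_sqrt (by linarith)]
    rcases Real.sign_apply_eq_of_ne_zero _ ht with h | h <;> rw [h] <;> norm_num
  exact ⟨_, isDiag_of_diag h.diag, h2, by rwa [← h2], rfl⟩

lemma IsLocalDatum.isDiag_pow (h : IsLocalDatum Γ P P₀ τ) {a : ℝ}
    (ha : IsDiag (τ * P₀ * τ⁻¹) a) (ha1 : 1 < a ^ 2) : ∃ n : ℕ, 1 ≤ n ∧ P₀ ^ n = P ∧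
    IsDiag (τ * P * τ⁻¹) (a ^ n) ∧ nrm (P : SL(2, ℝ)) = (a ^ n) ^ 2 ∧ 1 < (a ^ n) ^ 2 := by
  obtain ⟨n, hn, hP⟩ := h.pow
  have h1 : IsDiag (τ * P * τ⁻¹) (a ^ n) := by
    have := ha.pow n
    rw [conj_pow] at this
    rw [← hP]
    exact this
  have h2 : 1 < (a ^ n) ^ 2 := by
    rw [← pow_mul, mul_comm, pow_mul]
    exact one_lt_pow₀ ha1 (by omega)
  exact ⟨n, hn, hP, h1, by rw [← nrm_conj τ, sqrt_nrm_of_isDiag h1 h2], h2⟩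

/-- P₀ lies in the cyclic centralizer of P, say P₀ = Q^m, and primitivity forces m = ±1. As
primitivity speaks only of powers with natural exponents, m ≤ 0 is treated with Q⁻¹. -/
lemma IsLocalDatum.mem_zpowers_iff [DiscreteTopology Γ] (htf : ∀ γ : Γ, γ ≠ 1 → ¬ IsOfFinOrder γ)
    (h : IsLocalDatum Γ P P₀ τ) (δ : Γ) : δ ∈ Subgroup.zpowers P₀ ↔ Commute P δ := by
  obtain ⟨a, ha, -, ha1, -⟩ := h.isDiag
  obtain ⟨n, hn, hP, hd, -, hd1⟩ := h.isDiag_pow ha ha1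
  have hne : P ≠ 1 := fun h1 => by
    have hP := h.hyp
    rw [h1, isHyperbolic_iff] at hP
    simp at hP
    norm_num at hP
  obtain ⟨Q, t, ht, hQ, -⟩ := (isFlow_hyperbolic htf hd hd1).exists_generator hne
  have hc : Commute P P₀ := by rw [← hP]; exact (Commute.refl P₀).pow_left n
  obtain ⟨m, hm⟩ := (hQ P₀).mpr hc
  simp only at hm
  have hz : Subgroup.zpowers P₀ = Subgroup.zpowers Q := by
    rcases le_total 0 m with h0 | h0
    · have h1 := h.prim.2 Q m.toNat (by rw [← zpow_natCast, Int.toNat_of_nonneg h0, hm])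
      have h2 : m = 1 := by omega
      rw [h2, zpow_one] at hm
      rw [hm]
    · have h1 := h.prim.2 Q⁻¹ (-m).toNat (by
        rw [← zpow_natCast, Int.toNat_of_nonneg (by omega), inv_zpow, zpow_neg, inv_inv, hm])
      have h2 : m = -1 := by omega
      rw [h2, zpow_neg_one] at hm
      rw [← hm, Subgroup.zpowers_inv]
  rw [hz, hQ]

lemma IsLocalDatum.isFundamentalDomain (h : IsLocalDatum Γ P P₀ τ) :
    IsFundamentalDomain (Subgroup.zpowers P₀) {z : ℍ | τ • z ∈ halfAnnulus P₀}
      (volume : Measure ℍ) := by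
  obtain ⟨a, ha, hN, ha1, -⟩ := h.isDiag
  have h1 := isFundamentalDomain_zpowers (P := P₀) (continuous_logRad τ).measurable
    (Real.log_pos ha1) (fun z => logRad_smul ha z) 0
  convert h1 using 1
  ext z
  have hp := norm_coe_pos (τ • z)
  simp only [Set.mem_ofPred_eq, halfAnnulus, Set.mem_Ico, logRad, zero_add, hN]
  rw [Real.log_lt_log_iff hp ha.sq_pos, Real.log_nonneg_iff hp]

lemma rr_eq_rrScale {R : SL(2, ℝ)} {a : ℝ} (h : IsDiag R a) (z : ℍ) :
    rr z (R • z) = rrScale (a ^ 2) z := by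
  rw [rr, rrScale, h.coe_smul]

lemma wterm_diag {R : SL(2, ℝ)} {a : ℝ} (h : IsDiag R a) (k : ℕ) (s : ℂ) (f : ℍ → ℂ) (z : ℍ) :
    wterm k s f R z = ((((a ^ 2) ^ k / (a ^ 2 - 1) ^ (2 * k) : ℝ)) : ℂ) *
      (((z : ℂ) ^ (2 * k))⁻¹ * radial k s (rrScale (a ^ 2) z) * conj (f z) *
        ((z.im ^ (4 * k) : ℝ) : ℂ)) := by
  have e : (((a⁻¹ - a : ℝ) : ℂ) ^ (2 * k))⁻¹ = (((a ^ 2) ^ k / (a ^ 2 - 1) ^ (2 * k) : ℝ) : ℂ) := by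
    rw [← Complex.ofReal_pow, ← Complex.ofReal_inv]
    congr 1
    have h0 := h.ne_zero
    have e1 : a⁻¹ - a = -((a ^ 2 - 1) / a) := by field_simp; ring
    rw [e1, (even_two_mul k).neg_pow, div_pow, inv_div, pow_mul a]
  rw [wterm, hterm, rr_eq_rrScale h, h.quad, mul_pow, mul_inv, e]
  ring

/-- The local term is the total contribution of a hyperbolic conjugacy class. -/
lemma IsLocalDatum.localTerm_eq [DiscreteTopology Γ] (htf : ∀ γ : Γ, γ ≠ 1 → ¬ IsOfFinOrder γ)
    (h : IsLocalDatum Γ P P₀ τ) {D : Set ℍ} (hD : IsFundamentalDomain Γ D (volume : Measure ℍ))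
    (hvol : volume D ≠ ⊤) {k : ℕ} (g : CuspFormsFourK Γ k) {s : ℂ} (hs : 1 < s.re) :
    IntegrableOn (localIntegrand k s g P τ) (halfAnnulus P₀) ∧
      localTerm k s g P P₀ τ =
        ∑' x : {x : Γ // ConjClasses.mk x = ConjClasses.mk P},
          ∫ z in D, wterm k s g (x : Γ) z := by
  obtain ⟨a, ha, hN0, ha1, -⟩ := h.isDiag
  obtain ⟨n, hn, hP, hd, hN, hd1⟩ := h.isDiag_pow ha ha1
  have hne : P ≠ 1 := fun h1 => by
    have hP := h.hyp
    rw [h1, isHyperbolic_iff] at hP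
    simp at hP
    norm_num at hP
  obtain ⟨hint, heq⟩ := integral_conjClass htf hD hvol g hs hne (h.mem_zpowers_iff htf)
    h.isFundamentalDomain
  set N := nrm (P : SL(2, ℝ)) with hNdef
  set c : ℂ := ((N ^ k / (N - 1) ^ (2 * k) : ℝ) : ℂ) with hc
  have hN1 : 1 < N := by rw [hN]; exact hd1
  have hc0 : c ≠ 0 := by
    have : 0 < N - 1 := by linarith
    have : 0 < N := by linarith
    rw [hc]; exact_mod_cast (by positivity : (0:ℝ) < N ^ k / (N - 1) ^ (2 * k)).ne'
  have hw : (fun z => wterm k s g P z) = fun z => c * localIntegrand k s g P τ (τ • z) := by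
    ext z
    rw [wterm_eq_twist k s g P τ z, wterm_diag hd, ← hN]
    rfl
  have hw' : wterm k s g P = fun z => c * localIntegrand k s g P τ (τ • z) := hw
  rw [hw', integrableOn_twist_coords (f := fun z => c * localIntegrand k s g P τ z)] at hint
  refine ⟨?_, ?_⟩
  · have := hint.const_mul c⁻¹
    simp only [inv_mul_cancel_left₀ hc0] at this
    exact this
  · rw [← heq, hw, integral_twist_coords (f := fun z => c * localIntegrand k s g P τ z),
      integral_const_mul]
    rfl

end datum

end

/-! ### The Petersson product as a sum over hyperbolic classes -/

section

variable {Γ : Subgroup SL(2, ℝ)} {D : Set ℍ} {k : ℕ}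

/-- The integral of the contribution of `γ`, for nontrivial `γ`. -/
def orbInt (D : Set ℍ) (k : ℕ) (s : ℂ) (g : ℍ → ℂ) : Γ → ℂ :=
  ({1}ᶜ : Set Γ).indicator fun γ => ∫ z in D, wterm k s g γ z

lemma tsum_orbInt_hyperbolic (s : ℂ) (g : ℍ → ℂ) {P : Γ}
    (hP : (P : SL(2, ℝ)).1.IsHyperbolic) :
    ∑' x : {x : Γ // ConjClasses.mk x = ConjClasses.mk P}, orbInt D k s g (x : Γ) =
      ∑' x : {x : Γ // ConjClasses.mk x = ConjClasses.mk P},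
          ∫ z in D, wterm k s g (x : Γ) z := by
  refine tsum_congr ?_
  rintro ⟨x, hx⟩
  have h1 : x ≠ 1 := by
    rintro rfl
    have h2 := isConj_one_right.mp (ConjClasses.mk_eq_mk_iff_isConj.mp hx)
    rw [h2, isHyperbolic_iff] at hP
    simp at hP
    norm_num at hP
  exact Set.indicator_of_mem (by simpa using h1) _

variable [DiscreteTopology Γ]

lemma peterssonIntegrand_eq (htf : ∀ γ : Γ, γ ≠ 1 → ¬ IsOfFinOrder γ) {s : ℂ} (hs : 1 < s.re)
    (g : ℍ → ℂ) (z : ℍ) :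
    peterssonIntegrand Γ k s g z = ∑' γ : NT Γ, wterm k s g γ.mat z := by
  rw [peterssonIntegrand, poincareF_eq htf hs, mul_assoc, ← tsum_mul_right]
  exact tsum_congr fun γ => by rw [wterm, mul_assoc]

lemma integrableOn_peterssonIntegrand (htf : ∀ γ : Γ, γ ≠ 1 → ¬ IsOfFinOrder γ)
    (hD : IsFundamentalDomain Γ D (volume : Measure ℍ)) (hvol : volume D ≠ ⊤)
    (g : CuspFormsFourK Γ k) {s : ℂ} (hs : 1 < s.re) :
    IntegrableOn (peterssonIntegrand Γ k s g) D := by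
  obtain ⟨C, hC⟩ := exists_tsum_bound htf hD hvol g hs
  have hmeas : AEStronglyMeasurable (peterssonIntegrand Γ k s g) volume := by
    refine aestronglyMeasurable_of_tendsto_ae (Filter.atTop : Filter (Finset (NT Γ)))
      (f := fun F z => ∑ γ ∈ F, wterm k s g γ.mat z) (fun F => ?_) (.of_forall fun z => ?_)
    · exact (continuous_finsetSum _ fun γ _ => continuous_wterm k hs (cuspForm_continuous g)
        (fun z => smul_ne_self htf γ.ne z)).aestronglyMeasurable
    · rw [peterssonIntegrand_eq htf hs]
      simpa [HasSum] using (hC z).1.of_norm.hasSum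
  refine Measure.integrableOn_of_bounded hvol hmeas (M := C) (.of_forall fun z => ?_)
  rw [peterssonIntegrand_eq htf hs]
  exact (norm_tsum_le_tsum_norm (hC z).1).trans (hC z).2

lemma summable_norm_orbInt (htf : ∀ γ : Γ, γ ≠ 1 → ¬ IsOfFinOrder γ)
    (hD : IsFundamentalDomain Γ D (volume : Measure ℍ)) (hvol : volume D ≠ ⊤)
    (g : CuspFormsFourK Γ k) {s : ℂ} (hs : 1 < s.re) :
    Summable fun γ : Γ => ‖orbInt D k s g γ‖ := by
  have h1 := tsum_lintegral_lt_top htf hD hvol g hs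
  have h2 : Summable fun γ : NT Γ => ‖∫ z in D, wterm k s g γ.mat z‖ := by
    refine (ENNReal.summable_toReal h1.ne).of_nonneg_of_le (fun _ => norm_nonneg _) fun γ => ?_
    rw [← toReal_enorm]
    exact ENNReal.toReal_mono (ENNReal.ne_top_of_tsum_ne_top h1.ne γ)
      (enorm_integral_le_lintegral_enorm _)
  have h3 : ∀ γ ∉ Set.range (fun γ : NT Γ => (γ.1 : Γ)), ‖orbInt D k s g γ‖ = 0 := by
    intro γ hγ
    have h1 : γ = 1 := by
      by_contra h
      exact hγ ⟨⟨γ, h⟩, rfl⟩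
    rw [h1, orbInt, Set.indicator_of_notMem (by simp), norm_zero]
  refine (Function.Injective.summable_iff Subtype.val_injective h3).mp (h2.congr fun γ => ?_)
  rw [Function.comp_apply, orbInt, Set.indicator_of_mem (by simp)]

lemma integral_petersson_eq (htf : ∀ γ : Γ, γ ≠ 1 → ¬ IsOfFinOrder γ)
    (hD : IsFundamentalDomain Γ D (volume : Measure ℍ)) (hvol : volume D ≠ ⊤)
    (g : CuspFormsFourK Γ k) {s : ℂ} (hs : 1 < s.re) :
    ∫ z in D, peterssonIntegrand Γ k s g z = ∑' γ : Γ, orbInt D k s g γ := by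
  simp only [peterssonIntegrand_eq htf hs]
  rw [integral_tsum (fun γ : NT Γ => (continuous_wterm k hs (cuspForm_continuous g)
        (fun z => smul_ne_self htf γ.ne z)).aestronglyMeasurable)
        (tsum_lintegral_lt_top htf hD hvol g hs).ne]
  exact tsum_subtype ({1}ᶜ : Set Γ) fun γ => ∫ z in D, wterm k s g γ z

lemma tsum_orbInt_eq_zero (htf : ∀ γ : Γ, γ ≠ 1 → ¬ IsOfFinOrder γ)
    (hD : IsFundamentalDomain Γ D (volume : Measure ℍ)) (hvol : volume D ≠ ⊤)
    (g : CuspFormsFourK Γ k) {s : ℂ} (hs : 1 < s.re) (C : ConjClasses Γ)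
    (hC : ¬ ∃ P : Γ, (P : SL(2, ℝ)).1.IsHyperbolic ∧ ConjClasses.mk P = C) :
    ∑' x : {x : Γ // ConjClasses.mk x = C}, orbInt D k s g (x : Γ) = 0 := by
  obtain ⟨γ, rfl⟩ := ConjClasses.mk_surjective C
  by_cases hγ : γ = 1
  · subst hγ
    have : ∀ x : {x : Γ // ConjClasses.mk x = ConjClasses.mk 1}, orbInt D k s g (x : Γ) = 0 := by
      rintro ⟨x, hx⟩
      have h1 : x = 1 := isConj_one_right.mp (ConjClasses.mk_eq_mk_iff_isConj.mp hx).symm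
      subst h1
      simp [orbInt]
    simp [this]
  · have htr : (γ : SL(2, ℝ)).1.trace ^ 2 = 4 := by
      refine le_antisymm (not_lt.mp fun h => hC ⟨γ, (isHyperbolic_iff _).mpr h, rfl⟩)
        (four_le_trace_sq htf γ)
    rw [← tsum_parabolic_eq_zero htf hD hvol g hs hγ htr]
    refine tsum_congr ?_
    rintro ⟨x, hx⟩
    have h1 : x ≠ 1 := by
      rintro rfl
      exact hγ (isConj_one_right.mp (ConjClasses.mk_eq_mk_iff_isConj.mp hx))
    exact Set.indicator_of_mem (by simpa using h1) _

/-- The absolutely convergent sum over Γ \ {1} is regrouped by conjugacy classes. The right-hand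
side of `IsLocalDatum.localTerm_eq` involves only the class, which gives the independence of P, P₀
and τ. -/
theorem petersson_eq_tsum_localTerm (htf : ∀ γ : Γ, γ ≠ 1 → ¬ IsOfFinOrder γ)
    (hD : IsFundamentalDomain Γ D (volume : Measure ℍ)) (hvol : volume D ≠ ⊤)
    (g : CuspFormsFourK Γ k) {s : ℂ} (hs : 1 < s.re)
    (P P₀ : HypClass Γ → Γ) (τ : HypClass Γ → SL(2, ℝ))
    (h : ∀ C, ConjClasses.mk (P C) = C.1 ∧ IsLocalDatum Γ (P C) (P₀ C) (τ C)) :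
    (Summable fun C => ‖localTerm k s g (P C) (P₀ C) (τ C)‖) ∧
      ∫ z in D, peterssonIntegrand Γ k s g z =
        ∑' C, localTerm k s g (P C) (P₀ C) (τ C) := by
  have hterm : ∀ C : HypClass Γ, localTerm k s g (P C) (P₀ C) (τ C) =
      ∑' x : {x : Γ // ConjClasses.mk x = C.1}, orbInt D k s g (x : Γ) := by
    intro C
    obtain ⟨h1, h2⟩ := h C
    rw [(h2.localTerm_eq htf hD hvol g hs).2, ← tsum_orbInt_hyperbolic s g h2.hyp, h1]
  have hsum := summable_norm_orbInt htf hD hvol g hs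
  set e := Equiv.sigmaFiberEquiv (ConjClasses.mk : Γ → ConjClasses Γ)
  have hsig : Summable fun p : (C : ConjClasses Γ) × {x : Γ // ConjClasses.mk x = C} =>
      ‖orbInt D k s g (p.2 : Γ)‖ := by
    have := (e.summable_iff (f := fun γ : Γ => ‖orbInt D k s g γ‖)).mpr hsum
    exact this
  have hC : Summable fun C : ConjClasses Γ =>
      ‖∑' x : {x : Γ // ConjClasses.mk x = C}, orbInt D k s g (x : Γ)‖ :=
    hsig.sigma.of_nonneg_of_le (fun _ => norm_nonneg _) fun C =>
      norm_tsum_le_tsum_norm (hsig.sigma_factor C)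
  constructor
  · simp only [hterm]
    exact hC.subtype _
  · simp only [hterm]
    rw [integral_petersson_eq htf hD hvol g hs, ← e.tsum_eq]
    have h1 : ∑' p : (C : ConjClasses Γ) × {x : Γ // ConjClasses.mk x = C},
        orbInt D k s g (p.2 : Γ) = ∑' C : ConjClasses Γ,
          ∑' x : {x : Γ // ConjClasses.mk x = C}, orbInt D k s g (x : Γ) :=
      hsig.of_norm.tsum_sigma
    refine h1.trans ?_
    refine (tsum_subtype_eq_of_support_subset (s := {C : ConjClasses Γ |
      ∃ P : Γ, (P : SL(2, ℝ)).1.IsHyperbolic ∧ ConjClasses.mk P = C}) ?_).symm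
    intro C hC'
    by_contra hn
    exact hC' (tsum_orbInt_eq_zero htf hD hvol g hs C hn)

end

/-! ### A hypergeometric series of half-integral type -/

/-- The coefficients of the expansion in powers of `(2 cosh t)⁻²` of the derivatives of
`exp (-(2 s - 1) t)` with respect to `-2 cosh t`. -/
def wcoef (s : ℂ) (M n : ℕ) : ℂ :=
  (ascPochhammer ℂ (2 * n + M)).eval (2 * s - 1) /
    ((ascPochhammer ℂ n).eval (2 * s) * (n.factorial : ℂ) * 4 ^ n)

/-- Raising M by one is, up to the factor 2, the Euler operator on r^(n + s + (M-1)/2); the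
half-integral shift of the exponent is made for this. -/
lemma wcoef_succ (s : ℂ) (M n : ℕ) :
    wcoef s (M + 1) n = 2 * ((n + (s + (M - 1) / 2)) * wcoef s M n) := by
  rw [wcoef, wcoef, ← add_assoc, ascPochhammer_succ_eval]
  push_cast
  ring

lemma wcoef_zero_zero (s : ℂ) : wcoef s 0 0 = 1 := by simp [wcoef]

/-- The same Pochhammer symbol occurs on both sides. Read as a recursion in n, the case M = 0 is the
differential equation of `wser s 0`. -/
lemma wcoef_add_two {s : ℂ} (hs : 1 < s.re) (M n : ℕ) :
    wcoef s (M + 2) n = 4 * (2 * s + n) * (n + 1) * wcoef s M (n + 1) := by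
  have h1 := two_mul_add_natCast_ne_zero hs n
  have h2 : (ascPochhammer ℂ n).eval (2 * s) ≠ 0 :=
    ascPochhammer_eval_ne_zero n fun m _ => two_mul_add_natCast_ne_zero hs m
  have h3 : (n : ℂ) + 1 ≠ 0 := Nat.cast_add_one_ne_zero n
  have h4 : (n.factorial : ℂ) ≠ 0 := by exact_mod_cast n.factorial_ne_zero
  rw [wcoef, wcoef, show 2 * (n + 1) + M = 2 * n + (M + 2) by ring, ascPochhammer_succ_eval,
    Nat.factorial_succ, pow_succ]
  push_cast
  field_simp

lemma polyBdd_wcoef {s : ℂ} (hs : 1 < s.re) (M : ℕ) : PolyBdd (wcoef s M) := by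
  induction M with
  | zero =>
    refine .of_ratio hs (x := ‖s‖ + 1) (c := fun n => (n + (s - 1 / 2)) * (n + s)) (by positivity)
      (fun n => ?_) fun n => ?_
    · have h1 := two_mul_add_natCast_ne_zero hs n
      have h3 : (n : ℂ) + 1 ≠ 0 := Nat.cast_add_one_ne_zero n
      have h := wcoef_add_two hs 0 n
      rw [zero_add, wcoef_succ, wcoef_succ] at h
      push_cast at h
      rw [mul_div_assoc', eq_div_iff (mul_ne_zero h1 h3)]
      linear_combination -h / 4
    · rw [norm_mul, sq]
      gcongr
      · refine (norm_add_le _ _).trans ?_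
        have h1 : ‖s - 1 / 2‖ ≤ ‖s‖ + 1 / 2 := (norm_sub_le _ _).trans (by norm_num)
        rw [Complex.norm_natCast]
        linarith
      · refine (norm_add_le _ _).trans ?_
        rw [Complex.norm_natCast]
        linarith
  | succ M ih =>
    obtain ⟨C, N, hC, h⟩ := ih.add_mul (s + (M - 1) / 2)
    refine ⟨2 * C, N, by positivity, fun n => ?_⟩
    rw [wcoef_succ, norm_mul, mul_assoc]
    simpa using h n

/-- The function `∑ n, wcoef s M n * b ^ (n + s + (M - 1) / 2)`. -/
def wser (s : ℂ) (M : ℕ) : ℂ → ℂ := powser (s + (M - 1) / 2) (wcoef s M)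

lemma pser_const_mul (c : ℂ) (a : ℕ → ℂ) (r : ℂ) : pser (fun n => c * a n) r = c * pser a r := by
  simp only [pser, mul_assoc, tsum_mul_left]

lemma hasDerivAt_wser {s : ℂ} (hs : 1 < s.re) (M : ℕ) {r : ℂ} (hr : ‖r‖ < 1)
    (h0 : r ∈ Complex.slitPlane) :
    HasDerivAt (wser s M) (r ^ (-1 / 2 : ℂ) * wser s (M + 1) r / (2 * r)) r := by
  have hr0 := Complex.slitPlane_ne_zero h0
  refine HasDerivAt.congr_deriv ((polyBdd_wcoef hs M).hasDerivAt_powser _ hr h0) ?_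
  have h1 : wcoef s (M + 1) = fun n => 2 * ((n + (s + (M - 1) / 2)) * wcoef s M n) :=
    funext fun n => wcoef_succ s M n
  rw [wser, powser, powser, h1, pser_const_mul, ← mul_assoc, ← Complex.cpow_add _ _ hr0]
  have h2 : (-1 / 2 : ℂ) + (s + (((M + 1 : ℕ) : ℂ) - 1) / 2) = s + (M - 1) / 2 := by
    push_cast; ring
  rw [h2]
  field_simp

/-- At r = cosh(t)^(-2) this reads sinh² t · w₂ - cosh t · w₁ = (2s-1)² w₀, which by `hasDerivAt_wt`
says w₀'' = (2s-1)² w₀. -/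
lemma wser_two_eq {s : ℂ} (hs : 1 < s.re) {r : ℂ} (hr : ‖r‖ < 1) (h0 : r ≠ 0) :
    (1 / r - 1) * wser s 2 r - r ^ (-1 / 2 : ℂ) * wser s 1 r = (2 * s - 1) ^ 2 * wser s 0 r := by
  have e2 : wser s 2 r = r ^ (s - 1 / 2) * (r * pser (wcoef s 2) r) := by
    rw [wser, powser, ← mul_assoc, show s + (((2 : ℕ) : ℂ) - 1) / 2 = s - 1 / 2 + 1 by
      push_cast; ring, Complex.cpow_add _ _ h0, Complex.cpow_one]
  have e1 : r ^ (-1 / 2 : ℂ) * wser s 1 r = r ^ (s - 1 / 2) * pser (wcoef s 1) r := by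
    rw [wser, powser, ← mul_assoc, ← Complex.cpow_add _ _ h0]
    congr 2; push_cast; ring
  have e0 : wser s 0 r = r ^ (s - 1 / 2) * pser (wcoef s 0) r := by
    rw [wser, powser]
    congr 2; push_cast; ring
  have key : (1 - r) * pser (wcoef s 2) r - pser (wcoef s 1) r =
      (2 * s - 1) ^ 2 * pser (wcoef s 0) r := by
    have s0 := ((polyBdd_wcoef hs 0).summable_norm hr).of_norm
    have s1 := ((polyBdd_wcoef hs 1).summable_norm hr).of_norm
    have s2 := ((polyBdd_wcoef hs 2).summable_norm hr).of_norm
    have h1 : r * pser (wcoef s 2) r = ∑' n, (wcoef s 2 n * r ^ n - wcoef s 1 n * r ^ n -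
        (2 * s - 1) ^ 2 * (wcoef s 0 n * r ^ n)) := by
      rw [Summable.tsum_eq_zero_add ((s2.sub s1).sub (s0.mul_left _)), pser, ← tsum_mul_left]
      have hz : wcoef s 2 0 * r ^ 0 - wcoef s 1 0 * r ^ 0 -
        (2 * s - 1) ^ 2 * (wcoef s 0 0 * r ^ 0) = 0 := by
        rw [wcoef_succ, wcoef_succ, wcoef_zero_zero]; push_cast; ring
      rw [hz, zero_add]
      refine tsum_congr fun n => ?_
      have h := wcoef_add_two hs 0 n
      rw [zero_add] at h
      rw [h, wcoef_succ s 1, wcoef_succ s 0]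
      push_cast
      ring
    rw [(s2.sub s1).tsum_sub (s0.mul_left _), s2.tsum_sub s1, tsum_mul_left] at h1
    change r * pser (wcoef s 2) r = pser (wcoef s 2) r - pser (wcoef s 1) r -
      (2 * s - 1) ^ 2 * pser (wcoef s 0) r at h1
    linear_combination -h1
  have h2 : (1 / r - 1) * (r ^ (s - 1 / 2) * (r * pser (wcoef s 2) r)) =
      r ^ (s - 1 / 2) * ((1 - r) * pser (wcoef s 2) r) := by field_simp
  rw [e1, e2, e0, h2]
  linear_combination r ^ (s - 1 / 2) * key

/-- The function `wser s M` at `(cosh t)⁻²`. -/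
def wt (s : ℂ) (M : ℕ) (t : ℝ) : ℂ := wser s M (((Real.cosh t ^ 2)⁻¹ : ℝ) : ℂ)

lemma inv_cosh_sq_lt_one {t : ℝ} (ht : 0 < t) : (Real.cosh t ^ 2)⁻¹ < 1 := by
  have := Real.one_lt_cosh.mpr ht.ne'
  exact inv_lt_one_of_one_lt₀ (by nlinarith)

lemma norm_inv_cosh_sq_lt_one {t : ℝ} (ht : 0 < t) :
    ‖(((Real.cosh t ^ 2)⁻¹ : ℝ) : ℂ)‖ < 1 := by
  rw [Complex.norm_real, Real.norm_of_nonneg (by positivity)]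
  exact inv_cosh_sq_lt_one ht

lemma inv_cosh_sq_mem_slitPlane (t : ℝ) :
    (((Real.cosh t ^ 2)⁻¹ : ℝ) : ℂ) ∈ Complex.slitPlane := by
  have := Real.cosh_pos t
  exact Complex.ofReal_mem_slitPlane.mpr (by positivity)

lemma inv_cosh_sq_cpow (t : ℝ) (α : ℂ) :
    (((Real.cosh t ^ 2)⁻¹ : ℝ) : ℂ) ^ α = Complex.exp (-2 * α * Real.log (Real.cosh t)) := by
  have h := Real.cosh_pos t
  rw [Complex.cpow_def_of_ne_zero (Complex.slitPlane_ne_zero (inv_cosh_sq_mem_slitPlane t)),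
    ← Complex.ofReal_log (by positivity), Real.log_inv, Real.log_pow]
  congr 1
  push_cast
  ring

lemma inv_cosh_sq_cpow_neg_half (t : ℝ) :
    (((Real.cosh t ^ 2)⁻¹ : ℝ) : ℂ) ^ (-1 / 2 : ℂ) = Real.cosh t := by
  rw [inv_cosh_sq_cpow, show (-2 * (-1 / 2) * (Real.log (Real.cosh t) : ℂ) : ℂ) =
    Real.log (Real.cosh t) by ring, ← Complex.ofReal_exp, Real.exp_log (Real.cosh_pos t)]

/-- Equivalently, `wt s (M+1)` is the derivative of `wt s M` with respect to -cosh t. Once `wt s 0`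
is known to be an exponential, all `wt s M` become elementary. -/
lemma hasDerivAt_wt {s : ℂ} (hs : 1 < s.re) (M : ℕ) {t : ℝ} (ht : 0 < t) :
    HasDerivAt (wt s M) (-Real.sinh t * wt s (M + 1) t) t := by
  have hc := Real.cosh_pos t
  have h1 := hasDerivAt_wser hs M (norm_inv_cosh_sq_lt_one ht) (inv_cosh_sq_mem_slitPlane t)
  have h2 : HasDerivAt (fun t : ℝ => (((Real.cosh t ^ 2)⁻¹ : ℝ) : ℂ))
      ((-(2 * Real.cosh t * Real.sinh t) / (Real.cosh t ^ 2) ^ 2 : ℝ) : ℂ) t := by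
    refine HasDerivAt.ofReal_comp ?_
    refine (((Real.hasDerivAt_cosh t).pow 2).inv (pow_ne_zero 2 hc.ne')).congr_deriv ?_
    simp
  refine (h1.comp t h2).congr_deriv ?_
  rw [inv_cosh_sq_cpow_neg_half, wt]
  have hc' : (Real.cosh t : ℂ) ≠ 0 := by exact_mod_cast hc.ne'
  push_cast at hc' ⊢
  field_simp

lemma tendsto_inv_cosh_sq :
    Filter.Tendsto (fun t : ℝ => (((Real.cosh t ^ 2)⁻¹ : ℝ) : ℂ)) Filter.atTop (nhds 0) := by
  rw [← Complex.ofReal_zero]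
  refine (Complex.continuous_ofReal.tendsto 0).comp ?_
  refine (Filter.tendsto_pow_atTop two_ne_zero).comp ?_ |>.inv_tendsto_atTop
  exact Filter.tendsto_atTop_mono (fun t => (by rw [Real.cosh_eq]; linarith [Real.exp_pos (-t)] :
    Real.exp t / 2 ≤ Real.cosh t)) (Real.tendsto_exp_atTop.atTop_div_const two_pos)

lemma tendsto_pser_inv_cosh_sq {s : ℂ} (hs : 1 < s.re) (M : ℕ) :
    Filter.Tendsto (fun t : ℝ => pser (wcoef s M) (((Real.cosh t ^ 2)⁻¹ : ℝ) : ℂ)) Filter.atTop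
      (nhds (wcoef s M 0)) := by
  have h := ((polyBdd_wcoef hs M).differentiableAt_pser (r := 0) (by simp)).continuousAt.tendsto
  have h0 : pser (wcoef s M) 0 = wcoef s M 0 := by
    rw [pser, tsum_eq_single 0 fun n hn => by simp [hn]]
    simp
  rw [h0] at h
  exact h.comp tendsto_inv_cosh_sq

lemma tendsto_log_cosh_sub :
    Filter.Tendsto (fun t : ℝ => t - Real.log (Real.cosh t)) Filter.atTop (nhds (Real.log 2)) := by
  have h1 : Filter.Tendsto (fun t : ℝ => 1 + Real.exp (-(2 * t))) Filter.atTop (nhds 1) := by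
    simpa using (Real.tendsto_exp_neg_atTop_nhds_zero.comp
      (Filter.tendsto_id.const_mul_atTop (two_pos : (0 : ℝ) < 2))).const_add 1
  have h2 := (h1.log one_ne_zero).const_sub (Real.log 2)
  rw [Real.log_one, sub_zero] at h2
  refine h2.congr fun t => ?_
  have e : Real.cosh t = Real.exp t * (1 + Real.exp (-(2 * t))) / 2 := by
    rw [Real.cosh_eq, mul_add, ← Real.exp_add]; ring_nf
  have := Real.exp_pos (-(2 * t))
  rw [e, Real.log_div (by positivity) two_ne_zero, Real.log_mul (Real.exp_pos t).ne' (by positivity),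
    Real.log_exp]
  ring

lemma wt_eq (s : ℂ) (M : ℕ) (t : ℝ) : wt s M t =
    Complex.exp (-(2 * s - 1 + M) * Real.log (Real.cosh t)) *
      pser (wcoef s M) (((Real.cosh t ^ 2)⁻¹ : ℝ) : ℂ) := by
  rw [wt, wser, powser, inv_cosh_sq_cpow]
  congr 2
  ring

/-- The solution of `w'' = p² w` decaying at infinity. -/
lemma wt_zero {s : ℂ} (hs : 1 < s.re) {t : ℝ} (ht : 0 < t) :
    wt s 0 t = Complex.exp ((2 * s - 1) * (Real.log 2 - t)) := by
  set p : ℂ := 2 * s - 1 with hp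
  have hpre : 1 < p.re := by simp [hp]; linarith
  have h0 : ∀ t : ℝ, 0 < t → HasDerivAt (wt s 0) (-Real.sinh t * wt s 1 t) t :=
    fun t ht => hasDerivAt_wt hs 0 ht
  have hexp : ∀ (c : ℂ) (t : ℝ), HasDerivAt (fun t : ℝ => Complex.exp (c * t))
      (Complex.exp (c * t) * c) t := fun c t => by
    simpa using (((hasDerivAt_id (t : ℂ)).const_mul c).cexp).comp_ofReal
  -- the combination `w' + p w` is a multiple of `exp (p t)`
  have h1 : ∀ t : ℝ, 0 < t → HasDerivAt (fun t : ℝ => Complex.exp (-p * t) *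
      (-Real.sinh t * wt s 1 t + p * wt s 0 t)) 0 t := by
    intro t ht
    have e := (hexp (-p) t).mul ((((Real.hasDerivAt_sinh t).ofReal_comp.neg).mul
      (hasDerivAt_wt hs 1 ht)).add ((h0 t ht).const_mul p))
    refine e.congr_deriv ?_
    have h2 := wser_two_eq hs (norm_inv_cosh_sq_lt_one ht)
      (Complex.slitPlane_ne_zero (inv_cosh_sq_mem_slitPlane t))
    rw [inv_cosh_sq_cpow_neg_half, ← hp] at h2
    change (1 / _ - 1) * wt s 2 t - _ * wt s 1 t = p ^ 2 * wt s 0 t at h2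
    have h3 : 1 / (((Real.cosh t ^ 2)⁻¹ : ℝ) : ℂ) - 1 = (Real.sinh t : ℂ) ^ 2 := by
      rw [one_div, ← Complex.ofReal_inv, inv_inv, Real.cosh_sq]; push_cast; ring
    rw [h3] at h2
    simp only [Pi.add_apply, Pi.mul_apply, Pi.neg_apply]
    linear_combination Complex.exp (-p * t) * h2
  -- A function with zero derivative on (0, ∞) equals its limit at infinity; this is used once for
  -- each of the two exponential solutions.
  have hconst : ∀ F : ℝ → ℂ, (∀ t : ℝ, 0 < t → HasDerivAt F 0 t) → ∀ L : ℂ,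
      Filter.Tendsto F Filter.atTop (nhds L) → ∀ t : ℝ, 0 < t → F t = L := by
    intro F hF L hL t ht
    refine tendsto_nhds_unique (tendsto_const_nhds.congr' ?_) hL
    filter_upwards [Filter.eventually_gt_atTop 0] with u hu
    exact (convex_Ioi (0 : ℝ)).is_const_of_fderivWithin_eq_zero (𝕜 := ℝ)
      (fun x hx => (hF x hx).differentiableAt.differentiableWithinAt)
      (fun x hx => by
        have := (hF x hx).hasFDerivAt.hasFDerivWithinAt (s := Set.Ioi 0)
        rw [this.fderivWithin (isOpen_Ioi.uniqueDiffWithinAt hx)]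
        ext; simp) ht hu
  have hlog : Filter.Tendsto (fun t : ℝ => Real.log (Real.cosh t)) Filter.atTop Filter.atTop := by
    have := tendsto_log_cosh_sub.neg.add_atTop Filter.tendsto_id
    exact this.congr fun t => by simp
  have hdec : Filter.Tendsto (fun t : ℝ => Complex.exp (-p * Real.log (Real.cosh t)))
      Filter.atTop (nhds 0) := by
    rw [tendsto_zero_iff_norm_tendsto_zero]
    have : Filter.Tendsto (fun t : ℝ => Real.exp (-(p.re * Real.log (Real.cosh t))))
        Filter.atTop (nhds 0) :=
      Real.tendsto_exp_neg_atTop_nhds_zero.comp (hlog.const_mul_atTop (by linarith))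
    refine this.congr fun t => ?_
    rw [Complex.norm_exp]; simp
  have hw0 : Filter.Tendsto (wt s 0) Filter.atTop (nhds 0) := by
    have := hdec.mul (tendsto_pser_inv_cosh_sq hs 0)
    rw [zero_mul] at this
    refine this.congr fun t => ?_
    rw [wt_eq, hp]; simp
  have hw1 : Filter.Tendsto (fun t => (Real.cosh t : ℂ) * wt s 1 t) Filter.atTop (nhds 0) := by
    have := hdec.mul (tendsto_pser_inv_cosh_sq hs 1)
    rw [zero_mul] at this
    refine this.congr fun t => ?_
    have hc := Real.cosh_pos t
    rw [wt_eq, ← mul_assoc]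
    congr 1
    rw [← Real.exp_log hc, Complex.ofReal_exp, Real.log_exp, ← Complex.exp_add]
    congr 1
    push_cast; ring
  -- Decay at infinity excludes the growing solution, so that w' = -p w.
  have hC : ∀ t : ℝ, 0 < t → -Real.sinh t * wt s 1 t + p * wt s 0 t = 0 := by
    intro t ht
    have hlim : Filter.Tendsto (fun t : ℝ => Complex.exp (-p * t) *
        (-Real.sinh t * wt s 1 t + p * wt s 0 t)) Filter.atTop (nhds 0) := by
      have hd : Filter.Tendsto (fun t : ℝ => Complex.exp (-p * t)) Filter.atTop (nhds 0) := by
        rw [tendsto_zero_iff_norm_tendsto_zero]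
        have : Filter.Tendsto (fun t : ℝ => Real.exp (-(p.re * t))) Filter.atTop (nhds 0) :=
          Real.tendsto_exp_neg_atTop_nhds_zero.comp
            (Filter.tendsto_id.const_mul_atTop (by linarith))
        refine this.congr fun t => ?_
        rw [Complex.norm_exp]; simp
      have hs1 : Filter.Tendsto (fun t : ℝ => -Real.sinh t * wt s 1 t) Filter.atTop (nhds 0) := by
        refine squeeze_zero_norm' ?_ (tendsto_zero_iff_norm_tendsto_zero.mp hw1)
        filter_upwards [Filter.eventually_gt_atTop 0] with u hu
        rw [norm_mul, norm_mul, norm_neg, Complex.norm_real, Complex.norm_real,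
          Real.norm_of_nonneg (Real.sinh_pos_iff.mpr hu).le, Real.norm_of_nonneg (Real.cosh_pos u).le]
        gcongr
        exact (Real.sinh_lt_cosh u).le
      simpa using hd.mul (hs1.add (hw0.const_mul p))
    exact (mul_eq_zero.mp (hconst _ h1 0 hlim t ht)).resolve_left (Complex.exp_ne_zero _)
  have h4 : ∀ t : ℝ, 0 < t → HasDerivAt (fun t : ℝ => Complex.exp (p * t) * wt s 0 t) 0 t := by
    intro t ht
    refine ((hexp p t).mul (h0 t ht)).congr_deriv ?_
    linear_combination Complex.exp (p * t) * hC t ht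
  -- The remaining constant is 2^p, since the leading coefficient of the series is 1 and
  -- cosh(t)^(-p) behaves like (e^t/2)^(-p).
  have h5 : Filter.Tendsto (fun t : ℝ => Complex.exp (p * t) * wt s 0 t) Filter.atTop
      (nhds (Complex.exp (p * Real.log 2))) := by
    have h6 : Filter.Tendsto (fun t : ℝ => Complex.exp (p * ((t - Real.log (Real.cosh t) : ℝ) : ℂ)))
        Filter.atTop (nhds (Complex.exp (p * Real.log 2))) :=
      ((continuous_const.mul Complex.continuous_ofReal).cexp.tendsto _).comp tendsto_log_cosh_sub
    have h7 := h6.mul (tendsto_pser_inv_cosh_sq hs 0)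
    rw [wcoef_zero_zero, mul_one] at h7
    refine h7.congr fun t => ?_
    rw [wt_eq, ← mul_assoc, ← Complex.exp_add]
    congr 2
    push_cast; ring
  have h8 := hconst _ h4 _ h5 t ht
  rw [mul_sub, Complex.exp_sub, ← h8]
  field_simp

/-! ### Closed form of the series -/

/-- The coefficients of the polynomial part of the closed form of `wt`. -/
def ecoef (s : ℂ) (M i : ℕ) : ℂ :=
  ((i.factorial * (M - 1).choose i * (M + i - 1).choose i : ℕ) : ℂ) *
    ∏ l ∈ Finset.Icc (i + 2) M, (2 * s - (l : ℂ))

lemma pPoly_eq_ecoef (k i : ℕ) (s : ℂ) : pPoly k (i + 1) s = ecoef s (2 * k) i := rfl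

lemma ecoef_self (s : ℂ) {M : ℕ} (hM : 1 ≤ M) : ecoef s M M = 0 := by
  rw [ecoef, Nat.choose_eq_zero_of_lt (by omega : M - 1 < M)]
  simp

lemma factorial_mul_choose_mul_choose (i d : ℕ) :
    (i.factorial * (i + d).choose i * (i + d + i).choose i) * (d.factorial * i.factorial) =
      (i + d + i).factorial := by
  have h1 := Nat.add_choose_mul_factorial_mul_factorial i d
  have h2 := Nat.add_choose_mul_factorial_mul_factorial (i + d) i
  rw [← h1, ← Nat.choose_symm_add (a := i) (b := d)] at h2
  rw [← h2]
  ring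

lemma ecoef_eq (s : ℂ) (i d : ℕ) : ecoef s (i + d + 1) i =
    ((i + d + i).factorial : ℂ) / ((d.factorial : ℂ) * i.factorial) *
      ∏ l ∈ Finset.Icc (i + 2) (i + d + 1), (2 * s - (l : ℂ)) := by
  have hd : (d.factorial : ℂ) ≠ 0 := by exact_mod_cast d.factorial_ne_zero
  have hi : (i.factorial : ℂ) ≠ 0 := by exact_mod_cast i.factorial_ne_zero
  rw [ecoef, Nat.add_sub_cancel, show i + d + 1 + i - 1 = i + d + i by omega]
  congr 1
  rw [eq_div_iff (mul_ne_zero hd hi)]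
  exact_mod_cast factorial_mul_choose_mul_choose i d

lemma ecoef_succ_zero (s : ℂ) (m : ℕ) :
    ecoef s (m + 2) 0 = (2 * s - 1 - (m + 1)) * ecoef s (m + 1) 0 := by
  rw [ecoef, ecoef, Finset.prod_Icc_succ_top (by omega)]
  simp
  ring

/-- This is the recursion produced by differentiating the closed form once more. At the top index i
= m the first term on the right vanishes by `ecoef_self`. -/
lemma ecoef_succ_succ (s : ℂ) {m i : ℕ} (hi : i ≤ m) :
    ecoef s (m + 2) (i + 1) = (2 * s - 1 - (m + 1) - 2 * (i + 1)) * ecoef s (m + 1) (i + 1) +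
      2 * (m + 1 + i) * ecoef s (m + 1) i := by
  have hi0 : (i.factorial : ℂ) ≠ 0 := by exact_mod_cast i.factorial_ne_zero
  have hi1 : (i : ℂ) + 1 ≠ 0 := Nat.cast_add_one_ne_zero i
  rcases hi.eq_or_lt with rfl | hi
  · have e1 := ecoef_eq s (i + 1) 0
    have e2 := ecoef_eq s i 0
    rw [add_zero] at e1 e2
    rw [ecoef_self s (by omega), e1, e2, Finset.Icc_eq_empty (by omega),
      Finset.Icc_eq_empty (by omega), show i + 1 + (i + 1) = i + i + 1 + 1 by ring,
      Nat.factorial_succ, Nat.factorial_succ, Nat.factorial_succ]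
    push_cast
    simp only [Nat.factorial_zero, Finset.prod_empty]
    field_simp
    ring
  · obtain ⟨d, rfl⟩ := Nat.exists_eq_add_of_lt hi
    have hd0 : (d.factorial : ℂ) ≠ 0 := by exact_mod_cast d.factorial_ne_zero
    have hd1 : (d : ℂ) + 1 ≠ 0 := Nat.cast_add_one_ne_zero d
    have e1 := ecoef_eq s (i + 1) (d + 1)
    have e2 := ecoef_eq s (i + 1) d
    have e3 := ecoef_eq s i (d + 1)
    rw [show i + 1 + (d + 1) + 1 = i + d + 1 + 2 by ring] at e1
    rw [show i + 1 + d + 1 = i + d + 1 + 1 by ring] at e2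
    rw [show i + (d + 1) + 1 = i + d + 1 + 1 by ring] at e3
    rw [e1, e2, e3, Finset.prod_Icc_succ_top (by omega : i + 1 + 2 ≤ i + d + 1 + 1 + 1),
      ← Finset.mul_prod_Ioc_eq_prod_Icc (by omega : i + 2 ≤ i + d + 1 + 1),
      show Finset.Ioc (i + 2) (i + d + 1 + 1) = Finset.Icc (i + 1 + 2) (i + d + 1 + 1) by
        ext l; simp; omega,
      show i + 1 + (d + 1) + (i + 1) = i + (d + 1) + i + 1 + 1 by ring,
      show i + 1 + d + (i + 1) = i + (d + 1) + i + 1 by ring,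
      Nat.factorial_succ (i + (d + 1) + i + 1), Nat.factorial_succ (i + (d + 1) + i),
      Nat.factorial_succ d, Nat.factorial_succ i]
    push_cast
    field_simp
    ring

lemma sum_ecoef_succ (s X : ℂ) (m : ℕ) :
    ∑ i ∈ Finset.range (m + 2), ecoef s (m + 2) i * X ^ (m + 1 + i) =
      ∑ i ∈ Finset.range (m + 1), ecoef s (m + 1) i *
        ((2 * s - 1 - (m + 1) - 2 * i) * X ^ (m + 1 + i) + 2 * (m + 1 + i) * X ^ (m + 2 + i)) := by
  have h1 : ∑ i ∈ Finset.range (m + 2),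
      (2 * s - 1 - (m + 1) - 2 * i) * ecoef s (m + 1) i * X ^ (m + 1 + i) =
      ∑ i ∈ Finset.range (m + 1),
        (2 * s - 1 - (m + 1) - 2 * i) * ecoef s (m + 1) i * X ^ (m + 1 + i) := by
    rw [Finset.sum_range_succ, ecoef_self s (by omega)]
    ring
  rw [Finset.sum_range_succ'] at h1 ⊢
  rw [ecoef_succ_zero]
  have h2 : ∑ i ∈ Finset.range (m + 1), ecoef s (m + 2) (i + 1) * X ^ (m + 1 + (i + 1)) =
      ∑ i ∈ Finset.range (m + 1), (2 * s - 1 - (m + 1) - 2 * ((i + 1 : ℕ) : ℂ)) *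
        ecoef s (m + 1) (i + 1) * X ^ (m + 1 + (i + 1)) +
      ∑ i ∈ Finset.range (m + 1), 2 * (m + 1 + i) * ecoef s (m + 1) i * X ^ (m + 2 + i) := by
    rw [← Finset.sum_add_distrib]
    refine Finset.sum_congr rfl fun i hi => ?_
    rw [ecoef_succ_succ s (Nat.lt_succ_iff.mp (Finset.mem_range.mp hi))]
    push_cast
    ring
  have h3 : ∑ i ∈ Finset.range (m + 1), ecoef s (m + 1) i *
        ((2 * s - 1 - (m + 1) - 2 * i) * X ^ (m + 1 + i) + 2 * (m + 1 + i) * X ^ (m + 2 + i)) =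
      ∑ i ∈ Finset.range (m + 1),
        (2 * s - 1 - (m + 1) - 2 * i) * ecoef s (m + 1) i * X ^ (m + 1 + i) +
      ∑ i ∈ Finset.range (m + 1), 2 * (m + 1 + i) * ecoef s (m + 1) i * X ^ (m + 2 + i) := by
    rw [← Finset.sum_add_distrib]
    exact Finset.sum_congr rfl fun i _ => by ring
  rw [h2, h3, ← h1]
  push_cast
  ring

/-- The variable `1 / (1 - exp (-2 t))`. -/
def xvar (t : ℝ) : ℂ := (((1 - Real.exp (-(2 * t)))⁻¹ : ℝ) : ℂ)

lemma one_sub_exp_pos {t : ℝ} (ht : 0 < t) : 0 < 1 - Real.exp (-(2 * t)) := by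
  have : Real.exp (-(2 * t)) < 1 := by
    rw [← Real.exp_zero]; exact Real.exp_lt_exp.mpr (by linarith)
  linarith

lemma hasDerivAt_xvar {t : ℝ} (ht : 0 < t) :
    HasDerivAt xvar (-2 * (xvar t ^ 2 - xvar t)) t := by
  have h0 := one_sub_exp_pos ht
  have h : HasDerivAt (fun t : ℝ => (1 - Real.exp (-(2 * t)))⁻¹)
      (-2 * (((1 - Real.exp (-(2 * t)))⁻¹) ^ 2 - (1 - Real.exp (-(2 * t)))⁻¹)) t := by
    have h1 : HasDerivAt (fun t : ℝ => -(2 * t)) (-2) t := by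
      exact ((hasDerivAt_id t).const_mul 2).neg.congr_deriv (by simp)
    refine ((h1.exp.const_sub 1).inv h0.ne').congr_deriv ?_
    field_simp
    ring
  refine h.ofReal_comp.congr_deriv ?_
  rw [xvar]
  push_cast
  ring

lemma sinh_eq_xvar {t : ℝ} (ht : 0 < t) :
    (Real.sinh t : ℂ) * xvar t * 2 = Complex.exp t := by
  have h0 := one_sub_exp_pos ht
  have h : Real.sinh t * (1 - Real.exp (-(2 * t)))⁻¹ * 2 = Real.exp t := by
    have e : Real.exp (-t) = Real.exp t * Real.exp (-(2 * t)) := by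
      rw [← Real.exp_add]; congr 1; ring
    rw [Real.sinh_eq, e]
    field_simp
  rw [xvar, ← Complex.ofReal_exp, ← h]
  push_cast
  ring

/-- Repeated application of -(1/sinh t) d/dt to the exponential of `wt_zero`. With X = `xvar t` one
has X' = -2(X² - X), so polynomials in X are preserved, and `sum_ecoef_succ` matches the
coefficients. -/
lemma wt_succ_eq {s : ℂ} (hs : 1 < s.re) (m : ℕ) {t : ℝ} (ht : 0 < t) :
    wt s (m + 1) t = (2 * s - 1) * Complex.exp ((2 * s - 1 + (m + 1)) * (Real.log 2 - t)) *
      ∑ i ∈ Finset.range (m + 1), ecoef s (m + 1) i * xvar t ^ (m + 1 + i) := by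
  have hexp : ∀ (c : ℂ) (t : ℝ), HasDerivAt (fun t : ℝ => Complex.exp (c * (Real.log 2 - t)))
      (-c * Complex.exp (c * (Real.log 2 - t))) t := fun c t => by
    have := ((((hasDerivAt_id (t : ℂ)).const_sub (Real.log 2 : ℂ)).const_mul c).cexp).comp_ofReal
    refine this.congr_deriv ?_
    simp; ring
  -- Since 2 sinh t · X = e^t, the product sinh t · X · e^(log 2 - t) is 1; this supplies the factor
  -- sinh t that has to be divided out.
  have hE : ∀ (c : ℂ) {t : ℝ}, 0 < t → Complex.exp (c * (Real.log 2 - t)) =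
      Real.sinh t * xvar t * Complex.exp ((c + 1) * (Real.log 2 - t)) := by
    intro c t ht
    have h2 : Complex.exp (Real.log 2 : ℂ) = 2 := by
      rw [← Complex.ofReal_exp, Real.exp_log two_pos]; simp
    rw [add_mul, one_mul, Complex.exp_add, Complex.exp_sub (Real.log 2 : ℂ), h2,
      ← sinh_eq_xvar ht]
    have := sinh_eq_xvar ht
    have h3 : (Real.sinh t : ℂ) * xvar t * 2 ≠ 0 := by rw [this]; exact Complex.exp_ne_zero _
    have h4 : (Real.sinh t : ℂ) ≠ 0 := by rintro h; simp [h] at h3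
    have h5 : xvar t ≠ 0 := by rintro h; simp [h] at h3
    field_simp
  have hstep : ∀ (M : ℕ) (F : ℝ → ℂ) (F' : ℝ → ℂ), (∀ t : ℝ, 0 < t → wt s M t = F t) →
      (∀ t : ℝ, 0 < t → HasDerivAt F (-Real.sinh t * F' t) t) →
      ∀ t : ℝ, 0 < t → wt s (M + 1) t = F' t := by
    intro M F F' h1 h2 t ht
    have h3 : HasDerivAt (wt s M) (-Real.sinh t * F' t) t :=
      (h2 t ht).congr_of_eventuallyEq
        (Filter.eventually_of_mem (Ioi_mem_nhds ht) fun u hu => h1 u hu)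
    have h4 : (-(Real.sinh t : ℂ)) ≠ 0 := by
      exact_mod_cast (neg_ne_zero.mpr (Real.sinh_pos_iff.mpr ht).ne')
    exact mul_left_cancel₀ h4 ((hasDerivAt_wt hs M ht).unique h3)
  suffices H : ∀ t : ℝ, 0 < t → wt s (m + 1) t =
      (2 * s - 1) * Complex.exp ((2 * s - 1 + (m + 1)) * (Real.log 2 - t)) *
        ∑ i ∈ Finset.range (m + 1), ecoef s (m + 1) i * xvar t ^ (m + 1 + i) from H t ht
  clear ht t
  induction m with
  | zero =>
    refine hstep 0 _ _ (fun t ht => wt_zero hs ht) fun t ht => (hexp _ t).congr_deriv ?_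
    rw [hE _ ht]
    simp [ecoef]
    ring
  | succ m ih =>
    refine hstep (m + 1) _ _ ih fun t ht => ?_
    have hsum : HasDerivAt (fun t => ∑ i ∈ Finset.range (m + 1), ecoef s (m + 1) i *
        xvar t ^ (m + 1 + i)) (∑ i ∈ Finset.range (m + 1), ecoef s (m + 1) i *
        (-2 * (m + 1 + i) * (xvar t ^ (m + 2 + i) - xvar t ^ (m + 1 + i)))) t := by
      refine HasDerivAt.fun_sum fun i _ => ?_
      refine (((hasDerivAt_xvar ht).pow (m + 1 + i)).const_mul _).congr_deriv ?_
      rw [show m + 1 + i - 1 = m + i by omega, show m + 1 + i = m + i + 1 by ring,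
        show m + 2 + i = m + i + 2 by ring]
      push_cast
      ring
    refine (((hexp _ t).const_mul (2 * s - 1)).mul hsum).congr_deriv ?_
    have h1 := sum_ecoef_succ s (xvar t) m
    have h2 : ∑ i ∈ Finset.range (m + 2), ecoef s (m + 2) i * xvar t ^ (m + 2 + i) =
        xvar t * ∑ i ∈ Finset.range (m + 2), ecoef s (m + 2) i * xvar t ^ (m + 1 + i) := by
      rw [Finset.mul_sum]
      exact Finset.sum_congr rfl fun i _ => by ring
    have h3 : ∑ i ∈ Finset.range (m + 1), ecoef s (m + 1) i *
        ((2 * s - 1 - (m + 1) - 2 * i) * xvar t ^ (m + 1 + i) +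
          2 * (m + 1 + i) * xvar t ^ (m + 2 + i)) =
        (2 * s - 1 + (m + 1)) * ∑ i ∈ Finset.range (m + 1), ecoef s (m + 1) i *
          xvar t ^ (m + 1 + i) - ∑ i ∈ Finset.range (m + 1), ecoef s (m + 1) i *
          (-2 * (m + 1 + i) * (xvar t ^ (m + 2 + i) - xvar t ^ (m + 1 + i))) := by
      rw [Finset.mul_sum, ← Finset.sum_sub_distrib]
      exact Finset.sum_congr rfl fun i _ => by ring
    rw [h2, h1, h3, hE _ ht]
    push_cast
    ring_nf

/-! ### The integral of the radial function along a horocyclic direction -/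

lemma integrable_one_add_sq_cpow {m : ℂ} (hm : 1 / 2 < m.re) :
    Integrable fun v : ℝ => ((1 + v ^ 2 : ℝ) : ℂ) ^ (-m) := by
  have h : Integrable fun v : ℝ => (1 + ‖v‖ ^ 2) ^ (-(2 * m.re) / 2) :=
    integrable_rpow_neg_one_add_norm_sq (by simp; linarith)
  refine h.mono' (Measurable.aestronglyMeasurable (by fun_prop)) (.of_forall fun v => ?_)
  rw [Complex.norm_cpow_eq_rpow_re_of_pos (by positivity), Real.norm_eq_abs, sq_abs]
  apply le_of_eq
  congr 1
  simp; ring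

lemma inv_ofReal_cpow {x : ℝ} (hx : 0 < x) (α : ℂ) : ((x⁻¹ : ℝ) : ℂ) ^ α = (x : ℂ) ^ (-α) := by
  rw [Complex.ofReal_inv, Complex.inv_cpow, Complex.cpow_neg]
  rw [Complex.arg_ofReal_of_nonneg hx.le]
  exact Real.pi_pos.ne

/-- Γ(m)(1+v²)^(-m) is the integral of t^(m-1) e^(-t(1+v²)) over t > 0. Integrating first over v
gives a Gaussian and turns Γ(m) into √π Γ(m - 1/2). -/
lemma integral_one_add_sq_cpow {m : ℂ} (hm : 1 / 2 < m.re) :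
    ∫ v : ℝ, ((1 + v ^ 2 : ℝ) : ℂ) ^ (-m) =
      √Real.pi * Complex.Gamma (m - 1 / 2) / Complex.Gamma m := by
  have hm0 : 0 < m.re := by linarith
  have hm1 : 0 < (m - 1 / 2).re := by simp; linarith
  set f : ℝ → ℝ → ℂ := fun t v => (Real.exp (-t * v ^ 2) : ℂ) * ((Real.exp (-t) : ℂ) * (t : ℂ) ^ (m - 1))
    with hf
  have hmeas : AEStronglyMeasurable (Function.uncurry f)
      ((volume.restrict (Set.Ioi 0)).prod volume) := by
    refine Measurable.aestronglyMeasurable ?_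
    simp only [hf, Function.uncurry_def]
    fun_prop
  have hsqrt : ∀ t : ℝ, 0 < t → (√(Real.pi / t) : ℂ) * ((Real.exp (-t) : ℂ) * (t : ℂ) ^ (m - 1)) =
      √Real.pi * ((Real.exp (-t) : ℂ) * (t : ℂ) ^ (m - 1 / 2 - 1)) := by
    intro t ht
    have ht0 : (t : ℂ) ≠ 0 := by exact_mod_cast ht.ne'
    rw [show m - 1 / 2 - 1 = m - 1 + (-(1 / 2) : ℂ) by ring, Complex.cpow_add _ _ ht0,
      Real.sqrt_div Real.pi_pos.le, Complex.cpow_neg]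
    have : (t : ℂ) ^ (1 / 2 : ℂ) = (√t : ℂ) := by
      rw [Real.sqrt_eq_rpow, Complex.ofReal_cpow ht.le]; push_cast; rfl
    rw [this]
    push_cast
    ring
  have hint : Integrable (Function.uncurry f) ((volume.restrict (Set.Ioi 0)).prod volume) := by
    rw [integrable_prod_iff hmeas]
    constructor
    · filter_upwards [ae_restrict_mem measurableSet_Ioi] with t ht
      have h : Integrable fun v : ℝ => (Real.exp (-t * v ^ 2) : ℂ) :=
        (integrable_exp_neg_mul_sq ht).ofReal
      exact h.mul_const ((Real.exp (-t) : ℂ) * (t : ℂ) ^ (m - 1))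
    · have h1 := ((Complex.GammaIntegral_convergent hm1).const_mul (√Real.pi : ℂ)).norm
      refine h1.congr ?_
      filter_upwards [ae_restrict_mem measurableSet_Ioi] with t ht
      rw [← hsqrt t ht]
      simp only [Function.uncurry_apply_pair, hf, norm_mul]
      rw [integral_mul_const]
      congr 1
      simp only [Complex.norm_real, Real.norm_of_nonneg (Real.exp_pos _).le]
      rw [integral_gaussian, Real.norm_of_nonneg (Real.sqrt_nonneg _)]
  have h1 : ∫ t in Set.Ioi (0 : ℝ), ∫ v : ℝ, f t v = √Real.pi * Complex.Gamma (m - 1 / 2) := by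
    rw [Complex.Gamma_eq_integral hm1, Complex.GammaIntegral, ← integral_const_mul]
    refine setIntegral_congr_fun measurableSet_Ioi fun t ht => ?_
    simp only [hf]
    rw [integral_mul_const, integral_complex_ofReal, integral_gaussian]
    exact hsqrt t ht
  have h2 : ∫ v : ℝ, ∫ t in Set.Ioi (0 : ℝ), f t v =
      (∫ v : ℝ, ((1 + v ^ 2 : ℝ) : ℂ) ^ (-m)) * Complex.Gamma m := by
    rw [← integral_mul_const]
    refine integral_congr_ae (.of_forall fun v => ?_)
    have hv : (0 : ℝ) < 1 + v ^ 2 := by positivity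
    have h3 := Complex.integral_cpow_mul_exp_neg_mul_Ioi hm0 hv
    simp only
    rw [← inv_ofReal_cpow hv, Complex.ofReal_inv, ← one_div, ← h3]
    refine integral_congr_ae (.of_forall fun t => ?_)
    simp only [hf]
    rw [← mul_assoc, ← Complex.ofReal_mul, ← Real.exp_add, mul_comm]
    congr 1
    push_cast
    congr 1
    ring
  rw [eq_div_iff (Complex.Gamma_ne_zero_of_re_pos hm0), ← h2, ← h1]
  exact (integral_integral_swap hint).symm

lemma ascPochhammer_two_mul (s : ℂ) (k n : ℕ) :
    (ascPochhammer ℂ (2 * n + 2 * k)).eval (2 * s - 1) =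
      (ascPochhammer ℂ (2 * k)).eval (2 * s - 1) * 4 ^ n *
        (ascPochhammer ℂ n).eval (s + k - 1 / 2) * (ascPochhammer ℂ n).eval (s + k) := by
  induction n with
  | zero => simp
  | succ n ih =>
    rw [show 2 * (n + 1) + 2 * k = 2 * n + 2 * k + 1 + 1 by ring, ascPochhammer_succ_eval,
      ascPochhammer_succ_eval, ascPochhammer_succ_eval, ascPochhammer_succ_eval, ih]
    push_cast
    ring

lemma ne_neg_natCast {z : ℂ} (hz : 0 < z.re) (n : ℕ) : z ≠ -n := by
  rintro rfl
  simp at hz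
  linarith [(Nat.cast_nonneg n : (0 : ℝ) ≤ n)]

lemma Gamma_add_natCast {z : ℂ} (hz : 0 < z.re) (n : ℕ) :
    Complex.Gamma (z + n) = (ascPochhammer ℂ n).eval z * Complex.Gamma z := by
  rw [← Complex.Gamma_add_nat_div_Gamma_eq z (ne_neg_natCast hz),
    div_mul_cancel₀ _ (Complex.Gamma_ne_zero_of_re_pos hz)]

/-- The Gamma quotient replaces one of the two factors (s+k)_n in `hyp` by (s+k-1/2)_n. By
duplication the product (s+k)_n (s+k-1/2)_n is a single Pochhammer symbol of 2s-1, which is what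
makes the integrated series elementary. -/
lemma wcoef_eq_hyp {s : ℂ} (hs : 1 < s.re) (k n : ℕ) :
    hyp s k n * (Complex.Gamma (s + k + n - 1 / 2) / Complex.Gamma (s + k + n)) *
      (ascPochhammer ℂ (2 * k)).eval (2 * s - 1) =
    Complex.Gamma (s + k - 1 / 2) / Complex.Gamma (s + k) * wcoef s (2 * k) n := by
  have hk : (0 : ℝ) ≤ k := Nat.cast_nonneg k
  have h1 : 0 < (s + k).re := by simp; linarith
  have h2 : 0 < (s + k - 1 / 2).re := by simp; linarith
  have h3 : (ascPochhammer ℂ n).eval (s + k) ≠ 0 := ascPochhammer_eval_ne_zero n fun m _ h =>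
    ne_neg_natCast h1 m (eq_neg_of_add_eq_zero_left h)
  have h4 : (4 : ℂ) ^ n ≠ 0 := pow_ne_zero n (by norm_num)
  rw [show s + k + n - 1 / 2 = s + k - 1 / 2 + n by ring, Gamma_add_natCast h1,
    Gamma_add_natCast h2, hyp, wcoef, ascPochhammer_two_mul]
  field_simp

/-- The value of `radR` integrated over the line `1 / r = cosh² t + sinh² t * c²`. -/
lemma integral_radR {s : ℂ} (hs : 1 < s.re) (k : ℕ) {t : ℝ} (ht : 0 < t) :
    (∫ c : ℝ, radR s k (((1 + Real.sinh t ^ 2 * (1 + c ^ 2))⁻¹ : ℝ) : ℂ)) *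
      (Real.sinh t * (ascPochhammer ℂ (2 * k)).eval (2 * s - 1)) =
      √Real.pi * (Complex.Gamma (s + k - 1 / 2) / Complex.Gamma (s + k)) * wt s (2 * k) t := by
  have hk : (0 : ℝ) ≤ k := Nat.cast_nonneg k
  have hc := Real.cosh_pos t
  have hsh := Real.sinh_pos_iff.mpr ht
  set b : ℝ := (Real.cosh t ^ 2)⁻¹ with hb
  have hb0 : 0 < b := by positivity
  have hb1 : b < 1 := inv_cosh_sq_lt_one ht
  have hbc : (b : ℂ) ≠ 0 := by exact_mod_cast hb0.ne'
  set u : ℝ := Real.sinh t / Real.cosh t with hu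
  have hu0 : 0 < u := by positivity
  -- 1 + sinh² t (1 + c²) = cosh² t (1 + (uc)²) with u = tanh t, which separates c from the
  -- expansion variable b.
  have hr : ∀ c : ℝ, (1 + Real.sinh t ^ 2 * (1 + c ^ 2))⁻¹ = b * (1 + (u * c) ^ 2)⁻¹ := by
    intro c
    rw [hb, hu, ← mul_inv]
    congr 1
    field_simp
    rw [Real.cosh_sq]
    ring
  set a : ℕ → ℂ := hyp s k with ha
  set F : ℕ → ℝ → ℂ := fun n c => a n * (b : ℂ) ^ (s + k + n) *
    ((1 + (u * c) ^ 2 : ℝ) : ℂ) ^ (-(s + k + n)) with hF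
  have hα : ∀ n : ℕ, 1 / 2 < (s + k + n : ℂ).re := fun n => by
    have : (0 : ℝ) ≤ n := Nat.cast_nonneg n
    simp; linarith
  have hFint : ∀ n, Integrable (F n) := fun n =>
    ((integrable_one_add_sq_cpow (hα n)).comp_mul_left' hu0.ne').const_mul _
  have hFval : ∀ n, ∫ c, F n c = a n * (b : ℂ) ^ (s + k + n) * ((u⁻¹ : ℝ) *
      (√Real.pi * Complex.Gamma (s + k + n - 1 / 2) / Complex.Gamma (s + k + n))) := by
    intro n
    simp only [hF]
    rw [integral_const_mul,
      Measure.integral_comp_mul_left (fun v : ℝ => ((1 + v ^ 2 : ℝ) : ℂ) ^ (-(s + k + n))),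
      integral_one_add_sq_cpow (hα n), abs_of_pos (by positivity), Complex.real_smul]
  -- Because 1 + (uc)² ≥ 1, the extra exponent n only helps: the c-integrals are all bounded by the
  -- one with n = 0, and b < 1 makes the sum converge.
  have hFsum : Summable fun n => ∫ c, ‖F n c‖ := by
    set K := ∫ c : ℝ, ‖((1 + (u * c) ^ 2 : ℝ) : ℂ) ^ (-(s + k))‖ with hK
    have h1 : Summable fun n => ‖a n * (b : ℂ) ^ n‖ * (b ^ (s + k : ℂ).re * K) :=
      ((polyBdd_hyp hs k).summable_norm (by
        rwa [Complex.norm_real, Real.norm_of_nonneg hb0.le])).mul_right _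
    refine h1.of_nonneg_of_le (fun n => integral_nonneg fun c => norm_nonneg _) fun n => ?_
    rw [hK, ← mul_assoc, ← integral_const_mul]
    have h0 : Integrable fun c : ℝ => ((1 + (u * c) ^ 2 : ℝ) : ℂ) ^ (-(s + k)) :=
      (integrable_one_add_sq_cpow (by simpa using hα 0)).comp_mul_left' hu0.ne'
    refine integral_mono (hFint n).norm (h0.norm.const_mul _) fun c => ?_
    have hv : (1 : ℝ) ≤ 1 + (u * c) ^ 2 := by nlinarith [sq_nonneg (u * c)]
    simp only [hF]
    rw [norm_mul, norm_mul, norm_mul, Complex.norm_cpow_eq_rpow_re_of_pos hb0,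
      Complex.norm_cpow_eq_rpow_re_of_pos (by linarith), Complex.norm_cpow_eq_rpow_re_of_pos
      (by linarith), norm_pow, Complex.norm_real, Real.norm_of_nonneg hb0.le, Complex.add_re,
      Complex.natCast_re, Real.rpow_add hb0, Real.rpow_natCast]
    have h2 : (1 + (u * c) ^ 2) ^ (-(s + k + n) : ℂ).re ≤ (1 + (u * c) ^ 2) ^ (-(s + k) : ℂ).re :=
      Real.rpow_le_rpow_of_exponent_le hv (by
        simp only [Complex.neg_re, Complex.add_re, Complex.natCast_re]
        linarith [(Nat.cast_nonneg n : (0 : ℝ) ≤ n)])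
    calc ‖a n‖ * (b ^ (s + k : ℂ).re * b ^ n) * (1 + (u * c) ^ 2) ^ (-(s + k + n) : ℂ).re
        ≤ ‖a n‖ * (b ^ (s + k : ℂ).re * b ^ n) * (1 + (u * c) ^ 2) ^ (-(s + k) : ℂ).re := by gcongr
      _ = _ := by ring
  have hFtsum : ∀ c : ℝ, radR s k (((1 + Real.sinh t ^ 2 * (1 + c ^ 2))⁻¹ : ℝ) : ℂ) =
      ∑' n, F n c := by
    intro c
    have hv : (0 : ℝ) < 1 + (u * c) ^ 2 := by positivity
    have hr0 : (0 : ℝ) < b * (1 + (u * c) ^ 2)⁻¹ := by positivity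
    rw [hr, radR, powser, pser, ← tsum_mul_left]
    refine tsum_congr fun n => ?_
    simp only [hF]
    rw [mul_left_comm, ← Complex.cpow_natCast, ← Complex.cpow_add _ _ (by exact_mod_cast hr0.ne'),
      Complex.ofReal_mul, Complex.mul_cpow_ofReal_nonneg hb0.le (by positivity),
      inv_ofReal_cpow hv, mul_assoc]
  have hsum := hasSum_integral_of_summable_integral_norm hFint hFsum
  simp only [← hFtsum, hFval] at hsum
  rw [← hsum.tsum_eq, ← tsum_mul_right]
  rw [wt, wser, powser, pser, ← tsum_mul_left, ← tsum_mul_left]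
  refine tsum_congr fun n => ?_
  rw [← hb]
  have h5 := wcoef_eq_hyp hs k n
  have h6 : (b : ℂ) ^ (s + k + n) = (b : ℂ) ^ (s + (((2 * k : ℕ) : ℂ) - 1) / 2) * b ^ n *
      (Real.cosh t : ℂ)⁻¹ := by
    have h7 : (Real.cosh t : ℂ)⁻¹ = (b : ℂ) ^ (1 / 2 : ℂ) := by
      rw [← inv_cosh_sq_cpow_neg_half, ← Complex.cpow_neg]; congr 1; ring
    rw [h7, ← Complex.cpow_natCast, ← Complex.cpow_add _ _ hbc, ← Complex.cpow_add _ _ hbc]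
    congr 1; push_cast; ring
  have h8 : ((u⁻¹ : ℝ) : ℂ) * (Real.cosh t : ℂ)⁻¹ * Real.sinh t = 1 := by
    rw [hu]
    have := hsh.ne'
    have := hc.ne'
    norm_cast
    field_simp
  rw [h6]
  linear_combination (√Real.pi : ℂ) * (b : ℂ) ^ (s + (((2 * k : ℕ) : ℂ) - 1) / 2) * b ^ n * h5 +
    a n * ((b : ℂ) ^ (s + (((2 * k : ℕ) : ℂ) - 1) / 2) * b ^ n) *
      (√Real.pi * Complex.Gamma (s + k + n - 1 / 2) / Complex.Gamma (s + k + n)) *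
      (ascPochhammer ℂ (2 * k)).eval (2 * s - 1) * h8

/-- Legendre's duplication formula for Γ(s+k-1/2) Γ(s+k) cancels every Gamma factor in `cst` and in
the integral. -/
lemma cst_mul_integral_radR {s : ℂ} (hs : 1 < s.re) (k : ℕ) (hk : 1 ≤ k) {t : ℝ} (ht : 0 < t) :
    cst s k * (∫ c : ℝ, radR s k (((1 + Real.sinh t ^ 2 * (1 + c ^ 2))⁻¹ : ℝ) : ℂ)) *
      Real.sinh t = (-1) ^ k * 2 * Complex.exp (-(2 * s - 1 + 2 * k) * t) *
        ∑ i ∈ Finset.range (2 * k), ecoef s (2 * k) i * xvar t ^ (2 * k + i) := by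
  have hk0 : (0 : ℝ) ≤ k := Nat.cast_nonneg k
  have hp : 0 < (2 * s - 1).re := by simp; linarith
  have hp0 : 2 * s - 1 ≠ 0 := fun h => by simp [h] at hp
  have h1 := integral_radR hs k ht
  have h2 := Complex.Gamma_mul_Gamma_add_half (s + k - 1 / 2)
  have h3 := Gamma_add_natCast hp (2 * k)
  have h4 := Complex.Gamma_add_one _ hp0
  have hB : Complex.Gamma (s + k) ≠ 0 := Complex.Gamma_ne_zero_of_re_pos (by simp; linarith)
  have hC : Complex.Gamma (2 * s - 1) ≠ 0 := Complex.Gamma_ne_zero_of_re_pos hp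
  have hP : (ascPochhammer ℂ (2 * k)).eval (2 * s - 1) ≠ 0 :=
    ascPochhammer_eval_ne_zero _ fun m _ h =>
      ne_neg_natCast hp m (eq_neg_of_add_eq_zero_left h)
  have hpi : (√Real.pi : ℂ) ^ 2 = Real.pi := by
    exact_mod_cast Real.sq_sqrt Real.pi_pos.le
  have hpi0 : (Real.pi : ℂ) ≠ 0 := by exact_mod_cast Real.pi_ne_zero
  have hw := wt_succ_eq hs (2 * k - 1) ht
  rw [show 2 * k - 1 + 1 = 2 * k by omega] at hw
  rw [show s + k - 1 / 2 + 1 / 2 = s + k by ring,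
    show 2 * (s + (k : ℂ) - 1 / 2) = 2 * s - 1 + (2 * k : ℕ) by push_cast; ring, h3] at h2
  rw [show 2 * s - 1 + 1 = 2 * s by ring] at h4
  -- The power of 2 in the duplication formula cancels the one coming from the exponential of log 2,
  -- up to a single factor 2.
  have hE : (2 : ℂ) ^ (1 - (2 * s - 1 + (2 * k : ℕ))) *
      Complex.exp ((2 * s - 1 + (((2 * k - 1 : ℕ) : ℂ) + 1)) * (Real.log 2 - t)) =
      2 * Complex.exp (-(2 * s - 1 + 2 * k) * t) := by
    have e : ((2 * k - 1 : ℕ) : ℂ) + 1 = 2 * k := by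
      rw [← Nat.cast_add_one, show 2 * k - 1 + 1 = 2 * k by omega]; push_cast; rfl
    have e2 : Complex.exp (Real.log 2 : ℂ) = 2 := by
      rw [← Complex.ofReal_exp, Real.exp_log two_pos]; simp
    rw [e, Complex.cpow_def_of_ne_zero two_ne_zero, ← Complex.exp_add]
    nth_rewrite 5 [← e2]
    rw [← Complex.exp_add, Complex.ofReal_log two_pos.le]
    congr 1
    push_cast; ring
  rw [cst, h4]
  refine mul_right_cancel₀ hP ?_
  rw [mul_assoc _ (Real.sinh t : ℂ), mul_assoc (_ * _) (∫ c : ℝ, _) _, h1, hw]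
  generalize Complex.exp ((2 * s - 1 + (((2 * k - 1 : ℕ) : ℂ) + 1)) * (Real.log 2 - t)) = E' at *
  generalize Complex.exp (-(2 * s - 1 + 2 * k) * t) = E at *
  generalize (2 : ℂ) ^ (1 - (2 * s - 1 + (2 * k : ℕ))) = T at *
  generalize ∑ i ∈ Finset.range (2 * k), ecoef s (2 * k) i * xvar t ^ (2 * k + i) = S at *
  generalize (ascPochhammer ℂ (2 * k)).eval (2 * s - 1) = A at *
  generalize Complex.Gamma (s + k - 1 / 2) = GA at *
  generalize Complex.Gamma (s + k) = GB at *
  generalize Complex.Gamma (2 * s - 1) = GC at *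
  have h5 : (-1) ^ k * (Real.pi : ℂ)⁻¹ * (GB ^ 2 / ((2 * s - 1) * GC)) *
      (√Real.pi * (GA / GB) * ((2 * s - 1) * E' * S)) =
      (-1) ^ k * (Real.pi : ℂ)⁻¹ * √Real.pi * (GA * GB) * E' * S / GC := by field_simp
  have h6 : (-1) ^ k * (Real.pi : ℂ)⁻¹ * √Real.pi * (A * GC * T * √Real.pi) * E' * S / GC =
      (-1) ^ k * (Real.pi : ℂ)⁻¹ * (√Real.pi : ℂ) ^ 2 * A * (T * E') * S := by field_simp
  rw [h5, h2, h6, hpi, hE]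
  field_simp

/-- The value of the archimedean factor of the local terms. -/
lemma archimedean_factor {s : ℂ} (hs : 1 < s.re) (k : ℕ) (hk : 1 ≤ k) {t : ℝ} (ht : 0 < t) :
    (((2 * Real.sinh t) ^ (2 * k) : ℝ) : ℂ)⁻¹ * (cst s k * ((Real.sinh t ^ (4 * k) : ℝ) : ℂ) *
      ∫ c : ℝ, radR s k (((1 + Real.sinh t ^ 2 * (1 + c ^ 2))⁻¹ : ℝ) : ℂ)) =
      (-1) ^ k * (4 / 16 ^ k) * (∑ i ∈ Finset.range (2 * k), ecoef s (2 * k) i * xvar t ^ (i + 1)) *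
        Complex.exp (-(2 * t) * s) := by
  obtain ⟨l, rfl⟩ := Nat.exists_eq_add_of_le' hk
  have h1 := cst_mul_integral_radR hs (l + 1) hk ht
  -- With k = l + 1, the factor X^(2k-1) is split off because (2X sinh t)^(2k-1) = e^((2k-1)t),
  -- which reduces the exponential to e^(-2ts) = N(P)^(-s).
  have hsum : ∑ i ∈ Finset.range (2 * (l + 1)), ecoef s (2 * (l + 1)) i *
      xvar t ^ (2 * (l + 1) + i) = xvar t ^ (2 * l + 1) *
      ∑ i ∈ Finset.range (2 * (l + 1)), ecoef s (2 * (l + 1)) i * xvar t ^ (i + 1) := by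
    rw [Finset.mul_sum]
    exact Finset.sum_congr rfl fun i _ => by ring
  have hsh : (Real.sinh t : ℂ) ≠ 0 := by exact_mod_cast (Real.sinh_pos_iff.mpr ht).ne'
  have hx := sinh_eq_xvar ht
  have hE : Complex.exp (-(2 * s - 1 + 2 * ((l + 1 : ℕ) : ℂ)) * t) *
      Complex.exp t ^ (2 * l + 1) = Complex.exp (-(2 * t) * s) := by
    rw [← Complex.exp_nat_mul, ← Complex.exp_add]
    congr 1
    push_cast; ring
  rw [hsum] at h1
  rw [← hE, ← hx]
  generalize ∑ i ∈ Finset.range (2 * (l + 1)), ecoef s (2 * (l + 1)) i * xvar t ^ (i + 1) = S at *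
  generalize Complex.exp (-(2 * s - 1 + 2 * ((l + 1 : ℕ) : ℂ)) * t) = E at *
  generalize (∫ c : ℝ, radR s (l + 1) (((1 + Real.sinh t ^ 2 * (1 + c ^ 2))⁻¹ : ℝ) : ℂ)) = I at *
  push_cast
  have e16 : (16 : ℂ) ^ (l + 1) = 2 ^ (2 * (l + 1)) * (2 ^ (2 * l + 1) * 2) := by
    rw [show (16 : ℂ) = 2 ^ 4 by norm_num, ← pow_mul]; ring
  have h2 : (Real.sinh t : ℂ) ^ (4 * (l + 1)) = Real.sinh t * (Real.sinh t ^ (2 * l + 1) *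
    Real.sinh t ^ (2 * (l + 1))) := by ring
  rw [e16]
  rw [mul_pow]
  have h20 : (2 : ℂ) ^ (2 * (l + 1)) ≠ 0 := pow_ne_zero _ two_ne_zero
  have h21 : (2 : ℂ) ^ (2 * l + 1) ≠ 0 := pow_ne_zero _ two_ne_zero
  have h22 : (Real.sinh t : ℂ) ^ (2 * (l + 1)) ≠ 0 := pow_ne_zero _ hsh
  rw [← Complex.ofReal_sinh, h2, mul_pow, mul_pow]
  calc _ = (2 ^ (2 * (l + 1)))⁻¹ * (Real.sinh t : ℂ) ^ (2 * l + 1) *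
      (cst s (l + 1) * I * Real.sinh t) := by field_simp
    _ = _ := by
      rw [h1]
      field_simp
      ring

/-! ### Period integrals -/

lemma differentiableAt_comp_ofComplex {f : ℍ → ℂ} (hf : MDiff f) {w : ℂ} (hw : 0 < w.im) :
    DifferentiableAt ℂ (fun w => f (ofComplex w)) w :=
  ((UpperHalfPlane.mdifferentiable_iff.mp hf) w hw).differentiableAt
    (isOpen_upperHalfPlaneSet.mem_nhds hw)

lemma exists_primitive {φ : ℂ → ℂ} (hφ : ∀ w : ℂ, 0 < w.im → DifferentiableAt ℂ φ w) :
    ∃ F : ℂ → ℂ, ∀ w : ℂ, 0 < w.im → HasDerivAt F (φ w) w := by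
  obtain ⟨F, hF⟩ := (convex_halfSpace_im_gt 0).exists_forall_hasDerivWithinAt (f := φ)
    fun w hw => (hφ w hw).differentiableWithinAt
  exact ⟨F, fun w hw => (hF w hw).hasDerivAt (isOpen_upperHalfPlaneSet.mem_nhds hw)⟩

lemma eq_of_hasDerivAt_zero {F : ℂ → ℂ} (hF : ∀ w : ℂ, 0 < w.im → HasDerivAt F 0 w) {w w' : ℂ}
    (hw : 0 < w.im) (hw' : 0 < w'.im) : F w = F w' := by
  refine (convex_halfSpace_im_gt 0).is_const_of_fderivWithin_eq_zero (𝕜 := ℂ)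
    (fun x hx => (hF x hx).differentiableAt.differentiableWithinAt) (fun x hx => ?_) hw hw'
  rw [(hF x hx).hasFDerivAt.hasFDerivWithinAt.fderivWithin
    (isOpen_upperHalfPlaneSet.uniqueDiffWithinAt hx)]
  ext; simp

lemma hasDerivAt_moebius (τ : SL(2, ℝ)) {w : ℂ} (hw : 0 < w.im) :
    HasDerivAt (fun w : ℂ => ((τ 0 0 : ℂ) * w + (τ 0 1 : ℂ)) / jfac τ w) ((jfac τ w ^ 2)⁻¹) w := by
  have hj : jfac τ w ≠ 0 := jfac_ne_zero_of_im hw.ne'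
  have h1 : HasDerivAt (fun w : ℂ => (τ 0 0 : ℂ) * w + (τ 0 1 : ℂ)) (τ 0 0 : ℂ) w := by
    simpa using ((hasDerivAt_id w).const_mul (τ 0 0 : ℂ)).add_const (τ 0 1 : ℂ)
  have h2 : HasDerivAt (jfac τ) (τ 1 0 : ℂ) w := by
    change HasDerivAt (fun w : ℂ => (τ 1 0 : ℂ) * w + (τ 1 1 : ℂ)) _ w
    simpa using ((hasDerivAt_id w).const_mul (τ 1 0 : ℂ)).add_const (τ 1 1 : ℂ)
  refine (h1.div h2 hj).congr_deriv ?_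
  rw [div_eq_iff (pow_ne_zero 2 hj), inv_mul_cancel₀ (pow_ne_zero 2 hj), jfac]
  linear_combination det_eq_complex τ

/-- The period of a cusp form along a closed geodesic, computed by a primitive in the coordinates
in which the geodesic is the imaginary axis. -/
lemma exists_period_primitive {k : ℕ} (hk : 1 ≤ k) {g : ℍ → ℂ} (hg : MDiff g) {γ τ : SL(2, ℝ)}
    {a : ℝ} (hd : IsDiag (τ * γ * τ⁻¹) a)
    (hγ : ∀ z : ℍ, g (γ • z) = jfac γ z ^ (4 * k) * g z) :
    ∃ (F : ℂ → ℂ) (A : ℂ),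
      (∀ w : ℂ, 0 < w.im → HasDerivAt F (w ^ (2 * k - 1) * twist k g τ (ofComplex w)) w) ∧
      (∀ w : ℂ, 0 < w.im → F (((a ^ 2 : ℝ) : ℂ) * w) - F w = A) ∧
      ∀ z₀ : ℍ, period k g γ z₀ = ((a⁻¹ - a : ℝ) : ℂ) ^ (2 * k - 1) * A := by
  have ha := hd.ne_zero
  have hac : (a : ℂ) ≠ 0 := by exact_mod_cast ha
  have ha2 := hd.sq_pos
  have him : ∀ w : ℂ, 0 < w.im → 0 < (((a ^ 2 : ℝ) : ℂ) * w).im := fun w hw => by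
    rw [Complex.im_ofReal_mul]; positivity
  obtain ⟨F, hF⟩ := exists_primitive (φ := fun w => w ^ (2 * k - 1) * twist k g τ (ofComplex w))
    fun w hw => (differentiableAt_pow _).mul (differentiableAt_comp_ofComplex (twist_mdiff hg τ) hw)
  -- The differential w^(2k-1) g_τ(w) dw is invariant under w ↦ a²w: the powers of a are 2(2k-1),
  -- -4k and 2, with sum 0.
  have hFN : ∀ w : ℂ, 0 < w.im →
      HasDerivAt (fun w => F (((a ^ 2 : ℝ) : ℂ) * w) - F w) 0 w := by
    intro w hw
    have h1 := (hF _ (him w hw)).comp w ((hasDerivAt_id w).const_mul ((a ^ 2 : ℝ) : ℂ))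
    refine (h1.sub (hF w hw)).congr_deriv ?_
    have h2 : ofComplex (((a ^ 2 : ℝ) : ℂ) * w) = (τ * γ * τ⁻¹) • ofComplex w := by
      apply UpperHalfPlane.ext
      rw [hd.coe_smul, ofComplex_apply_of_im_pos hw, ofComplex_apply_of_im_pos (him w hw)]
    rw [h2, twist_smul hγ, jfac, hd.e10, hd.e11]
    obtain ⟨l, rfl⟩ := Nat.exists_eq_add_of_le' hk
    rw [show 2 * (l + 1) - 1 = 2 * l + 1 by omega, sub_eq_zero]
    push_cast
    rw [zero_mul, zero_add, mul_one, mul_pow, ← pow_mul, inv_pow,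
      show 4 * (l + 1) = 2 * (2 * l + 1) + 2 by ring, pow_add]
    field_simp
    ring
  refine ⟨F, F (((a ^ 2 : ℝ) : ℂ) * Complex.I) - F Complex.I, hF,
    fun w hw => eq_of_hasDerivAt_zero hFN hw (by simp), fun z₀ => ?_⟩
  set m : ℂ → ℂ := fun w => ((τ 0 0 : ℂ) * w + (τ 0 1 : ℂ)) / jfac τ w with hm
  have hmz : ∀ z : ℍ, m z = (τ • z : ℍ) := fun z => (coe_smul_eq τ z).symm
  -- Q_γ(z) = (a⁻¹ - a) · τz · j(τ, z)², and the automorphy factors cancel against those of g_τ and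
  -- of d(τz). So F ∘ τ, times the constant, is a primitive of the period integrand, and
  -- independence of z₀ follows.
  have hG : ∀ w : ℂ, 0 < w.im → HasDerivAt (fun w => ((a⁻¹ - a : ℝ) : ℂ) ^ (2 * k - 1) * F (m w))
      (quad γ w ^ (2 * k - 1) * g (ofComplex w)) w := by
    intro w hw
    obtain ⟨z, rfl⟩ : ∃ z : ℍ, (z : ℂ) = w := ⟨⟨w, hw⟩, rfl⟩
    have h1 : HasDerivAt F _ (m z) := hF (m z) (by rw [hmz]; exact (τ • z).im_pos)
    refine ((h1.comp (z : ℂ) (hasDerivAt_moebius τ hw)).const_mul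
      (((a⁻¹ - a : ℝ) : ℂ) ^ (2 * k - 1))).congr_deriv ?_
    have h2 := quad_conj (τ * γ * τ⁻¹) τ z
    rw [show τ⁻¹ * (τ * γ * τ⁻¹) * τ = γ by group, hd.quad] at h2
    have hj := jfac_ne_zero τ z
    rw [hmz, ofComplex_apply, ofComplex_apply, apply_eq_twist, h2]
    obtain ⟨l, rfl⟩ := Nat.exists_eq_add_of_le' hk
    rw [show 2 * (l + 1) - 1 = 2 * l + 1 by omega, mul_pow, mul_pow, ← pow_mul,
      show 4 * (l + 1) = 2 * (2 * l + 1) + 2 by ring, pow_add]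
    field_simp
    ring
  set d : ℂ := ((γ • z₀ : ℍ) : ℂ) - z₀ with hd'
  have hseg : ∀ t ∈ Set.uIcc (0 : ℝ) 1, 0 < ((z₀ : ℂ) + t * d).im := by
    intro t ht
    rw [Set.uIcc_of_le zero_le_one] at ht
    have h1 := z₀.im_pos
    have h2 := (γ • z₀).im_pos
    have e : ((z₀ : ℂ) + t * d).im = (1 - t) * z₀.im + t * (γ • z₀).im := by
      rw [hd', Complex.add_im, Complex.im_ofReal_mul, Complex.sub_im, coe_im, coe_im]; ring
    rw [e]
    rcases ht.1.eq_or_lt with rfl | h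
    · simpa using h1
    · nlinarith [ht.2, mul_pos h h2, mul_nonneg (sub_nonneg.mpr ht.2) h1.le]
  have hline : ∀ t : ℝ, HasDerivAt (fun t : ℝ => (z₀ : ℂ) + t * d) d t := fun t => by
    simpa using (((hasDerivAt_id (t : ℂ)).mul_const d).const_add (z₀ : ℂ)).comp_ofReal
  have hftc := intervalIntegral.integral_eq_sub_of_hasDerivAt (a := 0) (b := 1)
    (f := fun t : ℝ => ((a⁻¹ - a : ℝ) : ℂ) ^ (2 * k - 1) * F (m ((z₀ : ℂ) + t * d)))
    (f' := fun t : ℝ => quad γ ((z₀ : ℂ) + t * d) ^ (2 * k - 1) *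
      g (ofComplex ((z₀ : ℂ) + t * d)) * d)
    (fun t ht => HasDerivAt.comp (h₂ := fun w => ((a⁻¹ - a : ℝ) : ℂ) ^ (2 * k - 1) * F (m w)) t
      (hG _ (hseg t ht)) (hline t)) (by
      refine ContinuousOn.intervalIntegrable fun t ht => ?_
      have hc := (hline t).continuousAt
      refine ContinuousAt.continuousWithinAt ?_
      refine (ContinuousAt.mul (ContinuousAt.pow ?_ _) ?_).mul continuousAt_const
      · simp only [quad]; fun_prop
      · exact ContinuousAt.comp (f := fun t : ℝ => (z₀ : ℂ) + t * d)
          (differentiableAt_comp_ofComplex hg (hseg t ht)).continuousAt hc)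
  rw [period]
  refine hftc.trans ?_
  have e1 : (z₀ : ℂ) + ((1 : ℝ) : ℂ) * d = (γ • z₀ : ℍ) := by rw [hd']; push_cast; ring
  have e2 : (τ • γ • z₀ : ℍ) = (τ * γ * τ⁻¹) • τ • z₀ := by
    rw [smul_smul, smul_smul]; congr 1; group
  simp only [e1]
  rw [Complex.ofReal_zero, zero_mul, add_zero, hmz, hmz, ← mul_sub, e2, hd.coe_smul]
  congr 1
  exact eq_of_hasDerivAt_zero hFN (τ • z₀).im_pos (by simp)

/-! ### Integration along rays -/

/-- The measure `dc dy / y`. -/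
def rayMeas : Measure (ℝ × ℝ) :=
  (volume : Measure ℝ).prod ((volume.restrict (Set.Ioi 0)).withDensity
    fun y => ENNReal.ofReal (1 / y))

lemma lintegral_rayMeas (f : ℝ × ℝ → ENNReal) (hf : Measurable f) :
    ∫⁻ p, f p ∂rayMeas =
      ∫⁻ y in Set.Ioi (0 : ℝ), ∫⁻ c : ℝ, f (c, y) * ENNReal.ofReal (1 / y) := by
  rw [rayMeas, lintegral_prod_symm' _ hf, lintegral_withDensity_eq_lintegral_mul _
    (by fun_prop) hf.lintegral_prod_left']
  refine lintegral_congr fun y => ?_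
  simp only [Pi.mul_apply]
  rw [lintegral_mul_const _ (by fun_prop), mul_comm]

lemma measurePreserving_ray :
    MeasurePreserving (fun p : ℝ × ℝ => (p.1 * p.2, p.2)) rayMeas hypMeas := by
  have hm : Measurable fun p : ℝ × ℝ => (p.1 * p.2, p.2) := by fun_prop
  refine ⟨hm, ?_⟩
  ext s hs
  have hs1 : Measurable (s.indicator (1 : ℝ × ℝ → ENNReal)) := measurable_one.indicator hs
  rw [Measure.map_apply hm hs, ← lintegral_indicator_one (hm hs), ← lintegral_indicator_one hs,
    lintegral_hypMeas _ hs1, lintegral_rayMeas _ (measurable_one.indicator (hm hs))]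
  refine setLIntegral_congr_fun measurableSet_Ioi fun y hy => ?_
  have hy0 : (0 : ℝ) < y := hy
  have hsy : Measurable fun x : ℝ => s.indicator (1 : ℝ × ℝ → ENNReal) (x, y) :=
    hs1.comp measurable_prodMk_right
  have h1 : ∫⁻ x : ℝ, s.indicator (1 : ℝ × ℝ → ENNReal) (x, y) =
      ENNReal.ofReal |y| * ∫⁻ c : ℝ, s.indicator (1 : ℝ × ℝ → ENNReal) (c * y, y) := by
    conv_lhs => rw [← Real.smul_map_volume_mul_right hy0.ne']
    rw [lintegral_smul_measure, lintegral_map hsy (by fun_prop), smul_eq_mul]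
  rw [lintegral_mul_const _ (by exact (measurable_one.indicator (hm hs)).comp measurable_prodMk_right),
    lintegral_mul_const _ hsy, h1, abs_of_pos hy0]
  have h2 : ENNReal.ofReal (1 / y) = ENNReal.ofReal y * ENNReal.ofReal (1 / y ^ 2) := by
    rw [← ENNReal.ofReal_mul hy0.le]
    congr 1
    field_simp
  rw [h2]
  have h3 : ∀ c : ℝ, ((fun p : ℝ × ℝ => (p.1 * p.2, p.2)) ⁻¹' s).indicator
      (1 : ℝ × ℝ → ENNReal) (c, y) = s.indicator 1 (c * y, y) := fun c => rfl
  simp only [h3]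
  rw [← mul_assoc, mul_comm (ENNReal.ofReal y)]

lemma integral_eq_ray {F : ℍ → ℂ} (hF : Integrable F) :
    ∫ z, F z = ∫ c : ℝ, ∫ y in Set.Ioi (0 : ℝ), ((1 / y : ℝ) : ℂ) * F (toH (c * y, y)) := by
  have hmp : MeasurePreserving (fun p : ℝ × ℝ => toH (p.1 * p.2, p.2)) rayMeas volume :=
    measurePreserving_toH.comp measurePreserving_ray
  have hae : AEStronglyMeasurable F (Measure.map (fun p : ℝ × ℝ => toH (p.1 * p.2, p.2)) rayMeas) := by
    rw [hmp.map_eq]; exact hF.1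
  rw [← hmp.map_eq, integral_map hmp.measurable.aemeasurable hae]
  have hF' : Integrable (fun p : ℝ × ℝ => F (toH (p.1 * p.2, p.2))) rayMeas :=
    hmp.integrable_comp_of_integrable hF
  unfold rayMeas at hF' ⊢
  rw [integral_prod _ hF']
  refine integral_congr_ae (.of_forall fun c => ?_)
  simp only
  rw [integral_withDensity_eq_integral_toReal_smul (by fun_prop)
    (.of_forall fun _ => ENNReal.ofReal_lt_top)]
  refine setIntegral_congr_fun measurableSet_Ioi fun y hy => ?_
  have hy0 : (0 : ℝ) < y := hy
  rw [ENNReal.toReal_ofReal (by positivity), Complex.real_smul]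

/-- The contribution of a ray to an integral over a half-annulus. -/
lemma integral_ray_annulus {f : ℍ → ℂ} {F : ℂ → ℂ} {k : ℕ} (hk : 1 ≤ k)
    (hf : Continuous f)
    (hF : ∀ w : ℂ, 0 < w.im → HasDerivAt F (w ^ (2 * k - 1) * f (ofComplex w)) w) {N : ℝ}
    (hN : 1 < N) {A : ℂ} (hA : ∀ w : ℂ, 0 < w.im → F (N * w) - F w = A) (c : ℝ) :
    ∫ y in Set.Ioi (0 : ℝ), ((1 / y : ℝ) : ℂ) * {z : ℍ | 1 ≤ ‖(z : ℂ)‖ ∧ ‖(z : ℂ)‖ < N}.indicator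
      (fun z => ((z : ℂ) ^ (2 * k))⁻¹ * conj (f z) * ((z.im ^ (4 * k) : ℝ) : ℂ))
        (toH (c * y, y)) = (((1 + c ^ 2) ^ (2 * k) : ℝ) : ℂ)⁻¹ * conj A := by
  set ω : ℂ := c + Complex.I with hω
  have hωim : ω.im = 1 := by simp [hω]
  have hω0 : ω ≠ 0 := fun h => by simp [h] at hωim
  set β : ℝ := ‖ω‖ with hβ
  have hβ0 : 0 < β := norm_pos_iff.mpr hω0
  have hβ2 : (ω * conj ω) = ((1 + c ^ 2 : ℝ) : ℂ) := by
    rw [hω, map_add, Complex.conj_ofReal, Complex.conj_I]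
    push_cast
    linear_combination -Complex.I_sq
  have hray : ∀ y : ℝ, 0 < y → (toH (c * y, y) : ℂ) = y * ω := fun y hy => by
    rw [coe_toH hy, hω]; push_cast; ring
  have him : ∀ y : ℝ, 0 < y → 0 < ((y : ℂ) * ω).im := fun y hy => by
    rw [Complex.im_ofReal_mul, hωim, mul_one]; exact hy
  have hset : ∀ y : ℝ, 0 < y →
      (toH (c * y, y) ∈ {z : ℍ | 1 ≤ ‖(z : ℂ)‖ ∧ ‖(z : ℂ)‖ < N} ↔ y ∈ Set.Ico (1 / β) (N / β)) := by
    intro y hy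
    rw [Set.mem_ofPred_eq, hray y hy, norm_mul, Complex.norm_real, Real.norm_of_nonneg hy.le,
      Set.mem_Ico, div_le_iff₀ hβ0, lt_div_iff₀ hβ0]
  have hle : 1 / β ≤ N / β := by gcongr
  -- On the ray z = yω one has z^(-2k) = z̄^(2k) y^(-4k) (1+c²)^(-2k), so the integrand is
  -- (1+c²)^(-2k) times the conjugate of z^(2k-1) f(z) dz/dy.
  have h1 : ∫ y in Set.Ioi (0 : ℝ), ((1 / y : ℝ) : ℂ) *
      {z : ℍ | 1 ≤ ‖(z : ℂ)‖ ∧ ‖(z : ℂ)‖ < N}.indicator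
      (fun z => ((z : ℂ) ^ (2 * k))⁻¹ * conj (f z) * ((z.im ^ (4 * k) : ℝ) : ℂ))
        (toH (c * y, y)) = ∫ y in Set.Ioi (0 : ℝ), (Set.Ico (1 / β) (N / β)).indicator
      (fun y : ℝ => (((1 + c ^ 2) ^ (2 * k) : ℝ) : ℂ)⁻¹ *
        conj (((y : ℂ) * ω) ^ (2 * k - 1) * f (ofComplex (y * ω)) * ω)) y := by
    refine setIntegral_congr_fun measurableSet_Ioi fun y hy => ?_
    have hy0 : (0 : ℝ) < y := hy
    have hyc : (y : ℂ) ≠ 0 := by exact_mod_cast hy0.ne'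
    by_cases hm : y ∈ Set.Ico (1 / β) (N / β)
    · rw [Set.indicator_of_mem hm, Set.indicator_of_mem ((hset y hy0).mpr hm), hray y hy0,
        toH_im hy0]
      have e1 : toH (c * y, y) = ofComplex (y * ω) := by
        apply UpperHalfPlane.ext
        rw [hray y hy0, ofComplex_apply_of_im_pos (him y hy0)]
      rw [e1, map_mul, map_mul, map_pow, map_mul, Complex.conj_ofReal]
      have e2 : (((1 + c ^ 2) ^ (2 * k) : ℝ) : ℂ) = ω ^ (2 * k) * conj ω ^ (2 * k) := by
        rw [← mul_pow, hβ2]; push_cast; rfl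
      have hω' : conj ω ≠ 0 := by simpa using hω0
      rw [e2]
      obtain ⟨l, rfl⟩ := Nat.exists_eq_add_of_le' hk
      rw [show 2 * (l + 1) - 1 = 2 * l + 1 by omega]
      push_cast
      rw [mul_pow, mul_pow]
      field_simp
      ring
    · rw [Set.indicator_of_notMem hm, Set.indicator_of_notMem (mt (hset y hy0).mp hm), mul_zero]
  have hsub : Set.Ico (1 / β) (N / β) ⊆ Set.Ioi 0 := fun y hy =>
    lt_of_lt_of_le (by positivity) hy.1
  have hderiv : ∀ y ∈ Set.uIcc (1 / β) (N / β), HasDerivAt (fun y : ℝ => F (y * ω))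
      (((y : ℂ) * ω) ^ (2 * k - 1) * f (ofComplex (y * ω)) * ω) y := by
    intro y hy
    rw [Set.uIcc_of_le hle] at hy
    have hy0 : 0 < y := lt_of_lt_of_le (by positivity) hy.1
    have h2 : HasDerivAt (fun y : ℝ => (y : ℂ) * ω) ω y := by
      simpa using ((hasDerivAt_id (y : ℂ)).mul_const ω).comp_ofReal
    exact HasDerivAt.comp (h₂ := F) y (hF _ (him y hy0)) h2
  have hint : IntervalIntegrable (fun y : ℝ => ((y : ℂ) * ω) ^ (2 * k - 1) *
      f (ofComplex (y * ω)) * ω) volume (1 / β) (N / β) := by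
    refine ContinuousOn.intervalIntegrable fun y hy => ?_
    rw [Set.uIcc_of_le hle] at hy
    have hy0 : 0 < y := lt_of_lt_of_le (by positivity) hy.1
    refine ContinuousAt.continuousWithinAt ?_
    have h2 : ContinuousAt (fun y : ℝ => (y : ℂ) * ω) y := by fun_prop
    refine ((h2.pow _).mul ?_).mul continuousAt_const
    have h3 : ContinuousAt (fun w : ℂ => f (ofComplex w)) (y * ω) :=
      hf.continuousAt.comp (contMDiffAt_ofComplex (n := 0) (him y hy0)).continuousAt
    exact ContinuousAt.comp (f := fun y : ℝ => (y : ℂ) * ω) h3 h2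
  rw [h1, setIntegral_indicator measurableSet_Ico, Set.inter_eq_self_of_subset_right hsub,
    integral_const_mul, integral_Ico_eq_integral_Ioc, integral_conj,
    ← intervalIntegral.integral_of_le hle, intervalIntegral.integral_eq_sub_of_hasDerivAt hderiv hint,
    ← hA _ (him (1 / β) (by positivity))]
  rw [show ((N / β : ℝ) : ℂ) * ω = N * (((1 / β : ℝ) : ℂ) * ω) by push_cast; ring]

/-! ### Evaluation of the local terms -/

lemma rrScale_eq {R : SL(2, ℝ)} {a t : ℝ} (h : IsDiag R a) (ht : a ^ 2 = Real.exp (2 * t)) {c y : ℝ}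
    (hy : 0 < y) :
    rrScale (a ^ 2) (toH (c * y, y)) = (1 + Real.sinh t ^ 2 * (1 + c ^ 2))⁻¹ := by
  have ha := h.ne_zero
  have e1 : (a⁻¹ - a) ^ 2 = 4 * Real.sinh t ^ 2 := by
    have e2 : (a⁻¹ - a) ^ 2 = (a ^ 2)⁻¹ - 2 + a ^ 2 := by field_simp; ring
    have e3 : Real.exp t * Real.exp (-t) = 1 := by rw [← Real.exp_add]; simp
    rw [e2, ht, ← Real.exp_neg, Real.sinh_eq, two_mul, neg_add, Real.exp_add, Real.exp_add]
    linear_combination 2 * e3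
  have e4 : ‖(toH (c * y, y) : ℂ)‖ ^ 2 = y ^ 2 * (1 + c ^ 2) := by
    rw [coe_toH hy, ← Complex.normSq_eq_norm_sq, Complex.normSq_apply]
    simp
    ring
  rw [← rr_eq_rrScale h, rr_self_smul, disp, h.quad, norm_mul, mul_pow, Complex.norm_real,
    Real.norm_eq_abs, sq_abs, e1, e4, toH_im hy]
  congr 2
  field_simp

lemma exp_pow_div {t : ℝ} (ht : 0 < t) (k : ℕ) : Real.exp (2 * t) ^ k /
    (Real.exp (2 * t) - 1) ^ (2 * k) = ((2 * Real.sinh t) ^ (2 * k))⁻¹ := by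
  have hs := Real.sinh_pos_iff.mpr ht
  have e3 : Real.exp t * Real.exp (-t) = 1 := by rw [← Real.exp_add]; simp
  have e1 : Real.exp (2 * t) - 1 = Real.exp t * (2 * Real.sinh t) := by
    rw [Real.sinh_eq, two_mul, Real.exp_add]
    linear_combination e3
  have e2 : Real.exp (2 * t) = Real.exp t ^ 2 := by rw [← Real.exp_nat_mul]; push_cast; rfl
  rw [e1, mul_pow, e2, ← pow_mul]
  have := Real.exp_pos t
  field_simp

/-- Here (1-r)/r = sinh² t (1+c²), and its power 2k cancels the factor (1+c²)^(-2k) left by the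
integral along the ray. -/
lemma radial_sinh_cosh (k : ℕ) (s : ℂ) {t : ℝ} (c : ℝ) :
    radial k s (1 + Real.sinh t ^ 2 * (1 + c ^ 2))⁻¹ * (((1 + c ^ 2) ^ (2 * k) : ℝ) : ℂ)⁻¹ =
      cst s k * ((Real.sinh t ^ (4 * k) : ℝ) : ℂ) *
        radR s k (((1 + Real.sinh t ^ 2 * (1 + c ^ 2))⁻¹ : ℝ) : ℂ) := by
  have h1 : 0 < 1 + Real.sinh t ^ 2 * (1 + c ^ 2) := by positivity
  have h2 : (0 : ℝ) < 1 + c ^ 2 := by positivity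
  rw [radial_eq k s (by positivity)]
  set q : ℝ := 1 + Real.sinh t ^ 2 * (1 + c ^ 2) with hq
  have hqc : (q : ℂ) ≠ 0 := by exact_mod_cast h1.ne'
  have h2c : ((1 + c ^ 2 : ℝ) : ℂ) ≠ 0 := by exact_mod_cast h2.ne'
  have e : (((q⁻¹ : ℝ) : ℂ) - 1) ^ (2 * k) / ((q⁻¹ : ℝ) : ℂ) ^ (2 * k) =
      ((Real.sinh t ^ (4 * k) : ℝ) : ℂ) * (((1 + c ^ 2) ^ (2 * k) : ℝ) : ℂ) := by
    rw [← div_pow]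
    have e1 : (((q⁻¹ : ℝ) : ℂ) - 1) / ((q⁻¹ : ℝ) : ℂ) =
        -((Real.sinh t ^ 2 * (1 + c ^ 2) : ℝ) : ℂ) := by
      have e2 : ((Real.sinh t ^ 2 * (1 + c ^ 2) : ℝ) : ℂ) = q - 1 := by rw [hq]; push_cast; ring
      rw [e2]
      push_cast
      field_simp
      ring
    rw [e1, (even_two_mul k).neg_pow, ← Complex.ofReal_mul, ← Complex.ofReal_pow, mul_pow, ← pow_mul,
      show 2 * (2 * k) = 4 * k by ring]
  rw [mul_div_assoc, e, Complex.ofReal_pow (1 + c ^ 2)]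
  field_simp

section

variable {Γ : Subgroup SL(2, ℝ)} {P P₀ : Γ} {τ : SL(2, ℝ)} {k : ℕ}

/-- The local term as a product of a period and an archimedean factor. -/
lemma IsLocalDatum.localTerm_eq_sum (h : IsLocalDatum Γ P P₀ τ) (hk : 1 ≤ k)
    (g : CuspFormsFourK Γ k) {s : ℂ} (hs : 1 < s.re)
    (hint : IntegrableOn (localIntegrand k s g P τ) (halfAnnulus P₀)) (z₀ : ℍ) :
    localTerm k s g P P₀ τ = (-1) ^ (k + 1) * normPeriod k g P₀ z₀ *
      (∑ j ∈ Finset.Icc 1 (2 * k), pPoly k j s *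
        ((nrm P / (nrm P - 1) : ℝ) : ℂ) ^ j) * (nrm P : ℂ) ^ (-s) := by
  obtain ⟨a, ha, hN0, ha1, hsgn⟩ := h.isDiag
  obtain ⟨n, hn, hP, hd, hN, hd1⟩ := h.isDiag_pow ha ha1
  obtain ⟨F, A, hF, hA, hper⟩ := exists_period_primitive hk (cuspForm_mdiff g) ha
    (fun z => cuspForm_smul g P₀ z)
  set N := nrm (P : SL(2, ℝ)) with hNdef
  have hN1 : 1 < N := by rw [hN]; exact hd1
  set t : ℝ := Real.log N / 2 with htdef
  have ht : 0 < t := by have := Real.log_pos hN1; positivity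
  have hNt : N = Real.exp (2 * t) := by
    rw [htdef, mul_div_cancel₀ _ two_ne_zero, Real.exp_log (by linarith)]
  -- the integral
  have hmeas : MeasurableSet (halfAnnulus (P₀ : SL(2, ℝ))) := by
    have h1 : Continuous fun z : ℍ => ‖(z : ℂ)‖ := continuous_norm.comp continuous_coe
    exact (measurableSet_le measurable_const h1.measurable).inter
      (measurableSet_lt h1.measurable measurable_const)
  have hI : ∫ z in halfAnnulus P₀, localIntegrand k s g P τ z =
      (cst s k * ((Real.sinh t ^ (4 * k) : ℝ) : ℂ) *
        ∫ c : ℝ, radR s k (((1 + Real.sinh t ^ 2 * (1 + c ^ 2))⁻¹ : ℝ) : ℂ)) * conj A := by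
    rw [← integral_indicator hmeas, integral_eq_ray ((integrable_indicator_iff hmeas).mpr hint),
      ← integral_const_mul, ← integral_mul_const]
    refine integral_congr_ae (.of_forall fun c => ?_)
    simp only
    rw [← radial_sinh_cosh k s c, mul_assoc, ← integral_ray_annulus hk
      (twist_mdiff (cuspForm_mdiff g) τ).continuous hF (N := nrm P₀) (by rw [hN0]; exact ha1)
      (by rw [hN0]; exact hA) c, ← integral_const_mul]
    refine setIntegral_congr_fun measurableSet_Ioi fun y hy => ?_
    have hy0 : (0 : ℝ) < y := hy
    rw [← rrScale_eq hd (hN ▸ hNt) hy0, ← hN]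
    change _ = _ * (_ * (halfAnnulus (P₀ : SL(2, ℝ))).indicator _ _)
    simp only [Set.indicator]
    split_ifs
    · rw [localIntegrand, ← hNdef]; ring
    · simp
  -- the period
  set l : ℝ := Real.log (nrm P₀) / 2 with hl
  have hl0 : 0 < l := by
    have := Real.log_pos (hN0 ▸ ha1 : 1 < nrm (P₀ : SL(2, ℝ)))
    positivity
  set ε : ℝ := Real.sign (P₀ : SL(2, ℝ)).1.trace with hε
  have hε2 : ε = 1 ∨ ε = -1 := by
    rcases Real.sign_apply_eq_of_ne_zero _ (show (P₀ : SL(2, ℝ)).1.trace ≠ 0 from fun h0 => by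
      have := (isHyperbolic_iff _).mp h.prim.1
      rw [h0] at this; norm_num at this) with h1 | h1
    · exact Or.inr h1
    · exact Or.inl h1
  have hodd : Odd (2 * k - 1) := ⟨k - 1, by omega⟩
  -- a = ε e^l gives a⁻¹ - a = -2ε sinh l, and the odd power keeps -ε. This sign turns (-1)^k into
  -- (-1)^(k+1) and brings in the sign of the trace.
  have haε : (a⁻¹ - a) ^ (2 * k - 1) = -ε * (2 * Real.sinh l) ^ (2 * k - 1) := by
    have e1 : √(nrm (P₀ : SL(2, ℝ))) = Real.exp l := by
      rw [Real.sqrt_eq_rpow, Real.rpow_def_of_pos (by rw [hN0]; linarith), hl]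
      congr 1; ring
    rw [e1] at hsgn
    have e2 : a⁻¹ - a = -(ε * (2 * Real.sinh l)) := by
      rw [hsgn, Real.sinh_eq, Real.exp_neg]
      rcases hε2 with h1 | h1 <;> rw [h1] <;> ring
    rw [e2, hodd.neg_pow, mul_pow]
    rcases hε2 with h1 | h1 <;> rw [h1] <;> simp [hodd.neg_one_pow]
  -- The constant is 2^(2k-1) / 2^(6k-3) = 4/16^k, the same as in `archimedean_factor`.
  have hnp : normPeriod k g P₀ z₀ = -(4 / 16 ^ k) * conj A := by
    have hsh := Real.sinh_pos_iff.mpr hl0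
    have hshc : (Real.sinh l : ℂ) ≠ 0 := by exact_mod_cast hsh.ne'
    have hεε : (ε : ℂ) * ε = 1 := by rcases hε2 with h1 | h1 <;> rw [h1] <;> simp
    rw [normPeriod, hper z₀, ← Complex.ofReal_pow, haε, map_mul, Complex.conj_ofReal]
    obtain ⟨m, rfl⟩ := Nat.exists_eq_add_of_le' hk
    have e16 : (16 : ℂ) ^ (m + 1) = 2 ^ (4 * m + 4) := by
      rw [show (16 : ℂ) = 2 ^ 4 by norm_num, ← pow_mul]; ring
    rw [← hε, ← hl, e16, show 2 * (m + 1) - 1 = 2 * m + 1 by omega,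
      show 6 * (m + 1) - 3 = 2 * m + 1 + (4 * m + 2) by omega, mul_pow]
    push_cast
    rw [← Complex.ofReal_sinh]
    have h2 : (2 : ℂ) ^ (4 * m + 4) = 2 ^ (4 * m + 2) * 4 := by ring
    rw [h2, pow_add]
    field_simp
    linear_combination -conj A * 2 ^ (6 * m) * 8 * hεε
  have hX : ((N / (N - 1) : ℝ) : ℂ) = xvar t := by
    rw [xvar, hNt, Real.exp_neg]
    congr 1
    have : Real.exp (2 * t) - 1 ≠ 0 := by rw [← hNt]; linarith
    field_simp
  have hNs : (N : ℂ) ^ (-s) = Complex.exp (-(2 * t) * s) := by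
    rw [Complex.cpow_def_of_ne_zero (by exact_mod_cast (by linarith : (0:ℝ) < N).ne'),
      ← Complex.ofReal_log (by linarith)]
    congr 1
    rw [htdef]; push_cast; ring
  have hS : ∑ j ∈ Finset.Icc 1 (2 * k), pPoly k j s * xvar t ^ j =
      ∑ i ∈ Finset.range (2 * k), ecoef s (2 * k) i * xvar t ^ (i + 1) := by
    rw [Finset.range_eq_Ico, show Finset.Icc 1 (2 * k) = Finset.Ico (0 + 1) (2 * k + 1) by
      ext; simp]
    exact (Finset.sum_Ico_add' (fun j => pPoly k j s * xvar t ^ j) 0 (2 * k) 1).symm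
  have hmain := archimedean_factor hs k hk ht
  rw [localTerm, ← hNdef, hI, ← mul_assoc]
  have e5 : ((N ^ k / (N - 1) ^ (2 * k) : ℝ) : ℂ) = (((2 * Real.sinh t) ^ (2 * k) : ℝ) : ℂ)⁻¹ := by
    rw [hNt, exp_pow_div ht, Complex.ofReal_inv]
  rw [e5, hmain, hX, hNs, hS, hnp]
  ring

end

/-! ### Hypergeometric form of the local terms -/

lemma ecoef_step (s : ℂ) {M i : ℕ} (hi : i + 1 < M) :
    ecoef s M (i + 1) * ((2 * s - (i + 2)) * (i + 1)) = (M + i) * (M - 1 - i) * ecoef s M i := by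
  obtain ⟨d, rfl⟩ := Nat.exists_eq_add_of_lt hi
  have e1 := ecoef_eq s (i + 1) d
  have e2 := ecoef_eq s i (d + 1)
  rw [show i + (d + 1) + 1 = i + 1 + d + 1 by ring] at e2
  have hi0 : (i.factorial : ℂ) ≠ 0 := by exact_mod_cast i.factorial_ne_zero
  have hd0 : (d.factorial : ℂ) ≠ 0 := by exact_mod_cast d.factorial_ne_zero
  have hi1 : (i : ℂ) + 1 ≠ 0 := Nat.cast_add_one_ne_zero i
  have hd1 : (d : ℂ) + 1 ≠ 0 := Nat.cast_add_one_ne_zero d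
  rw [e1, e2, ← Finset.mul_prod_Ioc_eq_prod_Icc (by omega : i + 2 ≤ i + 1 + d + 1),
    show Finset.Ioc (i + 2) (i + 1 + d + 1) = Finset.Icc (i + 1 + 2) (i + 1 + d + 1) by
      ext l; simp; omega,
    show i + 1 + d + (i + 1) = i + (d + 1) + i + 1 by ring,
    Nat.factorial_succ (i + (d + 1) + i), Nat.factorial_succ d, Nat.factorial_succ i]
  push_cast
  field_simp
  ring

/-- The ratio of consecutive coefficients in `ecoef_step` is hypergeometric, the signs of its two
reflected factors cancelling. Denominators are multiplied out, so the identity also holds at the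
exceptional s. -/
lemma ecoef_mul_ascPochhammer (s : ℂ) {M i : ℕ} (hi : i < M) :
    ecoef s M i * ((ascPochhammer ℂ i).eval (2 - 2 * s) * (i.factorial : ℂ)) =
      (∏ l ∈ Finset.Icc 2 M, (2 * s - (l : ℂ))) *
        ((ascPochhammer ℂ i).eval (1 - M : ℂ) * (ascPochhammer ℂ i).eval (M : ℂ)) := by
  induction i with
  | zero => simp [ecoef]
  | succ i ih =>
    have h1 := ecoef_step s hi
    have h2 := ih (by omega)
    rw [ascPochhammer_succ_eval, ascPochhammer_succ_eval, ascPochhammer_succ_eval,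
      Nat.factorial_succ]
    push_cast
    linear_combination (-(ascPochhammer ℂ i).eval (2 - 2 * s) * (i.factorial : ℂ)) * h1 +
      (1 - M + i) * (M + i) * h2

lemma prod_mul_Gamma (s : ℂ) (n : ℕ) (h : ∀ m ∈ Finset.Icc 2 (n + 1), 2 * s ≠ (m : ℂ)) :
    (∏ l ∈ Finset.Icc 2 (n + 1), (2 * s - (l : ℂ))) * Complex.Gamma (2 * s - (n + 1 : ℕ)) =
      Complex.Gamma (2 * s - 1) := by
  induction n with
  | zero => simp
  | succ n ih =>
    have h1 : 2 * s - ((n + 1 + 1 : ℕ) : ℂ) ≠ 0 := sub_ne_zero.mpr (h _ (by simp))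
    have h2 := Complex.Gamma_add_one _ h1
    rw [show 2 * s - ((n + 1 + 1 : ℕ) : ℂ) + 1 = 2 * s - (n + 1 : ℕ) by push_cast; ring] at h2
    rw [Finset.prod_Icc_succ_top (by omega), mul_assoc, ← h2]
    exact ih fun m hm => h m (by simp at hm ⊢; omega)

section

variable {k : ℕ} {s : ℂ}

/-- The value 2s = 2 is excluded by Re s > 1, which is why the exceptional set begins at 3. -/
lemma two_mul_ne_natCast (hs : 1 < s.re) (h : ∀ m ∈ Finset.Icc 3 (2 * k), 2 * s ≠ (m : ℂ)) :
    ∀ m ∈ Finset.Icc 2 (2 * k), 2 * s ≠ (m : ℂ) := by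
  intro m hm heq
  rcases (Finset.mem_Icc.mp hm).1.eq_or_lt with rfl | h2
  · have := congrArg Complex.re heq
    simp at this
    linarith
  · exact h m (Finset.mem_Icc.mpr ⟨h2, (Finset.mem_Icc.mp hm).2⟩) heq

lemma Gamma_two_mul_sub_ne_zero (hs : 1 < s.re)
    (h : ∀ m ∈ Finset.Icc 3 (2 * k), 2 * s ≠ (m : ℂ)) :
    Complex.Gamma (2 * s - 2 * k) ≠ 0 := by
  refine Complex.Gamma_ne_zero fun m hm => ?_
  have h1 : (2 * k : ℝ) - m > 2 := by
    have := congrArg Complex.re hm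
    simp at this
    linarith
  have h2 : m + 2 < 2 * k := by
    have : (m : ℝ) + 2 < 2 * k := by linarith
    exact_mod_cast this
  refine two_mul_ne_natCast hs h (2 * k - m) (Finset.mem_Icc.mpr ⟨by omega, by omega⟩) ?_
  rw [Nat.cast_sub (by omega)]
  push_cast
  linear_combination hm

lemma ascPochhammer_two_sub_ne_zero (hs : 1 < s.re)
    (h : ∀ m ∈ Finset.Icc 3 (2 * k), 2 * s ≠ (m : ℂ)) {i : ℕ} (hi : i < 2 * k) :
    (ascPochhammer ℂ i).eval (2 - 2 * s) ≠ 0 := by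
  refine ascPochhammer_eval_ne_zero i fun m hm h0 => ?_
  refine two_mul_ne_natCast hs h (m + 2) (Finset.mem_Icc.mpr ⟨by omega, by omega⟩) ?_
  push_cast
  linear_combination -h0

lemma sum_pPoly_eq (hk : 1 ≤ k) (hs : 1 < s.re)
    (h : ∀ m ∈ Finset.Icc 3 (2 * k), 2 * s ≠ (m : ℂ)) (X : ℂ) :
    ∑ j ∈ Finset.Icc 1 (2 * k), pPoly k j s * X ^ j =
      Complex.Gamma (2 * s - 1) / Complex.Gamma (2 * s - 2 * k) *
        (∑ j ∈ Finset.range (2 * k),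
          (ascPochhammer ℂ j).eval (1 - 2 * k : ℂ) * (ascPochhammer ℂ j).eval (2 * k : ℂ) /
            ((ascPochhammer ℂ j).eval (2 - 2 * s) * (Nat.factorial j : ℂ)) * X ^ j) * X := by
  have hG := Gamma_two_mul_sub_ne_zero hs h
  have hprod := prod_mul_Gamma s (2 * k - 1) (by
    rw [show 2 * k - 1 + 1 = 2 * k by omega]; exact two_mul_ne_natCast hs h)
  rw [show 2 * k - 1 + 1 = 2 * k by omega, Nat.cast_mul, Nat.cast_two] at hprod
  rw [← hprod, mul_div_cancel_right₀ _ hG, Finset.mul_sum, Finset.sum_mul,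
    show Finset.Icc 1 (2 * k) = Finset.Ico (0 + 1) (2 * k + 1) by ext; simp,
    ← Finset.sum_Ico_add' (fun j => pPoly k j s * X ^ j) 0 (2 * k) 1, Finset.range_eq_Ico]
  refine Finset.sum_congr rfl fun i hi => ?_
  have hi' : i < 2 * k := (Finset.mem_Ico.mp hi).2
  have h1 := ecoef_mul_ascPochhammer s hi'
  rw [Nat.cast_mul, Nat.cast_two] at h1
  have h2 := ascPochhammer_two_sub_ne_zero hs h hi'
  have h3 : (i.factorial : ℂ) ≠ 0 := by exact_mod_cast i.factorial_ne_zero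
  rw [pPoly_eq_ecoef, eq_div_of_mul_eq (mul_ne_zero h2 h3) h1]
  ring

/-- The series terminates because the Pochhammer symbol of -(2k-1) vanishes from index 2k on. -/
lemma hypergeometric_eq_sum (hk : 1 ≤ k) (X : ℂ) :
    ₂F₁ (-(2 * k - 1) : ℂ) (2 * k : ℂ) (2 - 2 * s) X = ∑ j ∈ Finset.range (2 * k),
      (ascPochhammer ℂ j).eval (1 - 2 * k : ℂ) * (ascPochhammer ℂ j).eval (2 * k : ℂ) /
        ((ascPochhammer ℂ j).eval (2 - 2 * s) * (Nat.factorial j : ℂ)) * X ^ j := by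
  rw [ordinaryHypergeometric_eq_tsum]
  refine (tsum_eq_sum (s := Finset.range (2 * k)) fun j hj => ?_).trans
    (Finset.sum_congr rfl fun j _ => ?_)
  · have h1 : (-(2 * k - 1) : ℂ) = -((2 * k - 1 : ℕ) : ℂ) := by
      rw [Nat.cast_sub (by omega)]; push_cast; ring
    rw [h1, ascPochhammer_eval_neg_coe_nat_of_lt (by simp at hj; omega)]
    simp
  · rw [show (-(2 * k - 1) : ℂ) = 1 - 2 * k by ring, smul_eq_mul, div_eq_mul_inv, mul_inv]
    ring

end

end HypPeriod

end

/-! ### The main theorem -/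

theorem mainTheorem7 (Γ : Subgroup SL(2, ℝ)) [DiscreteTopology Γ]
    (htf : ∀ γ : Γ, γ ≠ 1 → ¬ IsOfFinOrder γ)
    (D : Set ℍ) (hD : IsFundamentalDomain Γ D (volume : Measure ℍ))
    (hvol : volume D ≠ ⊤)
    (k : ℕ) (hk : 1 ≤ k) (g : HypPeriod.CuspFormsFourK Γ k)
    (s : ℂ) (hs : 1 < s.re) :
    -- every hyperbolic class has a primitive root and a diagonalizing matrix
    (∀ P : Γ, (P : SL(2, ℝ)).1.IsHyperbolic → ∃ P₀ τ, HypPeriod.IsLocalDatum Γ P P₀ τ) ∧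
    -- the inner product is an absolutely convergent sum over the hyperbolic classes
    IntegrableOn (HypPeriod.peterssonIntegrand Γ k s g) D ∧
    (∀ (P P₀ : HypPeriod.HypClass Γ → Γ) (τ : HypPeriod.HypClass Γ → SL(2, ℝ)),
      (∀ C, ConjClasses.mk (P C) = C.1 ∧ HypPeriod.IsLocalDatum Γ (P C) (P₀ C) (τ C)) →
      Summable (fun C => ‖HypPeriod.localTerm k s g (P C) (P₀ C) (τ C)‖) ∧
      ∫ z in D, HypPeriod.peterssonIntegrand Γ k s g z =
        ∑' C, HypPeriod.localTerm k s g (P C) (P₀ C) (τ C)) ∧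
    -- evaluation of the local terms
    (∀ (P P₀ : Γ) (τ : SL(2, ℝ)) (z₀ : ℍ), HypPeriod.IsLocalDatum Γ P P₀ τ →
      IntegrableOn (HypPeriod.localIntegrand k s g P τ) (HypPeriod.halfAnnulus P₀) ∧
      HypPeriod.localTerm k s g P P₀ τ =
        (-1) ^ (k + 1) * HypPeriod.normPeriod k g P₀ z₀ *
          (∑ j ∈ Finset.Icc 1 (2 * k), HypPeriod.pPoly k j s *
            ((HypPeriod.nrm P / (HypPeriod.nrm P - 1) : ℝ) : ℂ) ^ j) *
          (HypPeriod.nrm P : ℂ) ^ (-s) ∧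
      ((∀ m ∈ Finset.Icc 3 (2 * k), 2 * s ≠ (m : ℂ)) →
        HypPeriod.localTerm k s g P P₀ τ =
          (-1) ^ (k + 1) * HypPeriod.normPeriod k g P₀ z₀ *
            (Complex.Gamma (2 * s - 1) / Complex.Gamma (2 * s - 2 * k)) *
            ₂F₁ (-(2 * k - 1) : ℂ) (2 * k : ℂ) (2 - 2 * s)
              ((HypPeriod.nrm P / (HypPeriod.nrm P - 1) : ℝ) : ℂ) *
            ((HypPeriod.nrm P / (HypPeriod.nrm P - 1) : ℝ) : ℂ) *
            (HypPeriod.nrm P : ℂ) ^ (-s) ∧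
        HypPeriod.localTerm k s g P P₀ τ =
          (-1) ^ (k + 1) * HypPeriod.normPeriod k g P₀ z₀ *
            (Complex.Gamma (2 * s - 1) / Complex.Gamma (2 * s - 2 * k)) *
            (∑ j ∈ Finset.range (2 * k),
              (ascPochhammer ℂ j).eval (1 - 2 * k : ℂ) * (ascPochhammer ℂ j).eval (2 * k : ℂ) /
                ((ascPochhammer ℂ j).eval (2 - 2 * s) * (Nat.factorial j : ℂ)) *
              ((HypPeriod.nrm P / (HypPeriod.nrm P - 1) : ℝ) : ℂ) ^ j) *
            ((HypPeriod.nrm P / (HypPeriod.nrm P - 1) : ℝ) : ℂ) *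
            (HypPeriod.nrm P : ℂ) ^ (-s))) := by
  refine ⟨fun P hP => HypPeriod.exists_isLocalDatum htf hP,
    HypPeriod.integrableOn_peterssonIntegrand htf hD hvol g hs,
    fun P P₀ τ h => HypPeriod.petersson_eq_tsum_localTerm htf hD hvol g hs P P₀ τ h,
    fun P P₀ τ z₀ h => ?_⟩
  have hint := (h.localTerm_eq htf hD hvol g hs).1
  have heq := h.localTerm_eq_sum hk g hs hint z₀
  refine ⟨hint, heq, fun hm => ?_⟩
  rw [HypPeriod.hypergeometric_eq_sum hk, and_self, heq, HypPeriod.sum_pPoly_eq hk hs hm]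
  ring
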